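/- Let $d\in\{2,3\}$, $T>0$, $\gamma>1$, $a>0$, $p(\varrho)=a\varrho^\gamma$, $P(\varrho)=\frac{a}{\gamma-1}\varrho^\gamma$. Let $\Omega$ be either a bounded domain in $\mathbb R^d$ of class $C^1$ with outer normal $\mathbf n$, or the flat torus $([-1,1]|_{\{-1,1\}})^d$ (then $\overline\Omega=\Omega$, $\partial\Omega=\emptyset$). Set $\frac{|\mathbf m|^2}{\varrho}=0$ if $\mathbf m=0$ and $=\infty$ if $\varrho=0$, $\mathbf m\neq0$. A pair $\varrho\in C_{\rm weak}([0,T];L^\gamma(\Omega))$, $\varrho\ge0$, $\mathbf m\in C_{\rm weak}([0,T];L^{\frac{2\gamma}{\gamma+1}}(\Omega;\mathbb R^d))$ is a *dissipative solution* of the Euler system if there are $\mathfrak R_v\in L^\infty(0,T;\mathcal M^+(\overline\Omega;\mathbb R^{d\times d}_{\rm sym}))$ (measures with values in the positive semi-definite matrices) and $\mathfrak R_p\in L^\infty(0,T;\mathcal M^+(\overline\Omega))$ such that (i) $\left[\int_\Omega\varrho\varphi\,dx\right]_{t=0}^{t=\tau}=\int_0^\tau\int_\Omega[\varrho\,\partial_t\varphi+\mathbf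 m\cdot\nabla_x\varphi]\,dx\,dt$ for all $0<\tau<T$, $\varphi\in C^1_c([0,T)\times\overline\Omega)$; (ii) $\left[\int_\Omega\mathbf m\cdot\boldsymbol\varphi\,dx\right]_{t=0}^{t=\tau}=\int_0^\tau\int_\Omega\left[\mathbf m\cdot\partial_t\boldsymbol\varphi+\frac{\mathbf m\otimes\mathbf m}{\varrho}:\nabla_x\boldsymbol\varphi+p(\varrho)\,{\rm div}_x\boldsymbol\varphi\right]dx\,dt+\int_0^\tau\int_{\overline\Omega}\nabla_x\boldsymbol\varphi:d[\mathfrak R_v+\mathfrak R_p\mathbb I]\,dt$ for all $0<\tau<T$, $\boldsymbol\varphi\in C^1_c([0,T)\times\overline\Omega;\mathbb R^d)$ with $\boldsymbol\varphi\cdot\mathbf n|_{\partial\Omega}=0$; (iii) the total energy $\mathcal E(t)=\int_\Omega\left[\frac12\frac{|\mathbf m|^2}{\varrho}+P(\varrho)\right]dx+\int_{\overline\Omega}\frac12\,d\,{\rm trace}[\mathfrak R_v]+\int_{\overline\Omega}\frac1{\gamma-1}\,d\mathfrak R_p$ is finite for a.e. $t\in(0,T)$, has essential one-sided limits $\mathcal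 E(\tau-)$ for $0<\tau<T$ and $\mathcal E(\tau+)$ for $0\le\tau<T$, and, with $\mathcal E(0-):=\int_\Omega\left[\frac12\frac{|\mathbf m(0,\cdot)|^2}{\varrho(0,\cdot)}+P(\varrho(0,\cdot))\right]dx<\infty$, $$\psi(\tau_2)\mathcal E(\tau_2+)-\psi(\tau_1)\mathcal E(\tau_1-)\le\int_{\tau_1}^{\tau_2}\partial_t\psi\,\mathcal E\,dt$$ for all $0\le\tau_1\le\tau_2<T$ and $\psi\in C^1_c[0,T)$, $\psi\ge0$. Let $\varrho_0\in L^\gamma(\Omega)$, $\varrho_0\ge0$, $\mathbf m_0\in L^{\frac{2\gamma}{\gamma+1}}(\Omega;\mathbb R^d)$ with $\int_\Omega\left[\frac12\frac{|\mathbf m_0|^2}{\varrho_0}+P(\varrho_0)\right]dx<\infty$, and let $\mathcal U[\varrho_0,\mathbf m_0]$ be the set of all dissipative solutions $[\varrho,\mathbf m]$ with $\varrho(0,\cdot)=\varrho_0$, $\mathbf m(0,\cdot)=\mathbf m_0$. Then: 1. $\mathcal U[\varrho_0,\mathbf m_0]$ is non-empty; 2. $\mathcal U[\varrho_0,\mathbf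 m_0]$ is convex; 3. $\mathcal U[\varrho_0,\mathbf m_0]$ is compact with respect to the metric topology on bounded sets of $[C_{\rm weak}([0,T];L^\gamma)\cap L^\infty(0,T;L^\gamma)]\times[C_{\rm weak}([0,T];L^{\frac{2\gamma}{\gamma+1}})\cap L^\infty(0,T;L^{\frac{2\gamma}{\gamma+1}})]$. That is, there is $M$ such that $\|\varrho(t)\|_{L^\gamma}\le M$ and $\|\mathbf m(t)\|_{L^{2\gamma/(\gamma+1)}}\le M$ for all $t\in[0,T]$ and all $[\varrho,\mathbf m]\in\mathcal U[\varrho_0,\mathbf m_0]$, the topology of $C_{\rm weak}([0,T];L^\gamma)\times C_{\rm weak}([0,T];L^{\frac{2\gamma}{\gamma+1}})$ (uniform convergence on $[0,T]$ in the weak topologies) is metrizable on the set of all pairs bounded by $M$ in this sense, and $\mathcal U[\varrho_0,\mathbf m_0]$ is compact in it. -/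

import Mathlib

open MeasureTheory Set Filter Topology
open scoped ENNReal NNReal

noncomputable section

namespace EulerDissipative

/-- The space `ℝ^d` with the Euclidean norm. -/
abbrev Space (d : ℕ) : Type := EuclideanSpace ℝ (Fin d)

/-! ### Spatial domains -/

/-- `g` is a `C¹` function near the point `x`, with non-vanishing derivative at `x`, and near `x`
the set `Ω` is `{g < 0}`. -/
def IsLocalDefiningFunction {d : ℕ} (Ω : Set (Space d)) (x : Space d) (g : Space d → ℝ) : Prop :=
  ContDiffAt ℝ 1 g x ∧ g x = 0 ∧ fderiv ℝ g x ≠ 0 ∧ ∀ᶠ y in 𝓝 x, (y ∈ Ω ↔ g y < 0)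

/-- The boundary of `Ω` is of class `C¹`. -/
def HasC1Boundary {d : ℕ} (Ω : Set (Space d)) : Prop :=
  ∀ x ∈ frontier Ω, ∃ g : Space d → ℝ, IsLocalDefiningFunction Ω x g

/-- `n` is the outer unit normal to `∂Ω` at `x`. -/
def IsOuterNormal {d : ℕ} (Ω : Set (Space d)) (x n : Space d) : Prop :=
  ∃ g : Space d → ℝ, IsLocalDefiningFunction Ω x g ∧ n = ‖gradient g x‖⁻¹ • gradient g x

/-- The region occupied by the fluid: a subset of `ℝ^d` (with impermeable boundary), or the flat
torus `([-1,1]|_{-1,1})^d`. Functions on the torus are represented by functions on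
the fundamental cell `[-1,1)^d`, and test functions on it by periodic functions on `ℝ^d`. -/
inductive FluidDomain (d : ℕ) : Type
  | bounded (Ω : Set (Space d)) : FluidDomain d
  | torus : FluidDomain d

namespace FluidDomain

variable {d : ℕ}

/-- In the first case we consider bounded domains (open connected sets) of class `C¹`. -/
def Admissible : FluidDomain d → Prop
  | bounded Ω => IsOpen Ω ∧ IsConnected Ω ∧ Bornology.IsBounded Ω ∧ HasC1Boundary Ω
  | torus => True

/-- The set `Ω` itself. -/
def cell : FluidDomain d → Set (Space d)
  | bounded Ω => Ω
  | torus => {x | ∀ i, -1 ≤ x i ∧ x i < 1}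

/-- The closure of `Ω`; the torus has no boundary. -/
def closedCell : FluidDomain d → Set (Space d)
  | bounded Ω => closure Ω
  | torus => {x | ∀ i, -1 ≤ x i ∧ x i < 1}

/-- The Lebesgue measure on `Ω`. -/
def vol (G : FluidDomain d) : Measure (Space d) := volume.restrict G.cell

/-- In the case of the torus, `f` is periodic with period `2` in each variable. -/
def RespectsPeriods {Y : Type*} : FluidDomain d → (Space d → Y) → Prop
  | bounded _, _ => True
  | torus, f => ∀ (x : Space d) (i : Fin d), f (x + EuclideanSpace.single i 2) = f x

/-- In the case of a domain with boundary, the vector field `f` satisfies `f · n = 0` on `∂Ω`. -/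
def Impermeable : FluidDomain d → (Space d → Space d) → Prop
  | bounded Ω, f => ∀ x ∈ frontier Ω, ∀ n, IsOuterNormal Ω x n → inner ℝ (f x) n = 0
  | torus, _ => True

end FluidDomain

/-! ### Test functions

Functions of class `C¹` up to the boundary of `[0,T) × Ω` are represented by their `C¹` extensions
to `ℝ × ℝ^d`. -/

/-- `φ ∈ C¹_c([0,T) × closure Ω)`. -/
structure IsScalarTest {d : ℕ} (G : FluidDomain d) (T : ℝ) (φ : ℝ → Space d → ℝ) : Prop where
  contDiff : ContDiff ℝ 1 (fun z : ℝ × Space d => φ z.1 z.2)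
  vanish : ∃ T' < T, ∀ t, T' ≤ t → ∀ x, φ t x = 0
  periodic : ∀ t, G.RespectsPeriods (φ t)

/-- `φ ∈ C¹_c([0,T) × closure Ω; ℝ^d)` with `φ · n = 0` on `∂Ω`. -/
structure IsVectorTest {d : ℕ} (G : FluidDomain d) (T : ℝ) (φ : ℝ → Space d → Space d) :
    Prop where
  contDiff : ContDiff ℝ 1 (fun z : ℝ × Space d => φ z.1 z.2)
  vanish : ∃ T' < T, ∀ t, T' ≤ t → ∀ x, φ t x = 0
  periodic : ∀ t, G.RespectsPeriods (φ t)
  impermeable : ∀ t ∈ Ico 0 T, G.Impermeable (φ t)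

/-- `ψ ∈ C¹_c[0,T)`, `ψ ≥ 0`. -/
structure IsTimeTest (T : ℝ) (ψ : ℝ → ℝ) : Prop where
  contDiff : ContDiff ℝ 1 ψ
  vanish : ∃ T' < T, ∀ t, T' ≤ t → ψ t = 0
  nonneg : ∀ t ∈ Ico 0 T, 0 ≤ ψ t

/-- The entry `∂_j v_i (x)` of the gradient of a vector field. -/
def grad {d : ℕ} (v : Space d → Space d) (x : Space d) (i j : Fin d) : ℝ :=
  fderiv ℝ v x (EuclideanSpace.single j 1) i

/-- The divergence of a vector field. -/
def divg {d : ℕ} (v : Space d → Space d) (x : Space d) : ℝ := ∑ i, grad v x i i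

/-! ### State spaces and trajectories -/

/-- The exponent `γ` of the density. -/
abbrev densExp (γ : ℝ) : ℝ≥0∞ := ENNReal.ofReal γ

/-- The exponent `2γ/(γ+1)` of the momentum. -/
abbrev momExp (γ : ℝ) : ℝ≥0∞ := ENNReal.ofReal (2 * γ / (γ + 1))

instance densExp_one_le (γ : ℝ) [h : Fact (1 < γ)] : Fact (1 ≤ densExp γ) :=
  ⟨ENNReal.one_le_ofReal.2 h.out.le⟩

instance momExp_one_le (γ : ℝ) [h : Fact (1 < γ)] : Fact (1 ≤ momExp γ) :=
  ⟨ENNReal.one_le_ofReal.2 (by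
    have h1 : 1 < γ := h.out
    rw [le_div_iff₀ (by linarith)]
    linarith)⟩

/-- `L^γ(Ω)`. -/
abbrev DensSpace {d : ℕ} (G : FluidDomain d) (γ : ℝ) : Type := Lp ℝ (densExp γ) G.vol

/-- `L^{2γ/(γ+1)}(Ω; ℝ^d)`. -/
abbrev MomSpace {d : ℕ} (G : FluidDomain d) (γ : ℝ) : Type := Lp (Space d) (momExp γ) G.vol

/-- `C_weak([0,T]; X)`. Its topology is the compact-open one, i.e. uniform convergence on
`[0,T]` with respect to the weak topology of `X`. -/
abbrev CWeak (T : ℝ) (X : Type) [NormedAddCommGroup X] [NormedSpace ℝ X] : Type :=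
  C(Icc (0 : ℝ) T, WeakSpace ℝ X)

/-- The value in `X` of a trajectory at time `t ∈ [0,T]` (and `0` for other `t`). -/
def CWeak.val {T : ℝ} {X : Type} [NormedAddCommGroup X] [NormedSpace ℝ X]
    (u : CWeak T X) (t : ℝ) : X :=
  open Classical in
  if h : t ∈ Icc (0 : ℝ) T then (toWeakSpace ℝ X).symm (u ⟨t, h⟩) else 0

/-- The trajectory space `C_weak([0,T]; L^γ(Ω)) × C_weak([0,T]; L^{2γ/(γ+1)}(Ω; ℝ^d))`. -/
abbrev Trajectory {d : ℕ} (G : FluidDomain d) (γ T : ℝ) [Fact (1 < γ)] : Type :=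
  CWeak T (DensSpace G γ) × CWeak T (MomSpace G γ)

/-- The trajectories bounded by `M` in `L^∞(0,T; L^γ) × L^∞(0,T; L^{2γ/(γ+1)})`. -/
def boundedTrajectories {d : ℕ} (G : FluidDomain d) (γ T : ℝ) [Fact (1 < γ)] (M : ℝ) :
    Set (Trajectory G γ T) :=
  {u | ∀ t ∈ Icc 0 T, ‖u.1.val t‖ ≤ M ∧ ‖u.2.val t‖ ≤ M}

/-! ### Energy -/

/-- The pressure `p(ρ) = a ρ^γ`. -/
def pressure (a γ r : ℝ) : ℝ := a * r ^ γ

/-- The pressure potential `P(ρ) = a/(γ-1) ρ^γ`. -/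
def potential (a γ r : ℝ) : ℝ := a / (γ - 1) * r ^ γ

/-- The energy density `½ |m|²/ρ + P(ρ)` for `ρ ≥ 0`. By the conventions of `ℝ≥0∞`, the kinetic
part is `0` if `m = 0` and `∞` if `ρ = 0` and `m ≠ 0`. -/
def energyDensity {d : ℕ} (a γ r : ℝ) (w : Space d) : ℝ≥0∞ :=
  ‖w‖ₑ ^ 2 / (2 * ENNReal.ofReal r) + ENNReal.ofReal (potential a γ r)

/-- The energy `∫_Ω [½ |m|²/ρ + P(ρ)] dx`. -/
def fluidEnergy {d : ℕ} (G : FluidDomain d) (a γ : ℝ) (ρ : DensSpace G γ) (m : MomSpace G γ) :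
    ℝ≥0∞ :=
  ∫⁻ x, energyDensity a γ (ρ x) (m x) ∂G.vol

/-! ### Turbulent defect measures -/

/-- Time-dependent families of `d × d` matrices of signed measures. -/
abbrev MatrixMeasures (d : ℕ) : Type := ℝ → Fin d → Fin d → SignedMeasure (Space d)

/-- `Rv ∈ L^∞(0,T; M⁺(closure Ω; ℝ^{d×d}_sym))`: a (weakly-* measurable) essentially bounded family
of finite measures on the closure of `Ω` ranging in symmetric positive semi-definite matrices. -/
structure IsConvectiveDefect {d : ℕ} (G : FluidDomain d) (T : ℝ) (Rv : MatrixMeasures d) :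
    Prop where
  measurable : ∀ i j, ∀ B, MeasurableSet B →
    AEMeasurable (fun t => Rv t i j B) (volume.restrict (Ioo 0 T))
  bounded : ∃ C : ℝ≥0, ∀ᵐ t ∂(volume.restrict (Ioo 0 T)), ∀ i j, (Rv t i j).variation univ ≤ C
  supported : ∀ᵐ t ∂(volume.restrict (Ioo 0 T)), ∀ i j, ∀ B, MeasurableSet B →
    Disjoint B G.closedCell → Rv t i j B = 0
  symmetric : ∀ᵐ t ∂(volume.restrict (Ioo 0 T)), ∀ i j, Rv t i j = Rv t j i
  posSemidef : ∀ᵐ t ∂(volume.restrict (Ioo 0 T)), ∀ ξ : Fin d → ℝ, ∀ B, MeasurableSet B →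
    0 ≤ ∑ i, ∑ j, ξ i * ξ j * Rv t i j B

/-- `Rp ∈ L^∞(0,T; M⁺(closure Ω))`. -/
structure IsPressureDefect {d : ℕ} (G : FluidDomain d) (T : ℝ) (Rp : ℝ → Measure (Space d)) :
    Prop where
  measurable : ∀ B, MeasurableSet B →
    AEMeasurable (fun t => Rp t B) (volume.restrict (Ioo 0 T))
  bounded : ∃ C : ℝ≥0, ∀ᵐ t ∂(volume.restrict (Ioo 0 T)), Rp t univ ≤ C
  supported : ∀ᵐ t ∂(volume.restrict (Ioo 0 T)), Rp t (G.closedCell)ᶜ = 0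

/-- `∫ ∇v : d[Rv + Rp 𝕀]` at a fixed time. -/
def defectAction {d : ℕ} (Rv : Fin d → Fin d → SignedMeasure (Space d)) (Rp : Measure (Space d))
    (v : Space d → Space d) : ℝ :=
  ∑ i, ∑ j, (Rv i j).integral (fun x => grad v x i j) (ContinuousLinearMap.lsmul ℝ ℝ)
    + ∫ x, divg v x ∂ Rp

/-- The energy augmented by the defects,
`∫_Ω [½ |m|²/ρ + P(ρ)] dx + ∫ ½ d trace[Rv] + ∫ 1/(γ-1) dRp`, at a fixed time. -/
def totalEnergy {d : ℕ} (G : FluidDomain d) (a γ : ℝ) (ρ : DensSpace G γ) (m : MomSpace G γ)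
    (Rv : Fin d → Fin d → SignedMeasure (Space d)) (Rp : Measure (Space d)) : ℝ≥0∞ :=
  fluidEnergy G a γ ρ m + ENNReal.ofReal ((1 / 2) * ∑ i, Rv i i univ)
    + ENNReal.ofReal (1 / (γ - 1)) * Rp univ

/-! ### Dissipative solutions -/

section

variable {d : ℕ} (G : FluidDomain d) (a γ T : ℝ) [Fact (1 < γ)]

/-- The weak form of the equation of continuity. -/
def ContinuityEquation (u : Trajectory G γ T) : Prop :=
  ∀ φ, IsScalarTest G T φ → ∀ τ ∈ Ioo 0 T,
    ∫ x, u.1.val τ x * φ τ x ∂G.vol - ∫ x, u.1.val 0 x * φ 0 x ∂G.vol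
      = ∫ t in (0 : ℝ)..τ, ∫ x,
          (u.1.val t x * deriv (fun s => φ s x) t + fderiv ℝ (φ t) x (u.2.val t x)) ∂G.vol

/-- The weak form of the momentum equation with the defects `Rv`, `Rp`. -/
def MomentumEquation (u : Trajectory G γ T) (Rv : MatrixMeasures d) (Rp : ℝ → Measure (Space d)) :
    Prop :=
  ∀ φ, IsVectorTest G T φ → ∀ τ ∈ Ioo 0 T,
    ∫ x, inner ℝ (u.2.val τ x) (φ τ x) ∂G.vol - ∫ x, inner ℝ (u.2.val 0 x) (φ 0 x) ∂G.vol
      = (∫ t in (0 : ℝ)..τ, ∫ x,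
          (inner ℝ (u.2.val t x) (deriv (fun s => φ s x) t)
            + ∑ i, ∑ j, (u.2.val t x i * u.2.val t x j / u.1.val t x) * grad (φ t) x i j
            + pressure a γ (u.1.val t x) * divg (φ t) x) ∂G.vol)
        + ∫ t in (0 : ℝ)..τ, defectAction (Rv t) (Rp t) (φ t)

/-- The energy inequality. The total energy is a function of time defined up to a null set,
`Eminus τ`, `Eplus τ` are its (essential) one-sided limits at `τ`, and its value at `0-` is the
initial energy. -/
def EnergyInequality (u : Trajectory G γ T) (Rv : MatrixMeasures d) (Rp : ℝ → Measure (Space d)) :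
    Prop :=
  let E : ℝ → ℝ≥0∞ := fun t => totalEnergy G a γ (u.1.val t) (u.2.val t) (Rv t) (Rp t)
  fluidEnergy G a γ (u.1.val 0) (u.2.val 0) < ∞ ∧
  (∀ᵐ t ∂(volume.restrict (Ioo 0 T)), E t < ∞) ∧
  ∃ Eminus Eplus : ℝ → ℝ,
    Eminus 0 = (fluidEnergy G a γ (u.1.val 0) (u.2.val 0)).toReal ∧
    (∀ τ ∈ Ioo 0 T, Tendsto (fun t => (E t).toReal) (𝓝[<] τ ⊓ ae volume) (𝓝 (Eminus τ))) ∧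
    (∀ τ ∈ Ico 0 T, Tendsto (fun t => (E t).toReal) (𝓝[>] τ ⊓ ae volume) (𝓝 (Eplus τ))) ∧
    ∀ ψ, IsTimeTest T ψ → ∀ τ₁ τ₂, 0 ≤ τ₁ → τ₁ ≤ τ₂ → τ₂ < T →
      ψ τ₂ * Eplus τ₂ - ψ τ₁ * Eminus τ₁ ≤ ∫ t in τ₁..τ₂, deriv ψ t * (E t).toReal

/-- Dissipative solutions of the Euler system on `(0,T) × Ω`. -/
def IsDissipativeSolution (u : Trajectory G γ T) : Prop :=
  (∀ t ∈ Icc 0 T, 0 ≤ᵐ[G.vol] u.1.val t) ∧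
  ContinuityEquation G γ T u ∧
  ∃ (Rv : MatrixMeasures d) (Rp : ℝ → Measure (Space d)),
    IsConvectiveDefect G T Rv ∧ IsPressureDefect G T Rp ∧
    MomentumEquation G a γ T u Rv Rp ∧ EnergyInequality G a γ T u Rv Rp

/-- The set `U[ρ₀, m₀]` of all dissipative solutions starting from `[ρ₀, m₀]`. -/
def solutionSet (ρ₀ : DensSpace G γ) (m₀ : MomSpace G γ) : Set (Trajectory G γ T) :=
  {u | IsDissipativeSolution G a γ T u ∧ u.1.val 0 = ρ₀ ∧ u.2.val 0 = m₀}

end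

end EulerDissipative

end

/-!
# Existence, convexity and compactness for dissipative solutions of the Euler system

The definition of a dissipative solution is not visibly convex: it contains the nonlinear stress
`(m ⊗ m / ρ, p(ρ))` next to the defects. But the equations and the energy see only the sum of stress
and defects, which is a functional `Λ t` on continuous matrix and scalar fields, and for which the
equations and the energy are linear. The positivity of the defects says that `Λ t` dominates the
stress of the state. As the functions `|ξ·m|²/ρ` and `p(ρ)` are suprema of their tangents, this is a
family of inequalities that are linear in `(ρ, m, Λ)` (`IsStressBound`). Conversely the defects are
recovered from `Λ t` by the Riesz representation theorem, polarization, and subtraction of the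
stress of the state. The energy inequality, with its one-sided limits, amounts to the energy being
almost everywhere equal to a non-increasing function bounded by the initial energy `E₀`. Hence the
dissipative solutions are the trajectories that admit a `Λ` with `IsRelaxed`; see
`isRelaxed_of_isDissipativeSolution` and `IsRelaxed.isDissipativeSolution`. On the torus, `Λ` acts on
functions on the closed cube and is transported to the half-open cell by identifying opposite faces.

*Convexity* is then immediate (`IsRelaxed.combination`).

*Compactness.* The energy bounds the norms of `ρ`, `m` and `Λ`, so the integrals of a solution
against a fixed test function are equicontinuous in time, and a diagonal argument gives subsequences
converging uniformly in time in the weak topologies (`IsSeparatingFamily.exists_subseq_tendsto`);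
this uses the weak compactness of balls, from the duality of Lebesgue spaces, and countable dense
families of test functions, which also make the topology metrizable on bounded sets
(`metrizable_boundedTrajectories`). For the functionals `Λ` no compactness in time is needed: convex
combinations of tails of the sequence converge almost everywhere in time
(`exists_tailConvex_ae_tendsto`), and every condition survives such combinations. The outcome is
`exists_subseq_isRelaxed`, which allows for vanishing errors in the equations.

*Existence* follows from the same lemma applied to Galerkin approximations in the variables dual to
`(ρ, m)`, which are the derivatives `θ = P'(ρ) - |u|²/2` and `u = m/ρ` of the energy density. With
`Q` the Legendre transform of `P`, the map from the coefficients of `(θ, u)` to the moments of `(ρ, m)`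
is the gradient of the convex function `∫ Q(θ + |u|²/2)`, and its Legendre transform is the energy.
The system conserves the energy, because the fluxes do no work: the integrand is the divergence of
`p(ρ) u`, and impermeable fields have divergence of mean zero (`integral_divg_eq_zero`, the
divergence theorem on `C¹` domains). A regularized explicit Euler scheme solves the system up to
small errors in the equations and the energy (`exists_approximate_solution`,
`exists_galerkin_solution`). The energy missing up to the bound is put into a spatially constant
pressure defect, which does not act on impermeable fields (`exists_isStressBound`); thus the total
energy of the approximations is constant in time, and the limit is a relaxed solution
(`exists_isRelaxed`).
-/

open ENNReal (ofReal ofReal_lt_top ofReal_ne_top toReal_nonneg ofReal_le_ofReal toReal_ofReal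
  ofReal_mul toReal_add toReal_mono toReal_mul toReal_le_of_le_ofReal toReal_zero ofReal_zero
  ofReal_eq_zero ofReal_sum_of_nonneg ofReal_toReal ofReal_div_of_pos
  toReal_le_toReal ofReal_add)
open Finset (sum_congr mul_sum sum_le_sum sum_eq_single sum_add_distrib sum_eq_zero sum_nonneg
  sum_div sum_sub_distrib aemeasurable_fun_sum sum_mul sum_const_zero single_le_sum sum_smul
  sum_comm sum_mul_sum)
open Real (norm_eq_abs norm_of_nonneg zero_rpow rpow_nonneg rpow_le_rpow rpow_mul
  smoothTransition)
open intervalIntegral (integral_interval_sub_left continuousOn_primitive_interval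
  norm_integral_le_of_norm_le_const norm_integral_le_of_norm_le_const_ae integral_deriv_eq_sub)
open EuclideanSpace (single)

noncomputable section

local notation "dt[" T "]" => volume.restrict (Ioo 0 T)

set_option linter.unusedSectionVars false

namespace EulerDissipative

/-! ### Duality of Lebesgue spaces -/

section LpDual

variable {α : Type*} [MeasurableSpace α] {μ : Measure α}
  {E : Type*} [NormedAddCommGroup E] {p q : ℝ≥0∞}

lemma sum_indicatorConstLp [IsFiniteMeasure μ] (v : E) {f : ℕ → Set α}
    (hf : ∀ i, MeasurableSet (f i)) (hd : Pairwise (Function.onFun Disjoint f)) (s : Finset ℕ) :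
    ∑ i ∈ s, indicatorConstLp p (hf i) (measure_ne_top μ _) v
      = indicatorConstLp p (s.measurableSet_biUnion fun i _ => hf i) (measure_ne_top μ _) v := by
  classical
  induction s using Finset.induction_on with
  | empty =>
    simp only [Finset.sum_empty]
    symm
    convert indicatorConstLp_empty (p := p) (μ := μ) (c := v)
    simp
  | insert a s ha ih =>
    rw [Finset.sum_insert ha, ih, ← indicatorConstLp_disjoint_union]
    · congr 1
      simp
    · rw [Set.disjoint_iUnion₂_right]
      exact fun j hj => hd (by rintro rfl; exact ha hj)

lemma hasSum_indicatorConstLp [IsFiniteMeasure μ] [Fact (1 ≤ p)] (hp : p ≠ ∞) (v : E)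
    {f : ℕ → Set α}
    (hf : ∀ i, MeasurableSet (f i)) (hd : Pairwise (Function.onFun Disjoint f)) :
    HasSum (fun i => indicatorConstLp p (hf i) (measure_ne_top μ _) v)
      (indicatorConstLp p (MeasurableSet.iUnion hf) (measure_ne_top μ _) v) := by
  unfold HasSum
  simp only [SummationFilter.unconditional_filter]
  simp_rw [sum_indicatorConstLp v hf hd]
  refine tendsto_indicatorConstLp_set hp ?_
  have hU : MeasurableSet (⋃ i, f i) := MeasurableSet.iUnion hf
  have h1 : ∀ s : Finset ℕ, μ (symmDiff (⋃ i ∈ s, f i) (⋃ i, f i))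
      = μ (⋃ i, f i) - μ (⋃ i ∈ s, f i) := by
    intro s
    have hsub : (⋃ i ∈ s, f i) ⊆ ⋃ i, f i := iUnion₂_subset fun i _ => subset_iUnion f i
    rw [symmDiff_of_le hsub]
    exact measure_sdiff hsub (s.measurableSet_biUnion fun i _ => hf i).nullMeasurableSet
      (measure_ne_top _ _)
  simp_rw [h1]
  have h2 : Tendsto (fun s : Finset ℕ => μ (⋃ i ∈ s, f i)) atTop (𝓝 (μ (⋃ i, f i))) := by
    have : ∀ s : Finset ℕ, μ (⋃ i ∈ s, f i) = ∑ i ∈ s, μ (f i) := fun s =>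
      measure_biUnion_finset (fun i _ j _ hij => hd hij) fun i _ => hf i
    simp_rw [this]
    rw [measure_iUnion hd hf]
    exact ENNReal.summable.hasSum
  have h3 := ENNReal.Tendsto.sub (tendsto_const_nhds (x := μ (⋃ i, f i)) (f := atTop)) h2
    (Or.inl (measure_ne_top _ _))
  simpa using h3

lemma indicatorConstLp_const_smul [InnerProductSpace ℝ E] {B : Set α} (hB : MeasurableSet B)
    (hμB : μ B ≠ ∞) (c : ℝ)
    (v : E) : indicatorConstLp p hB hμB (c • v) = c • indicatorConstLp p hB hμB v := by
  refine Lp.ext ?_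
  filter_upwards [indicatorConstLp_coeFn (p := p) (hs := hB) (hμs := hμB) (c := c • v),
    indicatorConstLp_coeFn (p := p) (hs := hB) (hμs := hμB) (c := v),
    Lp.coeFn_smul c (indicatorConstLp p hB hμB v)] with x h1 h2 h3
  rw [h1, h3, Pi.smul_apply, h2, indicator_const_smul_apply]

variable [IsFiniteMeasure μ] [InnerProductSpace ℝ E] [Fact (1 ≤ p)]

/-- The vector measure `B ↦ L (v 1_B)` attached to a functional `L` on `Lp`. -/
def indicatorMeasure (hp : p ≠ ∞) (L : StrongDual ℝ (Lp E p μ)) (v : E) : SignedMeasure α := by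
  classical
  exact
  { measureOf' := fun B => if h : MeasurableSet B then
      L (indicatorConstLp p h (measure_ne_top μ B) v) else 0
    empty' := by simp
    not_measurable' := fun B hB => by simp [hB]
    m_iUnion' := fun f hf hd => by
      simp only [hf, MeasurableSet.iUnion hf, dif_pos]
      exact L.hasSum (hasSum_indicatorConstLp hp v hf hd) }

lemma indicatorMeasure_apply (hp : p ≠ ∞) (L : StrongDual ℝ (Lp E p μ)) (v : E) {B : Set α}
    (hB : MeasurableSet B) :
    indicatorMeasure hp L v B = L (indicatorConstLp p hB (measure_ne_top μ B) v) :=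
  dif_pos hB

/-- Radon–Nikodym: a functional on `Lp` is given on indicators by an integrable density. -/
lemma exists_integrable_density [FiniteDimensional ℝ E] (hp : p ≠ ∞) (L : StrongDual ℝ (Lp E p μ)) :
    ∃ g : α → E, StronglyMeasurable g ∧ Integrable g μ ∧
      ∀ (B : Set α) (hB : MeasurableSet B) (v : E),
        L (indicatorConstLp p hB (measure_ne_top μ B) v) = ∫ x in B, inner ℝ (g x) v ∂μ := by
  classical
  let b := stdOrthonormalBasis ℝ E
  let ν := fun i => indicatorMeasure hp L (b i)
  -- the indicator functions of null sets vanish in `Lp`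
  have hac : ∀ i, ν i ≪ᵥ μ.toENNRealVectorMeasure := by
    intro i
    refine VectorMeasure.AbsolutelyContinuous.mk fun B hB h0 => ?_
    rw [Measure.toENNRealVectorMeasure_apply_measurable hB] at h0
    rw [indicatorMeasure_apply hp L _ hB]
    have : indicatorConstLp p hB (measure_ne_top μ B) (b i) = 0 := by
      rw [← norm_eq_zero]
      rw [norm_indicatorConstLp (by have := Fact.out (p := 1 ≤ p); positivity) hp]
      rw [measureReal_def, h0]
      have : 0 < 1 / p.toReal := by
        have : 0 < p.toReal := ENNReal.toReal_pos (by have := Fact.out (p := 1 ≤ p); positivity) hp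
        positivity
      simp only [toReal_zero, zero_rpow this.ne', mul_zero]
    rw [this, map_zero]
  let g : α → E := fun x => ∑ i, (ν i).rnDeriv μ x • b i
  have hint : ∀ i, Integrable ((ν i).rnDeriv μ) μ := fun i => SignedMeasure.integrable_rnDeriv _ _
  refine ⟨g, ?_, ?_, ?_⟩
  · have hm : ∀ i, StronglyMeasurable ((ν i).rnDeriv μ) := fun i =>
      (SignedMeasure.measurable_rnDeriv _ _).stronglyMeasurable
    exact Finset.stronglyMeasurable_fun_sum _ fun i _ => (hm i).smul_const (b i)
  · exact integrable_finsetSum _ fun i _ => (hint i).smul_const (b i)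
  · intro B hB v
    have hv : v = ∑ i, inner ℝ (b i) v • b i := (b.sum_repr' v).symm
    let φ : E →ₗ[ℝ] Lp E p μ :=
      { toFun := fun v => indicatorConstLp p hB (measure_ne_top μ B) v
        map_add' := fun v w => indicatorConstLp_add.symm
        map_smul' := fun c v => indicatorConstLp_const_smul hB (measure_ne_top μ B) c v }
    have h1 : indicatorConstLp p hB (measure_ne_top μ B) v
        = ∑ i, inner ℝ (b i) v • indicatorConstLp p hB (measure_ne_top μ B) (b i) := by
      exact (congrArg φ hv).trans (by simp [φ])
    rw [h1, map_sum]
    simp_rw [map_smul]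
    have h2 : ∀ i, L (indicatorConstLp p hB (measure_ne_top μ B) (b i))
        = ∫ x in B, (ν i).rnDeriv μ x ∂μ := by
      intro i
      rw [← indicatorMeasure_apply hp L _ hB]
      conv_lhs => rw [← SignedMeasure.withDensityᵥ_rnDeriv_eq (indicatorMeasure hp L (b i)) μ (hac i)]
      rw [withDensityᵥ_apply (hint i) hB]
    simp_rw [h2, g, sum_inner, real_inner_smul_left]
    rw [integral_finsetSum _ fun i _ => ((hint i).integrableOn.mul_const _)]
    refine sum_congr rfl fun i _ => ?_
    rw [integral_mul_const, smul_eq_mul, mul_comm]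

lemma apply_simpleFunc (L : StrongDual ℝ (Lp E p μ)) {g : α → E} (hg : Integrable g μ)
    (hL : ∀ (B : Set α) (hB : MeasurableSet B) (v : E),
      L (indicatorConstLp p hB (measure_ne_top μ B) v) = ∫ x in B, inner ℝ (g x) v ∂μ)
    (f : SimpleFunc α E) (hf : MemLp f p μ) : Integrable (fun x => inner ℝ (g x) (f x)) μ ∧
      L (hf.toLp f) = ∫ x, inner ℝ (g x) (f x) ∂μ := by
  have hi : ∀ f : SimpleFunc α E, Integrable (fun x => inner ℝ (g x) (f x)) μ := fun f => by
    obtain ⟨C, hC⟩ := f.exists_forall_norm_le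
    refine (hg.norm.mul_const C).mono' (hg.1.inner f.aestronglyMeasurable) (ae_of_all _ fun x => ?_)
    exact (norm_inner_le_norm _ _).trans (by gcongr; exact hC x)
  refine ⟨hi f, ?_⟩
  induction f using SimpleFunc.induction with
  | @const c s hs =>
    have h1 : hf.toLp _ = indicatorConstLp p hs (measure_ne_top μ s) c :=
      MemLp.toLp_congr _ _ (ae_of_all _ fun x => by simp [indicator, piecewise])
    rw [h1, hL, ← integral_indicator hs]
    refine integral_congr_ae (ae_of_all _ fun x => ?_)
    by_cases hx : x ∈ s <;> simp [hx]
  | @add f₁ f₂ _ h₁ h₂ =>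
    have m₁ := f₁.memLp_of_isFiniteMeasure p μ
    have m₂ := f₂.memLp_of_isFiniteMeasure p μ
    have h3 : hf.toLp _ = m₁.toLp f₁ + m₂.toLp f₂ := rfl
    rw [h3, map_add, h₁ m₁, h₂ m₂, ← integral_add (hi f₁) (hi f₂)]
    simp [inner_add_right]

/-- The density representing a functional on `Lp` is in the conjugate space. It is tested by
`|t|^(q-2) t` for simple functions `t` approximating `g`, restricted to the set where the relative
error is at most `1/2`. -/
lemma memLp_density [hpq : ENNReal.HolderConjugate p q] (hp : p ≠ ∞) (hq : q ≠ ∞)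
    (L : StrongDual ℝ (Lp E p μ)) {g : α → E} (hgm : StronglyMeasurable g) (hg : Integrable g μ)
    (hL : ∀ (B : Set α) (hB : MeasurableSet B) (v : E),
      L (indicatorConstLp p hB (measure_ne_top μ B) v) = ∫ x in B, inner ℝ (g x) v ∂μ) :
    MemLp g q μ := by
  have hc : p.toReal.HolderConjugate q.toReal := ENNReal.HolderConjugate.toReal_of_ne_top hp hq
  let A : ℕ → Set α := fun n => {x | ‖g x - hgm.approx n x‖ ≤ ‖hgm.approx n x‖ / 2}
  have hA : ∀ n, MeasurableSet (A n) := fun n => measurableSet_le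
    (hgm.sub (hgm.approx n).stronglyMeasurable).norm.measurable
    ((hgm.approx n).stronglyMeasurable.norm.measurable.div_const 2)
  let t : ℕ → SimpleFunc α E := fun n => (hgm.approx n).restrict (A n)
  have ht : ∀ n x, t n x = (A n).indicator (hgm.approx n) x := fun n x =>
    SimpleFunc.restrict_apply _ (hA n) x
  have hbound : ∀ n, eLpNorm (t n) q μ ≤ ofReal (2 * ‖L‖) := fun n => by
    let f : SimpleFunc α E := (t n).map fun v => ‖v‖ ^ (q.toReal - 2) • v
    have hf := f.memLp_of_isFiniteMeasure p μ
    have hpow : ∀ v : E, ‖‖v‖ ^ (q.toReal - 2) • v‖ ^ p.toReal = ‖v‖ ^ q.toReal ∧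
        ‖v‖ ^ (q.toReal - 2) * ‖v‖ ^ 2 = ‖v‖ ^ q.toReal := fun v => by
      rcases eq_or_ne v 0 with rfl | hv
      · simp [hc.pos.ne', hc.symm.pos.ne']
      · have h := norm_pos_iff.2 hv
        rw [norm_smul, norm_of_nonneg (by positivity), ← Real.rpow_add_one h.ne',
          ← rpow_mul h.le, ← Real.rpow_natCast ‖v‖ 2, ← Real.rpow_add h]
        have h2 := hc.symm.sub_one_mul_conj
        constructor <;> congr 1 <;> push_cast <;> linarith
    set I := ∫ x, ‖t n x‖ ^ q.toReal ∂μ with hI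
    have hI0 : 0 ≤ I := integral_nonneg fun x => by positivity
    -- on `A n` the pairing of `g` with the test function is at least half of `‖t‖^q`
    have h1 : I / 2 ≤ ‖L‖ * I ^ (p.toReal)⁻¹ := by
      obtain ⟨i1, h1⟩ := apply_simpleFunc L hg hL f hf
      have h2 : ‖hf.toLp f‖ = I ^ (p.toReal)⁻¹ := by
        rw [Lp.norm_toLp, hf.eLpNorm_eq_integral_rpow_norm hpq.ne_zero hp,
          toReal_ofReal (by positivity), hI]
        simp only [f, SimpleFunc.map_apply, (hpow _).1]
      rw [← h2]
      refine le_trans ?_ ((le_abs_self _).trans (L.le_opNorm _))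
      rw [h1, hI, ← integral_div]
      refine integral_mono_of_nonneg (ae_of_all _ fun x => by positivity) i1
        (ae_of_all _ fun x => ?_)
      simp only [f, SimpleFunc.map_apply, inner_smul_right, ← (hpow _).2, mul_div_assoc]
      refine mul_le_mul_of_nonneg_left ?_ (by positivity)
      rw [ht]
      by_cases hx : x ∈ A n
      · rw [indicator_of_mem hx]
        have h3 : ‖g x - hgm.approx n x‖ ≤ ‖hgm.approx n x‖ / 2 := hx
        have h4 := (abs_le.1 (abs_real_inner_le_norm (g x - hgm.approx n x) (hgm.approx n x))).1
        rw [inner_sub_left, real_inner_self_eq_norm_sq] at h4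
        nlinarith [norm_nonneg (hgm.approx n x)]
      · simp [hx]
    rw [((t n).memLp_of_isFiniteMeasure q μ).eLpNorm_eq_integral_rpow_norm hpq.symm.ne_zero hq, ← hI]
    refine ofReal_le_ofReal ?_
    rcases hI0.eq_or_lt with h | h
    · rw [← h, zero_rpow (inv_ne_zero hc.symm.pos.ne')]; positivity
    · refine le_of_mul_le_mul_right ?_ (Real.rpow_pos_of_pos h (p.toReal)⁻¹)
      rw [← Real.rpow_add h, hc.symm.inv_add_inv_eq_one, Real.rpow_one]
      linarith
  -- Fatou's lemma, as `t n` converges to `g` pointwise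
  refine ⟨hgm.aestronglyMeasurable, (Lp.eLpNorm_lim_le_liminf_eLpNorm
    (f := fun n => t n) (fun n => (t n).aestronglyMeasurable) g (ae_of_all _ fun x => ?_)).trans_lt
    ((liminf_le_liminf (Eventually.of_forall hbound)).trans_lt
      (by rw [liminf_const]; exact ofReal_lt_top))⟩
  · have h1 := hgm.tendsto_approx x
    rcases eq_or_ne (g x) 0 with h | h
    · rw [h] at h1 ⊢
      refine squeeze_zero_norm (fun n => ?_) (tendsto_zero_iff_norm_tendsto_zero.1 h1)
      rw [ht]
      exact norm_indicator_le_norm_self _ _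
    · refine h1.congr' ?_
      have h2 : Tendsto (fun n => ‖hgm.approx n x‖ / 2 - ‖g x - hgm.approx n x‖) atTop
          (𝓝 (‖g x‖ / 2 - ‖g x - g x‖)) :=
        (h1.norm.div_const 2).sub (tendsto_const_nhds.sub h1).norm
      rw [sub_self, norm_zero, sub_zero] at h2
      filter_upwards [h2.eventually (lt_mem_nhds (show 0 < ‖g x‖ / 2 by positivity))] with n hn
      rw [ht, indicator_of_mem (show x ∈ A n from (sub_pos.1 hn).le)]

/-- The dual of `Lp` is `Lq`. -/
lemma exists_lpPairing_eq [FiniteDimensional ℝ E] [hpq : ENNReal.HolderConjugate p q] [Fact (1 ≤ q)]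
    (hp : p ≠ ∞) (hq : q ≠ ∞) (L : StrongDual ℝ (Lp E p μ)) :
    ∃ g : Lp E q μ, L = (innerSL ℝ).lpPairing μ q p g := by
  obtain ⟨g, hgm, hgi, hL⟩ := exists_integrable_density hp L
  have hg := memLp_density (q := q) hp hq L hgm hgi hL
  refine ⟨hg.toLp g, ?_⟩
  ext f
  induction f using Lp.induction hp with
  | @indicatorConst c s hs hμs =>
    rw [Lp.simpleFunc.coe_indicatorConst, hL, ContinuousLinearMap.lpPairing_eq_integral,
      ← integral_indicator hs]
    refine integral_congr_ae ?_
    filter_upwards [indicatorConstLp_coeFn (p := p) (hs := hs) (hμs := hμs.ne) (c := c),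
      hg.coeFn_toLp] with x h2 h3
    rw [h2, h3]
    by_cases hx' : x ∈ s <;> simp [hx', innerSL_apply_apply ℝ]
  | add hf hg hd ihf ihg => rw [map_add, map_add, ihf, ihg]
  | isClosed => exact isClosed_eq L.continuous (ContinuousLinearMap.continuous _)

/-- Closed balls of `Lp`, `1 < p < ∞`, are weakly compact. -/
lemma isCompact_weak_closedBall_Lp [FiniteDimensional ℝ E] [hpq : ENNReal.HolderConjugate p q]
    [Fact (1 ≤ q)]
    (hp : p ≠ ∞) (hq : q ≠ ∞) (M : ℝ) :
    IsCompact {x : WeakSpace ℝ (Lp E p μ) | ‖(toWeakSpace ℝ (Lp E p μ)).symm x‖ ≤ M} := by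
  have hsurj : Set.range (NormedSpace.inclusionInDoubleDualWeak ℝ (Lp E p μ)) = univ := by
    refine eq_univ_of_forall fun F => ?_
    -- `F` is a functional on the dual of `Lp`, hence on `Lq`, hence it comes from `Lp`
    let F' : StrongDual ℝ (StrongDual ℝ (Lp E p μ)) := WeakDual.toStrongDual F
    obtain ⟨f, hf⟩ := exists_lpPairing_eq (p := q) (q := p) (hpq := hpq.symm) hq hp
      (F'.comp ((innerSL ℝ).lpPairing μ q p))
    refine ⟨toWeakSpace ℝ _ f, ?_⟩
    apply WeakDual.toStrongDual.injective
    ext L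
    obtain ⟨g, rfl⟩ := exists_lpPairing_eq (p := p) (q := q) hp hq L
    have h1 : F' ((innerSL ℝ).lpPairing μ q p g) = ((innerSL ℝ).lpPairing μ p q f) g :=
      DFunLike.congr_fun hf g
    change ((innerSL ℝ).lpPairing μ q p g) f = F' ((innerSL ℝ).lpPairing μ q p g)
    rw [h1, ContinuousLinearMap.lpPairing_eq_integral, ContinuousLinearMap.lpPairing_eq_integral]
    exact integral_congr_ae (ae_of_all _ fun x => (real_inner_comm (f x) (g x) :))
  have hcl : IsClosed {x : WeakSpace ℝ (Lp E p μ) | ‖(toWeakSpace ℝ (Lp E p μ)).symm x‖ ≤ M} := by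
    have hc : IsClosed (Metric.closedBall (0 : Lp E p μ) M) := Metric.isClosed_closedBall
    have hcv : Convex ℝ (Metric.closedBall (0 : Lp E p μ) M) := convex_closedBall _ _
    have := hcv.toWeakSpace_closure ℝ
    rw [hc.closure_eq] at this
    have h2 : {x : WeakSpace ℝ (Lp E p μ) | ‖(toWeakSpace ℝ (Lp E p μ)).symm x‖ ≤ M}
        = toWeakSpace ℝ (Lp E p μ) '' Metric.closedBall (0 : Lp E p μ) M := by
      ext x
      constructor
      · intro hx
        exact ⟨(toWeakSpace ℝ (Lp E p μ)).symm x, by simpa using hx, by simp⟩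
      · rintro ⟨y, hy, rfl⟩
        simpa using hy
    rw [h2, this]
    exact isClosed_closure
  rw [← hcl.closure_eq]
  refine NormedSpace.isCompact_closure_of_isBounded ℝ _ _ ?_ (by rw [hsurj]; exact subset_univ _)
  refine (Metric.isBounded_closedBall (x := (0 : Lp E p μ)) (r := M)).subset fun x hx => ?_
  simpa using hx

end LpDual

/-! ### Convex combinations of tails of sequences -/

/-- The combination `∑ wⱼ xⱼ` of the terms of a sequence. -/
abbrev combo {V : Type*} [AddCommGroup V] [Module ℝ V] (w : ℕ →₀ ℝ) (x : ℕ → V) : V :=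
  Finsupp.linearCombination ℝ x w

/-- `w` consists of the weights of a convex combination of terms with index at least `n`. -/
structure IsTailConvex (n : ℕ) (w : ℕ →₀ ℝ) : Prop where
  nonneg : ∀ j, 0 ≤ w j
  tail : ∀ j < n, w j = 0
  sum_eq : combo w (fun _ => (1 : ℝ)) = 1

section Combo

variable {V : Type*} [AddCommGroup V] [Module ℝ V]

lemma combo_eq_sum (w : ℕ →₀ ℝ) (x : ℕ → V) : combo w x = ∑ j ∈ w.support, w j • x j := by
  simp [combo, Finsupp.linearCombination_apply, Finsupp.sum]

lemma IsTailConvex.mem_support {n : ℕ} {w : ℕ →₀ ℝ} (hw : IsTailConvex n w) {j : ℕ}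
    (hj : j ∈ w.support) : n ≤ j := by
  by_contra h
  exact (Finsupp.mem_support_iff.1 hj) (hw.tail j (not_le.1 h))

lemma IsTailConvex.sum_support {n : ℕ} {w : ℕ →₀ ℝ} (hw : IsTailConvex n w) :
    ∑ j ∈ w.support, w j = 1 := by
  have := hw.sum_eq
  rw [combo_eq_sum] at this
  simpa using this

lemma IsTailConvex.mono {n m : ℕ} {w : ℕ →₀ ℝ} (hw : IsTailConvex n w) (h : m ≤ n) :
    IsTailConvex m w :=
  ⟨hw.nonneg, fun j hj => hw.tail j (hj.trans_le h), hw.sum_eq⟩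

lemma IsTailConvex.combo_const {n : ℕ} {w : ℕ →₀ ℝ} (hw : IsTailConvex n w) (v : V) :
    combo w (fun _ => v) = v := by
  rw [combo_eq_sum, ← sum_smul, hw.sum_support, one_smul]

lemma IsTailConvex.combo_mono {n : ℕ} {w : ℕ →₀ ℝ} (hw : IsTailConvex n w) {x y : ℕ → ℝ}
    (h : ∀ j, n ≤ j → x j ≤ y j) : combo w x ≤ combo w y := by
  rw [combo_eq_sum, combo_eq_sum]
  exact sum_le_sum fun j hj =>
    mul_le_mul_of_nonneg_left (h j (hw.mem_support hj)) (hw.nonneg j)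

lemma IsTailConvex.norm_combo_le {V : Type*} [NormedAddCommGroup V] [NormedSpace ℝ V] {n : ℕ}
    {w : ℕ →₀ ℝ} (hw : IsTailConvex n w) {x : ℕ → V} {C : ℝ} (h : ∀ j, n ≤ j → ‖x j‖ ≤ C) :
    ‖combo w x‖ ≤ C := by
  rw [combo_eq_sum]
  calc ‖∑ j ∈ w.support, w j • x j‖ ≤ ∑ j ∈ w.support, ‖w j • x j‖ := norm_sum_le _ _
    _ ≤ ∑ j ∈ w.support, w j * C := sum_le_sum fun j hj => by
        rw [norm_smul, norm_of_nonneg (hw.nonneg j)]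
        exact mul_le_mul_of_nonneg_left (h j (hw.mem_support hj)) (hw.nonneg j)
    _ = C := by rw [← sum_mul, hw.sum_support, one_mul]

lemma tendsto_combo {V : Type*} [NormedAddCommGroup V] [NormedSpace ℝ V] {w : ℕ → ℕ →₀ ℝ}
    (hw : ∀ n, IsTailConvex n (w n)) {x : ℕ → V} {l : V} (h : Tendsto x atTop (𝓝 l)) :
    Tendsto (fun n => combo (w n) x) atTop (𝓝 l) := by
  rw [Metric.tendsto_atTop] at h ⊢
  intro ε hε
  obtain ⟨N, hN⟩ := h (ε / 2) (half_pos hε)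
  refine ⟨N, fun n hn => ?_⟩
  have h1 : combo (w n) x - l = combo (w n) (fun j => x j - l) := by
    conv_lhs => rw [← (hw n).combo_const l]
    simp only [combo_eq_sum, smul_sub, sum_sub_distrib]
  rw [dist_eq_norm, h1]
  refine ((hw n).norm_combo_le fun j hj => ?_).trans_lt (half_lt_self hε)
  rw [← dist_eq_norm]
  exact (hN j (hn.trans hj)).le

/-- A convex combination of the midpoint of two convex combinations. -/
lemma IsTailConvex.midpoint {n : ℕ} {w w' : ℕ →₀ ℝ} (hw : IsTailConvex n w)
    (hw' : IsTailConvex n w') : IsTailConvex n ((1 / 2 : ℝ) • (w + w')) where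
  nonneg j := by
    have := hw.nonneg j
    have := hw'.nonneg j
    simp only [Finsupp.smul_apply, Finsupp.add_apply, smul_eq_mul]
    positivity
  tail j hj := by simp [hw.tail j hj, hw'.tail j hj]
  sum_eq := by
    rw [combo, map_smul, map_add]
    have h1 := hw.sum_eq
    have h2 := hw'.sum_eq
    rw [combo] at h1 h2
    rw [h1, h2]; norm_num

/-- A bounded sequence in a Hilbert space has convergent convex combinations of its tails: near
minimizers of the norm in the convex hulls of the tails form a Cauchy sequence. -/
lemma exists_tailConvex_tendsto {H : Type*} [NormedAddCommGroup H] [InnerProductSpace ℝ H]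
    [CompleteSpace H] {x : ℕ → H} {R : ℝ} (hx : ∀ n, ‖x n‖ ≤ R) :
    ∃ w : ℕ → ℕ →₀ ℝ, (∀ n, IsTailConvex n (w n)) ∧
      ∃ l, Tendsto (fun n => combo (w n) x) atTop (𝓝 l) := by
  let S : ℕ → Set ℝ := fun n => {r | ∃ w, IsTailConvex n w ∧ r = ‖combo w x‖}
  have hne : ∀ n, (S n).Nonempty := fun n => by
    refine ⟨_, Finsupp.single n 1, ⟨fun j => ?_, fun j hj => ?_, ?_⟩, rfl⟩
    · rw [Finsupp.single_apply]; split_ifs <;> norm_num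
    · rw [Finsupp.single_apply, if_neg hj.ne']
    · simp [combo]
  have hbdd : ∀ n, BddBelow (S n) := fun n => ⟨0, by rintro _ ⟨w, -, rfl⟩; exact norm_nonneg _⟩
  let d : ℕ → ℝ := fun n => sInf (S n)
  have hd0 : ∀ n, 0 ≤ d n := fun n => le_csInf (hne n)
      (by rintro _ ⟨w, -, rfl⟩; exact norm_nonneg _)
  have hdR : ∀ n, d n ≤ R := fun n => by
    obtain ⟨r, w, hw, rfl⟩ := hne n
    exact (csInf_le (hbdd n) ⟨w, hw, rfl⟩).trans (hw.norm_combo_le fun j _ => hx j)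
  have hmono : Monotone d := fun n m hnm => csInf_le_csInf (hbdd n) (hne m) (by
    rintro _ ⟨w, hw, rfl⟩
    exact ⟨w, hw.mono hnm, rfl⟩)
  obtain ⟨D, hD⟩ : ∃ D, Tendsto d atTop (𝓝 D) :=
    ⟨_, tendsto_atTop_ciSup hmono ⟨R, by rintro _ ⟨n, rfl⟩; exact hdR n⟩⟩
  have hdD : ∀ n, d n ≤ D := fun n => hmono.ge_of_tendsto hD n
  have hch : ∀ n : ℕ, ∃ w, IsTailConvex n w ∧ ‖combo w x‖ < d n + 1 / ((n : ℝ) + 1) := fun n => by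
    obtain ⟨_, ⟨w, hw, rfl⟩, h⟩ := exists_lt_of_csInf_lt (hne n)
      (show sInf (S n) < d n + 1 / ((n : ℝ) + 1) from lt_add_of_pos_right _ (by positivity))
    exact ⟨w, hw, h⟩
  choose w hw hwd using hch
  refine ⟨w, hw, cauchySeq_tendsto_of_complete ?_⟩
  let b : ℕ → ℝ := fun n => Real.sqrt (4 * ((D + 1 / ((n : ℝ) + 1)) ^ 2 - d n ^ 2))
  refine cauchySeq_of_le_tendsto_0 b (fun n m N hn hm => ?_) ?_
  · rw [dist_eq_norm]
    apply Real.le_sqrt_of_sq_le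
    have hb : ∀ k, N ≤ k → ‖combo (w k) x‖ ≤ D + 1 / ((N : ℝ) + 1) := fun k hk => by
      refine (hwd k).le.trans (add_le_add (hdD k) ?_)
      apply one_div_le_one_div_of_le (by positivity)
      exact_mod_cast Nat.succ_le_succ hk
    -- midpoints are admissible, so the parallelogram law bounds the distance
    have hmid : d N ≤ ‖(1 / 2 : ℝ) • (combo (w n) x + combo (w m) x)‖ := by
      refine csInf_le (hbdd N) ⟨_, ((hw n).mono hn).midpoint ((hw m).mono hm), ?_⟩
      simp only [combo, map_smul, map_add]
    rw [norm_smul, norm_of_nonneg (by norm_num)] at hmid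
    have hpl := parallelogram_law_with_norm ℝ (combo (w n) x) (combo (w m) x)
    have h1 := pow_le_pow_left₀ (norm_nonneg _) (hb n hn) 2
    have h2 := pow_le_pow_left₀ (norm_nonneg _) (hb m hm) 2
    have h3 := pow_le_pow_left₀ (hd0 N) hmid 2
    nlinarith
  · have h1 : Tendsto (fun n : ℕ => 4 * ((D + 1 / ((n : ℝ) + 1)) ^ 2 - d n ^ 2)) atTop
        (𝓝 (4 * ((D + 0) ^ 2 - D ^ 2))) :=
      (((tendsto_const_nhds.add tendsto_one_div_add_atTop_nhds_zero_nat).pow 2).sub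
        (hD.pow 2)).const_mul 4
    have h2 := (Real.continuous_sqrt.tendsto _).comp h1
    simpa [Function.comp_def, b] using h2

/-- Countably many bounded sequences of functions of time have common convex combinations of
tails converging almost everywhere. All of them are put into one `L²` space, over the
product of the given measure space with `ℕ`. -/
lemma exists_tailConvex_ae_tendsto {α : Type*} [MeasurableSpace α] {μ : Measure α}
    [IsFiniteMeasure μ] {g : ℕ → ℕ → α → ℝ} {C : ℕ → ℝ}
    (hm : ∀ n k, AEMeasurable (g n k) μ) (hC : ∀ n k, ∀ᵐ t ∂μ, |g n k t| ≤ C k) :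
    ∃ w : ℕ → ℕ →₀ ℝ, (∀ n, IsTailConvex n (w n)) ∧
      ∀ k, ∀ᵐ t ∂μ, ∃ l, Tendsto (fun n => combo (w n) (fun j => g j k t)) atTop (𝓝 l) := by
  -- a finite measure on `ℕ` charging every point
  let ν : Measure ℕ := (Measure.count : Measure ℕ).toFinite
  have hν : ∀ p : ℕ → Prop, (∀ᵐ k ∂ν, p k) → ∀ k, p k := fun p hp => by
    have : ∀ᵐ k ∂(Measure.count : Measure ℕ), p k := by
      rw [← ae_toFinite]; exact hp
    exact Measure.ae_count_iff.1 this
  have hc : ∀ k, 0 < 1 + |C k| := fun k => by positivity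
  -- the sequences are normalized by their bounds; the truncation changes null sets only
  let G : ℕ → α × ℕ → ℝ := fun n z => max (-1) (min 1 ((hm n z.2).mk _ z.1 / (1 + |C z.2|)))
  have hGm : ∀ n, Measurable (G n) := fun n => by
    refine measurable_from_prod_countable_left fun k => ?_
    exact measurable_const.max (measurable_const.min
      (((hm n k).measurable_mk.div_const (1 + |C k|) :)))
  have hGb : ∀ n z, ‖G n z‖ ≤ 1 := fun n z => by
    rw [norm_eq_abs, abs_le]
    exact ⟨le_max_left _ _, max_le (by norm_num) (min_le_left _ _)⟩
  have hGg : ∀ n k, ∀ᵐ t ∂μ, G n (t, k) * (1 + |C k|) = g n k t := fun n k => by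
    filter_upwards [(hm n k).ae_eq_mk, hC n k] with t h1 h2
    have h3 : |g n k t / (1 + |C k|)| ≤ 1 := by
      rw [abs_div, abs_of_pos (hc k), div_le_one (hc k)]
      linarith [le_abs_self (C k)]
    simp only [G]
    rw [← h1, min_eq_right (abs_le.1 h3).2, max_eq_right (abs_le.1 h3).1,
      div_mul_cancel₀ _ (hc k).ne']
  have hGp : ∀ n, MemLp (G n) 2 (μ.prod ν) := fun n =>
    MemLp.of_bound (hGm n).aestronglyMeasurable 1 (ae_of_all _ (hGb n))
  let x : ℕ → Lp ℝ 2 (μ.prod ν) := fun n => (hGp n).toLp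
  have hxb : ∀ n, ‖x n‖ ≤ (measureUnivNNReal (μ.prod ν) : ℝ) ^ (ENNReal.toReal 2)⁻¹ * 1 :=
      fun n => by
    refine Lp.norm_le_of_ae_bound zero_le_one ?_
    filter_upwards [(hGp n).coeFn_toLp] with z hz
    rw [hz]; exact hGb n z
  obtain ⟨w, hw, l, hl⟩ := exists_tailConvex_tendsto hxb
  obtain ⟨φ, hφ, hae⟩ := (tendstoInMeasure_of_tendsto_Lp hl).exists_seq_tendsto_ae
  refine ⟨fun n => w (φ n), fun n => (hw (φ n)).mono (hφ.id_le n), fun k => ?_⟩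
  have hcoe : ∀ᵐ z ∂(μ.prod ν), ∀ n, (combo (w n) x : Lp ℝ 2 (μ.prod ν)) z
      = combo (w n) (fun j => G j z) := by
    rw [ae_all_iff]
    intro n
    have h1 : ∀ᵐ z ∂(μ.prod ν), ∀ j, x j z = G j z := ae_all_iff.2 fun j => (hGp j).coeFn_toLp
    have h2 : ∀ᵐ z ∂(μ.prod ν), ∀ j, (w n j • x j : Lp ℝ 2 (μ.prod ν)) z = w n j • x j z :=
      ae_all_iff.2 fun j => Lp.coeFn_smul _ _
    rw [combo_eq_sum]
    filter_upwards [h1, h2, Lp.coeFn_fun_finsetSum (w n).support fun j => w n j • x j]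
      with z h1 h2 h3
    rw [h3, combo_eq_sum]
    exact sum_congr rfl fun j _ => by rw [h2, h1]
  have h1 := Measure.ae_ae_of_ae_prod (hae.and hcoe)
  filter_upwards [h1, ae_all_iff.2 fun n => hGg n k] with t h1 h2
  obtain ⟨h3, h4⟩ := hν _ h1 k
  refine ⟨l (t, k) * (1 + |C k|), ?_⟩
  have h5 := h3.mul_const (1 + |C k|)
  refine h5.congr fun n => ?_
  rw [h4, combo_eq_sum, combo_eq_sum, sum_mul]
  refine sum_congr rfl fun j _ => ?_
  rw [← h2 j, smul_eq_mul, smul_eq_mul, mul_assoc]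

/-- A bounded sequence of functionals which converges on a dense set converges everywhere. -/
lemma exists_tendsto_of_tendsto_dense {X ι : Type*} [NormedAddCommGroup X] [NormedSpace ℝ X]
    {L : ℕ → StrongDual ℝ X} {C : ℝ} (hC : ∀ n, ‖L n‖ ≤ C) {F : ι → X} (hF : DenseRange F)
    (h : ∀ k, ∃ l, Tendsto (fun n => L n (F k)) atTop (𝓝 l)) :
    ∃ L' : StrongDual ℝ X, ‖L'‖ ≤ C ∧ ∀ f, Tendsto (fun n => L n f) atTop (𝓝 (L' f)) := by
  have hC0 : 0 ≤ C := (norm_nonneg _).trans (hC 0)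
  have hc : ∀ f, ∃ l, Tendsto (fun n => L n f) atTop (𝓝 l) := by
    intro f
    refine cauchySeq_tendsto_of_complete (Metric.cauchySeq_iff.2 fun ε hε => ?_)
    obtain ⟨k, hk⟩ := Metric.denseRange_iff.1 hF f (ε / (3 * (C + 1))) (by positivity)
    obtain ⟨l, hl⟩ := h k
    obtain ⟨N, hN⟩ := Metric.cauchySeq_iff.1 hl.cauchySeq (ε / 3) (by positivity)
    refine ⟨N, fun m hm n hn => ?_⟩
    have h1 : ∀ n, dist (L n f) (L n (F k)) ≤ ε / 3 := fun n => by
      rw [dist_eq_norm, ← map_sub]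
      calc ‖L n (f - F k)‖ ≤ C * ‖f - F k‖ := (L n).le_of_opNorm_le (hC n) _
        _ ≤ (C + 1) * (ε / (3 * (C + 1))) := by
            rw [← dist_eq_norm]
            exact mul_le_mul (by linarith) hk.le dist_nonneg (by linarith)
        _ = ε / 3 := by field_simp
    calc dist (L m f) (L n f)
        ≤ dist (L m f) (L m (F k)) + dist (L m (F k)) (L n (F k)) + dist (L n (F k)) (L n f) :=
          dist_triangle4 _ _ _ _
      _ < ε / 3 + ε / 3 + ε / 3 :=
          add_lt_add_of_lt_of_le (add_lt_add_of_le_of_lt (h1 m) (hN m hm n hn))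
            (by rw [dist_comm]; exact h1 n)
      _ = ε := by ring
  choose l hl using hc
  let L' : X →ₗ[ℝ] ℝ :=
    { toFun := l
      map_add' := fun f g => tendsto_nhds_unique (hl (f + g))
        (((hl f).add (hl g)).congr fun n => (map_add (L n) f g).symm)
      map_smul' := fun c f => tendsto_nhds_unique (hl (c • f))
        (((hl f).const_mul c).congr fun n => by simp) }
  have hb : ∀ f, ‖L' f‖ ≤ C * ‖f‖ := fun f =>
    le_of_tendsto (hl f).norm (Eventually.of_forall fun n => (L n).le_of_opNorm_le (hC n) f)
  exact ⟨L'.mkContinuous C hb, L'.mkContinuous_norm_le hC0 hb, hl⟩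

end Combo

/-! ### Weakly continuous trajectories -/

section Weak

variable {X : Type} [NormedAddCommGroup X] [NormedSpace ℝ X]

/-- The closed ball of radius `M` with the weak topology. -/
def weakBall (X : Type) [NormedAddCommGroup X] [NormedSpace ℝ X] (M : ℝ) : Set (WeakSpace ℝ X) :=
  {x | ‖(toWeakSpace ℝ X).symm x‖ ≤ M}

/-- All closed balls are weakly compact and the countable family `ℓ` of functionals separates
points. -/
structure IsSeparatingFamily (X : Type) [NormedAddCommGroup X] [NormedSpace ℝ X]
    (ℓ : ℕ → StrongDual ℝ X) : Prop where
  compact : ∀ M, IsCompact (weakBall X M)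
  separates : ∀ x, (∀ k, ℓ k x = 0) → x = 0

variable {ℓ : ℕ → StrongDual ℝ X}

lemma continuous_apply_weak (L : StrongDual ℝ X) :
    Continuous fun x : WeakSpace ℝ X => L ((toWeakSpace ℝ X).symm x) :=
  WeakBilin.eval_continuous (topDualPairing ℝ X).flip L

/-- The moments with respect to the functionals `ℓ k`. -/
def weakMoments (ℓ : ℕ → StrongDual ℝ X) (M : ℝ) : C(weakBall X M, ℕ → ℝ) where
  toFun x k := ℓ k ((toWeakSpace ℝ X).symm x)
  continuous_toFun := continuous_pi fun k => (continuous_apply_weak (ℓ k)).comp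
    continuous_subtype_val

lemma IsSeparatingFamily.isEmbedding (h : IsSeparatingFamily X ℓ) (M : ℝ) :
    IsEmbedding (weakMoments ℓ M) := by
  have : CompactSpace (weakBall X M) := isCompact_iff_compactSpace.1 (h.compact M)
  refine ((weakMoments ℓ M).continuous.isClosedEmbedding fun x y hxy => ?_).isEmbedding
  apply Subtype.ext
  apply (toWeakSpace ℝ X).symm.injective
  rw [← sub_eq_zero]
  refine h.separates _ fun k => ?_
  rw [map_sub, sub_eq_zero]
  exact congrFun hxy k

lemma IsSeparatingFamily.metrizable_weakBall (h : IsSeparatingFamily X ℓ) (M : ℝ) :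
    TopologicalSpace.MetrizableSpace (weakBall X M) :=
  (h.isEmbedding M).metrizableSpace

variable {T : ℝ}

/-- The inclusion of the trajectories with values in a ball. -/
def ballInclusion (X : Type) [NormedAddCommGroup X] [NormedSpace ℝ X] (T M : ℝ) :
    C(Icc (0 : ℝ) T, weakBall X M) → CWeak T X :=
  fun u => (⟨Subtype.val, continuous_subtype_val⟩ : C(weakBall X M, WeakSpace ℝ X)).comp u

lemma isEmbedding_ballInclusion (M : ℝ) : IsEmbedding (ballInclusion X T M) :=
  ContinuousMap.isEmbedding_postcomp _ IsEmbedding.subtypeVal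

lemma val_apply (u : CWeak T X) {t : ℝ} (ht : t ∈ Icc 0 T) :
    u.val t = (toWeakSpace ℝ X).symm (u ⟨t, ht⟩) := dif_pos ht

lemma range_ballInclusion (M : ℝ) :
    range (ballInclusion X T M) = {u | ∀ t ∈ Icc 0 T, ‖u.val t‖ ≤ M} := by
  ext u
  constructor
  · rintro ⟨v, rfl⟩ t ht
    rw [val_apply _ ht]
    exact (v ⟨t, ht⟩).2
  · intro hu
    have hu' : ∀ t, u t ∈ weakBall X M := fun t => by
      have := hu t t.2
      rwa [val_apply _ t.2] at this
    exact ⟨⟨fun t => ⟨u t, hu' t⟩, u.continuous.subtype_mk hu'⟩, by ext; rfl⟩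

lemma IsSeparatingFamily.metrizable_bounded (h : IsSeparatingFamily X ℓ) (T M : ℝ) :
    TopologicalSpace.MetrizableSpace {u : CWeak T X | ∀ t ∈ Icc 0 T, ‖u.val t‖ ≤ M} := by
  rw [← range_ballInclusion]
  have h1 : TopologicalSpace.MetrizableSpace C(Icc (0 : ℝ) T, weakBall X M) := by
    have h2 : IsEmbedding fun u : C(Icc (0 : ℝ) T, weakBall X M) => (weakMoments ℓ M).comp u :=
      ContinuousMap.isEmbedding_postcomp _ (h.isEmbedding M)
    have : TopologicalSpace.MetrizableSpace C(Icc (0 : ℝ) T, ℕ → ℝ) := inferInstance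
    exact h2.metrizableSpace
  exact (isEmbedding_ballInclusion M).toHomeomorph.symm.isEmbedding.metrizableSpace

lemma continuous_val (u : CWeak T X) (L : StrongDual ℝ X) :
    ContinuousOn (fun t => L (u.val t)) (Icc 0 T) := by
  rw [continuousOn_iff_continuous_domRestrict]
  refine ((continuous_apply_weak L).comp u.continuous).congr fun t => ?_
  simp [val_apply u t.2]

/-- Convergence of trajectories with values in a ball is the uniform convergence of the moments. -/
lemma IsSeparatingFamily.tendsto_of_moments (h : IsSeparatingFamily X ℓ) {M : ℝ}
    {u : ℕ → CWeak T X} {v : CWeak T X} (hu : ∀ n, ∀ t ∈ Icc 0 T, ‖(u n).val t‖ ≤ M)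
    (hv : ∀ t ∈ Icc 0 T, ‖v.val t‖ ≤ M)
    (hlim : ∀ k, TendstoUniformlyOn (fun n t => ℓ k ((u n).val t)) (fun t => ℓ k (v.val t)) atTop
      (Icc 0 T)) : Tendsto u atTop (𝓝 v) := by
  have hu' : ∀ n, ∃ u' : C(Icc (0 : ℝ) T, weakBall X M), ballInclusion X T M u' = u n := fun n => by
    have : u n ∈ range (ballInclusion X T M) := by rw [range_ballInclusion]; exact hu n
    exact this
  choose u' hu' using hu'
  obtain ⟨v', hv'⟩ : v ∈ range (ballInclusion X T M) := by rw [range_ballInclusion]; exact hv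
  have h2 : IsEmbedding fun u : C(Icc (0 : ℝ) T, weakBall X M) => (weakMoments ℓ M).comp u :=
    ContinuousMap.isEmbedding_postcomp _ (h.isEmbedding M)
  have h3 : Tendsto u' atTop (𝓝 v') := by
    rw [h2.tendsto_nhds_iff, ContinuousMap.tendsto_iff_tendstoUniformly]
    rw [tendstoUniformly_iff_tendsto, Pi.uniformity, tendsto_iInf]
    intro k
    rw [tendsto_comap_iff]
    suffices hs : TendstoUniformly (fun n t => (weakMoments ℓ M).comp (u' n) t k)
        (fun t => (weakMoments ℓ M).comp v' t k) atTop from tendstoUniformly_iff_tendsto.1 hs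
    have := tendstoUniformlyOn_iff_tendstoUniformly_comp_coe.1 (hlim k)
    convert this using 1
    · ext n t
      simp only [val_apply _ t.2, ← hu']
      rfl
    · ext t
      simp only [Function.comp_apply, val_apply _ t.2, ← hv']
      rfl
  have h4 := ((isEmbedding_ballInclusion M).continuous.tendsto v').comp h3
  rw [hv'] at h4
  exact h4.congr hu'

/-- A sequence of functions of time with values in a ball, whose moments are Lipschitz up to
vanishing errors, has a subsequence converging to a weakly continuous trajectory. -/
lemma IsSeparatingFamily.exists_subseq_tendsto (h : IsSeparatingFamily X ℓ) {M : ℝ} (hT : 0 < T)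
    {v : ℕ → ℝ → X} (hv : ∀ n, ∀ t ∈ Icc 0 T, ‖v n t‖ ≤ M) {C : ℕ → ℝ} {ε : ℕ → ℕ → ℝ}
    (hε : ∀ k, Tendsto (fun n => ε n k) atTop (𝓝 0))
    (hlip : ∀ n k, ∀ s ∈ Icc 0 T, ∀ t ∈ Icc 0 T, |ℓ k (v n t) - ℓ k (v n s)| ≤ C k * |t - s|
      + ε n k) :
    ∃ φ : ℕ → ℕ, StrictMono φ ∧ ∃ u : CWeak T X, (∀ t ∈ Icc 0 T, ‖u.val t‖ ≤ M) ∧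
      (∀ k, TendstoUniformlyOn (fun n t => ℓ k (v (φ n) t)) (fun t => ℓ k (u.val t)) atTop
        (Icc 0 T)) ∧
      ∀ (L : StrongDual ℝ X), ∀ t ∈ Icc 0 T,
        Tendsto (fun n => L (v (φ n) t)) atTop (𝓝 (L (u.val t))) := by
  have hcpt : CompactSpace (weakBall X M) := isCompact_iff_compactSpace.1 (h.compact M)
  have := h.metrizable_weakBall M
  let I := Icc (0 : ℝ) T
  have : Nonempty I := ⟨⟨0, left_mem_Icc.2 hT.le⟩⟩
  let b : ℕ → I → weakBall X M := fun n t => ⟨toWeakSpace ℝ X (v n t), by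
    simpa [weakBall] using hv n t t.2⟩
  let q : ℕ → I := TopologicalSpace.denseSeq I
  -- diagonal sequence converging weakly at the times of a dense sequence
  obtain ⟨z, -, φ, hφ, hz⟩ := (isCompact_univ (X := ℕ → weakBall X M)).isSeqCompact
    (x := fun n i => b n (q i)) fun n => mem_univ _
  have hb : ∀ n k (t : I), weakMoments ℓ M (b n t) k = ℓ k (v n t) := fun n k t => by
    simp [weakMoments, b]
  -- the moments form Cauchy sequences, uniformly in time
  have hcauchy : ∀ k, UniformCauchySeqOn (fun n (t : I) => ℓ k (v (φ n) t)) atTop univ := by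
    intro k
    rw [Metric.uniformCauchySeqOn_iff]
    intro δ hδ
    have hC : 0 < |C k| + 1 := by positivity
    obtain ⟨r, hr, hrC⟩ : ∃ r > 0, (|C k| + 1) * r ≤ δ / 8 := ⟨δ / 8 / (|C k| + 1), by positivity,
      by rw [mul_div_cancel₀ _ hC.ne']⟩
    have hcov : (univ : Set I) ⊆ ⋃ i, Metric.ball (q i) r := fun t _ => by
      obtain ⟨i, hi⟩ := Metric.denseRange_iff.1 (TopologicalSpace.denseRange_denseSeq I) t r hr
      exact mem_iUnion.2 ⟨i, hi⟩
    obtain ⟨F, hF⟩ := isCompact_univ.elim_finite_subcover _ (fun i => Metric.isOpen_ball) hcov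
    have hq : ∀ i, ∃ N, ∀ m ≥ N, ∀ n ≥ N, dist (ℓ k (v (φ m) (q i))) (ℓ k (v (φ n) (q i)))
        < δ / 4 := by
      intro i
      have h1 : Tendsto (fun n => weakMoments ℓ M (b (φ n) (q i)) k) atTop
          (𝓝 (weakMoments ℓ M (z i) k)) :=
        (((continuous_apply k).comp (weakMoments ℓ M).continuous).tendsto _).comp
          ((tendsto_pi_nhds.1 hz) i)
      simp_rw [hb] at h1
      exact Metric.cauchySeq_iff.1 h1.cauchySeq _ (by positivity)
    choose N hN using hq
    obtain ⟨N', hN'⟩ := (Metric.tendsto_atTop.1 ((hε k).comp hφ.tendsto_atTop)) (δ / 8)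
      (by positivity)
    refine ⟨max N' (F.sup N), fun m hm n hn t _ => ?_⟩
    obtain ⟨i, hiF, hi⟩ := mem_iUnion₂.1 (hF (mem_univ t))
    have h1 : ∀ n ≥ N', dist (ℓ k (v (φ n) t)) (ℓ k (v (φ n) (q i))) ≤ δ / 4 := fun n hn => by
      rw [Real.dist_eq]
      refine (hlip _ k _ (q i).2 _ t.2).trans ?_
      have h2 : |(t : ℝ) - q i| ≤ r := by
        have := Metric.mem_ball.1 hi
        rw [Subtype.dist_eq, Real.dist_eq] at this
        exact this.le
      have h3 := hN' n hn
      rw [Real.dist_eq, sub_zero, Function.comp_apply] at h3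
      have h4 : C k * |(t : ℝ) - q i| ≤ (|C k| + 1) * r :=
        mul_le_mul (by linarith [le_abs_self (C k)]) h2 (abs_nonneg _) hC.le
      linarith [le_abs_self (ε (φ n) k)]
    have hi' : N i ≤ F.sup N := Finset.le_sup hiF
    have h5 := hN i m (hi'.trans (le_of_max_le_right hm)) n (hi'.trans (le_of_max_le_right hn))
    calc dist (ℓ k (v (φ m) t)) (ℓ k (v (φ n) t))
        ≤ dist (ℓ k (v (φ m) t)) (ℓ k (v (φ m) (q i)))
          + dist (ℓ k (v (φ m) (q i))) (ℓ k (v (φ n) (q i)))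
          + dist (ℓ k (v (φ n) (q i))) (ℓ k (v (φ n) t)) := dist_triangle4 _ _ _ _
      _ < δ / 4 + δ / 4 + δ / 4 := add_lt_add_of_lt_of_le
          (add_lt_add_of_le_of_lt (h1 m (le_of_max_le_left hm)) h5)
          (by rw [dist_comm]; exact h1 n (le_of_max_le_left hn))
      _ < δ := by linarith
  -- pointwise in time the whole sequence converges weakly
  have hpt : ∀ t : I, ∃ y : weakBall X M, Tendsto (fun n => b (φ n) t) atTop (𝓝 y) := by
    intro t
    obtain ⟨y, -, ψ, hψ, hy⟩ := (isCompact_univ (X := weakBall X M)).isSeqCompact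
      (x := fun n => b (φ n) t) fun n => mem_univ _
    refine ⟨y, ?_⟩
    rw [(h.isEmbedding M).tendsto_nhds_iff, tendsto_pi_nhds]
    intro k
    have h1 : CauchySeq fun n => ℓ k (v (φ n) t) := (hcauchy k).cauchySeq (mem_univ t)
    have h2 : Tendsto (fun n => ℓ k (v (φ (ψ n)) t)) atTop (𝓝 (weakMoments ℓ M y k)) := by
      have := (((continuous_apply k).comp (weakMoments ℓ M).continuous).tendsto _).comp hy
      simpa [Function.comp_def, hb] using this
    have h3 := tendsto_nhds_of_cauchySeq_of_subseq h1 hψ.tendsto_atTop h2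
    simpa [Function.comp_def, hb] using h3
  choose y hy using hpt
  have hmom : ∀ k (t : I), Tendsto (fun n => ℓ k (v (φ n) t)) atTop
      (𝓝 (weakMoments ℓ M (y t) k)) := by
    intro k t
    have := (((continuous_apply k).comp (weakMoments ℓ M).continuous).tendsto _).comp (hy t)
    simpa [Function.comp_def, hb] using this
  -- the moments of the limit are Lipschitz, the errors having vanished
  have hcont : Continuous y := by
    rw [(h.isEmbedding M).continuous_iff, continuous_pi_iff]
    intro k
    have h1 : ∀ s t : I, |weakMoments ℓ M (y t) k - weakMoments ℓ M (y s) k| ≤ C k * |(t : ℝ)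
        - s| := by
      intro s t
      have h2 := ((hmom k t).sub (hmom k s)).abs
      have h3 : Tendsto (fun n => C k * |(t : ℝ) - s| + ε (φ n) k) atTop
          (𝓝 (C k * |(t : ℝ) - s| + 0)) :=
        tendsto_const_nhds.add ((hε k).comp hφ.tendsto_atTop)
      rw [add_zero] at h3
      exact le_of_tendsto_of_tendsto' h2 h3 fun n => hlip _ k _ s.2 _ t.2
    refine Metric.continuous_iff.2 fun s δ hδ => ⟨δ / (|C k| + 1), by positivity, fun t ht => ?_⟩
    rw [Real.dist_eq]
    refine (h1 s t).trans_lt ?_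
    rw [Subtype.dist_eq, Real.dist_eq, lt_div_iff₀ (by positivity)] at ht
    have := abs_nonneg ((t : ℝ) - s)
    nlinarith [le_abs_self (C k)]
  let u : CWeak T X := ballInclusion X T M ⟨y, hcont⟩
  have hu : ∀ t : I, u.val t = (toWeakSpace ℝ X).symm (y t) := fun t => val_apply u t.2
  refine ⟨φ, hφ, u, ?_, ?_, ?_⟩
  · have : u ∈ range (ballInclusion X T M) := ⟨_, rfl⟩
    rwa [range_ballInclusion] at this
  · intro k
    rw [tendstoUniformlyOn_iff_tendstoUniformly_comp_coe]
    have h1 := (hcauchy k).tendstoUniformlyOn_of_tendsto fun t _ => hmom k t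
    rw [tendstoUniformlyOn_univ] at h1
    convert h1 using 1
    ext t
    simp [hu, weakMoments]
  · intro L t ht
    have h1 := ((continuous_apply_weak L).comp continuous_subtype_val).tendsto (y ⟨t, ht⟩)
    have h2 := h1.comp (hy ⟨t, ht⟩)
    have h3 := hu ⟨t, ht⟩
    simp only at h3
    rw [h3]
    refine h2.congr fun n => ?_
    simp [b]

end Weak

/-! ### The divergence theorem -/

section Divergence

variable {d : ℕ}

lemma grad_smul {F : Space d → ℝ} {v : Space d → Space d} {x : Space d}
    (hF : DifferentiableAt ℝ F x) (hv : DifferentiableAt ℝ v x) (i j : Fin d) :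
    grad (fun y => F y • v y) x i j
      = F x * grad v x i j + fderiv ℝ F x (single j 1) * v x i := by
  simp only [grad]
  rw [fderiv_fun_smul hF hv]
  simp

lemma sum_fderiv_single_mul {L : Space d →L[ℝ] ℝ} (w : Space d) :
    ∑ i, L (single i 1) * w i = L w := by
  have h : w = ∑ i, w i • single i (1 : ℝ) := by
    have := (EuclideanSpace.basisFun (Fin d) ℝ).sum_repr w
    simpa using this.symm
  conv_rhs => rw [h, map_sum]
  exact sum_congr rfl fun i _ => by rw [map_smul, smul_eq_mul, mul_comm]

lemma divg_smul {F : Space d → ℝ} {v : Space d → Space d} {x : Space d}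
    (hF : DifferentiableAt ℝ F x) (hv : DifferentiableAt ℝ v x) :
    divg (fun y => F y • v y) x = F x * divg v x + fderiv ℝ F x (v x) := by
  simp only [divg, grad_smul hF hv, sum_add_distrib, ← mul_sum]
  rw [sum_fderiv_single_mul]

lemma continuous_grad {v : Space d → Space d} (hv : ContDiff ℝ 1 v) (i j : Fin d) :
    Continuous fun x => grad v x i j := by
  have h : Continuous fun x => fderiv ℝ v x (single j 1) :=
    (hv.continuous_fderiv one_ne_zero).clm_apply continuous_const
  exact (EuclideanSpace.proj (𝕜 := ℝ) i).continuous.comp h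

lemma continuous_divg {v : Space d → Space d} (hv : ContDiff ℝ 1 v) :
    Continuous fun x => divg v x :=
  continuous_finsetSum _ fun i _ => continuous_grad hv i i

lemma grad_sum {ι : Type*} {s : Finset ι} {v : ι → Space d → Space d} {x : Space d}
    (hv : ∀ k ∈ s, DifferentiableAt ℝ (v k) x) (i j : Fin d) :
    grad (fun y => ∑ k ∈ s, v k y) x i j = ∑ k ∈ s, grad (v k) x i j := by
  simp only [grad]
  rw [fderiv_fun_sum hv]
  simp

lemma divg_sum {ι : Type*} {s : Finset ι} {v : ι → Space d → Space d} {x : Space d}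
    (hv : ∀ k ∈ s, DifferentiableAt ℝ (v k) x) :
    divg (fun y => ∑ k ∈ s, v k y) x = ∑ k ∈ s, divg (v k) x := by
  simp only [divg, grad_sum hv]
  exact sum_comm

lemma grad_eq_zero_of_notMem_tsupport {v : Space d → Space d} {x : Space d} (hx : x ∉ tsupport v)
    (i j : Fin d) : grad v x i j = 0 := by
  simp only [grad]
  rw [image_eq_zero_of_notMem_tsupport fun h => hx (tsupport_fderiv_subset ℝ h)]
  simp

lemma divg_eq_zero_of_notMem_tsupport {v : Space d → Space d} {x : Space d} (hx : x ∉ tsupport v) :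
    divg v x = 0 := by
  simp [divg, grad_eq_zero_of_notMem_tsupport hx]

lemma integrable_divg {v : Space d → Space d} (hv : ContDiff ℝ 1 v) (hc : HasCompactSupport v) :
    Integrable fun y => divg v y :=
  (continuous_divg hv).integrable_of_hasCompactSupport
    (hc.of_isClosed_subset (isClosed_tsupport _) (closure_minimal (fun y hy => by
      by_contra hy'
      exact hy (divg_eq_zero_of_notMem_tsupport hy')) (isClosed_tsupport _)))

lemma integral_fderiv_apply_eq_zero {F : Space d → ℝ} (hF : ContDiff ℝ 1 F)
    (hc : HasCompactSupport F) (b : Space d) : ∫ x, fderiv ℝ F x b = 0 := by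
  have hF' : Continuous fun x => fderiv ℝ F x b :=
    (hF.continuous_fderiv one_ne_zero).clm_apply continuous_const
  have h := integral_mul_fderiv_eq_neg_fderiv_mul_of_integrable (μ := (volume : Measure (Space d)))
    (f := fun _ => (1 : ℝ)) (g := F) (v := b) (by simp)
    (by simpa using hF'.integrable_of_hasCompactSupport (hc.fderiv_apply ℝ b))
    (by simpa using hF.continuous.integrable_of_hasCompactSupport hc)
    (fun x _ => by fun_prop) (fun x _ => hF.differentiable one_ne_zero x)
  simpa using h

lemma integral_divg_eq_zero_of_hasCompactSupport {v : Space d → Space d} (hv : ContDiff ℝ 1 v)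
    (hc : HasCompactSupport v) : ∫ x, divg v x = 0 := by
  have hcomp : ∀ i, ContDiff ℝ 1 fun x => v x i := fun i =>
    (EuclideanSpace.proj (𝕜 := ℝ) i).contDiff.comp hv
  have hcc : ∀ i, HasCompactSupport fun x => v x i := fun i =>
    hc.comp_left (g := fun w : Space d => w i) rfl
  have hg : ∀ i x, grad v x i i = fderiv ℝ (fun x => v x i) x (single i 1) := by
    intro i x
    have h := ((EuclideanSpace.proj (𝕜 := ℝ) i).hasFDerivAt.comp x
      (hv.differentiable one_ne_zero x).hasFDerivAt).fderiv
    have h2 : (fun x => v x i) = (EuclideanSpace.proj (𝕜 := ℝ) i) ∘ v := rfl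
    rw [h2, h]
    rfl
  simp only [divg]
  rw [integral_finsetSum]
  · refine sum_eq_zero fun i _ => ?_
    simp_rw [hg]
    exact integral_fderiv_apply_eq_zero (hcomp i) (hcc i) _
  · intro i _
    simp_rw [hg]
    exact (((hcomp i).continuous_fderiv one_ne_zero).clm_apply
      continuous_const).integrable_of_hasCompactSupport ((hcc i).fderiv_apply ℝ _)

/-- A smooth cutoff equal to `1` on `(-∞,-1]` and to `0` on `[0,∞)`. -/
def cutoff (s : ℝ) : ℝ := smoothTransition (-s)

lemma contDiff_cutoff : ContDiff ℝ 1 cutoff :=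
  smoothTransition.contDiff.comp contDiff_neg

lemma cutoff_of_nonneg {s : ℝ} (hs : 0 ≤ s) : cutoff s = 0 :=
  smoothTransition.zero_of_nonpos (by linarith)

lemma cutoff_of_le {s : ℝ} (hs : s ≤ -1) : cutoff s = 1 :=
  smoothTransition.one_of_one_le (by linarith)

lemma norm_cutoff_le (s : ℝ) : ‖cutoff s‖ ≤ 1 := by
  change ‖smoothTransition (-s)‖ ≤ 1
  rw [norm_of_nonneg (smoothTransition.nonneg _)]
  exact smoothTransition.le_one _

lemma deriv_cutoff_nonpos (s : ℝ) : deriv cutoff s ≤ 0 := by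
  have : Antitone cutoff := by
    intro s t hst
    exact smoothTransition.monotone (neg_le_neg hst)
  exact this.deriv_nonpos

lemma deriv_cutoff_eq_zero {s : ℝ} (hs : 0 < s ∨ s < -1) : deriv cutoff s = 0 := by
  rcases hs with hs | hs
  · have : cutoff =ᶠ[𝓝 s] fun _ => 0 := by
      filter_upwards [lt_mem_nhds hs] with t ht using cutoff_of_nonneg ht.le
    rw [this.deriv_eq]; simp
  · have : cutoff =ᶠ[𝓝 s] fun _ => 1 := by
      filter_upwards [gt_mem_nhds hs] with t ht using cutoff_of_le ht.le
    rw [this.deriv_eq]; simp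

lemma contDiff_of_contDiffAt_tsupport {F : Type*} [NormedAddCommGroup F] [NormedSpace ℝ F]
    {f : Space d → F} (h : ∀ x ∈ tsupport f, ContDiffAt ℝ 1 f x) : ContDiff ℝ 1 f := by
  rw [contDiff_iff_contDiffAt]
  intro x
  by_cases hx : x ∈ tsupport f
  · exact h x hx
  · have : f =ᶠ[𝓝 x] fun _ => 0 := notMem_tsupport_iff_eventuallyEq.1 hx
    exact contDiffAt_const.congr_of_eventuallyEq this

/-- The part of a neighbourhood of a boundary point in which a defining function `g` is of class
`C¹` and increases in the direction `e`. -/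
structure IsBoundaryChart (Ω V : Set (Space d)) (g : Space d → ℝ) (e : Space d) (c : ℝ) : Prop where
  contDiffAt : ∀ y ∈ V, ContDiffAt ℝ 1 g y
  mem_iff : ∀ y ∈ V, (y ∈ Ω ↔ g y < 0)
  slope : ∀ y ∈ V, c ≤ fderiv ℝ g y e
  pos : 0 < c
  isOpen : IsOpen V

variable {Ω V : Set (Space d)} {g : Space d → ℝ} {e : Space d} {c : ℝ}

lemma exists_isBoundaryChart {x : Space d} (h : IsLocalDefiningFunction Ω x g) :
    ∃ r > 0, ∃ e c, IsBoundaryChart Ω (Metric.ball x r) g e c := by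
  obtain ⟨h1, h2, h3, h4⟩ := h
  obtain ⟨e, he⟩ : ∃ e, 0 < fderiv ℝ g x e := by
    obtain ⟨e, he⟩ : ∃ e, fderiv ℝ g x e ≠ 0 := by
      by_contra! hcon
      exact h3 (ContinuousLinearMap.ext hcon)
    rcases he.lt_or_gt with he | he
    · exact ⟨-e, by rw [map_neg]; linarith⟩
    · exact ⟨e, he⟩
  have h5 : ContinuousAt (fun y => fderiv ℝ g y e) x :=
    (h1.continuousAt_fderiv one_ne_zero).clm_apply continuousAt_const
  have h6 : ∀ᶠ y in 𝓝 x, fderiv ℝ g x e / 2 < fderiv ℝ g y e :=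
    h5.eventually (lt_mem_nhds (half_lt_self he))
  have h7 : ∀ᶠ y in 𝓝 x, ContDiffAt ℝ 1 g y := h1.eventually (by simp)
  obtain ⟨r, hr, hrs⟩ := Metric.eventually_nhds_iff_ball.1 (h4.and (h6.and h7))
  exact ⟨r, hr, e, _, ⟨fun y hy => (hrs y hy).2.2, fun y hy => (hrs y hy).1,
    fun y hy => (hrs y hy).2.1.le, half_pos he, Metric.isOpen_ball⟩⟩

/-- An impermeable field is tangent to the level set `{g = 0}`. -/
lemma IsBoundaryChart.fderiv_apply_eq_zero (h : IsBoundaryChart Ω V g e c) {w : Space d → Space d}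
    (hw : (FluidDomain.bounded Ω).Impermeable w) {y : Space d} (hy : y ∈ V) (hgy : g y = 0) :
    fderiv ℝ g y (w y) = 0 := by
  have hne : fderiv ℝ g y ≠ 0 := fun h0 => by
    have := h.slope y hy
    rw [h0] at this
    exact absurd this (not_le.2 h.pos)
  have hVy : V ∈ 𝓝 y := h.isOpen.mem_nhds hy
  -- otherwise `g` would have a local minimum at `y`, or would be negative there
  have hmem : y ∈ frontier Ω := by
    refine ⟨?_, fun hint => ?_⟩
    · by_contra hcl
      refine hne (IsLocalMin.fderiv_eq_zero ?_)
      have h1 : ∀ᶠ z in 𝓝 y, z ∉ Ω := by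
        filter_upwards [isClosed_closure.isOpen_compl.mem_nhds hcl] with z hz hz'
        exact hz (subset_closure hz')
      filter_upwards [h1, hVy] with z hz hzV
      rw [hgy]
      exact not_lt.1 fun h2 => hz ((h.mem_iff z hzV).2 h2)
    · have := (h.mem_iff y hy).1 (interior_subset hint)
      rw [hgy] at this
      exact lt_irrefl _ this
  have hloc : IsLocalDefiningFunction Ω y g := by
    refine ⟨h.contDiffAt y hy, hgy, hne, ?_⟩
    filter_upwards [hVy] with z hz using h.mem_iff z hz
  have h1 := hw y hmem _ ⟨g, hloc, rfl⟩
  have hgrad : gradient g y ≠ 0 := by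
    intro h0
    apply hne
    rw [gradient] at h0
    simpa using h0
  rw [real_inner_smul_right, mul_eq_zero] at h1
  rcases h1 with h1 | h1
  · exact absurd (inv_eq_zero.1 h1) (norm_ne_zero_iff.2 hgrad)
  · rw [real_inner_comm, gradient, InnerProductSpace.toDual_symm_apply] at h1
    exact h1

lemma IsBoundaryChart.differentiableAt_cutoff (h : IsBoundaryChart Ω V g e c) (n : ℝ) {y : Space d}
    (hy : y ∈ V) :
    ContDiffAt ℝ 1 (fun y => cutoff (n * g y)) y ∧
      ∀ b, fderiv ℝ (fun y => cutoff (n * g y)) y b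
        = deriv cutoff (n * g y) * (n * fderiv ℝ g y b) := by
  have h1 : ContDiffAt ℝ 1 (fun y => n * g y) y := contDiffAt_const.mul (h.contDiffAt y hy)
  refine ⟨contDiff_cutoff.contDiffAt.comp y h1, fun b => ?_⟩
  have h2 : HasDerivAt cutoff (deriv cutoff (n * g y)) (n * g y) :=
    (contDiff_cutoff.differentiable one_ne_zero _).hasDerivAt
  have h3 : HasFDerivAt (fun y => n * g y) (n • fderiv ℝ g y) y :=
    ((h.contDiffAt y hy).differentiableAt one_ne_zero).hasFDerivAt.const_mul n
  have h4 := (h2.comp_hasFDerivAt y h3).fderiv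
  simp only [Function.comp_def] at h4
  rw [h4]
  simp

lemma IsBoundaryChart.integral_cutoff_mul_divg (h : IsBoundaryChart Ω V g e c)
    {w : Space d → Space d} (hw : ContDiff ℝ 1 w) (hwc : HasCompactSupport w)
    (hwV : tsupport w ⊆ V) (n : ℕ) :
    Integrable (fun y => cutoff (n * g y) * divg w y) ∧
    Integrable (fun y => (-deriv cutoff (n * g y)) * n * fderiv ℝ g y (w y)) ∧
    ∫ y, cutoff (n * g y) * divg w y
      = ∫ y, (-deriv cutoff (n * g y)) * n * fderiv ℝ g y (w y) := by
  have hprod : ContDiff ℝ 1 fun y => cutoff (n * g y) • w y := by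
    refine contDiff_of_contDiffAt_tsupport fun y hy => ?_
    have hy' : y ∈ V := hwV (tsupport_smul_subset_right _ _ hy)
    exact (h.differentiableAt_cutoff n hy').1.smul hw.contDiffAt
  have hpc : HasCompactSupport fun y => cutoff (n * g y) • w y := by
    refine hwc.mono fun y hy hy0 => hy ?_
    simp only [hy0, smul_zero]
  have h0 := integral_divg_eq_zero_of_hasCompactSupport hprod hpc
  have hd : ∀ y, divg (fun y => cutoff (n * g y) • w y) y
      = cutoff (n * g y) * divg w y - (-deriv cutoff (n * g y)) * n * fderiv ℝ g y (w y) := by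
    intro y
    by_cases hy : y ∈ tsupport w
    · obtain ⟨h1, h2⟩ := h.differentiableAt_cutoff n (hwV hy)
      rw [divg_smul (h1.differentiableAt one_ne_zero) (hw.differentiable one_ne_zero y), h2]
      ring
    · rw [divg_eq_zero_of_notMem_tsupport hy, image_eq_zero_of_notMem_tsupport hy,
        divg_eq_zero_of_notMem_tsupport fun hy' => hy (tsupport_smul_subset_right _ _ hy')]
      simp
  have hmeas : AEStronglyMeasurable (fun y => cutoff (n * g y)) (volume.restrict (tsupport w)) := by
    refine ContinuousOn.aestronglyMeasurable (fun y hy => ?_) (isClosed_tsupport _).measurableSet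
    exact (h.differentiableAt_cutoff n (hwV hy)).1.continuousAt.continuousWithinAt
  have hi1 : Integrable fun y => cutoff (n * g y) * divg w y := by
    have h1 : IntegrableOn (fun y => cutoff (n * g y) * divg w y) (tsupport w) :=
      Integrable.bdd_mul (c := 1) (integrable_divg hw hwc).integrableOn hmeas
        (ae_of_all _ fun y => norm_cutoff_le _)
    refine (integrableOn_iff_integrable_of_support_subset fun y hy => ?_).1 h1
    by_contra hy'
    exact hy (by simp [divg_eq_zero_of_notMem_tsupport hy'])
  have hi2 : Integrable fun y => (-deriv cutoff (n * g y)) * n * fderiv ℝ g y (w y) := by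
    have h1 := hi1.sub (integrable_divg hprod hpc)
    have h2 : (fun y => (-deriv cutoff (n * g y)) * n * fderiv ℝ g y (w y))
        = fun y => cutoff (n * g y) * divg w y - divg (fun y => cutoff (n * g y) • w y) y := by
      funext y
      rw [hd y, sub_sub_cancel]
    rw [h2]
    exact h1
  rw [funext hd, integral_sub hi1 hi2, sub_eq_zero] at h0
  exact ⟨hi1, hi2, h0⟩

/-- The mass of the layer in which the cutoffs `cutoff (n g)` vary, weighted by `ζ`, is bounded
independently of `n`, by the integration by parts formula for the field `ζ e`. -/
lemma IsBoundaryChart.exists_layer_mass_le (h : IsBoundaryChart Ω V g e c) {ζ : Space d → ℝ}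
    (hζ : ContDiff ℝ 1 ζ) (hζc : HasCompactSupport ζ) (hζV : tsupport ζ ⊆ V) :
    ∃ C, ∀ n : ℕ, ∫ y, (-deriv cutoff (n * g y)) * n * fderiv ℝ g y (ζ y • e) ≤ C ∧
      Integrable fun y => (-deriv cutoff (n * g y)) * n * fderiv ℝ g y (ζ y • e) := by
  have hw : ContDiff ℝ 1 fun y => ζ y • e := hζ.smul contDiff_const
  have hwc : HasCompactSupport fun y => ζ y • e := hζc.smul_right
  refine ⟨∫ y, ‖divg (fun y => ζ y • e) y‖, fun n => ?_⟩
  obtain ⟨h1, h2, h3⟩ := h.integral_cutoff_mul_divg hw hwc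
    ((tsupport_smul_subset_left _ _).trans hζV) n
  refine ⟨h3.symm.trans_le (integral_mono h1 (integrable_divg hw hwc).norm fun y => ?_), h2⟩
  refine (le_abs_self _).trans ?_
  rw [abs_mul]
  exact mul_le_of_le_one_left (abs_nonneg _) (norm_cutoff_le _)

lemma IsBoundaryChart.tendsto_integral_cutoff_mul_divg (h : IsBoundaryChart Ω V g e c)
    (hΩ : MeasurableSet Ω) {w : Space d → Space d} (hw : ContDiff ℝ 1 w)
    (hwc : HasCompactSupport w) (hwV : tsupport w ⊆ V) :
    Tendsto (fun n : ℕ => ∫ y, cutoff (n * g y) * divg w y) atTop (𝓝 (∫ y in Ω, divg w y)) := by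
  rw [← integral_indicator hΩ]
  have hdw : Integrable fun y => ‖divg w y‖ :=
    ((integrable_divg hw hwc)).norm
  refine tendsto_integral_of_dominated_convergence (fun y => ‖divg w y‖) (fun n => ?_) hdw
    (fun n => ae_of_all _ fun y => ?_) (ae_of_all _ fun y => ?_)
  · exact (h.integral_cutoff_mul_divg hw hwc hwV n).1.1
  · rw [norm_mul]
    exact mul_le_of_le_one_left (norm_nonneg _) (norm_cutoff_le _)
  · by_cases hy : y ∈ tsupport w
    · by_cases hyΩ : y ∈ Ω
      · have hg : g y < 0 := (h.mem_iff y (hwV hy)).1 hyΩ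
        refine tendsto_const_nhds.congr' ?_
        obtain ⟨N, hN⟩ := exists_nat_gt (-g y)⁻¹
        filter_upwards [eventually_ge_atTop N] with n hn
        have h1 : (-g y)⁻¹ < n := hN.trans_le (by exact_mod_cast hn)
        rw [inv_lt_iff_one_lt_mul₀ (by linarith)] at h1
        have h2 : cutoff (n * g y) = 1 := cutoff_of_le (by nlinarith)
        rw [h2, one_mul, indicator_of_mem hyΩ]
      · have hg : 0 ≤ g y := not_lt.1 fun h1 => hyΩ ((h.mem_iff y (hwV hy)).2 h1)
        refine tendsto_const_nhds.congr fun n => ?_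
        have h2 : cutoff (n * g y) = 0 := cutoff_of_nonneg (mul_nonneg (Nat.cast_nonneg n) hg)
        rw [h2, zero_mul, indicator_of_notMem hyΩ]
    · simp [indicator, divg_eq_zero_of_notMem_tsupport hy]

/-- The divergence theorem for fields supported near a boundary point. The indicator function of
`{g < 0}` is approximated by `cutoff (n g)`; the error is an integral over the layer
`{-1/n < g < 0}` of `n ∂g/∂w`, where `∂g/∂w` is small by impermeability. -/
lemma IsBoundaryChart.integral_divg_eq_zero (h : IsBoundaryChart Ω V g e c) (hΩ : MeasurableSet Ω)
    {ζ : Space d → ℝ}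
    (hζ : ContDiff ℝ 1 ζ) (hζc : HasCompactSupport ζ) (hζV : tsupport ζ ⊆ V) (hζ0 : ∀ x, 0 ≤ ζ x)
    {w : Space d → Space d} (hw : ContDiff ℝ 1 w) (hwζ : ∀ x ∈ tsupport w, ζ x = 1)
    (hwi : (FluidDomain.bounded Ω).Impermeable w) : ∫ x in Ω, divg w x = 0 := by
  have hwsupp : tsupport w ⊆ tsupport ζ := fun x hx => subset_tsupport _ (by
    rw [Function.mem_support, hwζ x hx]; exact one_ne_zero)
  have hwc : HasCompactSupport w := hζc.of_isClosed_subset (isClosed_tsupport _) hwsupp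
  have hwV : tsupport w ⊆ V := hwsupp.trans hζV
  have hgV : ∀ y ∈ V, ContinuousAt g y := fun y hy => (h.contDiffAt y hy).continuousAt
  obtain ⟨C, hC⟩ := h.exists_layer_mass_le hζ hζc hζV
  refine tendsto_nhds_unique (h.tendsto_integral_cutoff_mul_divg hΩ hw hwc hwV) ?_
  simp_rw [fun n => (h.integral_cutoff_mul_divg hw hwc hwV n).2.2]
  rw [Metric.tendsto_atTop]
  intro ε hε
  have hc := h.pos
  obtain ⟨η, hη, hηC⟩ : ∃ η > 0, η / c * (|C| + 1) ≤ ε / 2 :=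
    ⟨c * (ε / 2 / (|C| + 1)), by positivity, by field_simp; rfl⟩
  have hφc : ContinuousOn (fun y => ‖fderiv ℝ g y (w y)‖) (tsupport w) := fun y hy =>
    (((h.contDiffAt y (hwV hy)).continuousAt_fderiv one_ne_zero).clm_apply
      hw.continuous.continuousAt).norm.continuousWithinAt
  have hgc : ContinuousOn (fun y => ‖g y‖) (tsupport w) := fun y hy =>
    (hgV y (hwV hy)).norm.continuousWithinAt
  -- near `{g = 0}` the normal component of `w` is small, by compactness
  have hδ : ∃ δ > 0, ∀ y ∈ tsupport w, |g y| < δ → ‖fderiv ℝ g y (w y)‖ ≤ η := by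
    let K := tsupport w ∩ (fun y => ‖fderiv ℝ g y (w y)‖) ⁻¹' Ici η
    have hK : IsCompact K := hwc.isCompact.of_isClosed_subset
      (hφc.preimage_isClosed_of_isClosed (isClosed_tsupport _) isClosed_Ici) inter_subset_left
    rcases K.eq_empty_or_nonempty with hKe | hKne
    · refine ⟨1, one_pos, fun y hy _ => ?_⟩
      by_contra hcon
      have : y ∈ K := ⟨hy, (not_le.1 hcon).le⟩
      rw [hKe] at this
      exact this
    · obtain ⟨z, hz, hzmin⟩ := hK.exists_isMinOn hKne (hgc.mono inter_subset_left)
      have hz0 : 0 < ‖g z‖ := by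
        rw [norm_pos_iff]
        intro h0
        have h1 := h.fderiv_apply_eq_zero hwi (hwV hz.1) h0
        have h2 : η ≤ ‖fderiv ℝ g z (w z)‖ := hz.2
        rw [h1, norm_zero] at h2
        linarith
      refine ⟨‖g z‖, hz0, fun y hy hgy => ?_⟩
      by_contra hcon
      exact absurd (hzmin (show y ∈ K from ⟨hy, (not_le.1 hcon).le⟩)) (not_le.2 hgy)
  obtain ⟨δ, hδ, hδη⟩ := hδ
  obtain ⟨N, hN⟩ := exists_nat_gt δ⁻¹
  refine ⟨N, fun n hn => ?_⟩
  have hnδ : δ⁻¹ < n := hN.trans_le (by exact_mod_cast hn)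
  have hn0 : (0 : ℝ) < n := (inv_pos.2 hδ).trans hnδ
  rw [dist_zero_right]
  -- the integrand is dominated by the mass of the layer, which is bounded in `n`
  have hb : ∀ y, ‖(-deriv cutoff (n * g y)) * n * fderiv ℝ g y (w y)‖
      ≤ η / c * ((-deriv cutoff (n * g y)) * n * fderiv ℝ g y (ζ y • e)) := by
    intro y
    have hp : 0 ≤ (-deriv cutoff (n * g y)) * n :=
      mul_nonneg (neg_nonneg.2 (deriv_cutoff_nonpos _)) hn0.le
    by_cases hyζ : y ∈ tsupport ζ
    swap
    · rw [image_eq_zero_of_notMem_tsupport fun hy => hyζ (hwsupp hy),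
        image_eq_zero_of_notMem_tsupport hyζ]
      simp
    have hs := h.slope y (hζV hyζ)
    by_cases hy : y ∈ tsupport w
    · rw [hwζ y hy, one_smul, norm_mul, norm_of_nonneg hp, div_mul_comm]
      rcases eq_or_ne (deriv cutoff (n * g y)) 0 with h0 | h0
      · simp [h0]
      · have h1 : ¬(0 < n * g y ∨ n * g y < -1) := fun h1 => h0 (deriv_cutoff_eq_zero h1)
        push Not at h1
        have h2 : g y ≤ 0 := by
          by_contra hcon
          exact absurd h1.1 (not_le.2 (mul_pos hn0 (not_le.1 hcon)))
        have h4 := hδη y hy (by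
          rw [abs_of_nonpos h2]
          rw [inv_lt_iff_one_lt_mul₀ hδ] at hnδ
          nlinarith)
        refine mul_le_mul ?_ h4 (norm_nonneg _) (by have := hc.le.trans hs; positivity)
        rw [mul_div_assoc]
        exact le_mul_of_one_le_right hp ((one_le_div hc).2 hs)
    · rw [image_eq_zero_of_notMem_tsupport hy, map_zero, mul_zero, norm_zero, map_smul, smul_eq_mul]
      have := hζ0 y
      have := hc.le.trans hs
      positivity
  calc _ ≤ ∫ y, η / c * ((-deriv cutoff (n * g y)) * n * fderiv ℝ g y (ζ y • e)) :=
        norm_integral_le_of_norm_le ((hC n).2.const_mul _) (ae_of_all _ hb)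
    _ ≤ η / c * C := by
        rw [integral_const_mul]
        exact mul_le_mul_of_nonneg_left (hC n).1 (by positivity)
    _ ≤ η / c * (|C| + 1) :=
        mul_le_mul_of_nonneg_left (by linarith [le_abs_self C]) (by positivity)
    _ < ε := by linarith

/-- Near any point of the closure of `Ω` the divergence theorem holds for localized fields. -/
lemma exists_ball_integral_divg_eq_zero {Ω : Set (Space d)} (ho : IsOpen Ω) (hΩ : HasC1Boundary Ω)
    {x : Space d} (hx : x ∈ closure Ω) :
    ∃ r > 0, ∀ w : Space d → Space d, ContDiff ℝ 1 w → tsupport w ⊆ Metric.ball x r →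
      (FluidDomain.bounded Ω).Impermeable w → ∫ x in Ω, divg w x = 0 := by
  by_cases hxΩ : x ∈ Ω
  · obtain ⟨r, hr, hrs⟩ := Metric.isOpen_iff.1 ho x hxΩ
    refine ⟨r, hr, fun w hw hws _ => ?_⟩
    have hwc : HasCompactSupport w :=
      (isCompact_closedBall x r).of_isClosed_subset (isClosed_tsupport _)
        (hws.trans Metric.ball_subset_closedBall)
    rw [setIntegral_eq_integral_of_forall_compl_eq_zero,
      integral_divg_eq_zero_of_hasCompactSupport hw hwc]
    intro y hy
    exact divg_eq_zero_of_notMem_tsupport fun hy' => hy (hrs (hws hy'))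
  · obtain ⟨g, hg⟩ := hΩ x ⟨hx, by rwa [ho.interior_eq]⟩
    obtain ⟨R, hR, e, c, hch⟩ := exists_isBoundaryChart hg
    let ζ : ContDiffBump x := ⟨R / 3, R / 2, by positivity, by linarith⟩
    refine ⟨R / 3, by positivity, fun w hw hws hwi => ?_⟩
    refine hch.integral_divg_eq_zero ho.measurableSet (ζ := ζ) ζ.contDiff ζ.hasCompactSupport ?_
      (fun _ => ζ.nonneg) hw (fun y hy => ?_) hwi
    · rw [ζ.tsupport_eq]
      exact Metric.closedBall_subset_ball (by change R / 2 < R; linarith)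
    · exact ζ.one_of_mem_closedBall (Metric.ball_subset_closedBall (hws hy))

/-- By a partition of unity the divergence theorem reduces to fields of small support. -/
lemma integral_divg_eq_zero_of_bounded {Ω : Set (Space d)} (ho : IsOpen Ω)
    (hb : Bornology.IsBounded Ω) (hΩ : HasC1Boundary Ω) {v : Space d → Space d}
    (hv : ContDiff ℝ 1 v) (hvi : (FluidDomain.bounded Ω).Impermeable v) :
    ∫ x in Ω, divg v x = 0 := by
  choose! r hr hrw using fun x (hx : x ∈ closure Ω) => exists_ball_integral_divg_eq_zero ho hΩ hx
  obtain ⟨t, ht, hcov⟩ := hb.isCompact_closure.elim_nhds_subcover (fun x => Metric.ball x (r x))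
    fun x hx => Metric.ball_mem_nhds x (hr x hx)
  obtain ⟨f, hf⟩ := SmoothPartitionOfUnity.exists_isSubordinate (modelWithCornersSelf ℝ (Space d))
    isClosed_closure (fun x : t => Metric.ball (x : Space d) (r x)) (fun x => Metric.isOpen_ball)
    (by simpa [iUnion_subtype] using hcov)
  have hfc : ∀ k, ContDiff ℝ 1 (f k) := fun k =>
    (contMDiff_iff_contDiff.1 (f k).contMDiff).of_le (by exact_mod_cast le_top)
  have hw : ∀ k, ContDiff ℝ 1 fun y => f k y • v y := fun k => (hfc k).smul hv
  have hzero : ∀ k, ∫ x in Ω, divg (fun y => f k y • v y) x = 0 := by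
    intro k
    refine hrw k (ht k k.2) _ (hw k) ((tsupport_smul_subset_left _ _).trans (hf k)) ?_
    intro x hx n hn
    rw [real_inner_smul_left, hvi x hx n hn, mul_zero]
  have hint : ∀ k, IntegrableOn (fun x => divg (fun y => f k y • v y) x) Ω := fun k =>
    ((continuous_divg (hw k)).continuousOn.integrableOn_compact hb.isCompact_closure).mono_set
      subset_closure
  have hsum : ∀ x ∈ Ω, divg v x = ∑ k, divg (fun y => f k y • v y) x := by
    intro x hx
    rw [← divg_sum fun k _ => (hw k).differentiable one_ne_zero x]
    have : v =ᶠ[𝓝 x] fun y => ∑ k, f k y • v y := by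
      filter_upwards [ho.mem_nhds hx] with y hy
      have h1 := f.sum_eq_one (subset_closure hy)
      rw [finsum_eq_sum_of_fintype] at h1
      rw [← sum_smul, h1, one_smul]
    simp only [divg, grad, this.fderiv_eq]
  rw [setIntegral_congr_fun ho.measurableSet hsum, integral_finsetSum _ fun k _ => hint k]
  exact sum_eq_zero fun k _ => hzero k

lemma integral_divg_eq_zero_of_periodic {n : ℕ} {v : Space (n + 1) → Space (n + 1)}
    (hv : ContDiff ℝ 1 v) (hp : (FluidDomain.torus : FluidDomain (n + 1)).RespectsPeriods v) :
    ∫ x, divg v x ∂(FluidDomain.torus : FluidDomain (n + 1)).vol = 0 := by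
  let L : (Fin (n + 1) → ℝ) ≃L[ℝ] Space (n + 1) := (EuclideanSpace.equiv (Fin (n + 1)) ℝ).symm
  have hcell : L ⁻¹' (FluidDomain.torus : FluidDomain (n + 1)).cell
      = Set.pi univ fun _ => Ico (-1 : ℝ) 1 := by
    ext x
    simp [FluidDomain.cell, L, Set.mem_pi]
  have hmp : MeasurePreserving L := PiLp.volume_preserving_toLp (Fin (n + 1))
  have h1 := hmp.setIntegral_preimage_emb L.toHomeomorph.measurableEmbedding (fun x => divg v x)
    (FluidDomain.torus : FluidDomain (n + 1)).cell
  rw [hcell] at h1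
  rw [FluidDomain.vol, ← h1, volume_pi,
    setIntegral_congr_set (Measure.univ_pi_Ico_ae_eq_Icc (μ := fun _ => volume)
      (f := fun _ : Fin (n + 1) => (-1 : ℝ)) (g := fun _ => 1)), ← volume_pi]
  have h2 := integral_divergence_of_hasFDerivAt_off_countable' (fun _ : Fin (n + 1) => (-1 : ℝ))
    (fun _ => 1) (fun _ => by norm_num) (fun i x => v (L x) i)
    (fun i x => (EuclideanSpace.proj (𝕜 := ℝ) i).comp ((fderiv ℝ v (L x)).comp
      (L : (Fin (n + 1) → ℝ) →L[ℝ] Space (n + 1)))) ∅ countable_empty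
    (fun i => ((EuclideanSpace.proj (𝕜 := ℝ) i).continuous.comp
      (hv.continuous.comp L.continuous)).continuousOn)
    (fun x _ i => (EuclideanSpace.proj (𝕜 := ℝ) i).hasFDerivAt.comp x
      ((hv.differentiable one_ne_zero (L x)).hasFDerivAt.comp x L.hasFDerivAt))
    (by
      refine ContinuousOn.integrableOn_compact isCompact_Icc (Continuous.continuousOn ?_)
      exact (continuous_divg hv).comp L.continuous)
  refine Eq.trans h2 (sum_eq_zero fun i _ => ?_)
  rw [sub_eq_zero]
  refine integral_congr_ae (ae_of_all _ fun x => ?_)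
  -- the values on opposite faces agree by periodicity
  have h3 : L (i.insertNth (1 : ℝ) x) = L (i.insertNth (-1 : ℝ) x) + single i 2 := by
    ext j
    refine Fin.succAboveCases i ?_ (fun k => ?_) j
    · simp [L]; norm_num
    · simp [L]
  change v (L (i.insertNth (1 : ℝ) x)) i = v (L (i.insertNth (-1 : ℝ) x)) i
  rw [h3, hp]

/-- The divergence theorem for impermeable (respectively periodic) fields. -/
lemma integral_divg_eq_zero (hd : d ≠ 0) {G : FluidDomain d} (hG : G.Admissible)
    {v : Space d → Space d} (hv : ContDiff ℝ 1 v) (hp : G.RespectsPeriods v)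
    (hi : G.Impermeable v) : ∫ x, divg v x ∂G.vol = 0 := by
  cases G with
  | bounded Ω => exact integral_divg_eq_zero_of_bounded hG.1 hG.2.2.1 hG.2.2.2 hv hi
  | torus =>
    obtain ⟨n, rfl⟩ := Nat.exists_eq_succ_of_ne_zero hd
    exact integral_divg_eq_zero_of_periodic hv hp

end Divergence

/-! ### Kinetic energy and pressure as suprema of affine functions -/

section Suprema

variable {α : Type*} [MeasurableSpace α] {μ : Measure α}

lemma lintegral_le_of_le_liminf {F : α → ℝ≥0∞} {h : ℕ → α → ℝ} {C : ℝ≥0∞}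
    (hm : ∀ n, Measurable (h n))
    (hi : ∀ n, Integrable (h n) μ) (h0 : ∀ n, 0 ≤ᵐ[μ] h n)
    (hC : ∀ n, ofReal (∫ x, h n x ∂μ) ≤ C)
    (hF : ∀ᵐ x ∂μ, F x ≤ liminf (fun n => ofReal (h n x)) atTop) :
    ∫⁻ x, F x ∂μ ≤ C :=
  calc ∫⁻ x, F x ∂μ ≤ ∫⁻ x, liminf (fun n => ofReal (h n x)) atTop ∂μ := lintegral_mono_ae hF
    _ ≤ liminf (fun n => ∫⁻ x, ofReal (h n x) ∂μ) atTop :=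
      lintegral_liminf_le fun n => (hm n).ennreal_ofReal
    _ ≤ C := by
      refine liminf_le_of_le (by isBoundedDefault) fun b hb => ?_
      obtain ⟨n, hn⟩ := hb.exists
      refine hn.trans ?_
      rw [← ofReal_integral_eq_lintegral_ofReal (hi n) (h0 n)]
      exact hC n

lemma ofReal_integral_le_lintegral {h : α → ℝ} {F : α → ℝ≥0∞}
    (hF : ∀ᵐ x ∂μ, ofReal (h x) ≤ F x) :
    ofReal (∫ x, h x ∂μ) ≤ ∫⁻ x, F x ∂μ := by
  by_cases hi : Integrable h μ
  · refine le_trans ?_ (lintegral_mono_ae hF)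
    have h1 : ∫ x, h x ∂μ ≤ ∫ x, max (h x) 0 ∂μ :=
      integral_mono hi hi.pos_part fun x => le_max_left _ _
    refine (ofReal_le_ofReal h1).trans ?_
    rw [ofReal_integral_eq_lintegral_ofReal hi.pos_part (ae_of_all _ fun x => le_max_right _ _)]
    refine lintegral_mono fun x => ?_
    rw [ENNReal.ofReal_max, ofReal_zero, max_eq_left zero_le]
  · rw [integral_undef hi]
    simp

/-- The quotient `g²/r`, with the conventions `0/0 = 0` and `g²/0 = ∞` for `g ≠ 0`. -/
def kin (r g : ℝ) : ℝ≥0∞ := ofReal (g ^ 2) / ofReal r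

lemma ofReal_le_kin {r g a : ℝ} (hr : 0 ≤ r) :
    ofReal (2 * a * g - a ^ 2 * r) ≤ kin r g := by
  rcases hr.eq_or_lt with rfl | hr
  · by_cases hg : g = 0
    · simp [hg]
    · have : ofReal (g ^ 2) ≠ 0 := by
        rw [Ne, ofReal_eq_zero, not_le]; positivity
      rw [kin, ofReal_zero, ENNReal.div_zero this]
      exact le_top
  · rw [kin, ← ofReal_div_of_pos hr]
    refine ofReal_le_ofReal ?_
    rw [le_div_iff₀ hr]
    nlinarith [sq_nonneg (g - a * r)]

lemma kin_of_pos {r g : ℝ} (hr : 0 < r) : kin r g = ofReal (g ^ 2 / r) := by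
  rw [kin, ofReal_div_of_pos hr]

/-- Maximizers of `a ↦ 2 a g - a² r` over `[-n,n]`, up to an error for small `r > 0`. -/
def kinSlope (n : ℕ) (r g : ℝ) : ℝ := if |g| ≤ n * r then g / r else if g < 0 then -n else n

lemma abs_kinSlope_le (n : ℕ) {r g : ℝ} (hr : 0 ≤ r) : |kinSlope n r g| ≤ n := by
  unfold kinSlope
  split_ifs with h
  · rw [abs_div, abs_of_nonneg hr]
    exact div_le_of_le_mul₀ hr n.cast_nonneg h
  all_goals simp

lemma measurable_kinSlope {r g : α → ℝ} (hr : Measurable r) (hg : Measurable g) (n : ℕ) :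
    Measurable fun x => kinSlope n (r x) (g x) :=
  Measurable.ite (measurableSet_le hg.abs (hr.const_mul _)) (hg.div hr)
    (Measurable.ite (measurableSet_lt hg measurable_const) measurable_const measurable_const)

lemma kinSlope_eq {n : ℕ} {r g : ℝ} (h : ¬ |g| ≤ n * r) :
    2 * kinSlope n r g * g - kinSlope n r g ^ 2 * r = n * (2 * |g| - n * r) := by
  rw [kinSlope, if_neg h]
  split_ifs with hg
  · rw [abs_of_neg hg]; ring
  · rw [abs_of_nonneg (not_lt.1 hg)]; ring

lemma kinSlope_nonneg (n : ℕ) {r g : ℝ} (hr : 0 ≤ r) :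
    0 ≤ 2 * kinSlope n r g * g - kinSlope n r g ^ 2 * r := by
  by_cases h : |g| ≤ n * r
  · rw [kinSlope, if_pos h]
    rcases hr.eq_or_lt with rfl | hr
    · simp
    · have : 2 * (g / r) * g - (g / r) ^ 2 * r = g ^ 2 / r := by field_simp; ring
      rw [this]
      positivity
  · rw [kinSlope_eq h]
    exact mul_nonneg n.cast_nonneg (by linarith [abs_nonneg g])

lemma kin_le_liminf {r g f : ℝ} (hr : 0 ≤ r) (hf : 0 ≤ f) :
    ofReal f * kin r g ≤ liminf (fun n : ℕ =>
      ofReal (f * (2 * kinSlope n r g * g - kinSlope n r g ^ 2 * r))) atTop := by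
  rcases hf.eq_or_lt with rfl | hf
  · simp
  rcases hr.eq_or_lt with rfl | hr
  · by_cases hg : g = 0
    · simp [hg, kin]
    · refine le_top.trans_eq (Tendsto.liminf_eq ?_).symm
      have h1 : ∀ n : ℕ, ¬ |g| ≤ n * 0 := fun n => by simpa using hg
      simp_rw [fun n => kinSlope_eq (h1 n), mul_zero, sub_zero, mul_left_comm f]
      exact ENNReal.tendsto_ofReal_atTop.comp
        (tendsto_natCast_atTop_atTop.atTop_mul_const (by positivity))
  · refine ((tendsto_const_nhds.congr' ?_).liminf_eq).ge
    obtain ⟨N, hN⟩ := exists_nat_ge (|g| / r)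
    filter_upwards [eventually_ge_atTop N] with n hn
    have h1 : |g| ≤ n * r := by
      rw [← div_le_iff₀ hr]
      exact hN.trans (by exact_mod_cast hn)
    rw [kinSlope, if_pos h1, kin_of_pos hr, ← ofReal_mul hf.le]
    congr 2
    field_simp
    ring

lemma integrable_weight_mul {f h : α → ℝ} (hf : Measurable f) (hfb : ∃ c, ∀ x, |f x| ≤ c)
    (hh : Integrable h μ) : Integrable (fun x => f x * h x) μ := by
  obtain ⟨c, hc⟩ := hfb
  exact hh.bdd_mul hf.aestronglyMeasurable (ae_of_all _ hc)

lemma integrable_kin_affine {f r g a : α → ℝ} (hf : Measurable f) (hfb : ∃ c, ∀ x, |f x| ≤ c)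
    (hg : Integrable g μ) (hr : Integrable r μ) (ha : Measurable a) (hab : ∃ c, ∀ x, |a x| ≤ c) :
    Integrable (fun x => f x * (2 * a x * g x - a x ^ 2 * r x)) μ := by
  obtain ⟨c, hc⟩ := hab
  refine integrable_weight_mul hf hfb (Integrable.sub ?_ ?_)
  · refine integrable_weight_mul (ha.const_mul 2) ⟨2 * c, fun x => ?_⟩ hg
    rw [abs_mul, abs_two]
    linarith [hc x]
  · refine integrable_weight_mul (ha.pow_const 2) ⟨c ^ 2, fun x => ?_⟩ hr
    rw [abs_pow]
    exact pow_le_pow_left₀ (abs_nonneg _) (hc x) 2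

lemma lintegral_kin_le {f r g : α → ℝ} (hfm : Measurable f) (hfb : ∃ c, ∀ x, |f x| ≤ c)
    (hf0 : ∀ᵐ x ∂μ, 0 ≤ f x) (hgm : Measurable g) (hrm : Measurable r) (hg : Integrable g μ)
    (hr : Integrable r μ) (hr0 : ∀ᵐ x ∂μ, 0 ≤ r x) {C : ℝ≥0∞}
    (h : ∀ a : α → ℝ, Measurable a → (∃ c, ∀ x, |a x| ≤ c) →
      ofReal (∫ x, f x * (2 * a x * g x - a x ^ 2 * r x) ∂μ) ≤ C) :
    ∫⁻ x, ofReal (f x) * kin (r x) (g x) ∂μ ≤ C := by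
  have hmr : Measurable fun x => max (r x) 0 := hrm.max measurable_const
  have hrr : ∀ᵐ x ∂μ, max (r x) 0 = r x := by
    filter_upwards [hr0] with x hx using max_eq_left hx
  let a : ℕ → α → ℝ := fun n x => kinSlope n (max (r x) 0) (g x)
  have ham : ∀ n, Measurable (a n) := fun n => measurable_kinSlope hmr hgm n
  have hab : ∀ n, ∃ c, ∀ x, |a n x| ≤ c := fun n =>
    ⟨n, fun x => abs_kinSlope_le n (le_max_right _ _)⟩
  refine lintegral_le_of_le_liminf (h := fun n x => f x * (2 * a n x * g x - a n x ^ 2 * r x))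
    (fun n => ?_) (fun n => integrable_kin_affine hfm hfb hg hr (ham n) (hab n)) (fun n => ?_)
    (fun n => h _ (ham n) (hab n)) ?_
  · have := ham n
    fun_prop
  · filter_upwards [hf0, hrr, hr0] with x hx hx' hx''
    simp only [a, hx']
    exact mul_nonneg hx (kinSlope_nonneg n hx'')
  · filter_upwards [hf0, hrr, hr0] with x hx hx' hx''
    simp only [a, hx']
    exact kin_le_liminf hx'' hx

lemma ofReal_integral_le_lintegral_kin {f r g : α → ℝ} (hf0 : ∀ᵐ x ∂μ, 0 ≤ f x)
    (hr0 : ∀ᵐ x ∂μ, 0 ≤ r x) (a : α → ℝ) :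
    ofReal (∫ x, f x * (2 * a x * g x - a x ^ 2 * r x) ∂μ)
      ≤ ∫⁻ x, ofReal (f x) * kin (r x) (g x) ∂μ := by
  refine ofReal_integral_le_lintegral ?_
  filter_upwards [hf0, hr0] with x hx hx'
  rw [ofReal_mul hx]
  gcongr
  exact ofReal_le_kin hx'

variable {A γ : ℝ}

/-- The tangent at `s` of the graph of the pressure, evaluated at `r`. -/
def pressureTangent (A γ s r : ℝ) : ℝ := A * s ^ γ + A * γ * s ^ (γ - 1) * (r - s)

lemma pressureTangent_le (hA : 0 ≤ A) (hγ : 1 < γ) {s r : ℝ} (hs : 0 ≤ s) (hr : 0 ≤ r) :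
    pressureTangent A γ s r ≤ pressure A γ r := by
  unfold pressureTangent pressure
  rcases hs.eq_or_lt with rfl | hs
  · rw [zero_rpow (by linarith), zero_rpow (by linarith)]
    simp only [mul_zero, zero_mul, add_zero]
    positivity
  · have h1 : -1 ≤ (r - s) / s := by
      rw [le_div_iff₀ hs]; linarith
    have h2 := one_add_mul_self_le_rpow_one_add h1 hγ.le
    have h3 : 1 + (r - s) / s = r / s := by field_simp; ring
    rw [h3, Real.div_rpow hr hs.le, le_div_iff₀ (Real.rpow_pos_of_pos hs _)] at h2
    have h4 : s ^ γ = s ^ (γ - 1) * s := by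
      rw [← Real.rpow_add_one hs.ne', sub_add_cancel]
    have h5 : (1 + γ * ((r - s) / s)) * s ^ γ = s ^ γ + γ * s ^ (γ - 1) * (r - s) := by
      rw [h4]
      field_simp
    rw [h5] at h2
    linarith [mul_le_mul_of_nonneg_left h2 hA]

lemma pressure_nonneg (hA : 0 ≤ A) {r : ℝ} (hr : 0 ≤ r) : 0 ≤ pressure A γ r :=
  mul_nonneg hA (rpow_nonneg hr _)

lemma measurable_pressureTangent {s r : α → ℝ} (hs : Measurable s)
    (hr : Measurable r) : Measurable fun x => pressureTangent A γ (s x) (r x) := by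
  unfold pressureTangent
  fun_prop

lemma integrable_press_affine [IsFiniteMeasure μ] (hγ : 1 < γ) {f r s : α → ℝ} (hf : Measurable f)
    (hfb : ∃ c, ∀ x, |f x| ≤ c) (hr : Integrable r μ) (hs : Measurable s)
    (hs0 : ∀ x, 0 ≤ s x) (hsb : ∃ c, ∀ x, s x ≤ c) :
    Integrable (fun x => f x * pressureTangent A γ (s x) (r x)) μ := by
  obtain ⟨c, hc⟩ := hsb
  have hpow : ∀ δ : ℝ, 0 ≤ δ → ∀ x, |s x ^ δ| ≤ c ^ δ := fun δ hδ x => by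
    rw [abs_of_nonneg (rpow_nonneg (hs0 x) _)]
    exact rpow_le_rpow (hs0 x) (hc x) hδ
  refine integrable_weight_mul hf hfb (Integrable.add ?_ ?_)
  · refine Integrable.const_mul ?_ A
    exact Integrable.of_bound (hs.pow_const γ).aestronglyMeasurable (c ^ γ)
      (ae_of_all _ (hpow γ (by linarith)))
  · refine integrable_weight_mul ((hs.pow_const (γ - 1)).const_mul (A * γ))
      ⟨|A * γ| * c ^ (γ - 1), fun x => ?_⟩ (hr.sub ?_)
    · rw [abs_mul]
      exact mul_le_mul_of_nonneg_left (hpow _ (by linarith) x) (abs_nonneg _)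
    · exact Integrable.of_bound hs.aestronglyMeasurable c
        (ae_of_all _ fun x => by rw [norm_of_nonneg (hs0 x)]; exact hc x)

lemma lintegral_pressure_le [IsFiniteMeasure μ] (hA : 0 ≤ A) (hγ : 1 < γ) {f r : α → ℝ}
    (hfm : Measurable f) (hfb : ∃ c, ∀ x, |f x| ≤ c)
    (hf0 : ∀ᵐ x ∂μ, 0 ≤ f x) (hrm : Measurable r)
    (hr : Integrable r μ) (hr0 : ∀ᵐ x ∂μ, 0 ≤ r x) {C : ℝ≥0∞}
    (h : ∀ s : α → ℝ, Measurable s → (∀ x, 0 ≤ s x) → (∃ c, ∀ x, s x ≤ c) →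
      ofReal (∫ x, f x * pressureTangent A γ (s x) (r x) ∂μ) ≤ C) :
    ∫⁻ x, ofReal (f x * pressure A γ (r x)) ∂μ ≤ C := by
  let s : ℕ → α → ℝ := fun n x => min (max (r x) 0) n
  have hsm : ∀ n, Measurable (s n) := fun n => (hrm.max measurable_const).min measurable_const
  have hs0 : ∀ n x, 0 ≤ s n x := fun n x => le_min (le_max_right _ _) (Nat.cast_nonneg n)
  have hsb : ∀ n, ∃ c, ∀ x, s n x ≤ c := fun n => ⟨n, fun x => min_le_right _ _⟩
  refine lintegral_le_of_le_liminf (h := fun n x => f x * pressureTangent A γ (s n x) (r x))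
    (fun n => hfm.mul (measurable_pressureTangent (hsm n) hrm))
    (fun n => integrable_press_affine hγ hfm hfb hr (hsm n) (hs0 n) (hsb n)) (fun n => ?_)
    (fun n => h _ (hsm n) (hs0 n) (hsb n)) ?_
  · filter_upwards [hf0, hr0] with x hx hx'
    refine mul_nonneg hx (add_nonneg (mul_nonneg hA (rpow_nonneg (hs0 n x) _))
      (mul_nonneg (mul_nonneg (mul_nonneg hA (by linarith)) (rpow_nonneg (hs0 n x) _)) ?_))
    simp only [s, max_eq_left hx', sub_nonneg]
    exact min_le_left _ _
  · filter_upwards [hf0, hr0] with x hx hx'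
    refine le_of_eq (Eq.symm (Tendsto.liminf_eq ?_))
    refine tendsto_const_nhds.congr' ?_
    obtain ⟨N, hN⟩ := exists_nat_ge (r x)
    filter_upwards [eventually_ge_atTop N] with n hn
    have h1 : s n x = r x := by
      simp only [s, max_eq_left hx']
      exact min_eq_left (hN.trans (by exact_mod_cast hn))
    simp [pressureTangent, pressure, h1]

lemma ofReal_integral_le_lintegral_pressure (hA : 0 ≤ A) (hγ : 1 < γ) {f r s : α → ℝ}
    (hf0 : ∀ᵐ x ∂μ, 0 ≤ f x) (hr0 : ∀ᵐ x ∂μ, 0 ≤ r x) (hs0 : ∀ x, 0 ≤ s x) :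
    ofReal (∫ x, f x * pressureTangent A γ (s x) (r x) ∂μ)
      ≤ ∫⁻ x, ofReal (f x * pressure A γ (r x)) ∂μ := by
  refine ofReal_integral_le_lintegral ?_
  filter_upwards [hf0, hr0] with x hx hx'
  exact ofReal_le_ofReal (mul_le_mul_of_nonneg_left (pressureTangent_le hA hγ (hs0 x) hx') hx)

end Suprema

/-! ### Comparison of measures by continuous functions -/

section Comparison

variable {X : Type*} [MeasurableSpace X] [PseudoEMetricSpace X] [BorelSpace X]

lemma measure_le_of_forall_lintegral_le {μ ν : Measure X} [IsFiniteMeasure μ] [IsFiniteMeasure ν]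
    (h : ∀ f : BoundedContinuousFunction X ℝ≥0, ∫⁻ x, f x ∂μ ≤ ∫⁻ x, f x ∂ν) : μ ≤ ν := by
  have hclosed : ∀ F : Set X, IsClosed F → μ F ≤ ν F := fun F hF =>
    le_of_tendsto_of_tendsto' (HasOuterApproxClosed.tendsto_lintegral_apprSeq hF μ)
      (HasOuterApproxClosed.tendsto_lintegral_apprSeq hF ν) fun n => h _
  refine Measure.le_iff.2 fun B hB => ?_
  rw [hB.measure_eq_iSup_isClosed_of_ne_top (measure_ne_top μ B)]
  exact iSup₂_le fun F hFB => iSup_le fun hF => (hclosed F hF).trans (measure_mono hFB)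

/-- If `∫ f h dλ ≤ ∫ f dν` for all continuous `f ≥ 0`, then `h λ ≤ ν` on Borel sets. -/
lemma setIntegral_le_of_forall_integral_le {μ ν : Measure X} [IsFiniteMeasure ν] {h : X → ℝ}
    (hh : Integrable h μ)
    (hle : ∀ f : C(X, ℝ), (∀ x, 0 ≤ f x) → (∃ c, ∀ x, f x ≤ c) →
      ∫ x, f x * h x ∂μ ≤ ∫ x, f x ∂ν) {B : Set X} (hB : MeasurableSet B) :
    ∫ x in B, h x ∂μ ≤ ν.real B := by
  let p : Measure X := μ.withDensity fun x => ofReal (h x)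
  let m : Measure X := μ.withDensity fun x => ofReal (-h x)
  have : IsFiniteMeasure p := isFiniteMeasure_withDensity_ofReal hh.2
  have : IsFiniteMeasure m := isFiniteMeasure_withDensity_ofReal hh.neg.2
  have hb : ∀ (f : BoundedContinuousFunction X ℝ≥0) x, (f x : ℝ) ≤ nndist f 0 := fun f x =>
    mod_cast BoundedContinuousFunction.NNReal.upper_bound f x
  have hc : ∀ f : BoundedContinuousFunction X ℝ≥0, Continuous fun x => (f x : ℝ) := fun f =>
    NNReal.continuous_coe.comp f.continuous
  have hmul : ∀ f : BoundedContinuousFunction X ℝ≥0, Integrable (fun x => (f x : ℝ) * h x) μ :=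
    fun f => integrable_weight_mul (hc f).measurable ⟨_, fun x => (abs_of_nonneg (f x).2).trans_le
      (hb f x)⟩ hh
  have hden : ∀ (f : BoundedContinuousFunction X ℝ≥0) {k : X → ℝ}, AEMeasurable k μ →
      ∫⁻ x, f x ∂(μ.withDensity fun x => ofReal (k x))
        = ∫⁻ x, ofReal ((f x : ℝ) * k x) ∂μ := by
    intro f k hk
    rw [lintegral_withDensity_eq_lintegral_mul₀ hk.ennreal_ofReal
      f.continuous.measurable.coe_nnreal_ennreal.aemeasurable]
    refine lintegral_congr fun x => ?_
    rw [Pi.mul_apply, ofReal_mul (NNReal.coe_nonneg _), ENNReal.ofReal_coe_nnreal, mul_comm]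
  -- positive and negative parts turn the inequality into one between measures
  have hpm : p ≤ ν + m := by
    refine measure_le_of_forall_lintegral_le fun f => ?_
    rw [lintegral_add_measure, hden f hh.aemeasurable, hden f (k := fun x =>
      -h x) hh.neg.aemeasurable]
    have hfin : ∀ {k : X → ℝ}, Integrable k μ → ∫⁻ x, ofReal (k x) ∂μ ≠ ∞ := fun hk =>
      (lt_of_le_of_lt (lintegral_ofReal_le_lintegral_enorm _) hk.2).ne
    have h1 := hle ⟨_, hc f⟩ (fun x => NNReal.coe_nonneg _) ⟨_, hb f⟩
    simp only [ContinuousMap.coe_mk] at h1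
    rw [integral_eq_lintegral_pos_part_sub_lintegral_neg_part (hmul f),
      ← BoundedContinuousFunction.toReal_lintegral_coe_eq_integral] at h1
    simp only [← mul_neg] at h1
    have hfi : Integrable (fun x => (f x : ℝ) * (-h x)) μ := by simpa using (hmul f).neg
    have h2 := hfin (hmul f)
    have h3 := hfin hfi
    have h4 := (BoundedContinuousFunction.lintegral_lt_top_of_nnreal ν f).ne
    rw [← toReal_le_toReal h2 (ENNReal.add_ne_top.2 ⟨h4, h3⟩), toReal_add h4 h3]
    linarith
  have hreal : p.real B ≤ ν.real B + m.real B := by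
    rw [measureReal_def, measureReal_def, measureReal_def,
      ← toReal_add (measure_ne_top _ _) (measure_ne_top _ _)]
    exact toReal_mono (by finiteness) (hpm B)
  rw [integral_eq_lintegral_pos_part_sub_lintegral_neg_part hh.integrableOn]
  rw [measureReal_def, measureReal_def m, withDensity_apply _ hB, withDensity_apply _ hB] at hreal
  linarith

end Comparison

/-! ### Integration with respect to signed measures -/

section Signed

variable {X : Type*} [MeasurableSpace X]

instance isFiniteMeasure_variation (s : SignedMeasure X) : IsFiniteMeasure s.variation := by
  rw [← SignedMeasure.totalVariation_eq_variation, SignedMeasure.totalVariation]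
  infer_instance

/-- The integral of a function with respect to a signed measure. -/
abbrev sint (s : SignedMeasure X) (f : X → ℝ) : ℝ := s.integral f (ContinuousLinearMap.lsmul ℝ ℝ)

variable {s s' : SignedMeasure X} {f g : X → ℝ}

lemma integrable_of_bounded {μ : Measure X} [IsFiniteMeasure μ] (hf : Measurable f)
    (hb : ∃ c, ∀ x, |f x| ≤ c) : Integrable f μ := by
  obtain ⟨c, hc⟩ := hb
  exact Integrable.of_bound hf.aestronglyMeasurable c (ae_of_all _ hc)

lemma abs_sint_le {c : ℝ} (hb : ∀ x, |f x| ≤ c) : |sint s f| ≤ c * s.variation.real univ := by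
  have h0 : |sint s f| ≤ ‖(ContinuousLinearMap.lsmul ℝ ℝ : ℝ →L[ℝ] ℝ →L[ℝ] ℝ)‖ *
      ∫ x, ‖f x‖ ∂s.variation := by
    rw [← norm_eq_abs]
    exact VectorMeasure.norm_integral_le_integral_norm
  refine h0.trans ?_
  have h1 : ‖(ContinuousLinearMap.lsmul ℝ ℝ : ℝ →L[ℝ] ℝ →L[ℝ] ℝ)‖ ≤ 1 :=
    ContinuousLinearMap.opNorm_lsmul_le
  have h2 : ∫ x, ‖f x‖ ∂s.variation ≤ c * s.variation.real univ := by
    by_cases hi : Integrable (fun x => ‖f x‖) s.variation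
    · calc ∫ x, ‖f x‖ ∂s.variation ≤ ∫ _, c ∂s.variation :=
          integral_mono hi (integrable_const c) hb
        _ = _ := by rw [integral_const, smul_eq_mul, mul_comm]
    · rw [integral_undef hi]
      by_cases hX : Nonempty X
      · exact mul_nonneg ((abs_nonneg _).trans (hb hX.some)) measureReal_nonneg
      · rw [not_nonempty_iff] at hX
        simp [Subsingleton.elim s.variation 0]
  calc ‖(ContinuousLinearMap.lsmul ℝ ℝ : ℝ →L[ℝ] ℝ →L[ℝ] ℝ)‖ * ∫ x, ‖f x‖ ∂s.variation
      ≤ 1 * ∫ x, ‖f x‖ ∂s.variation :=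
        mul_le_mul_of_nonneg_right h1 (integral_nonneg fun _ => norm_nonneg _)
    _ ≤ _ := by rw [one_mul]; exact h2

lemma sint_toSignedMeasure (μ : Measure X) [IsFiniteMeasure μ] (f : X → ℝ) :
    sint μ.toSignedMeasure f = ∫ x, f x ∂μ := by
  have h : (ContinuousLinearMap.lsmul ℝ ℝ : ℝ →L[ℝ] ℝ →L[ℝ] ℝ).flip
      = ContinuousLinearMap.lsmul ℝ ℝ := by
    ext
    simp
  rw [sint, ← h]
  exact VectorMeasure.integral_toSignedMeasure

lemma sint_add_measure (hf : Measurable f) (hb : ∃ c, ∀ x, |f x| ≤ c) :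
    sint (s + s') f = sint s f + sint s' f :=
  VectorMeasure.integral_add_vectorMeasure (integrable_of_bounded hf hb)
    (integrable_of_bounded hf hb)

lemma sint_sub_measure (hf : Measurable f) (hb : ∃ c, ∀ x, |f x| ≤ c) :
    sint (s - s') f = sint s f - sint s' f :=
  VectorMeasure.integral_sub_vectorMeasure (integrable_of_bounded hf hb)
    (integrable_of_bounded hf hb)

lemma sint_smul_measure (c : ℝ) : sint (c • s) f = c * sint s f :=
  VectorMeasure.integral_smul_vectorMeasure f c

lemma sint_sum_measure {ι : Type*} {σ : ι → SignedMeasure X} (t : Finset ι) (hf : Measurable f)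
    (hb : ∃ c, ∀ x, |f x| ≤ c) : sint (∑ i ∈ t, σ i) f = ∑ i ∈ t, sint (σ i) f :=
  VectorMeasure.integral_finsetSum_vectorMeasure fun _ _ => integrable_of_bounded hf hb

lemma sint_add (hf : Measurable f) (hb : ∃ c, ∀ x, |f x| ≤ c) (hg : Measurable g)
    (hgb : ∃ c, ∀ x, |g x| ≤ c) : sint s (fun x => f x + g x) = sint s f + sint s g :=
  VectorMeasure.integral_fun_add (integrable_of_bounded hf hb) (integrable_of_bounded hg hgb)

lemma sint_const_mul (c : ℝ) : sint s (fun x => c * f x) = c * sint s f :=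
  VectorMeasure.integral_fun_smul _ _ c f

lemma sint_withDensityᵥ {μ : Measure X} {h : X → ℝ} (hh : Integrable h μ) (hf : Measurable f)
    (hb : ∃ c, ∀ x, |f x| ≤ c) : sint (μ.withDensityᵥ h) f = ∫ x, f x * h x ∂μ := by
  have hfin : ∀ {k : X → ℝ}, Integrable k μ →
      IsFiniteMeasure (μ.withDensity fun x => ofReal (k x)) := fun hk =>
    isFiniteMeasure_withDensity_ofReal hk.2
  have := hfin hh
  have := hfin hh.neg
  have hint : ∀ {k : X → ℝ}, AEMeasurable k μ →
      ∫ x, f x ∂(μ.withDensity fun x => ofReal (k x)) = ∫ x, f x * max (k x) 0 ∂μ := by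
    intro k hk
    rw [integral_withDensity_eq_integral_toReal_smul₀ hk.ennreal_ofReal
      (ae_of_all _ fun x => ofReal_lt_top)]
    refine integral_congr_ae (ae_of_all _ fun x => ?_)
    simp only [ENNReal.toReal_ofReal', smul_eq_mul, mul_comm]
  rw [withDensityᵥ_eq_withDensity_pos_part_sub_withDensity_neg_part hh, sint_sub_measure hf hb,
    sint_toSignedMeasure, sint_toSignedMeasure, hint hh.aemeasurable,
    hint (k := fun x => -h x) hh.neg.aemeasurable,
    ← integral_sub (integrable_weight_mul hf hb hh.pos_part)
      (integrable_weight_mul (h := fun x => max (-h x) 0) hf hb hh.neg.pos_part)]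
  refine integral_congr_ae (ae_of_all _ fun x => ?_)
  simp only
  rw [← mul_sub, max_zero_sub_max_neg_zero_eq_self]

lemma sint_nonneg (hs : ∀ B, MeasurableSet B → 0 ≤ s B) (hf : ∀ x, 0 ≤ f x) : 0 ≤ sint s f := by
  have h0 : VectorMeasure.restrict 0 univ ≤ VectorMeasure.restrict s univ := by
    rw [VectorMeasure.restrict_univ, VectorMeasure.restrict_univ]
    exact fun B hB => hs B hB
  have h1 : (s.toMeasureOfZeroLE univ MeasurableSet.univ h0).toSignedMeasure = s := by
    rw [SignedMeasure.toMeasureOfZeroLE_toSignedMeasure]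
  rw [← h1, sint_toSignedMeasure]
  exact integral_nonneg hf

variable {Ω : Type*} [MeasurableSpace Ω] {P : Measure Ω}

lemma aemeasurable_sint {σ : Ω → SignedMeasure X}
    (hσ : ∀ B, MeasurableSet B → AEMeasurable (fun t => σ t B) P) (hf : Measurable f)
    (hb : ∃ c, ∀ x, |f x| ≤ c) : AEMeasurable (fun t => sint (σ t) f) P := by
  obtain ⟨c, hc⟩ := hb
  let φ : ℕ → SimpleFunc X ℝ := fun n => hf.stronglyMeasurable.approxBounded c n
  have hφ : ∀ n x, |φ n x| ≤ |c| := fun n x =>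
    (hf.stronglyMeasurable.norm_approxBounded_le ((abs_nonneg _).trans (hc x)) n x).trans
      (le_abs_self c)
  have hlim : ∀ t, Tendsto (fun n => sint (σ t) (φ n)) atTop (𝓝 (sint (σ t) f)) := fun t =>
    VectorMeasure.tendsto_integral_of_dominated_convergence (fun _ => |c|)
      (fun n => (φ n).measurable.aestronglyMeasurable) (integrable_const _)
      (fun n => ae_of_all _ (hφ n))
      (ae_of_all _ fun x => hf.stronglyMeasurable.tendsto_approxBounded_of_norm_le (hc x))
  refine aemeasurable_of_tendsto_metrizable_ae atTop (fun n => ?_) (ae_of_all _ hlim)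
  have hsimple : ∀ ψ : SimpleFunc X ℝ, AEMeasurable (fun t => sint (σ t) ψ) P := by
    intro ψ
    induction ψ using SimpleFunc.induction with
    | const a hB =>
      rename_i B
      refine ((hσ B hB).const_mul a).congr (ae_of_all _ fun t => ?_)
      have h1 : (⇑(SimpleFunc.piecewise B hB (SimpleFunc.const X a) (SimpleFunc.const X 0)) : X → ℝ)
          = B.indicator fun _ => a := by
        ext x; by_cases hx : x ∈ B <;> simp [hx]
      simp only
      rw [sint, h1, VectorMeasure.integral_indicator_const _ hB]
      simp
    | add hd h1 h2 =>
      rename_i ψ₁ ψ₂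
      refine (h1.add h2).congr (ae_of_all _ fun t => ?_)
      have hbd : ∀ ψ : SimpleFunc X ℝ, ∃ c, ∀ x, |ψ x| ≤ c := fun ψ => by
        obtain ⟨c, hc⟩ := ψ.exists_forall_norm_le
        exact ⟨c, hc⟩
      exact (sint_add ψ₁.measurable (hbd _) ψ₂.measurable (hbd _)).symm
  exact hsimple (φ n)

end Signed

/-! ### Stress functionals and relaxed solutions -/

section Relaxed

variable {d : ℕ} {G : FluidDomain d}

/-- The values of test functions for the stress: a matrix, to be paired with `m ⊗ m / ρ` and the
convective defect, and a scalar, to be paired with the pressure and the pressure defect. -/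
abbrev Stress (d : ℕ) : Type := (Fin d → Fin d → ℝ) × ℝ

/-- The closure of the domain; in the case of the torus, the closed cube `[-1,1]^d`. -/
abbrev Hull (G : FluidDomain d) : Type := closure G.cell

/-- The functionals on the space of continuous stress fields. -/
abbrev StressDual {d : ℕ} (G : FluidDomain d) [CompactSpace (Hull G)] : Type :=
  StrongDual ℝ C(Hull G, Stress d)

lemma measurableSet_cell (hG : G.Admissible) : MeasurableSet G.cell := by
  cases G with
  | bounded Ω => exact hG.1.measurableSet
  | torus =>
    have h : (FluidDomain.torus : FluidDomain d).cell = ⋂ i, {x : Space d | -1 ≤ x i ∧ x i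
        < 1} := by
      ext x; simp [FluidDomain.cell]
    rw [h]
    refine MeasurableSet.iInter fun i => ?_
    have hm : Measurable fun x : Space d => x i := by fun_prop
    exact (measurableSet_le measurable_const hm).inter (measurableSet_lt hm measurable_const)

lemma compactSpace_hull (hG : G.Admissible) : CompactSpace (Hull G) := by
  rw [← isCompact_iff_compactSpace]
  refine Bornology.IsBounded.isCompact_closure ?_
  cases G with
  | bounded Ω => exact hG.2.2.1
  | torus =>
    refine (Metric.isBounded_closedBall (x := (0 : Space d)) (r := √d)).subset fun x hx => ?_
    rw [mem_closedBall_zero_iff, EuclideanSpace.norm_eq]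
    refine Real.sqrt_le_sqrt ?_
    calc ∑ i, ‖x i‖ ^ 2 ≤ ∑ _i : Fin d, (1 : ℝ) := by
          refine sum_le_sum fun i _ => ?_
          rw [norm_eq_abs, sq_abs]
          have := hx i
          nlinarith [this.1, this.2]
      _ = d := by simp

lemma closedCell_subset_hull : G.closedCell ⊆ closure G.cell := by
  cases G with
  | bounded Ω => exact subset_rfl
  | torus => exact subset_closure

lemma cell_subset_closedCell : G.cell ⊆ G.closedCell := by
  cases G with
  | bounded Ω => exact subset_closure
  | torus => exact subset_rfl

lemma ae_mem_cell (hG : G.Admissible) : ∀ᵐ x ∂G.vol, x ∈ G.cell :=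
  ae_restrict_mem (measurableSet_cell hG)

/-- The test function `x ↦ f(x) A`. -/
def stressTest (A : Stress d) : C(Hull G, ℝ) →L[ℝ] C(Hull G, Stress d) :=
  ((1 : ℝ →L[ℝ] ℝ).smulRight A).compLeftContinuous ℝ (Hull G)

lemma stressTest_apply (A : Stress d) (f : C(Hull G, ℝ)) (x : Hull G) :
    stressTest A f x = f x • A := rfl

/-- The scalar functions forming a test function for the stress. -/
def stressEntry (i j : Fin d) : C(Hull G, Stress d) →L[ℝ] C(Hull G, ℝ) :=
  ((ContinuousLinearMap.proj (R := ℝ) (φ := fun _ : Fin d => ℝ) j).comp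
    ((ContinuousLinearMap.proj (R := ℝ) (φ := fun _ : Fin d => Fin d → ℝ) i).comp
      (ContinuousLinearMap.fst ℝ (Fin d → Fin d → ℝ) ℝ))).compLeftContinuous ℝ (Hull G)

/-- The scalar part of a test function for the stress. -/
def stressScalar : C(Hull G, Stress d) →L[ℝ] C(Hull G, ℝ) :=
  (ContinuousLinearMap.snd ℝ (Fin d → Fin d → ℝ) ℝ).compLeftContinuous ℝ (Hull G)

/-- The matrix with one entry `1`. -/
def unitStress (i j : Fin d) : Stress d := (fun k l => if k = i ∧ l = j then 1 else 0, 0)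

/-- The matrix `ξ ⊗ ξ`. -/
def squareStress (ξ : Fin d → ℝ) : Stress d := (fun i j => ξ i * ξ j, 0)

/-- The unit scalar. -/
def scalarStress (d : ℕ) : Stress d := (0, 1)

/-- Testing with `½ 𝕀` and `1/(γ-1)` yields the energy. -/
def energyStress (d : ℕ) (γ : ℝ) : Stress d := (fun i j => if i = j then 1 / 2 else 0, 1 / (γ - 1))

lemma stress_eq_sum (F : C(Hull G, Stress d)) :
    F = ∑ i, ∑ j, stressTest (unitStress i j) (stressEntry i j F)
      + stressTest (scalarStress d) (stressScalar F) := by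
  ext x <;> simp [stressTest_apply, unitStress, scalarStress, stressEntry, stressScalar,
    Prod.fst_sum, Prod.snd_sum, Finset.sum_apply, ite_and]

lemma stressEntry_stressTest (i j : Fin d) (S : Stress d) (f : C(Hull G, ℝ)) :
    stressEntry i j (stressTest S f) = S.1 i j • f := by
  ext x; simp [stressEntry, stressTest_apply, mul_comm]

lemma stressScalar_stressTest (S : Stress d) (f : C(Hull G, ℝ)) :
    stressScalar (stressTest S f) = S.2 • f := by
  ext x; simp [stressScalar, stressTest_apply, mul_comm]

lemma stressTest_eq_sum (S : Stress d) (f : C(Hull G, ℝ)) : stressTest S f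
    = ∑ i, ∑ j, S.1 i j • stressTest (unitStress i j) f + S.2 • stressTest (scalarStress d) f := by
  rw [stress_eq_sum (stressTest S f)]
  simp only [stressEntry_stressTest, stressScalar_stressTest, map_smul]

variable [CompactSpace (Hull G)]

instance isFiniteMeasure_vol : IsFiniteMeasure G.vol := by
  refine ⟨?_⟩
  rw [FluidDomain.vol, Measure.restrict_apply_univ]
  exact (measure_mono subset_closure).trans_lt
    (isCompact_iff_compactSpace.2 (inferInstance : CompactSpace (Hull G))).measure_lt_top

/-- The test function `(∇φ, div φ)` for the stress. -/
def gradTest {φ : Space d → Space d} (hφ : ContDiff ℝ 1 φ) : C(Hull G, Stress d) where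
  toFun x := (fun i j => grad φ x i j, divg φ x)
  continuous_toFun := by
    refine Continuous.prodMk (continuous_pi fun i => continuous_pi fun j => ?_) ?_
    · exact (continuous_grad hφ i j).comp continuous_subtype_val
    · exact (continuous_divg hφ).comp continuous_subtype_val

/-- Time-independent test functions for the equation of continuity. -/
structure IsStaticScalar (G : FluidDomain d) (φ : Space d → ℝ) : Prop where
  contDiff : ContDiff ℝ 1 φ
  periodic : G.RespectsPeriods φ

/-- Time-independent test functions for the momentum equation. -/
structure IsStaticVector (G : FluidDomain d) (φ : Space d → Space d) : Prop where
  contDiff : ContDiff ℝ 1 φ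
  periodic : G.RespectsPeriods φ
  impermeable : G.Impermeable φ

variable (a γ T : ℝ) [Fact (1 < γ)]

/-- The stress functional `L` is symmetric and dominates the stress of the state `[ρ, m]`, i.e. it
exceeds `(m ⊗ m / ρ, p(ρ))` by positive semi-definite defects. The convex functions `|ξ·m|²/ρ` and
`p(ρ)` being the suprema of their tangents, this is expressed by inequalities that are jointly
linear in `ρ`, `m` and `L`. -/
structure IsStressBound (ρ : DensSpace G γ) (m : MomSpace G γ)
    (L : StressDual G) : Prop where
  symm : ∀ i j f, L (stressTest (unitStress i j) f) = L (stressTest (unitStress j i) f)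
  convective : ∀ (ξ : Fin d → ℝ) (f : C(Space d, ℝ)), (∀ x, 0 ≤ f x) → (∃ c, ∀ x, |f x| ≤ c) →
    ∀ α : Space d → ℝ, Measurable α → (∃ c, ∀ x, |α x| ≤ c) →
      ∫ x, f x * (2 * α x * (∑ i, ξ i * m x i) - α x ^ 2 * ρ x) ∂G.vol
        ≤ L (stressTest (squareStress ξ) (f.restrict (closure G.cell)))
  pressure : ∀ f : C(Space d, ℝ), (∀ x, 0 ≤ f x) → (∃ c, ∀ x, |f x| ≤ c) →
    ∀ s : Space d → ℝ, Measurable s → (∀ x, 0 ≤ s x) → (∃ c, ∀ x, s x ≤ c) →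
      ∫ x, f x * pressureTangent a γ (s x) (ρ x) ∂G.vol
        ≤ L (stressTest (scalarStress d) (f.restrict (closure G.cell)))

/-- The conditions on a family `Λ` of stress functionals along a trajectory apart from the
equations. The total energy `Λ (½ 𝕀, 1/(γ-1))` coincides a.e. with a non-increasing function bounded
by `E₀`. -/
structure IsStressFamily (E₀ : ℝ) (ρ : ℝ → DensSpace G γ) (m : ℝ → MomSpace G γ)
    (Λ : ℝ → StressDual G) : Prop where
  measurable : ∀ F, AEMeasurable (fun t => Λ t F) dt[T]
  bounded : ∃ C, ∀ᵐ t ∂dt[T], ‖Λ t‖ ≤ C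
  bound : ∀ᵐ t ∂dt[T], IsStressBound a γ (ρ t) (m t) (Λ t)
  energy : ∃ S : Set ℝ, (∀ᵐ t ∂dt[T], t ∈ S) ∧
    AntitoneOn (fun t => Λ t (stressTest (energyStress d γ) 1)) S ∧
    ∀ t ∈ S, Λ t (stressTest (energyStress d γ) 1) ≤ E₀

/-- A relaxed solution: a trajectory together with a family of stress functionals. All conditions
are jointly convex and stable under weak convergence. -/
structure IsRelaxed (E₀ : ℝ) (u : Trajectory G γ T)
    (Λ : ℝ → StressDual G) : Prop where
  stress : IsStressFamily a γ T E₀ u.1.val u.2.val Λ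
  nonneg : ∀ t ∈ Icc 0 T, 0 ≤ᵐ[G.vol] u.1.val t
  mass : ∀ φ, IsStaticScalar G φ → ∀ τ ∈ Icc 0 T,
    ∫ x, u.1.val τ x * φ x ∂G.vol - ∫ x, u.1.val 0 x * φ x ∂G.vol
      = ∫ t in (0 : ℝ)..τ, ∫ x, fderiv ℝ φ x (u.2.val t x) ∂G.vol
  momentum : ∀ φ (hφ : IsStaticVector G φ), ∀ τ ∈ Icc 0 T,
    ∫ x, inner ℝ (u.2.val τ x) (φ x) ∂G.vol - ∫ x, inner ℝ (u.2.val 0 x) (φ x) ∂G.vol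
      = ∫ t in (0 : ℝ)..τ, Λ t (gradTest hφ.contDiff)

end Relaxed

/-! ### Stress functionals given by measures -/

section StressOf

variable {d : ℕ} {G : FluidDomain d}

section ZeroExt

variable {E : Type*} [Zero E] [TopologicalSpace E]

/-- Extension by zero of a function on the closure of the domain. -/
def zeroExt (f : C(Hull G, E)) (x : Space d) : E :=
  open Classical in if h : x ∈ closure G.cell then f ⟨x, h⟩ else 0

lemma zeroExt_of_mem (f : C(Hull G, E)) {x : Space d} (h : x ∈ closure G.cell) :
    zeroExt f x = f ⟨x, h⟩ := dif_pos h

lemma zeroExt_of_notMem (f : C(Hull G, E)) {x : Space d} (h : x ∉ closure G.cell) :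
    zeroExt f x = 0 := dif_neg h

lemma measurable_zeroExt [MeasurableSpace E] [BorelSpace E] (f : C(Hull G, E)) :
    Measurable (zeroExt f) := by
  classical
  exact Measurable.dite (s := closure G.cell) f.continuous.measurable
    (measurable_const (a := (0 : E))) isClosed_closure.measurableSet

end ZeroExt

lemma zeroExt_add (f g : C(Hull G, ℝ)) :
    zeroExt (f + g) = fun x => zeroExt f x + zeroExt g x := by
  ext x
  by_cases h : x ∈ closure G.cell
  · simp [zeroExt_of_mem _ h]
  · simp [zeroExt_of_notMem _ h]

lemma zeroExt_smul (c : ℝ) (f : C(Hull G, ℝ)) : zeroExt (c • f) = fun x => c * zeroExt f x := by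
  ext x
  by_cases h : x ∈ closure G.cell
  · simp [zeroExt_of_mem _ h]
  · simp [zeroExt_of_notMem _ h]

lemma zeroExt_restrict (f : C(Space d, ℝ)) {x : Space d} (h : x ∈ closure G.cell) :
    zeroExt (G := G) (f.restrict (closure G.cell)) x = f x := by
  rw [zeroExt_of_mem _ h]; rfl

lemma zeroExt_nonneg {f : C(Hull G, ℝ)} (hf : ∀ x, 0 ≤ f x) (x : Space d) : 0 ≤ zeroExt f x := by
  by_cases h : x ∈ closure G.cell
  · rw [zeroExt_of_mem _ h]; exact hf _
  · rw [zeroExt_of_notMem _ h]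

variable [CompactSpace (Hull G)]

lemma abs_zeroExt_le (f : C(Hull G, ℝ)) (x : Space d) : |zeroExt f x| ≤ ‖f‖ := by
  by_cases h : x ∈ closure G.cell
  · rw [zeroExt_of_mem _ h]; exact f.norm_coe_le_norm _
  · rw [zeroExt_of_notMem _ h, abs_zero]; exact norm_nonneg _

/-- Integration with respect to a signed measure, as a functional on continuous functions. -/
def signedFunctional (s : SignedMeasure (Space d)) : StrongDual ℝ C(Hull G, ℝ) :=
  LinearMap.mkContinuous
    { toFun := fun f => sint s (zeroExt f)
      map_add' := fun f g => by
        rw [zeroExt_add]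
        exact sint_add (measurable_zeroExt f) ⟨_, abs_zeroExt_le f⟩ (measurable_zeroExt g)
          ⟨_, abs_zeroExt_le g⟩
      map_smul' := fun c f => by
        rw [zeroExt_smul]
        exact sint_const_mul c }
    (s.variation.real univ) fun f => (abs_sint_le (abs_zeroExt_le f)).trans (mul_comm _ _).le

lemma signedFunctional_apply (s : SignedMeasure (Space d)) (f : C(Hull G, ℝ)) :
    signedFunctional s f = sint s (zeroExt f) := rfl

lemma norm_signedFunctional_le (s : SignedMeasure (Space d)) :
    ‖signedFunctional (G := G) s‖ ≤ s.variation.real univ :=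
  LinearMap.mkContinuous_norm_le _ measureReal_nonneg _

/-- The stress functional given by a matrix of signed measures and a signed measure. -/
def stressOf (A : Fin d → Fin d → SignedMeasure (Space d)) (B : SignedMeasure (Space d)) :
    StressDual G :=
  ∑ i, ∑ j, (signedFunctional (A i j)).comp (stressEntry i j) + (signedFunctional B).comp
    stressScalar

lemma stressOf_apply (A : Fin d → Fin d → SignedMeasure (Space d)) (B : SignedMeasure (Space d))
    (F : C(Hull G, Stress d)) :
    stressOf A B F = ∑ i, ∑ j, sint (A i j) (zeroExt (stressEntry i j F))
      + sint B (zeroExt (stressScalar F)) := by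
  simp [stressOf, signedFunctional_apply]

lemma stressOf_stressTest (A : Fin d → Fin d → SignedMeasure (Space d))
    (B : SignedMeasure (Space d)) (S : Stress d) (f : C(Hull G, ℝ)) :
    stressOf A B (stressTest S f)
      = ∑ i, ∑ j, S.1 i j * sint (A i j) (zeroExt f) + S.2 * sint B (zeroExt f) := by
  simp only [stressOf_apply, stressEntry_stressTest, stressScalar_stressTest, zeroExt_smul,
    sint_const_mul]

lemma norm_stressEntry_le (i j : Fin d) : ‖stressEntry (G := G) i j‖ ≤ 1 :=
  ContinuousLinearMap.opNorm_le_bound _ zero_le_one fun F => by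
    rw [one_mul, ContinuousMap.norm_le _ (norm_nonneg _)]
    intro x
    calc ‖(F x).1 i j‖ ≤ ‖(F x).1 i‖ := norm_le_pi_norm _ j
      _ ≤ ‖(F x).1‖ := norm_le_pi_norm _ i
      _ ≤ ‖F x‖ := norm_fst_le _
      _ ≤ ‖F‖ := F.norm_coe_le_norm x

lemma norm_stressScalar_le : ‖stressScalar (G := G)‖ ≤ 1 :=
  ContinuousLinearMap.opNorm_le_bound _ zero_le_one fun F => by
    rw [one_mul, ContinuousMap.norm_le _ (norm_nonneg _)]
    intro x
    exact (norm_snd_le _).trans (F.norm_coe_le_norm x)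

lemma norm_stressOf_le (A : Fin d → Fin d → SignedMeasure (Space d)) (B : SignedMeasure (Space d)) :
    ‖stressOf (G := G) A B‖ ≤ ∑ i, ∑ j, (A i j).variation.real univ + B.variation.real univ := by
  have h1 : ∀ (s : SignedMeasure (Space d)) (E : C(Hull G, Stress d) →L[ℝ] C(Hull G, ℝ)), ‖E‖ ≤ 1 →
      ‖(signedFunctional s).comp E‖ ≤ s.variation.real univ := fun s E hE =>
    (ContinuousLinearMap.opNorm_comp_le _ _).trans
      ((mul_le_of_le_one_right (norm_nonneg _) hE).trans (norm_signedFunctional_le s))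
  have h2 := norm_add_le (∑ i, ∑ j, (signedFunctional (G := G) (A i j)).comp (stressEntry i j))
    ((signedFunctional (G := G) B).comp stressScalar)
  refine h2.trans (add_le_add ?_ ?_)
  swap
  · exact h1 B _ norm_stressScalar_le
  refine norm_sum_le_of_le (E := StressDual G) _ fun i _ => ?_
  exact norm_sum_le_of_le (E := StressDual G) _ fun j _ =>
    h1 _ _ (norm_stressEntry_le i j)

lemma integral_mul_sq_sum_div {μ : Measure (Space d)} {m : Space d → Space d} {ρ g : Space d → ℝ}
    (hk : ∀ i j, Integrable (fun x => m x i * m x j / ρ x) μ) (hg : Measurable g)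
    (hgb : ∃ c, ∀ x, |g x| ≤ c) (ξ : Fin d → ℝ) :
    Integrable (fun x => (∑ i, ξ i * m x i) ^ 2 / ρ x) μ ∧
      ∫ x, g x * ((∑ i, ξ i * m x i) ^ 2 / ρ x) ∂μ
        = ∑ i, ∑ j, ξ i * ξ j * ∫ x, g x * (m x i * m x j / ρ x) ∂μ := by
  have hexp : ∀ x, (∑ i, ξ i * m x i) ^ 2 / ρ x
      = ∑ i, ∑ j, ξ i * ξ j * (m x i * m x j / ρ x) := fun x => by
    simp only [sq, sum_mul_sum, sum_div]
    exact sum_congr rfl fun i _ => sum_congr rfl fun j _ => by ring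
  have hint : ∀ i j, Integrable (fun x => ξ i * ξ j * (g x * (m x i * m x j / ρ x))) μ := fun i j =>
    (integrable_weight_mul hg hgb (hk i j)).const_mul _
  simp_rw [hexp, mul_sum, ← integral_const_mul, mul_left_comm (g _)]
  refine ⟨integrable_finsetSum _ fun i _ => integrable_finsetSum _ fun j _ =>
    (hk i j).const_mul _, ?_⟩
  rw [integral_finsetSum _ fun i _ => integrable_finsetSum _ fun j _ => hint i j]
  exact sum_congr rfl fun i _ => integral_finsetSum _ fun j _ => hint i j

/-- The stress functional of a state and defects dominates the stress of the state. -/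
lemma isStressBound_stressOf (hG : G.Admissible) {a γ : ℝ} (ha : 0 ≤ a) [hγ : Fact (1 < γ)]
    {ρ : DensSpace G γ} {m : MomSpace G γ}
    (hρ : 0 ≤ᵐ[G.vol] ρ) (hp : Integrable (fun x => pressure a γ (ρ x)) G.vol)
    (hk : ∀ i j, Integrable (fun x => m x i * m x j / ρ x) G.vol)
    (hvac : ∀ᵐ x ∂G.vol, ρ x = 0 → m x = 0)
    {R : Fin d → Fin d → SignedMeasure (Space d)} {Q : SignedMeasure (Space d)}
    (hsymm : ∀ i j, R i j = R j i)
    (hpos : ∀ ξ : Fin d → ℝ, ∀ B, MeasurableSet B → 0 ≤ ∑ i, ∑ j, ξ i * ξ j * R i j B)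
    (hQ : ∀ B, MeasurableSet B → 0 ≤ Q B) :
    IsStressBound a γ ρ m (stressOf
      (fun i j => G.vol.withDensityᵥ (fun x => m x i * m x j / ρ x) + R i j)
      (G.vol.withDensityᵥ (fun x => pressure a γ (ρ x)) + Q)) := by
  have hmi : ∀ i, Integrable (fun x => m x i) G.vol := fun i =>
    (((Lp.memLp m).integrable (Fact.out)).eval_piLp i)
  have hρi : Integrable (fun x => ρ x) G.vol := (Lp.memLp ρ).integrable (Fact.out)
  have hg : ∀ f : C(Space d, ℝ), ∀ᵐ x ∂G.vol, f x = zeroExt (G := G)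
      (f.restrict (closure G.cell)) x :=
    fun f => (ae_mem_cell hG).mono fun x hx => (zeroExt_restrict f (subset_closure hx)).symm
  have hgb : ∀ f : C(Hull G, ℝ), ∃ c, ∀ x, |zeroExt f x| ≤ c := fun f => ⟨_, abs_zeroExt_le f⟩
  refine ⟨fun i j f => ?_, fun ξ f hf hfb α hα hαb => ?_, fun f hf hfb s hs hs0 hsb => ?_⟩
  · simp [stressOf_stressTest, unitStress, ite_and, hsymm i j, mul_comm]
  · set g := zeroExt (G := G) (f.restrict (closure G.cell)) with hgdef
    have hgm : Measurable g := measurable_zeroExt _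
    have hg0 : ∀ x, 0 ≤ g x := zeroExt_nonneg fun x => hf x
    obtain ⟨hi, hsq⟩ := integral_mul_sq_sum_div hk hgm (hgb _) ξ
    have hpos' : 0 ≤ sint (∑ i, ∑ j, (ξ i * ξ j) • R i j) g :=
      sint_nonneg (fun B hB => by simpa using hpos ξ B hB) hg0
    simp only [sint_sum_measure _ hgm (hgb _), sint_smul_measure] at hpos'
    rw [stressOf_stressTest]
    simp only [squareStress, zero_mul, add_zero, ← hgdef, sint_add_measure hgm (hgb _),
      sint_withDensityᵥ (hk _ _) hgm (hgb _), mul_add, sum_add_distrib, ← hsq]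
    refine le_trans ?_ (le_add_of_nonneg_right hpos')
    have hsum : Integrable (fun x => ∑ i, ξ i * m x i) G.vol :=
      integrable_finsetSum _ fun i _ => (hmi i).const_mul _
    refine integral_mono_ae (integrable_kin_affine f.continuous.measurable hfb hsum hρi hα hαb)
      (integrable_weight_mul hgm (hgb _) hi) ?_
    filter_upwards [hg f, hρ, hvac] with x h1 (h2 : 0 ≤ ρ x) h3
    rw [h1]
    refine mul_le_mul_of_nonneg_left ?_ (hg0 x)
    -- on the vacuum both sides vanish; elsewhere this is `(ξ·m - α ρ)² ≥ 0`
    rcases h2.eq_or_lt with h4 | h4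
    · simp [← h4, h3 h4.symm]
    · rw [le_div_iff₀ h4]
      nlinarith [sq_nonneg ((∑ i, ξ i * m x i) - α x * ρ x)]
  · set g := zeroExt (G := G) (f.restrict (closure G.cell)) with hgdef
    have hgm : Measurable g := measurable_zeroExt _
    have hg0 : ∀ x, 0 ≤ g x := zeroExt_nonneg fun x => hf x
    rw [stressOf_stressTest]
    simp only [scalarStress, Pi.zero_apply, zero_mul, sum_const_zero, zero_add, one_mul,
      ← hgdef, sint_add_measure hgm (hgb _), sint_withDensityᵥ hp hgm (hgb _)]
    refine le_trans ?_ (le_add_of_nonneg_right (sint_nonneg hQ hg0))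
    refine integral_mono_ae
      (integrable_press_affine hγ.out f.continuous.measurable hfb hρi hs hs0 hsb)
      (integrable_weight_mul hgm (hgb _) hp) ?_
    filter_upwards [hg f, hρ] with x h1 h2
    rw [h1]
    exact mul_le_mul_of_nonneg_left (pressureTangent_le ha hγ.out (hs0 x) h2) (hg0 x)

end StressOf

/-! ### Bounded weights as functionals on Lebesgue spaces -/

section Weights

variable {α : Type*} [MeasurableSpace α] {μ : Measure α} [IsFiniteMeasure μ]
  {E : Type*} [NormedAddCommGroup E] [InnerProductSpace ℝ E] {p : ℝ≥0∞} [Fact (1 ≤ p)]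

/-- Essentially bounded measurable functions. -/
structure IsWeight (μ : Measure α) (b : α → E) : Prop where
  meas : AEStronglyMeasurable b μ
  bdd : ∃ c, ∀ᵐ x ∂μ, ‖b x‖ ≤ c

lemma norm_inner_le_mul {v b : E} {c : ℝ} (h : ‖b‖ ≤ c) : ‖inner ℝ v b‖ ≤ c * ‖v‖ :=
  (norm_inner_le_norm _ _).trans
    ((mul_comm _ _).trans_le (mul_le_mul_of_nonneg_right h (norm_nonneg _)))

lemma integrable_inner_weight {b : α → E} (hb : IsWeight μ b) {v : α → E} (hv : Integrable v μ) :
    Integrable (fun x => inner ℝ (v x) (b x)) μ :=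
  let ⟨c, hc⟩ := hb.bdd
  (hv.norm.const_mul c).mono' (hv.1.inner hb.meas) (hc.mono fun _ => norm_inner_le_mul)

lemma integral_norm_le_norm (v : Lp E p μ) :
    ∫ x, ‖v x‖ ∂μ ≤ (μ univ ^ (1 - 1 / p.toReal)).toReal * ‖v‖ := by
  have h1 := eLpNorm_le_eLpNorm_mul_rpow_measure_univ (μ := μ) (p := 1) (q := p) Fact.out
    (Lp.aestronglyMeasurable v)
  have hp0 : (0 : ℝ) ≤ 1 - 1 / p.toReal := by
    rcases eq_or_ne p ∞ with rfl | hp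
    · simp
    · have : 1 ≤ p.toReal := by
        have := (toReal_le_toReal ENNReal.one_ne_top hp).2 (Fact.out : 1 ≤ p)
        simpa using this
      rw [sub_nonneg, div_le_one (by linarith)]
      exact this
  have h2 : μ univ ^ (1 - 1 / p.toReal) ≠ ∞ := ENNReal.rpow_ne_top_of_nonneg hp0
    (measure_ne_top _ _)
  rw [integral_norm_eq_lintegral_enorm (Lp.aestronglyMeasurable v),
    ← eLpNorm_one_eq_lintegral_enorm,
    Lp.norm_def, mul_comm, ← toReal_mul]
  refine toReal_mono (ENNReal.mul_ne_top (Lp.eLpNorm_ne_top v) h2) ?_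
  simpa using h1

lemma abs_integral_inner_le {b : α → E} {c : ℝ} (hc0 : 0 ≤ c) (hc : ∀ᵐ x ∂μ, ‖b x‖ ≤ c)
    (v : Lp E p μ) : |∫ x, inner ℝ (v x) (b x) ∂μ|
      ≤ c * (μ univ ^ (1 - 1 / p.toReal)).toReal * ‖v‖ := by
  refine (norm_integral_le_of_norm_le (((Lp.memLp v).integrable Fact.out).norm.const_mul c)
    (hc.mono fun _ => norm_inner_le_mul)).trans ?_
  rw [integral_const_mul, mul_assoc]
  exact mul_le_mul_of_nonneg_left (integral_norm_le_norm v) hc0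

/-- The functional `v ↦ ∫ v · b`. -/
def weightFunctional {b : α → E} (hb : IsWeight μ b) : StrongDual ℝ (Lp E p μ) :=
  LinearMap.mkContinuousOfExistsBound
    { toFun := fun v => ∫ x, inner ℝ (v x) (b x) ∂μ
      map_add' := fun v w => by
        rw [← integral_add (integrable_inner_weight hb ((Lp.memLp v).integrable Fact.out))
          (integrable_inner_weight hb ((Lp.memLp w).integrable Fact.out))]
        refine integral_congr_ae ?_
        filter_upwards [Lp.coeFn_add v w] with x hx
        rw [hx, Pi.add_apply, inner_add_left]
      map_smul' := fun c v => by
        rw [RingHom.id_apply, smul_eq_mul, ← integral_const_mul]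
        refine integral_congr_ae ?_
        filter_upwards [Lp.coeFn_smul c v] with x hx
        rw [hx, Pi.smul_apply, real_inner_smul_left] }
    (let ⟨c, hc⟩ := hb.bdd
    ⟨_, abs_integral_inner_le (abs_nonneg c) (hc.mono fun _ h => h.trans (le_abs_self c))⟩)

lemma weightFunctional_apply {b : α → E} (hb : IsWeight μ b) (v : Lp E p μ) :
    weightFunctional hb v = ∫ x, inner ℝ (v x) (b x) ∂μ := rfl

lemma isWeight_of_bounded {E' : Type*} [NormedAddCommGroup E'] [InnerProductSpace ℝ E']
    [MeasurableSpace E'] [BorelSpace E'] [SecondCountableTopology E'] {b : α → E'}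
    (hb : Measurable b) (hc : ∃ c, ∀ x, ‖b x‖ ≤ c) : IsWeight μ b :=
  ⟨hb.aestronglyMeasurable, hc.imp fun _ h => ae_of_all _ h⟩

end Weights

/-! ### States of finite energy -/

section States

variable {d : ℕ} {G : FluidDomain d} {a γ : ℝ} [hγ : Fact (1 < γ)]
  {ρ : DensSpace G γ} {m : MomSpace G γ}

lemma measurable_dens (ρ : DensSpace G γ) : Measurable ρ := (Lp.stronglyMeasurable ρ).measurable

lemma measurable_mom (m : MomSpace G γ) (i : Fin d) : Measurable fun x => m x i :=
  (measurable_pi_apply i).comp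
    ((PiLp.continuous_ofLp 2 _).measurable.comp (Lp.stronglyMeasurable m).measurable)

lemma sum_single_mul (w : Space d) (i : Fin d) : ∑ j, (Pi.single i (1 : ℝ) : Fin d → ℝ) j * w j
    = w i := by
  simp [Pi.single_apply]

lemma squareStress_single (i : Fin d) :
    squareStress (Pi.single i (1 : ℝ) : Fin d → ℝ) = unitStress i i := by
  ext <;> simp [unitStress, squareStress, Pi.single_apply, ite_and]
  split_ifs <;> simp

lemma energyDensity_eq {r : ℝ} (w : Space d) :
    energyDensity a γ r w = 2⁻¹ * ∑ i, kin r (w i)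
      + ofReal (1 / (γ - 1)) * ofReal (pressure a γ r) := by
  have hγ1 := sub_pos.2 hγ.out
  unfold energyDensity
  congr 1
  · have h1 : ‖w‖ₑ ^ 2 = ∑ i, ofReal (w i ^ 2) := by
      rw [← ofReal_sum_of_nonneg fun i _ => sq_nonneg _, ← ofReal_norm,
        ← ENNReal.ofReal_pow (norm_nonneg _), EuclideanSpace.real_norm_sq_eq]
    rw [h1, ENNReal.div_eq_inv_mul, ENNReal.mul_inv (by simp) (by simp), mul_assoc, mul_sum]
    congr 1
    exact sum_congr rfl fun i _ => by rw [kin, ENNReal.div_eq_inv_mul]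
  · rw [← ofReal_mul (by positivity)]
    congr 1
    simp only [potential, pressure]
    ring

lemma measurable_kin {α : Type*} [MeasurableSpace α] {r g : α → ℝ} (hr : Measurable r)
    (hg : Measurable g) : Measurable fun x => kin (r x) (g x) := by
  unfold kin
  fun_prop

lemma measurable_pressure {α : Type*} [MeasurableSpace α] {r : α → ℝ} (hr : Measurable r) :
    Measurable fun x => pressure a γ (r x) := by
  unfold pressure
  fun_prop

lemma fluidEnergy_eq (a : ℝ) (ρ : DensSpace G γ) (m : MomSpace G γ) :
    fluidEnergy G a γ ρ m = 2⁻¹ * ∑ i, ∫⁻ x, kin (ρ x) (m x i) ∂G.vol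
      + ofReal (1 / (γ - 1)) * ∫⁻ x, ofReal (pressure a γ (ρ x)) ∂G.vol := by
  have h1 : fluidEnergy G a γ ρ m = ∫⁻ x, (2⁻¹ * ∑ i, kin (ρ x) (m x i)
      + ofReal (1 / (γ - 1)) * ofReal (pressure a γ (ρ x))) ∂G.vol := by
    refine lintegral_congr_ae ?_
    exact ae_of_all _ fun x => energyDensity_eq _
  have h2 : ∀ i, Measurable fun x => kin (ρ x) (m x i) := fun i =>
    measurable_kin (measurable_dens ρ) (measurable_mom m i)
  rw [h1, lintegral_add_left ((Finset.measurable_sum _ fun i _ => h2 i).const_mul _),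
    lintegral_const_mul _ (Finset.measurable_sum _ fun i _ => h2 i),
    lintegral_finsetSum _ fun i _ => h2 i,
    lintegral_const_mul _ (measurable_pressure (measurable_dens ρ)).ennreal_ofReal]

lemma lintegral_kin_lt_top
    (hE : fluidEnergy G a γ ρ m < ∞) (i : Fin d) :
    ∫⁻ x, kin (ρ x) (m x i) ∂G.vol < ∞ := by
  rw [fluidEnergy_eq, ENNReal.add_lt_top] at hE
  have h1 := ENNReal.lt_top_of_mul_ne_top_right hE.1.ne (by simp)
  exact (single_le_sum (f := fun i => ∫⁻ x, kin (ρ x) (m x i) ∂G.vol)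
    (fun _ _ => zero_le) (Finset.mem_univ i)).trans_lt h1

lemma eq_zero_of_kin_lt_top {g : ℝ} (h : kin 0 g < ∞) : g = 0 := by
  by_contra hg
  have : ofReal (g ^ 2) ≠ 0 := by
    rw [Ne, ofReal_eq_zero, not_le]; positivity
  rw [kin, ofReal_zero, ENNReal.div_zero this] at h
  exact lt_irrefl _ h

lemma kin_eq_ofReal {r g : ℝ} (hr : 0 ≤ r) (h : r = 0 → g = 0) :
    kin r g = ofReal (g ^ 2 / r) := by
  rcases hr.eq_or_lt with h0 | h0
  · rw [h h0.symm, ← h0]; simp [kin]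
  · exact kin_of_pos h0

lemma ae_vacuum_of_kin
    (hk : ∀ i, ∫⁻ x, kin (ρ x) (m x i) ∂G.vol < ∞) : ∀ᵐ x ∂G.vol, ρ x = 0 → m x = 0 := by
  have h1 : ∀ᵐ x ∂G.vol, ∀ i, kin (ρ x) (m x i) < ∞ := ae_all_iff.2 fun i =>
    ae_lt_top (measurable_kin (measurable_dens ρ) (measurable_mom m i)) (hk i).ne
  filter_upwards [h1] with x hx h0
  ext i
  exact eq_zero_of_kin_lt_top (h0 ▸ hx i)

lemma abs_mul_div_le (x y : ℝ) {r : ℝ} (hr : 0 ≤ r) : |x * y / r| ≤ x * x / r + y * y / r := by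
  rw [abs_div, abs_of_nonneg hr, ← add_div, abs_mul]
  refine div_le_div_of_nonneg_right ?_ hr
  nlinarith [abs_mul_abs_self x, abs_mul_abs_self y, sq_nonneg (|x| - |y|), sq_nonneg x,
    sq_nonneg y]

lemma integrable_flux (hρ : 0 ≤ᵐ[G.vol] ρ)
    (hk : ∀ i, ∫⁻ x, kin (ρ x) (m x i) ∂G.vol < ∞) (i j : Fin d) :
    Integrable (fun x => m x i * m x j / ρ x) G.vol := by
  have hdiag : ∀ i, Integrable (fun x => m x i ^ 2 / ρ x) G.vol := fun i => by
    refine ⟨(((measurable_mom m i).pow_const 2).div (measurable_dens ρ)).aestronglyMeasurable, ?_⟩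
    refine lt_of_le_of_lt (lintegral_mono_ae ?_) (hk i)
    filter_upwards [hρ, ae_vacuum_of_kin hk] with x hx hv
    rw [kin_eq_ofReal hx fun h => by rw [hv h]; rfl,
      Real.enorm_of_nonneg (div_nonneg (sq_nonneg _) hx)]
  refine ((hdiag i).add (hdiag j)).mono'
    (((measurable_mom m i).mul (measurable_mom m j)).div (measurable_dens ρ)).aestronglyMeasurable ?_
  filter_upwards [hρ] with x hx
  simpa only [Pi.add_apply, sq, norm_eq_abs] using abs_mul_div_le (m x i) (m x j) hx

lemma integral_flux_nonneg (hρ : 0 ≤ᵐ[G.vol] ρ) (i : Fin d) :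
    0 ≤ ∫ x, m x i * m x i / ρ x ∂G.vol :=
  integral_nonneg_of_ae (hρ.mono fun _ hx => div_nonneg (mul_self_nonneg _) hx)

lemma ae_pressure_nonneg (ha : 0 ≤ a) (hρ : 0 ≤ᵐ[G.vol] ρ) :
    ∀ᵐ x ∂G.vol, 0 ≤ pressure a γ (ρ x) :=
  hρ.mono fun _ hx => pressure_nonneg ha hx

lemma integral_pressure_nonneg (ha : 0 ≤ a) (hρ : 0 ≤ᵐ[G.vol] ρ) :
    0 ≤ ∫ x, pressure a γ (ρ x) ∂G.vol :=
  integral_nonneg_of_ae (ae_pressure_nonneg ha hρ)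

variable [CompactSpace (Hull G)]

lemma integrable_dens (ρ : DensSpace G γ) : Integrable (fun x => ρ x) G.vol :=
  (Lp.memLp ρ).integrable Fact.out

lemma integrable_mom (m : MomSpace G γ) (i : Fin d) : Integrable (fun x => m x i) G.vol :=
  ((Lp.memLp m).integrable Fact.out).eval_piLp i

lemma integrable_pressure (hρ : 0 ≤ᵐ[G.vol] ρ) :
    Integrable (fun x => pressure a γ (ρ x)) G.vol := by
  have h1 := (Lp.memLp ρ).integrable_norm_rpow
    (by simp [densExp]; linarith [hγ.out]) ofReal_ne_top
  rw [toReal_ofReal (by linarith [hγ.out])] at h1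
  refine (h1.const_mul a).congr ?_
  filter_upwards [hρ] with x hx
  rw [norm_of_nonneg hx, pressure]

/-- The energy in terms of the stress of the state. -/
lemma fluidEnergy_toReal (ha : 0 ≤ a)
    (hρ : 0 ≤ᵐ[G.vol] ρ) (hk : ∀ i, ∫⁻ x, kin (ρ x) (m x i) ∂G.vol < ∞) :
    (fluidEnergy G a γ ρ m).toReal = 1 / 2 * ∑ i, ∫ x, m x i * m x i / ρ x ∂G.vol
      + 1 / (γ - 1) * ∫ x, pressure a γ (ρ x) ∂G.vol ∧ fluidEnergy G a γ ρ m < ∞ := by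
  have hγ1 := sub_pos.2 hγ.out
  have h1 : ∀ i, ∫⁻ x, kin (ρ x) (m x i) ∂G.vol
      = ofReal (∫ x, m x i * m x i / ρ x ∂G.vol) := fun i => by
    rw [ofReal_integral_eq_lintegral_ofReal (integrable_flux hρ hk i i)]
    · refine lintegral_congr_ae ?_
      filter_upwards [hρ, ae_vacuum_of_kin hk] with x hx hv
      rw [kin_eq_ofReal hx fun h => by rw [hv h]; rfl, sq]
    · filter_upwards [hρ] with x hx using div_nonneg (mul_self_nonneg _) hx
  have h2 : ∫⁻ x, ofReal (pressure a γ (ρ x)) ∂G.vol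
      = ofReal (∫ x, pressure a γ (ρ x) ∂G.vol) := by
    rw [ofReal_integral_eq_lintegral_ofReal (integrable_pressure hρ) (ae_pressure_nonneg ha hρ)]
  have h0 := integral_flux_nonneg (m := m) hρ
  have h0' := integral_pressure_nonneg ha hρ
  have h3 : fluidEnergy G a γ ρ m = ofReal (1 / 2 * ∑ i, ∫ x, m x i * m x i / ρ x ∂G.vol
      + 1 / (γ - 1) * ∫ x, pressure a γ (ρ x) ∂G.vol) := by
    rw [fluidEnergy_eq, h2, ofReal_add
      (mul_nonneg (by norm_num) (sum_nonneg fun i _ => h0 i)) (by positivity),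
      ofReal_mul (by norm_num), ofReal_mul (by positivity),
      ofReal_sum_of_nonneg fun i _ => h0 i]
    simp_rw [h1]
    congr 2
    rw [one_div, ENNReal.ofReal_inv_of_pos two_pos]
    simp
  rw [h3]
  refine ⟨toReal_ofReal (add_nonneg
    (mul_nonneg (by norm_num) (sum_nonneg fun i _ => h0 i)) (by positivity)),
    ofReal_lt_top⟩

lemma integral_le_of_energy (ha : 0 ≤ a) (hρ : 0 ≤ᵐ[G.vol] ρ) {E₀ : ℝ} (hE₀ : 0 ≤ E₀)
    (hE : fluidEnergy G a γ ρ m ≤ ofReal E₀) : ∑ i, ∫ x, m x i * m x i / ρ x ∂G.vol ≤ 2 * E₀ ∧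
      ∫ x, pressure a γ (ρ x) ∂G.vol ≤ (γ - 1) * E₀ := by
  have hγ1 := sub_pos.2 hγ.out
  have h2 := toReal_le_of_le_ofReal hE₀ hE
  rw [(fluidEnergy_toReal ha hρ (lintegral_kin_lt_top (hE.trans_lt ofReal_lt_top))).1] at h2
  have h0 := sum_nonneg fun i (_ : i ∈ Finset.univ) => integral_flux_nonneg (m := m) hρ i
  have h3 := mul_nonneg (one_div_pos.2 hγ1).le (integral_pressure_nonneg ha hρ)
  refine ⟨by linarith, ?_⟩
  rw [← inv_mul_le_iff₀ hγ1, ← one_div]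
  linarith

/-- The state `[ρ, m]` is bounded by its energy; the momentum by Young's inequality
`|m|^q ≤ |m|²/ρ + ρ^γ`, `q = 2γ/(γ+1)`. -/
lemma norm_rpow_le_of_energy (ha : 0 < a)
    (hρ : 0 ≤ᵐ[G.vol] ρ) {E₀ : ℝ} (hE₀ : 0 ≤ E₀) (hE : fluidEnergy G a γ ρ m ≤ ofReal E₀) :
    ‖ρ‖ ≤ ((γ - 1) / a * E₀) ^ (1 / γ) ∧
      ‖m‖ ≤ (2 * E₀ + (γ - 1) / a * E₀) ^ (1 / (2 * γ / (γ + 1))) := by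
  have hγ1 := sub_pos.2 hγ.out
  have hγ0 : 0 < γ := by linarith
  have hq0 : 0 < 2 * γ / (γ + 1) := by positivity
  have hk := lintegral_kin_lt_top (hE.trans_lt ofReal_lt_top)
  obtain ⟨hK, hP⟩ := integral_le_of_energy ha.le hρ hE₀ hE
  have hργ : ∫ x, ‖ρ x‖ ^ γ ∂G.vol ≤ (γ - 1) / a * E₀ := by
    have : ∫ x, pressure a γ (ρ x) ∂G.vol = a * ∫ x, ‖ρ x‖ ^ γ ∂G.vol := by
      rw [← integral_const_mul]
      refine integral_congr_ae ?_
      filter_upwards [hρ] with x hx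
      rw [norm_of_nonneg hx, pressure]
    rw [this] at hP
    rw [div_mul_eq_mul_div, le_div_iff₀ ha]
    linarith
  have hρi : Integrable (fun x => ‖ρ x‖ ^ γ) G.vol := by
    have h1 := (Lp.memLp ρ).integrable_norm_rpow
      (by simp [densExp]; linarith) ofReal_ne_top
    rwa [toReal_ofReal hγ0.le] at h1
  have hnorm : ∀ {E : Type} [NormedAddCommGroup E] {r : ℝ} (hr : 0 < r)
      [Fact (1 ≤ ofReal r)] (v : Lp E (ofReal r) G.vol) {c : ℝ},
      ∫ x, ‖v x‖ ^ r ∂G.vol ≤ c → ‖v‖ ≤ c ^ (1 / r) := by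
    intro E _ r hr _ v c hc
    rw [Lp.norm_def, (Lp.memLp v).eLpNorm_eq_integral_rpow_norm (by simpa using hr)
      ofReal_ne_top, toReal_ofReal hr.le,
      toReal_ofReal (by positivity), one_div]
    exact rpow_le_rpow (integral_nonneg fun _ => by positivity) hc (by positivity)
  refine ⟨hnorm hγ0 ρ hργ, hnorm hq0 m ?_⟩
  have hmi : Integrable (fun x => ‖m x‖ ^ (2 * γ / (γ + 1))) G.vol := by
    have h1 := (Lp.memLp m).integrable_norm_rpow
      (by simpa [momExp] using hq0) ofReal_ne_top
    rwa [toReal_ofReal hq0.le] at h1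
  have hs : Integrable (fun x => ∑ i, m x i * m x i / ρ x) G.vol :=
    integrable_finsetSum _ fun i _ => integrable_flux hρ hk i i
  calc ∫ x, ‖m x‖ ^ (2 * γ / (γ + 1)) ∂G.vol
      ≤ ∫ x, (∑ i, m x i * m x i / ρ x + ‖ρ x‖ ^ γ) ∂G.vol := by
        refine integral_mono_ae hmi (hs.add hρi) ?_
        filter_upwards [hρ, ae_vacuum_of_kin hk] with x hx hv
        have hx' : 0 ≤ ρ x := hx
        rcases hx'.eq_or_lt with h4 | h4
        · rw [hv h4.symm, norm_zero, zero_rpow hq0.ne', ← h4]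
          simp [zero_rpow hγ0.ne']
        · have h5 : ∑ i, m x i * m x i / ρ x = ‖m x‖ ^ 2 / ρ x := by
            rw [← sum_div, EuclideanSpace.real_norm_sq_eq]
            simp_rw [sq]
          rw [h5, norm_of_nonneg hx']
          -- Young's inequality with the exponents `(γ+1)/γ` and `γ+1`
          have hpq : ((γ + 1) / γ).HolderConjugate (γ + 1) := by
            rw [Real.holderConjugate_iff]
            refine ⟨by rw [lt_div_iff₀ hγ0]; linarith, by field_simp⟩
          have h6 := Real.young_inequality_of_nonneg
            (a := (‖m x‖ ^ 2 / ρ x) ^ (γ / (γ + 1))) (b := ρ x ^ (γ / (γ + 1))) (by positivity)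
            (by positivity) hpq
          rw [← Real.mul_rpow (by positivity) hx', div_mul_cancel₀ _ h4.ne', ← rpow_mul
            (by positivity), ← rpow_mul hx', ← Real.rpow_natCast, ← rpow_mul (norm_nonneg _)]
            at h6
          have e1 : ((2 : ℕ) : ℝ) * (γ / (γ + 1)) = 2 * γ / (γ + 1) := by push_cast; ring
          have e2 : γ / (γ + 1) * ((γ + 1) / γ) = 1 := by field_simp
          have e3 : γ / (γ + 1) * (γ + 1) = γ := by field_simp
          rw [e1, e2, e3, Real.rpow_one, Real.rpow_natCast] at h6
          refine h6.trans (add_le_add ?_ ?_)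
          · exact div_le_self (by positivity) (by rw [le_div_iff₀ hγ0]; linarith)
          · exact div_le_self (by positivity) (by linarith)
    _ ≤ 2 * E₀ + (γ - 1) / a * E₀ := by
        rw [integral_add hs hρi, integral_finsetSum _ fun i _ => integrable_flux hρ hk i i]
        exact add_le_add hK hργ

end States

/-! ### Measurability in time -/

section TimeMeasurability

lemma ae_mem_Icc (T : ℝ) : ∀ᵐ t ∂dt[T], t ∈ Icc 0 T :=
  (ae_restrict_mem measurableSet_Ioo).mono fun _ ht => Ioo_subset_Icc_self ht

lemma ae_mem_uIoc {T : ℝ} {p : ℝ → Prop} (h : ∀ᵐ t ∂dt[T], p t) {s τ : ℝ} (hs : s ∈ Icc 0 T)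
    (hτ : τ ∈ Icc 0 T) : ∀ᵐ t, t ∈ uIoc s τ → p t := by
  rw [restrict_Ioo_eq_restrict_Ioc, ae_restrict_iff' measurableSet_Ioc] at h
  exact h.mono fun t ht hI => ht ⟨(le_min hs.1 hτ.1).trans_lt hI.1, hI.2.trans (max_le hs.2 hτ.2)⟩

lemma aemeasurable_of_isClosed_le {T : ℝ} {F : ℝ → ℝ≥0∞}
    (h : ∀ C, IsClosed {t | t ∈ Icc 0 T ∧ F t ≤ C}) :
    AEMeasurable F dt[T] := by
  have hm : Measurable ((Icc 0 T).indicator F) := by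
    refine measurable_of_Iic fun C => ?_
    have : (Icc 0 T).indicator F ⁻¹' Iic C = (Icc 0 T)ᶜ ∪ {t | t ∈ Icc 0 T ∧ F t ≤ C} := by
      ext t
      by_cases ht : t ∈ Icc 0 T
      · simp [ht, ht.1, ht.2]
      · simp [ht]
    rw [this]
    exact measurableSet_Icc.compl.union (h C).measurableSet
  refine hm.aemeasurable.congr ?_
  filter_upwards [ae_mem_Icc T] with t ht using indicator_of_mem ht F

lemma aemeasurable_apply_curve {Ω Y : Type*} [TopologicalSpace Ω] [MeasurableSpace Ω]
    [OpensMeasurableSpace Ω] [SecondCountableTopology Ω] {P : Measure Ω}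
    [NormedAddCommGroup Y] [NormedSpace ℝ Y] {Λ : Ω → StrongDual ℝ Y}
    (hΛ : ∀ y, AEMeasurable (fun t => Λ t y) P) {F : Ω → Y} (hF : Continuous F) :
    AEMeasurable (fun t => Λ t (F t)) P := by
  have hs : StronglyMeasurable F := hF.stronglyMeasurable
  refine aemeasurable_of_tendsto_metrizable_ae atTop (f := fun n t => Λ t (hs.approx n t))
    (fun n => ?_) (ae_of_all _ fun t => ((Λ t).continuous.tendsto _).comp (hs.tendsto_approx t))
  have h1 : (fun t => Λ t (hs.approx n t))
      = fun t => ∑ y ∈ (hs.approx n).range, (hs.approx n ⁻¹' {y}).indicator (fun t => Λ t y) t := by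
    funext t
    rw [sum_eq_single (hs.approx n t) (fun y _ hy => indicator_of_notMem (fun h => hy h.symm) _)
      fun h => absurd ((hs.approx n).mem_range_self t) h]
    exact (indicator_of_mem (s := hs.approx n ⁻¹' {hs.approx n t}) (a := t) rfl
      fun t' => Λ t' (hs.approx n t)).symm
  rw [h1]
  exact aemeasurable_fun_sum _ fun y _ =>
    (hΛ y).indicator ((hs.approx n).measurableSet_preimage _)

lemma continuousOn_primitive_of_integrableOn {T : ℝ} (hT : 0 ≤ T) {f : ℝ → ℝ}
    (hf : IntegrableOn f (Ioo 0 T)) : ContinuousOn (fun τ => ∫ t in (0 : ℝ)..τ, f t) (Icc 0 T) := by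
  have h1 := continuousOn_primitive_interval (μ := volume)
    (f := f) (a := 0) (b := T) (by
      rwa [uIcc_of_le hT, integrableOn_Icc_iff_integrableOn_Ioo])
  rwa [uIcc_of_le hT] at h1

lemma intervalIntegrable_of_integrableOn_Ioo {T : ℝ} {f : ℝ → ℝ} (hf : IntegrableOn f (Ioo 0 T))
    {τ : ℝ} (hτ : τ ∈ Icc 0 T) : IntervalIntegrable f volume 0 τ := by
  rw [intervalIntegrable_iff_integrableOn_Ioo_of_le hτ.1]
  exact hf.mono_set (Ioo_subset_Ioo_right hτ.2)

lemma integrableOn_apply_of_bounded {T C : ℝ} {Y : Type*} [NormedAddCommGroup Y] [NormedSpace ℝ Y]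
    {Λ : ℝ → StrongDual ℝ Y} (hΛ : ∀ y, AEMeasurable (fun t => Λ t y) dt[T])
    (hC : ∀ᵐ t ∂dt[T], ‖Λ t‖ ≤ C) {F : ℝ → Y} (hF : Continuous F) :
    IntegrableOn (fun t => Λ t (F t)) (Ioo 0 T) := by
  obtain ⟨K, hK⟩ := (isCompact_Icc (a := (0 : ℝ)) (b := T)).exists_bound_of_continuousOn
    hF.continuousOn
  refine Integrable.of_bound (aemeasurable_apply_curve hΛ hF).aestronglyMeasurable (C * K) ?_
  filter_upwards [hC, ae_mem_Icc T] with t ht htT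
  refine ((Λ t).le_opNorm _).trans ?_
  exact mul_le_mul ht (hK t htT) (norm_nonneg _) ((norm_nonneg _).trans ht)

variable {d : ℕ} {G : FluidDomain d} {γ T : ℝ} [hγ : Fact (1 < γ)] [CompactSpace (Hull G)]

/-- The tangents to the kinetic energy density give functionals linear in the state. -/
lemma exists_convective_functional {f : Space d → ℝ} (hf : Measurable f)
    (hfb : ∃ c, ∀ x, |f x| ≤ c) (ξ : Fin d → ℝ) {α : Space d → ℝ} (hαm : Measurable α)
    (hα : ∃ c, ∀ x, |α x| ≤ c) :
    ∃ (ℓ : StrongDual ℝ (MomSpace G γ)) (ℓ' : StrongDual ℝ (DensSpace G γ)), ∀ ρ m,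
      ∫ x, f x * (2 * α x * (∑ i, ξ i * m x i) - α x ^ 2 * ρ x) ∂G.vol = ℓ m - ℓ' ρ := by
  obtain ⟨cα, hcα⟩ := hα
  obtain ⟨c, hc⟩ := hfb
  have hb1 : ∀ x, |f x * (2 * α x)| ≤ c * (2 * cα) := fun x => by
    rw [abs_mul, abs_mul, abs_two]
    have := hcα x
    have := hc x
    have := abs_nonneg (f x)
    gcongr
    linarith
  have hb2 : ∀ x, |f x * α x ^ 2| ≤ c * cα ^ 2 := fun x => by
    rw [abs_mul, abs_pow]
    have := hcα x
    have := hc x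
    have := abs_nonneg (f x)
    gcongr
    linarith
  have hm1 : Measurable fun x => f x * (2 * α x) := hf.mul (hαm.const_mul 2)
  have hm2 : Measurable fun x => f x * α x ^ 2 := hf.mul (hαm.pow_const 2)
  have hw : IsWeight G.vol fun x => (f x * (2 * α x)) • (WithLp.toLp 2 ξ : Space d) :=
    isWeight_of_bounded (hm1.smul_const _) ⟨c * (2 * cα) * ‖(WithLp.toLp 2 ξ : Space d)‖,
      fun x => by
      rw [norm_smul]; exact mul_le_mul_of_nonneg_right (hb1 x) (norm_nonneg _)⟩
  have hw' : IsWeight G.vol fun x => f x * α x ^ 2 := isWeight_of_bounded hm2 ⟨_, hb2⟩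
  refine ⟨weightFunctional hw, weightFunctional hw', fun ρ m => ?_⟩
  rw [weightFunctional_apply, weightFunctional_apply,
    ← integral_sub (integrable_inner_weight hw ((Lp.memLp m).integrable Fact.out))
    (integrable_inner_weight hw' (integrable_dens ρ))]
  refine integral_congr_ae (ae_of_all _ fun x => ?_)
  have e1 : inner ℝ (m x) ((f x * (2 * α x)) • (WithLp.toLp 2 ξ : Space d))
      = f x * (2 * α x) * ∑ i, ξ i * m x i := by
    rw [inner_smul_right, PiLp.inner_apply]
    rfl
  have e2 : inner ℝ (ρ x) (f x * α x ^ 2) = f x * α x ^ 2 * ρ x := rfl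
  simp only [e1, e2]
  ring

/-- The tangents to the pressure give functionals affine in the density. -/
lemma exists_pressure_functional (a : ℝ) {f : Space d → ℝ} (hf : Measurable f)
    (hfb : ∃ c, ∀ x, |f x| ≤ c) {s : Space d → ℝ} (hsm : Measurable s) (hs0 : ∀ x, 0 ≤ s x)
    (hs : ∃ c, ∀ x, s x ≤ c) :
    ∃ (C : ℝ) (ℓ : StrongDual ℝ (DensSpace G γ)), ∀ ρ,
      ∫ x, f x * pressureTangent a γ (s x) (ρ x) ∂G.vol = C + ℓ ρ := by
  obtain ⟨cs, hcs⟩ := hs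
  have hbm : Measurable fun x => f x * (a * γ * s x ^ (γ - 1)) :=
    hf.mul ((hsm.pow_const _).const_mul _)
  have hbb : ∃ c, ∀ x, |f x * (a * γ * s x ^ (γ - 1))| ≤ c := by
    obtain ⟨c, hc⟩ := hfb
    refine ⟨c * (|a * γ| * cs ^ (γ - 1)), fun x => ?_⟩
    rw [abs_mul, abs_mul (a * γ), abs_of_nonneg (rpow_nonneg (hs0 x) _)]
    have h2 := rpow_le_rpow (hs0 x) (hcs x) (by linarith [hγ.out] : 0 ≤ γ - 1)
    have h3 := rpow_nonneg (hs0 x) (γ - 1)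
    exact mul_le_mul (hc x) (mul_le_mul_of_nonneg_left h2 (abs_nonneg _)) (by positivity)
      ((abs_nonneg _).trans (hc x))
  have hw : IsWeight G.vol fun x => f x * (a * γ * s x ^ (γ - 1)) := isWeight_of_bounded hbm hbb
  refine ⟨∫ x, f x * pressureTangent a γ (s x) 0 ∂G.vol, weightFunctional hw, fun ρ => ?_⟩
  rw [weightFunctional_apply, ← integral_add
    (integrable_press_affine hγ.out hf hfb (r := fun _ => 0)
      (integrable_zero _ _ _) hsm hs0 ⟨cs, hcs⟩)
    (integrable_inner_weight hw (integrable_dens ρ))]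
  refine integral_congr_ae (ae_of_all _ fun x => ?_)
  have e2 : inner ℝ (ρ x) (f x * (a * γ * s x ^ (γ - 1))) = f x *
      (a * γ * s x ^ (γ - 1)) * ρ x := rfl
  simp only [pressureTangent, e2]
  ring

/-- The weighted kinetic energy along a weakly continuous trajectory is lower semicontinuous in
time, being a supremum of continuous functions. -/
lemma isClosed_kin_le (u : Trajectory G γ T) (hu : ∀ t ∈ Icc 0 T, 0 ≤ᵐ[G.vol] u.1.val t)
    {f : Space d → ℝ} (hf : Measurable f) (hfb : ∃ c, ∀ x, |f x| ≤ c) (hf0 : ∀ x, 0 ≤ f x)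
    (ξ : Fin d → ℝ) (C : ℝ≥0∞) :
    IsClosed {t | t ∈ Icc 0 T ∧
      ∫⁻ x, ofReal (f x) * kin (u.1.val t x) (∑ i, ξ i * u.2.val t x i) ∂G.vol ≤ C} := by
  have hsum : ∀ t, Measurable fun x => ∑ i, ξ i * u.2.val t x i := fun t =>
    Finset.measurable_fun_sum _ fun i _ => (measurable_mom _ i).const_mul _
  have hsumi : ∀ t, Integrable (fun x => ∑ i, ξ i * u.2.val t x i) G.vol := fun t =>
    integrable_finsetSum _ fun i _ => (integrable_mom _ i).const_mul _
  have h1 : {t | t ∈ Icc 0 T ∧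
      ∫⁻ x, ofReal (f x) * kin (u.1.val t x) (∑ i, ξ i * u.2.val t x i) ∂G.vol ≤ C}
      = Icc 0 T ∩ ⋂ (α : Space d → ℝ) (_ : Measurable α ∧ ∃ c, ∀ x, |α x| ≤ c), Icc 0 T ∩
        (fun t => ofReal (∫ x, f x * (2 * α x * (∑ i, ξ i * u.2.val t x i)
          - α x ^ 2 * u.1.val t x) ∂G.vol)) ⁻¹' Iic C := by
    ext t
    simp only [mem_ofPred_eq, mem_inter_iff, mem_iInter, mem_preimage, mem_Iic]
    refine and_congr_right fun ht => ⟨fun h α hα => ⟨ht, ?_⟩, fun h => ?_⟩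
    · exact (ofReal_integral_le_lintegral_kin (ae_of_all _ hf0) (hu t ht) α).trans h
    · exact lintegral_kin_le hf hfb (ae_of_all _ hf0) (hsum t) (measurable_dens _) (hsumi t)
        (integrable_dens _) (hu t ht) fun α hα hαb => (h α ⟨hα, hαb⟩).2
  -- each tangent is linear in the state, hence continuous in time
  rw [h1]
  refine isClosed_Icc.inter (isClosed_iInter fun α => isClosed_iInter fun hα => ?_)
  refine ContinuousOn.preimage_isClosed_of_isClosed ?_ isClosed_Icc isClosed_Iic
  refine ENNReal.continuous_ofReal.comp_continuousOn ?_
  obtain ⟨ℓ, ℓ', h⟩ := exists_convective_functional (G := G) (γ := γ) hf hfb ξ hα.1 hα.2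
  simp only [h]
  exact (continuous_val u.2 ℓ).sub (continuous_val u.1 ℓ')

lemma isClosed_pressure_le {a : ℝ} (ha : 0 ≤ a) (u : Trajectory G γ T)
    (hu : ∀ t ∈ Icc 0 T, 0 ≤ᵐ[G.vol] u.1.val t)
    {f : Space d → ℝ} (hf : Measurable f) (hfb : ∃ c, ∀ x, |f x| ≤ c) (hf0 : ∀ x, 0 ≤ f x)
    (C : ℝ≥0∞) : IsClosed {t | t ∈ Icc 0 T ∧
      ∫⁻ x, ofReal (f x * pressure a γ (u.1.val t x)) ∂G.vol ≤ C} := by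
  have h1 : {t | t ∈ Icc 0 T ∧
      ∫⁻ x, ofReal (f x * pressure a γ (u.1.val t x)) ∂G.vol ≤ C}
      = Icc 0 T ∩ ⋂ (s : Space d → ℝ) (_ : Measurable s ∧ (∀ x, 0 ≤ s x) ∧ ∃ c, ∀ x, s x ≤ c),
        Icc 0 T ∩ (fun t => ofReal
          (∫ x, f x * pressureTangent a γ (s x) (u.1.val t x) ∂G.vol)) ⁻¹' Iic C := by
    ext t
    simp only [mem_ofPred_eq, mem_inter_iff, mem_iInter, mem_preimage, mem_Iic]
    refine and_congr_right fun ht => ⟨fun h s hs => ⟨ht, ?_⟩, fun h => ?_⟩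
    · exact (ofReal_integral_le_lintegral_pressure ha hγ.out (ae_of_all _ hf0) (hu t ht)
        hs.2.1).trans h
    · exact lintegral_pressure_le ha hγ.out hf hfb (ae_of_all _ hf0) (measurable_dens _)
        (integrable_dens _) (hu t ht) fun s hs hs0 hsb => (h s ⟨hs, hs0, hsb⟩).2
  rw [h1]
  refine isClosed_Icc.inter (isClosed_iInter fun s => isClosed_iInter fun hs => ?_)
  refine ContinuousOn.preimage_isClosed_of_isClosed ?_ isClosed_Icc isClosed_Iic
  refine ENNReal.continuous_ofReal.comp_continuousOn ?_
  obtain ⟨c, ℓ, h⟩ := exists_pressure_functional (G := G) (γ := γ) a hf hfb hs.1 hs.2.1 hs.2.2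
  simp only [h]
  exact continuousOn_const.add (continuous_val u.1 ℓ)

/-- The measures `m_i m_j / ρ dx`. -/
def flux (ρ : DensSpace G γ) (m : MomSpace G γ) (i j : Fin d) : SignedMeasure (Space d) :=
  G.vol.withDensityᵥ fun x => m x i * m x j / ρ x

/-- The measure `p(ρ) dx`. -/
def pressMeasure (a : ℝ) (ρ : DensSpace G γ) : SignedMeasure (Space d) :=
  G.vol.withDensityᵥ fun x => pressure a γ (ρ x)

lemma toReal_lintegral_kin {ρ : DensSpace G γ} {m : MomSpace G γ} (hρ : 0 ≤ᵐ[G.vol] ρ)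
    (hk : ∀ i, ∫⁻ x, kin (ρ x) (m x i) ∂G.vol < ∞) {f : Space d → ℝ} (hf : Measurable f)
    (hf0 : ∀ x, 0 ≤ f x) (ξ : Fin d → ℝ) :
    (∫⁻ x, ofReal (f x) * kin (ρ x) (∑ i, ξ i * m x i) ∂G.vol).toReal
      = ∫ x, f x * ((∑ i, ξ i * m x i) ^ 2 / ρ x) ∂G.vol := by
  rw [integral_eq_lintegral_of_nonneg_ae]
  · congr 1
    refine lintegral_congr_ae ?_
    filter_upwards [hρ, ae_vacuum_of_kin hk] with x hx hv
    rw [kin_eq_ofReal hx fun h => by simp [hv h], ofReal_mul (hf0 x)]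
  · filter_upwards [hρ] with x hx using mul_nonneg (hf0 x) (div_nonneg (sq_nonneg _) hx)
  · exact (hf.mul (((Finset.measurable_fun_sum _ fun i _ =>
      (measurable_mom m i).const_mul (ξ i)).pow_const 2).div
        (measurable_dens ρ))).aestronglyMeasurable

lemma exists_indicator_weight {X : Type*} [MeasurableSpace X] {B : Set X} (hB : MeasurableSet B) :
    ∃ f : X → ℝ, Measurable f ∧ (∀ x, 0 ≤ f x) ∧ (∃ c, ∀ x, |f x| ≤ c) ∧
      ∀ (μ : Measure X) (h : X → ℝ), ∫ x in B, h x ∂μ = ∫ x, f x * h x ∂μ := by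
  refine ⟨B.indicator fun _ => 1, measurable_const.indicator hB,
    indicator_nonneg fun _ _ => zero_le_one, ⟨1, fun x => ?_⟩, fun μ h => ?_⟩
  · by_cases hx : x ∈ B <;> simp [hx]
  · rw [← integral_indicator hB]
    congr with x
    by_cases hx : x ∈ B <;> simp [hx]

/-- The kinetic stress is weakly measurable, being a difference of lower semicontinuous functions
of time. -/
lemma aemeasurable_flux (u : Trajectory G γ T) (hu : ∀ t ∈ Icc 0 T, 0 ≤ᵐ[G.vol] u.1.val t)
    (hk : ∀ᵐ t ∂dt[T], ∀ i, ∫⁻ x, kin (u.1.val t x) (u.2.val t x i) ∂G.vol < ∞)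
    (i j : Fin d) {B : Set (Space d)} (hB : MeasurableSet B) :
    AEMeasurable (fun t => flux (u.1.val t) (u.2.val t) i j B) dt[T] := by
  obtain ⟨f, hf, hf0, hfb, hfB⟩ := exists_indicator_weight hB
  have hK : ∀ ξ : Fin d → ℝ, AEMeasurable (fun t => (∫⁻ x, ofReal (f x) *
      kin (u.1.val t x) (∑ i, ξ i * u.2.val t x i) ∂G.vol).toReal) dt[T] :=
    fun ξ => (aemeasurable_of_isClosed_le fun C =>
      isClosed_kin_le u hu hf hfb hf0 ξ C).ennreal_toReal
  let e : Fin d → Fin d → ℝ := fun i => Pi.single i 1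
  -- polarization of the quadratic form `|ξ·m|²/ρ`
  refine ((((hK (e i + e j)).sub (hK (e i))).sub (hK (e j))).const_mul (1 / 2)).congr ?_
  filter_upwards [hk, ae_mem_Icc T] with t hkt ht
  have hρ := hu t ht
  have hint := integrable_flux hρ hkt
  have hintf : ∀ i j, Integrable
      (fun x => f x * (u.2.val t x i * u.2.val t x j / u.1.val t x)) G.vol :=
    fun i j => integrable_weight_mul hf hfb (hint i j)
  change 1 / 2 * ((∫⁻ x, ofReal (f x) *
      kin (u.1.val t x) (∑ k, (e i + e j) k * u.2.val t x k) ∂G.vol).toReal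
    - (∫⁻ x, ofReal (f x) * kin (u.1.val t x) (∑ k, e i k * u.2.val t x k) ∂G.vol).toReal
    - (∫⁻ x, ofReal (f x) *
      kin (u.1.val t x) (∑ k, e j k * u.2.val t x k) ∂G.vol).toReal) = _
  rw [toReal_lintegral_kin hρ hkt hf hf0, toReal_lintegral_kin hρ hkt hf hf0,
    toReal_lintegral_kin hρ hkt hf hf0]
  have e1 : ∀ x, ∑ k, (e i + e j) k * u.2.val t x k = u.2.val t x i + u.2.val t x j := fun x => by
    simp only [Pi.add_apply, add_mul, sum_add_distrib]
    rw [sum_single_mul, sum_single_mul]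
  have e2 : ∀ i x, ∑ k, e i k * u.2.val t x k = u.2.val t x i := fun i x => sum_single_mul _ i
  simp only [e1, e2]
  have e3 : ∀ x, f x * ((u.2.val t x i + u.2.val t x j) ^ 2 / u.1.val t x)
      = f x * (u.2.val t x i * u.2.val t x i / u.1.val t x)
        + f x * (u.2.val t x j * u.2.val t x j / u.1.val t x)
        + 2 * (f x * (u.2.val t x i * u.2.val t x j / u.1.val t x)) := fun x => by ring
  simp_rw [e3]
  have hadd : Integrable (fun x => f x * (u.2.val t x i * u.2.val t x i / u.1.val t x)
      + f x * (u.2.val t x j * u.2.val t x j / u.1.val t x)) G.vol := (hintf i i).add (hintf j j)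
  rw [integral_add hadd ((hintf i j).const_mul 2),
    integral_add (hintf i i) (hintf j j), integral_const_mul]
  simp_rw [sq]
  rw [flux, withDensityᵥ_apply (hint i j) hB, hfB]
  ring

lemma aemeasurable_pressMeasure {a : ℝ} (ha : 0 ≤ a) (u : Trajectory G γ T)
    (hu : ∀ t ∈ Icc 0 T, 0 ≤ᵐ[G.vol] u.1.val t) {B : Set (Space d)} (hB : MeasurableSet B) :
    AEMeasurable (fun t => pressMeasure a (u.1.val t) B) dt[T] := by
  obtain ⟨f, hf, hf0, hfb, hfB⟩ := exists_indicator_weight hB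
  refine (aemeasurable_of_isClosed_le fun C =>
      isClosed_pressure_le ha u hu hf hfb hf0 C).ennreal_toReal.congr ?_
  filter_upwards [ae_mem_Icc T] with t ht
  have hρ := hu t ht
  rw [pressMeasure, withDensityᵥ_apply (integrable_pressure hρ) hB, hfB,
    ← integral_eq_lintegral_of_nonneg_ae]
  · filter_upwards [hρ] with x hx using mul_nonneg (hf0 x) (pressure_nonneg ha hx)
  · exact (hf.mul (measurable_pressure (measurable_dens _))).aestronglyMeasurable

lemma variation_withDensityᵥ_le {X : Type*} [MeasurableSpace X] {μ : Measure X} {h : X → ℝ}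
    (hh : Integrable h μ) : (μ.withDensityᵥ h).variation.real univ ≤ ∫ x, ‖h x‖ ∂μ := by
  have h1 : (μ.withDensityᵥ h).variation ≤ μ.withDensity fun x => ‖h x‖ₑ := by
    refine VectorMeasure.variation_le_of_forall_enorm_le fun B hB => ?_
    rw [withDensityᵥ_apply hh hB, withDensity_apply _ hB]
    exact enorm_integral_le_lintegral_enorm _
  rw [integral_norm_eq_lintegral_enorm hh.1, measureReal_def]
  refine toReal_mono hh.2.ne ((h1 univ).trans ?_)
  rw [withDensity_apply _ MeasurableSet.univ, Measure.restrict_univ]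

lemma variation_flux_le {a : ℝ} (ha : 0 ≤ a) {ρ : DensSpace G γ} {m : MomSpace G γ}
    (hρ : 0 ≤ᵐ[G.vol] ρ) {E₀ : ℝ} (hE₀ : 0 ≤ E₀) (hE : fluidEnergy G a γ ρ m ≤ ofReal E₀)
    (i j : Fin d) : (flux ρ m i j).variation.real univ ≤ 4 * E₀ := by
  have hk := integrable_flux hρ (lintegral_kin_lt_top (hE.trans_lt ofReal_lt_top))
  have h0s : ∀ i, ∫ x, m x i * m x i / ρ x ∂G.vol ≤ 2 * E₀ := fun i =>
    (single_le_sum (fun i _ => integral_flux_nonneg (m := m) hρ i) (Finset.mem_univ i)).trans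
      (integral_le_of_energy ha hρ hE₀ hE).1
  calc _ ≤ ∫ x, ‖m x i * m x j / ρ x‖ ∂G.vol := variation_withDensityᵥ_le (hk i j)
    _ ≤ ∫ x, (m x i * m x i / ρ x + m x j * m x j / ρ x) ∂G.vol :=
      integral_mono_ae (hk i j).norm ((hk i i).add (hk j j))
        (hρ.mono fun x hx => abs_mul_div_le (m x i) (m x j) hx)
    _ ≤ 4 * E₀ := by
      rw [integral_add (hk i i) (hk j j)]
      linarith [h0s i, h0s j]

lemma variation_pressMeasure_le {a : ℝ} (ha : 0 ≤ a) {ρ : DensSpace G γ} {m : MomSpace G γ}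
    (hρ : 0 ≤ᵐ[G.vol] ρ) {E₀ : ℝ} (hE₀ : 0 ≤ E₀) (hE : fluidEnergy G a γ ρ m ≤ ofReal E₀) :
    (pressMeasure a ρ).variation.real univ ≤ (γ - 1) * E₀ := by
  refine (variation_withDensityᵥ_le (integrable_pressure hρ)).trans (le_of_eq_of_le ?_
    (integral_le_of_energy ha hρ hE₀ hE).2)
  exact integral_congr_ae (hρ.mono fun x hx => norm_of_nonneg (pressure_nonneg ha hx))

end TimeMeasurability

/-! ### Time-dependent test functions -/

section TimeDependent

/-- An identity tested by time-independent functions extends to time-dependent ones. -/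
lemma eq_integral_of_static {Z Y : Type*} [NormedAddCommGroup Z] [NormedSpace ℝ Z]
    [NormedAddCommGroup Y] [NormedSpace ℝ Y] {T M C : ℝ} {W : ℝ → StrongDual ℝ Z}
    (hW : ∀ z, ContinuousOn (fun t => W t z) (Icc 0 T)) (hM : ∀ t ∈ Icc 0 T, ‖W t‖ ≤ M)
    {Λ : ℝ → StrongDual ℝ Y}
    (hΛ : ∀ y, AEMeasurable (fun t => Λ t y) dt[T])
    (hC : ∀ᵐ t ∂dt[T], ‖Λ t‖ ≤ C) {Φ Φ' : ℝ → Z}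
    (hΦ : ∀ t, HasDerivAt Φ (Φ' t) t) (hΦ' : Continuous Φ') {F : ℝ → Y} (hF : Continuous F)
    (hstat : ∀ s ∈ Ico 0 T, ∀ τ ∈ Icc 0 T, W τ (Φ s) - W 0 (Φ s) = ∫ t in (0 : ℝ)..τ, Λ t (F s))
    {τ : ℝ} (hτ : τ ∈ Icc 0 T) :
    IntervalIntegrable (fun t => W t (Φ' t)) volume 0 τ ∧
    IntervalIntegrable (fun t => Λ t (F t)) volume 0 τ ∧
    W τ (Φ τ) - W 0 (Φ 0) = ∫ t in (0 : ℝ)..τ, (W t (Φ' t) + Λ t (F t)) := by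
  have hT : 0 ≤ T := hτ.1.trans hτ.2
  have hjoint : ∀ {Ψ : ℝ → Z} {z : Z} {s : ℝ} {l : Filter ℝ}, s ∈ Icc 0 T → l ≤ 𝓝[Icc 0 T] s →
      Tendsto Ψ l (𝓝 z) → Tendsto (fun t => W t (Ψ t)) l (𝓝 (W s z)) := by
    intro Ψ z s l hs hl hΨ
    have h1 : Tendsto (fun t => W t z + W t (Ψ t - z)) l (𝓝 (W s z + 0)) := by
      refine ((hW z s hs).mono_left hl).add (squeeze_zero_norm' ?_
        (a := fun t => M * ‖Ψ t - z‖) ?_)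
      · filter_upwards [hl self_mem_nhdsWithin] with t ht
        exact ((W t).le_opNorm _).trans (mul_le_mul_of_nonneg_right (hM t ht) (norm_nonneg _))
      · simpa using (hΨ.sub_const z).norm.const_mul M
    simpa using h1
  have hcurve : ∀ {Ψ : ℝ → Z}, Continuous Ψ → ContinuousOn (fun t => W t (Ψ t)) (Icc 0 T) :=
    fun hΨ s hs => hjoint hs le_rfl hΨ.continuousWithinAt
  have hΦc : Continuous Φ := continuous_iff_continuousAt.2 fun t => (hΦ t).continuousAt
  have hWint : IntegrableOn (fun t => W t (Φ' t)) (Icc 0 T) :=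
    (hcurve hΦ').integrableOn_compact isCompact_Icc
  have hΛint : ∀ {Ψ : ℝ → Y}, Continuous Ψ → IntegrableOn (fun t => Λ t (Ψ t)) (Icc 0 T) :=
    fun hΨ => by
    rw [integrableOn_Icc_iff_integrableOn_Ioo]
    exact integrableOn_apply_of_bounded hΛ hC hΨ
  have hsub : ∀ {f : ℝ → ℝ}, IntegrableOn f (Icc 0 T) → ∀ t ∈ Icc 0 T,
      IntervalIntegrable f volume 0 t := fun hf t ht =>
    (intervalIntegrable_iff_integrableOn_Icc_of_le ht.1).2 (hf.mono_set (Icc_subset_Icc_right ht.2))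
  refine ⟨hsub hWint τ hτ, hsub (hΛint hF) τ hτ, ?_⟩
  -- the defect `D` in the identity is continuous with vanishing right derivative
  let D : ℝ → ℝ := fun τ => W τ (Φ τ) - W 0 (Φ 0) - ∫ t in (0 : ℝ)..τ, (W t (Φ' t) + Λ t (F t))
  have hDc : ContinuousOn D (Icc 0 T) :=
    ((hcurve hΦc).sub continuousOn_const).sub (continuousOn_primitive_of_integrableOn hT
      ((hWint.add (hΛint hF)).mono_set Ioo_subset_Icc_self))
  rw [restrict_Ioo_eq_restrict_Icc] at hC
  have hDd : ∀ s ∈ Ico 0 T, HasDerivWithinAt D 0 (Ici s) s := by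
    intro s hs
    have hsT : s ∈ Icc 0 T := Ico_subset_Icc_self hs
    have : Fact (s ∈ Icc 0 T) := ⟨hsT⟩
    have hFs := hΛint (Ψ := fun r => F r - F s) (by fun_prop)
    have d1 : HasDerivWithinAt (fun t => W t (Φ t - Φ s)) (W s (Φ' s)) (Icc 0 T) s := by
      rw [hasDerivWithinAt_iff_tendsto_slope]
      refine (hjoint hsT (nhdsWithin_mono _ sdiff_subset)
        (hasDerivWithinAt_iff_tendsto_slope.1 (hΦ s).hasDerivWithinAt)).congr fun t => ?_
      simp [slope_def_module]
    have d2 : HasDerivWithinAt (fun t => ∫ r in (0 : ℝ)..t, (W r (Φ' r) + Λ r (F r - F s)))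
        (W s (Φ' s) + 0) (Icc 0 T) s := by
      refine intervalIntegral.integral_hasDerivWithinAt_of_tendsto_ae_right (t := Icc 0 T)
        (hsub (hWint.add hFs) s hsT) ⟨Icc 0 T, self_mem_nhdsWithin, (hWint.add hFs).1⟩
        (((hcurve hΦ' s hsT).mono_left inf_le_left).add (squeeze_zero_norm'
          (a := fun r => C * ‖F r - F s‖) ?_ ?_))
      · filter_upwards [mem_inf_of_left self_mem_nhdsWithin,
          mem_inf_of_right ((ae_restrict_iff' measurableSet_Icc).1 hC)] with r hr hr'
        exact ((Λ r).le_opNorm _).trans (mul_le_mul_of_nonneg_right (hr' hr) (norm_nonneg _))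
      · have : Continuous fun r => C * ‖F r - F s‖ := by fun_prop
        have h0 := this.tendsto s
        rw [sub_self, norm_zero, mul_zero] at h0
        exact h0.mono_left (inf_le_left.trans nhdsWithin_le_nhds)
    have d3 := (d1.sub d2).add_const (W 0 (Φ s) - W 0 (Φ 0))
    rw [add_zero, sub_self] at d3
    refine (d3.congr_of_mem (fun t ht => ?_) hsT).mono_of_mem_nhdsWithin
      (mem_of_superset (Icc_mem_nhdsGE hs.2) (Icc_subset_Icc_left hs.1))
    -- by the static identity, `W t (Φ s)` is a constant plus the integral of `Λ r (F s)`
    have e1 := hstat s hs t ht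
    have e2 := intervalIntegral.integral_add (hsub (hWint.add hFs) t ht)
      (hsub (hΛint (Ψ := fun _ => F s) continuous_const) t ht)
    simp only [Pi.add_apply, map_sub, add_assoc, sub_add_cancel] at e2
    simp only [D, Pi.sub_apply, map_sub]
    linarith
  have hconst := constant_of_has_deriv_right_zero hDc hDd τ hτ
  rw [show D 0 = 0 by simp [D]] at hconst
  exact sub_eq_zero.1 hconst

end TimeDependent

/-! ### The stress functional of a dissipative solution -/

section StressFacts

variable {d : ℕ} {G : FluidDomain d}

lemma isWeight_of_continuous {E : Type*} [NormedAddCommGroup E] [SecondCountableTopology E]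
    [MeasurableSpace E] [BorelSpace E] [InnerProductSpace ℝ E]
    [CompactSpace (Hull G)] (hG : G.Admissible) {b : Space d → E} (hb : Continuous b) :
    IsWeight G.vol b := by
  obtain ⟨c, hc⟩ := (isCompact_iff_compactSpace.2
    (inferInstance : CompactSpace (Hull G))).exists_bound_of_continuousOn hb.continuousOn
  refine ⟨hb.aestronglyMeasurable, c, ?_⟩
  filter_upwards [ae_mem_cell hG] with x hx using hc x (subset_closure hx)

lemma integral_zeroExt_mul (hG : G.Admissible) {f : C(Hull G, ℝ)} {g : Space d → ℝ}
    (hfg : ∀ x (h : x ∈ closure G.cell), f ⟨x, h⟩ = g x) (h : Space d → ℝ) :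
    ∫ x, zeroExt f x * h x ∂G.vol = ∫ x, g x * h x ∂G.vol := by
  refine integral_congr_ae ?_
  filter_upwards [ae_mem_cell hG] with x hx
  rw [zeroExt_of_mem f (subset_closure hx), hfg]

/-- The signed measure vanishes outside the domain with its boundary. -/
def SupportedInCell (G : FluidDomain d) (s : SignedMeasure (Space d)) : Prop :=
  ∀ B, MeasurableSet B → Disjoint B G.closedCell → s B = 0

lemma sint_zeroExt {s : SignedMeasure (Space d)} (hs : SupportedInCell G s)
    {f : C(Hull G, ℝ)} {g : Space d → ℝ}
    (hfg : ∀ x (h : x ∈ closure G.cell), f ⟨x, h⟩ = g x) : sint s (zeroExt f) = sint s g := by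
  refine VectorMeasure.integral_congr_ae ?_
  have h0 : s.variation (closure G.cell)ᶜ = 0 :=
    (VectorMeasure.variation_apply_eq_zero isClosed_closure.measurableSet.compl).2
      fun t ht htm => hs t htm ((disjoint_compl_left.mono_left ht).mono_right
        closedCell_subset_hull)
  filter_upwards [compl_mem_ae_iff.2 h0] with x hx
  rw [compl_compl] at hx
  rw [zeroExt_of_mem f hx, hfg]

lemma sint_one (s : SignedMeasure (Space d)) : sint s (fun _ => 1) = s univ := by
  simp

lemma supportedInCell_toSignedMeasure {μ : Measure (Space d)} [IsFiniteMeasure μ]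
    (h : μ G.closedCellᶜ = 0) : SupportedInCell G μ.toSignedMeasure := by
  intro B hB hd
  rw [Measure.toSignedMeasure_apply_measurable hB, measureReal_def,
    measure_mono_null hd.subset_compl_right h, toReal_zero]

variable [CompactSpace (Hull G)]

lemma stressOf_add (A A' : Fin d → Fin d → SignedMeasure (Space d))
    (B B' : SignedMeasure (Space d)) (F : C(Hull G, Stress d)) :
    stressOf (fun i j => A i j + A' i j) (B + B') F = stressOf A B F + stressOf A' B' F := by
  have h1 : ∀ (s s' : SignedMeasure (Space d)) (f : C(Hull G, ℝ)),
      sint (s + s') (zeroExt f) = sint s (zeroExt f) + sint s' (zeroExt f) := fun s s' f =>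
    sint_add_measure (measurable_zeroExt f) ⟨_, abs_zeroExt_le f⟩
  simp only [stressOf_apply, h1, sum_add_distrib]
  ring

lemma aemeasurable_stressOf {Ω : Type*} [MeasurableSpace Ω] {P : Measure Ω}
    {A : Ω → Fin d → Fin d → SignedMeasure (Space d)} {B : Ω → SignedMeasure (Space d)}
    (hA : ∀ i j S, MeasurableSet S → AEMeasurable (fun t => A t i j S) P)
    (hB : ∀ S, MeasurableSet S → AEMeasurable (fun t => B t S) P) (F : C(Hull G, Stress d)) :
    AEMeasurable (fun t => stressOf (A t) (B t) F) P := by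
  simp only [stressOf_apply]
  refine AEMeasurable.add (aemeasurable_fun_sum _ fun i _ =>
    aemeasurable_fun_sum _ fun j _ => ?_) ?_
  · exact aemeasurable_sint (hA i j) (measurable_zeroExt _) ⟨_, abs_zeroExt_le _⟩
  · exact aemeasurable_sint hB (measurable_zeroExt _) ⟨_, abs_zeroExt_le _⟩

lemma stressOf_gradTest_defect {R : Fin d → Fin d → SignedMeasure (Space d)}
    {μ : Measure (Space d)} [IsFiniteMeasure μ] (hR : ∀ i j, SupportedInCell G (R i j))
    (hμ : μ G.closedCellᶜ = 0) {φ : Space d → Space d} (hφ : ContDiff ℝ 1 φ) :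
    stressOf R μ.toSignedMeasure (gradTest (G := G) hφ) = defectAction R μ φ := by
  rw [stressOf_apply, defectAction, sint_zeroExt (supportedInCell_toSignedMeasure hμ)
    (g := divg φ) fun x hx => rfl, sint_toSignedMeasure]
  congr 1
  refine sum_congr rfl fun i _ => sum_congr rfl fun j _ => ?_
  exact sint_zeroExt (hR i j) fun x hx => rfl

variable {γ : ℝ} [hγ : Fact (1 < γ)]

lemma stressOf_gradTest_state (hG : G.Admissible) {a : ℝ} {ρ : DensSpace G γ} {m : MomSpace G γ}
    (hρ : 0 ≤ᵐ[G.vol] ρ) (hk : ∀ i, ∫⁻ x, kin (ρ x) (m x i) ∂G.vol < ∞)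
    {φ : Space d → Space d} (hφ : ContDiff ℝ 1 φ) :
    Integrable (fun x => ∑ i, ∑ j, (m x i * m x j / ρ x) * grad φ x i j
      + pressure a γ (ρ x) * divg φ x) G.vol ∧
    stressOf (flux ρ m) (pressMeasure a ρ) (gradTest (G := G) hφ)
      = ∫ x, (∑ i, ∑ j, (m x i * m x j / ρ x) * grad φ x i j
        + pressure a γ (ρ x) * divg φ x) ∂G.vol := by
  have hw : ∀ {g h : Space d → ℝ}, Continuous g → Integrable h G.vol →
      Integrable (fun x => h x * g x) G.vol := by
    intro g h hg hh
    obtain ⟨h1, c, hc⟩ := isWeight_of_continuous hG hg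
    exact hh.mul_bdd h1 (c := c) hc
  have i1 : ∀ i j, Integrable (fun x => (m x i * m x j / ρ x) * grad φ x i j) G.vol := fun i j =>
    hw (continuous_grad hφ i j) (integrable_flux hρ hk i j)
  have i2 : Integrable (fun x => pressure a γ (ρ x) * divg φ x) G.vol :=
    hw (continuous_divg hφ) (integrable_pressure hρ)
  have i3 : Integrable (fun x => ∑ i, ∑ j, (m x i * m x j / ρ x) * grad φ x i j) G.vol :=
    integrable_finsetSum _ fun i _ => integrable_finsetSum _ fun j _ => i1 i j
  refine ⟨i3.add i2, ?_⟩
  rw [integral_add i3 i2, stressOf_apply]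
  congr 1
  · rw [integral_finsetSum _ fun i _ => integrable_finsetSum _ fun j _ => i1 i j]
    refine sum_congr rfl fun i _ => ?_
    rw [integral_finsetSum _ fun j _ => i1 i j]
    refine sum_congr rfl fun j _ => ?_
    rw [flux, sint_withDensityᵥ (integrable_flux hρ hk i j) (measurable_zeroExt _)
      ⟨_, abs_zeroExt_le _⟩, integral_zeroExt_mul hG (g := fun x => grad φ x i j) fun x hx => rfl]
    simp_rw [mul_comm]
  · rw [pressMeasure, sint_withDensityᵥ (integrable_pressure hρ) (measurable_zeroExt _)
      ⟨_, abs_zeroExt_le _⟩, integral_zeroExt_mul hG (g := divg φ) fun x hx => rfl]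
    simp_rw [mul_comm]

lemma stressOf_energy (A : Fin d → Fin d → SignedMeasure (Space d)) (B : SignedMeasure (Space d)) :
    stressOf A B (stressTest (G := G) (energyStress d γ) 1)
      = 1 / 2 * ∑ i, sint (A i i) (zeroExt (1 : C(Hull G, ℝ)))
        + 1 / (γ - 1) * sint B (zeroExt (1 : C(Hull G, ℝ))) := by
  rw [stressOf_stressTest]
  simp [energyStress, mul_sum]

/-- The total energy is the action of the stress functional on `(½ 𝕀, 1/(γ-1))`. -/
lemma stressOf_energy_eq_totalEnergy (hG : G.Admissible) {a : ℝ} (ha : 0 ≤ a)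
    {ρ : DensSpace G γ} {m : MomSpace G γ}
    (hρ : 0 ≤ᵐ[G.vol] ρ) (hk : ∀ i, ∫⁻ x, kin (ρ x) (m x i) ∂G.vol < ∞)
    {R : Fin d → Fin d → SignedMeasure (Space d)} {μ : Measure (Space d)} [IsFiniteMeasure μ]
    (hR : ∀ i j, SupportedInCell G (R i j))
    (hpos : ∀ ξ : Fin d → ℝ, ∀ B, MeasurableSet B → 0 ≤ ∑ i, ∑ j, ξ i * ξ j * R i j B)
    (hμ : μ G.closedCellᶜ = 0) :
    stressOf (fun i j => flux ρ m i j + R i j) (pressMeasure a ρ + μ.toSignedMeasure)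
      (stressTest (G := G) (energyStress d γ) 1) = (totalEnergy G a γ ρ m R μ).toReal := by
  have hγ1 := sub_pos.2 hγ.out
  obtain ⟨h1, h2⟩ := fluidEnergy_toReal ha hρ hk
  have hR0 : 0 ≤ ∑ i, R i i univ := sum_nonneg fun i _ => by
    simpa [Pi.single_apply] using hpos (Pi.single i 1) univ MeasurableSet.univ
  have e1 : ∀ {h : Space d → ℝ}, Integrable h G.vol →
      sint (G.vol.withDensityᵥ h) (zeroExt (1 : C(Hull G, ℝ))) = ∫ x, h x ∂G.vol := by
    intro h hh
    rw [sint_withDensityᵥ hh (measurable_zeroExt _) ⟨_, abs_zeroExt_le _⟩,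
      integral_zeroExt_mul hG (g := fun _ => 1) fun x hx => rfl]
    simp
  have e2 : ∀ {s : SignedMeasure (Space d)}, SupportedInCell G s →
      sint s (zeroExt (1 : C(Hull G, ℝ))) = s univ := by
    intro s hs
    rw [sint_zeroExt hs (g := fun _ => 1) fun x hx => rfl, sint_one]
  rw [stressOf_add, stressOf_energy, stressOf_energy, totalEnergy,
    toReal_add (ENNReal.add_ne_top.2 ⟨h2.ne, ofReal_ne_top⟩)
      (ENNReal.mul_ne_top ofReal_ne_top (measure_ne_top _ _)),
    toReal_add h2.ne ofReal_ne_top, h1, toReal_mul,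
    toReal_ofReal (by positivity), toReal_ofReal (by positivity)]
  simp only [e2 (hR _ _), e2 (supportedInCell_toSignedMeasure hμ), flux, pressMeasure,
    e1 (integrable_flux hρ hk _ _), e1 (integrable_pressure hρ)]
  rw [Measure.toSignedMeasure_apply_measurable MeasurableSet.univ, measureReal_def]
  ring

end StressFacts

/-! ### Essential one-sided limits -/

section EssentialLimits

lemma neBot_inf_ae {l : Filter ℝ} (h : ∀ U ∈ l, ∃ b c, b < c ∧ Ioo b c ⊆ U) :
    NeBot (l ⊓ ae volume) := by
  refine inf_neBot_iff.2 fun {U} hU {V} hV => ?_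
  obtain ⟨b, c, hbc, hU⟩ := h U hU
  by_contra hn
  have h1 := measure_mono_null (fun x hx hxV => hn ⟨x, hU hx, hxV⟩ : Ioo b c ⊆ Vᶜ) hV
  rw [Real.volume_Ioo, ofReal_eq_zero] at h1
  linarith

/-- A function with essential one-sided limits coincides with them almost everywhere. -/
lemma ae_eq_of_essential_limits {T : ℝ} {E El Er : ℝ → ℝ}
    (hl : ∀ τ ∈ Ioo 0 T, Tendsto E (𝓝[<] τ ⊓ ae volume) (𝓝 (El τ)))
    (hr : ∀ τ ∈ Ioo 0 T, Tendsto E (𝓝[>] τ ⊓ ae volume) (𝓝 (Er τ))) :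
    ∀ᵐ t ∂dt[T], E t = El t ∧ E t = Er t := by
  -- on an interval where `E` is nearly constant, so are its limits
  have key : ∀ {b c y ε : ℝ}, (∀ᵐ t, t ∈ Ioo b c → |E t - y| < ε) →
      volume {t | t ∈ Ioo b c ∧ t ∈ Ioo 0 T ∧ (2 * ε < |E t - El t| ∨ 2 * ε < |E t - Er t|)}
        = 0 := by
    intro b c y ε h
    refine measure_mono_null (t := {t | ¬ (t ∈ Ioo b c → |E t - y| < ε)}) ?_ h
    rintro t ⟨ht, htT, hor⟩ himp
    have h1 := himp ht
    have hlim : ∀ {l : Filter ℝ} {z : ℝ}, l ≤ 𝓝 t → NeBot (l ⊓ ae volume) →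
        Tendsto E (l ⊓ ae volume) (𝓝 z) → |z - y| ≤ ε := fun hl _ hz => by
      refine le_of_tendsto (hz.sub_const y).abs ?_
      filter_upwards [mem_inf_of_left (hl (Ioo_mem_nhds ht.1 ht.2)), mem_inf_of_right h]
        with s hs hs' using (hs' hs).le
    have hL := hlim nhdsWithin_le_nhds (neBot_inf_ae fun U hU =>
      let ⟨b, hb, h⟩ := mem_nhdsLT_iff_exists_Ioo_subset.1 hU; ⟨b, t, hb, h⟩) (hl t htT)
    have hR := hlim nhdsWithin_le_nhds (neBot_inf_ae fun U hU =>
      let ⟨c, hc, h⟩ := mem_nhdsGT_iff_exists_Ioo_subset.1 hU; ⟨t, c, hc, h⟩) (hr t htT)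
    rcases hor with h2 | h2
    · have := abs_sub_le (E t) y (El t)
      rw [abs_sub_comm y] at this
      linarith
    · have := abs_sub_le (E t) y (Er t)
      rw [abs_sub_comm y] at this
      linarith
  -- such intervals lie on both sides of every point, so the exceptional set is locally null
  have hnull : ∀ ε > 0,
      volume {t | t ∈ Ioo 0 T ∧ (2 * ε < |E t - El t| ∨ 2 * ε < |E t - Er t|)} = 0 := by
    intro ε hε
    refine measure_null_of_locally_null _ fun τ hτ => ?_
    have h1 := Metric.tendsto_nhds.1 (hl τ hτ.1) ε hε
    have h2 := Metric.tendsto_nhds.1 (hr τ hτ.1) ε hε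
    rw [Filter.Eventually, mem_inf_iff] at h1 h2
    obtain ⟨U, hU, V, hV, hUV⟩ := h1
    obtain ⟨U', hU', V', hV', hUV'⟩ := h2
    obtain ⟨b, hb, hbU⟩ := mem_nhdsLT_iff_exists_Ioo_subset.1 hU
    obtain ⟨c, hc, hcU⟩ := mem_nhdsGT_iff_exists_Ioo_subset.1 hU'
    refine ⟨Ioo b c ∩ {t | t ∈ Ioo 0 T ∧ (2 * ε < |E t - El t| ∨ 2 * ε < |E t - Er t|)},
      inter_mem (mem_nhdsWithin_of_mem_nhds (Ioo_mem_nhds hb hc)) self_mem_nhdsWithin, ?_⟩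
    have k1 := key (b := b) (c := τ) (y := El τ) (ε := ε) (by
      filter_upwards [hV] with t ht htI
      have : t ∈ U ∩ V := ⟨hbU htI, ht⟩
      rwa [← hUV] at this)
    have k2 := key (b := τ) (c := c) (y := Er τ) (ε := ε) (by
      filter_upwards [hV'] with t ht htI
      have : t ∈ U' ∩ V' := ⟨hcU htI, ht⟩
      rwa [← hUV'] at this)
    have k3 : volume {τ} = 0 := measure_singleton τ
    refine measure_mono_null ?_ (measure_union_null (measure_union_null k1 k2) k3)
    rintro t ⟨htI, ht⟩
    rcases lt_trichotomy t τ with h | h | h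
    · exact Or.inl (Or.inl ⟨⟨htI.1, h⟩, ht⟩)
    · exact Or.inr h
    · exact Or.inl (Or.inr ⟨⟨h, htI.2⟩, ht⟩)
  rw [ae_restrict_iff' measurableSet_Ioo]
  have hall : ∀ᵐ t, ∀ n : ℕ, ¬ (t ∈ Ioo 0 T ∧ (2 * (1 / ((n : ℝ) + 1)) < |E t - El t| ∨
      2 * (1 / ((n : ℝ) + 1)) < |E t - Er t|)) :=
    ae_all_iff.2 fun n => by
      have := hnull (1 / ((n : ℝ) + 1)) Nat.one_div_pos_of_nat
      rw [ae_iff]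
      simpa only [not_not] using this
  filter_upwards [hall] with t ht htT
  have hz : ∀ {x : ℝ}, (∀ n : ℕ, |x| ≤ 2 * (1 / ((n : ℝ) + 1))) → x = 0 := fun {x} hx => by
    have h1 := ge_of_tendsto' (tendsto_one_div_add_atTop_nhds_zero_nat.const_mul 2) hx
    rw [mul_zero] at h1
    exact abs_eq_zero.1 (le_antisymm h1 (abs_nonneg _))
  refine ⟨sub_eq_zero.1 (hz fun n => ?_), sub_eq_zero.1 (hz fun n => ?_)⟩
  · by_contra h
    exact ht n ⟨htT, Or.inl (not_le.1 h)⟩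
  · by_contra h
    exact ht n ⟨htT, Or.inr (not_le.1 h)⟩

lemma exists_time_cutoff {τ T : ℝ} (h : τ < T) : ∃ θ : ℝ → ℝ, ContDiff ℝ 1 θ ∧ (∀ t, 0 ≤ θ t) ∧
    (∃ τ' > τ, ∀ t < τ', θ t = 1) ∧ ∃ T' < T, ∀ t, T' ≤ t → θ t = 0 := by
  let δ := (T - τ) / 3
  have hδ : 0 < δ := by simp only [δ]; linarith
  refine ⟨fun t => smoothTransition ((T - δ - t) / δ), ?_, fun t => smoothTransition.nonneg _,
    ⟨τ + δ, by linarith, fun t ht => ?_⟩, T - δ, by linarith, fun t ht => ?_⟩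
  · exact smoothTransition.contDiff.comp ((contDiff_const.sub contDiff_id).div_const _)
  · refine smoothTransition.one_of_one_le ?_
    rw [le_div_iff₀ hδ]
    have : T = τ + 3 * δ := by simp only [δ]; ring
    linarith
  · exact smoothTransition.zero_of_nonpos (div_nonpos_of_nonpos_of_nonneg (by linarith) hδ.le)

end EssentialLimits

/-! ### Dissipative solutions are relaxed solutions -/

section ToRelaxed

variable {d : ℕ} {G : FluidDomain d} {γ : ℝ} [hγ : Fact (1 < γ)]

lemma fderiv_eq_inner_gradient {φ : Space d → ℝ} (x v : Space d) :
    fderiv ℝ φ x v = inner ℝ v (gradient φ x) := by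
  rw [real_inner_comm, gradient, InnerProductSpace.toDual_symm_apply]

lemma continuous_gradient {φ : Space d → ℝ} (hφ : ContDiff ℝ 1 φ) : Continuous (gradient φ) :=
  (InnerProductSpace.toDual ℝ (Space d)).symm.continuous.comp (hφ.continuous_fderiv one_ne_zero)

lemma deriv_eq_zero_of_eq_const {E : Type*} [NormedAddCommGroup E] [NormedSpace ℝ E] {f : ℝ → E}
    {c : E} {τ t : ℝ} (h : ∀ s < τ, f s = c) (ht : t < τ) : deriv f t = 0 := by
  have : f =ᶠ[𝓝 t] fun _ => c := mem_of_superset (Iio_mem_nhds ht) h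
  rw [this.deriv_eq, deriv_const]

/-- Product test functions with a time cutoff. -/
lemma isScalarTest_cutoff {T : ℝ} {θ : ℝ → ℝ} (hθ : ContDiff ℝ 1 θ)
    (hθ0 : ∃ T' < T, ∀ t, T' ≤ t → θ t = 0) {φ : Space d → ℝ} (hφ : IsStaticScalar G φ) :
    IsScalarTest G T fun t x => θ t * φ x := by
  refine ⟨(hθ.comp contDiff_fst).mul (hφ.contDiff.comp contDiff_snd), ?_, fun t => ?_⟩
  · obtain ⟨T', hT', h⟩ := hθ0
    exact ⟨T', hT', fun t ht x => by rw [h t ht, zero_mul]⟩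
  · have := hφ.periodic
    cases G with
    | bounded Ω => trivial
    | torus => exact fun x i => congrArg (fun y => θ t * y) (this x i)

lemma isVectorTest_cutoff {T : ℝ} {θ : ℝ → ℝ} (hθ : ContDiff ℝ 1 θ)
    (hθ0 : ∃ T' < T, ∀ t, T' ≤ t → θ t = 0) {φ : Space d → Space d} (hφ : IsStaticVector G φ) :
    IsVectorTest G T fun t x => θ t • φ x := by
  refine ⟨(hθ.comp contDiff_fst).smul (hφ.contDiff.comp contDiff_snd), ?_, fun t => ?_,
    fun t _ => ?_⟩
  · obtain ⟨T', hT', h⟩ := hθ0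
    exact ⟨T', hT', fun t ht x => by rw [h t ht, zero_smul]⟩
  · have := hφ.periodic
    cases G with
    | bounded Ω => trivial
    | torus => exact fun x i => congrArg (fun y => θ t • y) (this x i)
  · have := hφ.impermeable
    cases G with
    | bounded Ω => exact fun x hx n hn => by rw [real_inner_smul_left, this x hx n hn, mul_zero]
    | torus => trivial

variable [CompactSpace (Hull G)]

lemma continuousOn_integral_inner {T : ℝ} (hG : G.Admissible) (u : Trajectory G γ T)
    {b : Space d → Space d} (hb : Continuous b) :
    ContinuousOn (fun t => ∫ x, inner ℝ (u.2.val t x) (b x) ∂G.vol) (Icc 0 T) :=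
  continuous_val u.2 (weightFunctional (isWeight_of_continuous hG hb))

lemma continuousOn_integral_mul {T : ℝ} (hG : G.Admissible) (u : Trajectory G γ T)
    {b : Space d → ℝ} (hb : Continuous b) :
    ContinuousOn (fun t => ∫ x, u.1.val t x * b x ∂G.vol) (Icc 0 T) := by
  refine (continuous_val u.1 (weightFunctional (isWeight_of_continuous hG hb))).congr fun t _ => ?_
  change _ = ∫ x, inner ℝ (u.1.val t x) (b x) ∂G.vol
  simp [mul_comm]

lemma eqOn_Icc_of_Ioo {T : ℝ} (hT : 0 < T) {f g : ℝ → ℝ} (hf : ContinuousOn f (Icc 0 T))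
    (hg : ContinuousOn g (Icc 0 T)) (h : EqOn f g (Ioo 0 T)) : EqOn f g (Icc 0 T) :=
  h.of_subset_closure hf hg Ioo_subset_Icc_self (by rw [closure_Ioo hT.ne])

lemma static_mass_of_continuityEquation (hG : G.Admissible) {T : ℝ} (hT : 0 < T)
    {u : Trajectory G γ T} (hu : ContinuityEquation G γ T u) {φ : Space d → ℝ}
    (hφ : IsStaticScalar G φ) : ∀ τ ∈ Icc 0 T,
    ∫ x, u.1.val τ x * φ x ∂G.vol - ∫ x, u.1.val 0 x * φ x ∂G.vol
      = ∫ t in (0 : ℝ)..τ, ∫ x, fderiv ℝ φ x (u.2.val t x) ∂G.vol := by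
  have hc : ContinuousOn (fun t => ∫ x, fderiv ℝ φ x (u.2.val t x) ∂G.vol) (Icc 0 T) := by
    simp_rw [fderiv_eq_inner_gradient]
    exact continuousOn_integral_inner hG u (continuous_gradient hφ.contDiff)
  refine eqOn_Icc_of_Ioo hT ((continuousOn_integral_mul hG u hφ.contDiff.continuous).sub
    continuousOn_const) (continuousOn_primitive_of_integrableOn hT.le
      ((hc.integrableOn_compact isCompact_Icc).mono_set Ioo_subset_Icc_self)) fun τ hτ => ?_
  obtain ⟨θ, hθ, -, ⟨τ', hτ', hθ1⟩, hθ0⟩ := exists_time_cutoff hτ.2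
  have h := hu _ (isScalarTest_cutoff hθ hθ0 hφ) τ hτ
  simp only [hθ1 τ hτ', hθ1 0 (hτ.1.trans hτ'), one_mul] at h
  change _ - _ = _
  rw [h]
  refine intervalIntegral.integral_congr fun t ht => ?_
  rw [uIcc_of_le hτ.1.le] at ht
  have htτ : t < τ' := ht.2.trans_lt hτ'
  refine integral_congr_ae (ae_of_all _ fun x => ?_)
  have e1 : deriv (fun s => θ s * φ x) t = 0 :=
    deriv_eq_zero_of_eq_const (c := φ x) (fun s hs => by rw [hθ1 s hs, one_mul]) htτ
  simp only [e1, hθ1 t htτ, one_mul, mul_zero, zero_add]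

/-- The energy inequality implies that the total energy coincides almost everywhere with a
non-increasing function bounded by the initial energy. -/
lemma ae_energy_le_of_energyInequality {T a : ℝ} {u : Trajectory G γ T} {Rv : MatrixMeasures d}
    {Rp : ℝ → Measure (Space d)} (h : EnergyInequality G a γ T u Rv Rp) :
    ∃ S : Set ℝ, (∀ᵐ t ∂dt[T], t ∈ S) ∧
      AntitoneOn (fun t => (totalEnergy G a γ (u.1.val t) (u.2.val t) (Rv t) (Rp t)).toReal) S ∧
      ∀ t ∈ S, (totalEnergy G a γ (u.1.val t) (u.2.val t) (Rv t) (Rp t)).toReal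
        ≤ (fluidEnergy G a γ (u.1.val 0) (u.2.val 0)).toReal := by
  obtain ⟨-, -, El, Er, h0, hl, hr, hψ⟩ := h
  set E : ℝ → ℝ := fun t => (totalEnergy G a γ (u.1.val t) (u.2.val t) (Rv t) (Rp t)).toReal with hE
  have hmono : ∀ s t, 0 ≤ s → s ≤ t → t < T → Er t ≤ El s := by
    intro s t hs hst htT
    -- the energy inequality with `ψ = 1` up to the time `t`
    obtain ⟨θ, hθ, hθn, ⟨τ', hτ', hθ1⟩, hθ0⟩ := exists_time_cutoff htT
    have h1 := hψ θ ⟨hθ, hθ0, fun t _ => hθn t⟩ s t hs hst htT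
    rw [hθ1 t hτ', hθ1 s (hst.trans_lt hτ'), one_mul, one_mul] at h1
    have h2 : ∫ r in s..t, deriv θ r * E r = 0 := by
      rw [← intervalIntegral.integral_zero (a := s) (b := t) (μ := volume)]
      refine intervalIntegral.integral_congr fun r hr' => ?_
      rw [uIcc_of_le hst] at hr'
      simp only [deriv_eq_zero_of_eq_const hθ1 (hr'.2.trans_lt hτ'), zero_mul]
    change _ ≤ ∫ r in s..t, deriv θ r * E r at h1
    rw [h2] at h1
    linarith
  have hae := ae_eq_of_essential_limits (E := E) hl fun τ hτ => hr τ (Ioo_subset_Ico_self hτ)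
  refine ⟨{t | t ∈ Ioo 0 T ∧ E t = El t ∧ E t = Er t}, ?_, ?_, ?_⟩
  · filter_upwards [hae, ae_restrict_mem measurableSet_Ioo] with t ht htT using ⟨htT, ht⟩
  · intro s hs t ht hst
    rw [ht.2.2, hs.2.1]
    exact hmono s t hs.1.1.le hst ht.1.2
  · intro t ht
    change E t ≤ _
    rw [ht.2.2, ← h0]
    exact hmono 0 t le_rfl ht.1.1.le ht.1.2

/-- The pressure defect as a signed measure. -/
def signedDefect (μ : Measure (Space d)) : SignedMeasure (Space d) :=
  open Classical in if _h : IsFiniteMeasure μ then μ.toSignedMeasure else 0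

lemma signedDefect_eq (μ : Measure (Space d)) [h : IsFiniteMeasure μ] :
    signedDefect μ = μ.toSignedMeasure := dif_pos h

/-- The stress functional of the state. -/
def stateStress (a : ℝ) (ρ : DensSpace G γ) (m : MomSpace G γ) :
    StressDual G :=
  stressOf (flux ρ m) (pressMeasure a ρ)

/-- The stress functional of the defects. -/
def defectStress (R : Fin d → Fin d → SignedMeasure (Space d)) (μ : Measure (Space d)) :
    StressDual G :=
  stressOf R (signedDefect μ)

lemma stateStress_add_defectStress (a : ℝ) (ρ : DensSpace G γ) (m : MomSpace G γ)
    (R : Fin d → Fin d → SignedMeasure (Space d)) (μ : Measure (Space d)) :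
    stateStress a ρ m + defectStress R μ
      = stressOf (fun i j => flux ρ m i j + R i j) (pressMeasure a ρ + signedDefect μ) := by
  ext F
  rw [stressOf_add]
  rfl

section Families

variable {a T E₀ : ℝ} {u : Trajectory G γ T} {Rv : MatrixMeasures d} {Rp : ℝ → Measure (Space d)}

lemma aemeasurable_stateStress (ha : 0 ≤ a) (hρ : ∀ t ∈ Icc 0 T, 0 ≤ᵐ[G.vol] u.1.val t)
    (hE : ∀ᵐ t ∂dt[T],
      fluidEnergy G a γ (u.1.val t) (u.2.val t) ≤ ofReal E₀) (F : C(Hull G, Stress d)) :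
    AEMeasurable (fun t => stateStress a (u.1.val t) (u.2.val t) F) dt[T] := by
  have hk : ∀ᵐ t ∂dt[T], ∀ i,
      ∫⁻ x, kin (u.1.val t x) (u.2.val t x i) ∂G.vol < ∞ := by
    filter_upwards [hE] with t ht using lintegral_kin_lt_top (ht.trans_lt ofReal_lt_top)
  exact aemeasurable_stressOf (fun i j S hS => aemeasurable_flux u hρ hk i j hS)
    (fun S hS => aemeasurable_pressMeasure ha u hρ hS) F

lemma norm_stateStress_le (ha : 0 ≤ a) {ρ : DensSpace G γ} {m : MomSpace G γ}
    (hρ : 0 ≤ᵐ[G.vol] ρ) (hE₀ : 0 ≤ E₀) (hE : fluidEnergy G a γ ρ m ≤ ofReal E₀) :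
    ‖stateStress a ρ m‖ ≤ ∑ _i : Fin d, ∑ _j : Fin d, 4 * E₀ + (γ - 1) * E₀ := by
  refine (norm_stressOf_le _ _).trans (add_le_add (sum_le_sum fun i _ =>
    sum_le_sum fun j _ => variation_flux_le ha hρ hE₀ hE i j) ?_)
  exact variation_pressMeasure_le ha hρ hE₀ hE

lemma ae_isFiniteMeasure_of_isPressureDefect (hRp : IsPressureDefect G T Rp) :
    ∀ᵐ t ∂dt[T], IsFiniteMeasure (Rp t) := by
  obtain ⟨C, hC⟩ := hRp.bounded
  filter_upwards [hC] with t ht using ⟨ht.trans_lt ENNReal.coe_lt_top⟩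

lemma aemeasurable_defectStress (hRv : IsConvectiveDefect G T Rv) (hRp : IsPressureDefect G T Rp)
    (F : C(Hull G, Stress d)) :
    AEMeasurable (fun t => defectStress (Rv t) (Rp t) F) dt[T] := by
  refine aemeasurable_stressOf hRv.measurable (fun S hS => ?_) F
  refine (hRp.measurable S hS).ennreal_toReal.congr ?_
  filter_upwards [ae_isFiniteMeasure_of_isPressureDefect hRp] with t ht
  rw [signedDefect_eq, Measure.toSignedMeasure_apply_measurable hS, measureReal_def]

lemma exists_norm_defectStress_le (hRv : IsConvectiveDefect G T Rv)
    (hRp : IsPressureDefect G T Rp) :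
    ∃ C, ∀ᵐ t ∂dt[T], ‖defectStress (G := G) (Rv t) (Rp t)‖ ≤ C := by
  obtain ⟨C, hC⟩ := hRv.bounded
  obtain ⟨C', hC'⟩ := hRp.bounded
  refine ⟨∑ _i : Fin d, ∑ _j : Fin d, (C : ℝ) + C', ?_⟩
  filter_upwards [hC, hC', ae_isFiniteMeasure_of_isPressureDefect hRp] with t ht ht' hfin
  refine (norm_stressOf_le _ _).trans (add_le_add (sum_le_sum fun i _ =>
    sum_le_sum fun j _ => ?_) ?_)
  · exact ENNReal.toReal_le_coe_of_le_coe (ht i j)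
  · rw [signedDefect_eq, Measure.variation_toSignedMeasure]
    exact ENNReal.toReal_le_coe_of_le_coe ht'

lemma ae_defectStress_gradTest (hRv : IsConvectiveDefect G T Rv) (hRp : IsPressureDefect G T Rp) :
    ∀ᵐ t ∂dt[T], ∀ (φ : Space d → Space d) (hφ : ContDiff ℝ 1 φ),
      defectStress (Rv t) (Rp t) (gradTest (G := G) hφ) = defectAction (Rv t) (Rp t) φ := by
  filter_upwards [hRv.supported, hRp.supported, ae_isFiniteMeasure_of_isPressureDefect hRp]
    with t h1 h2 h3 φ hφ
  rw [defectStress, signedDefect_eq]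
  exact stressOf_gradTest_defect h1 h2 hφ

lemma continuous_gradTest_curve {φ : ℝ → Space d → Space d}
    (hφ : ContDiff ℝ 1 (fun z : ℝ × Space d => φ z.1 z.2)) (hφt : ∀ t, ContDiff ℝ 1 (φ t)) :
    Continuous fun t => gradTest (G := G) (hφt t) := by
  have hg : ∀ i j, Continuous fun z : ℝ × Space d => grad (φ z.1) z.2 i j := by
    intro i j
    have h1 : ∀ z : ℝ × Space d, grad (φ z.1) z.2 i j
        = fderiv ℝ (fun z : ℝ × Space d => φ z.1 z.2) z (0, single j 1) i := by
      intro z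
      have h2 : HasFDerivAt (fun x : Space d => ((z.1, x) : ℝ × Space d))
          (ContinuousLinearMap.inr ℝ ℝ (Space d)) z.2 := hasFDerivAt_prodMk_right z.1 z.2
      have h3 := ((hφ.differentiable one_ne_zero z).hasFDerivAt).comp z.2 h2
      have h4 : fderiv ℝ (φ z.1) z.2 = _ := h3.fderiv
      rw [grad, h4]
      simp
    simp_rw [h1]
    have h5 : Continuous fun z => fderiv ℝ (fun z : ℝ × Space d => φ z.1 z.2) z
        (0, single j 1) :=
      (hφ.continuous_fderiv one_ne_zero).clm_apply continuous_const
    fun_prop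
  refine ContinuousMap.continuous_of_continuous_uncurry _ ?_
  have hc : Continuous fun p : ℝ × Hull G => ((p.1, (p.2 : Space d)) : ℝ × Space d) :=
    continuous_fst.prodMk (continuous_subtype_val.comp continuous_snd)
  refine Continuous.prodMk (continuous_pi fun i => continuous_pi fun j => (hg i j).comp hc) ?_
  exact continuous_finsetSum _ fun i _ => (hg i i).comp hc

/-- The right-hand side of the momentum equation, expressed by the stress functionals. -/
lemma momentum_rhs (hG : G.Admissible) (ha : 0 ≤ a) (hρ : ∀ t ∈ Icc 0 T, 0 ≤ᵐ[G.vol] u.1.val t)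
    (hE₀ : 0 ≤ E₀) (hE : ∀ᵐ t ∂dt[T],
      fluidEnergy G a γ (u.1.val t) (u.2.val t) ≤ ofReal E₀)
    (hRv : IsConvectiveDefect G T Rv) (hRp : IsPressureDefect G T Rp)
    {φ : ℝ → Space d → Space d} (hφ : ContDiff ℝ 1 (fun z : ℝ × Space d => φ z.1 z.2))
    (hφt : ∀ t, ContDiff ℝ 1 (φ t)) (hdt : ∀ t, Continuous fun x => deriv (fun s => φ s x) t)
    {τ : ℝ} (hτ : τ ∈ Icc 0 T) (hX : IntervalIntegrable
      (fun t => ∫ x, inner ℝ (u.2.val t x) (deriv (fun s => φ s x) t) ∂G.vol) volume 0 τ) :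
    (∫ t in (0 : ℝ)..τ, ∫ x,
          (inner ℝ (u.2.val t x) (deriv (fun s => φ s x) t)
            + ∑ i, ∑ j, (u.2.val t x i * u.2.val t x j / u.1.val t x) * grad (φ t) x i j
            + pressure a γ (u.1.val t x) * divg (φ t) x) ∂G.vol)
        + ∫ t in (0 : ℝ)..τ, defectAction (Rv t) (Rp t) (φ t)
      = ∫ t in (0 : ℝ)..τ, (∫ x, inner ℝ (u.2.val t x) (deriv (fun s => φ s x) t) ∂G.vol
        + (stateStress a (u.1.val t) (u.2.val t) + defectStress (Rv t) (Rp t) :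
          StressDual G) (gradTest (hφt t))) := by
  have hF := continuous_gradTest_curve (G := G) hφ hφt
  obtain ⟨C, hC⟩ := exists_norm_defectStress_le hRv hRp
  have hCs : ∀ᵐ t ∂dt[T], ‖stateStress a (u.1.val t) (u.2.val t)‖
      ≤ ∑ _i : Fin d, ∑ _j : Fin d, 4 * E₀ + (γ - 1) * E₀ := by
    filter_upwards [hE, ae_mem_Icc T] with t ht htT
    exact norm_stateStress_le ha (hρ t htT) hE₀ ht
  have i1 := intervalIntegrable_of_integrableOn_Ioo
    (integrableOn_apply_of_bounded (Λ := fun t => stateStress a (u.1.val t) (u.2.val t))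
      (aemeasurable_stateStress ha hρ hE) hCs hF) hτ
  have i2 := intervalIntegrable_of_integrableOn_Ioo
    (integrableOn_apply_of_bounded (Λ := fun t => defectStress (G := G) (Rv t) (Rp t))
      (aemeasurable_defectStress hRv hRp) hC hF) hτ
  have h0 : (0 : ℝ) ∈ Icc 0 T := ⟨le_rfl, hτ.1.trans hτ.2⟩
  have e1 : ∫ t in (0 : ℝ)..τ, ∫ x,
          (inner ℝ (u.2.val t x) (deriv (fun s => φ s x) t)
            + ∑ i, ∑ j, (u.2.val t x i * u.2.val t x j / u.1.val t x) * grad (φ t) x i j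
            + pressure a γ (u.1.val t x) * divg (φ t) x) ∂G.vol
      = ∫ t in (0 : ℝ)..τ, (∫ x, inner ℝ (u.2.val t x) (deriv (fun s => φ s x) t) ∂G.vol
        + stateStress a (u.1.val t) (u.2.val t) (gradTest (G := G) (hφt t))) := by
    refine intervalIntegral.integral_congr_ae (ae_mem_uIoc ?_ h0 hτ)
    filter_upwards [hE, ae_mem_Icc T] with t ht htT
    obtain ⟨k1, k2⟩ := stressOf_gradTest_state hG (a := a) (hρ t htT)
      (lintegral_kin_lt_top (ht.trans_lt ofReal_lt_top)) (hφt t)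
    rw [stateStress, k2, ← integral_add (integrable_inner_weight
      (isWeight_of_continuous hG (hdt t)) ((Lp.memLp (u.2.val t)).integrable Fact.out)) k1]
    simp_rw [add_assoc]
  have e2 : ∫ t in (0 : ℝ)..τ, defectAction (Rv t) (Rp t) (φ t)
      = ∫ t in (0 : ℝ)..τ, defectStress (Rv t) (Rp t) (gradTest (G := G) (hφt t)) := by
    exact intervalIntegral.integral_congr_ae (ae_mem_uIoc
      ((ae_defectStress_gradTest hRv hRp).mono fun t ht => (ht _ (hφt t)).symm) h0 hτ)
  rw [e1, e2, ← intervalIntegral.integral_add (hX.add i1) i2]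
  refine intervalIntegral.integral_congr fun t _ => ?_
  simp only [add_apply]
  ring

end Families

/-- The stress of a dissipative solution together with its defects is an admissible stress
functional. -/
lemma isRelaxed_of_isDissipativeSolution (hG : G.Admissible) {a T : ℝ} (ha : 0 < a) (hT : 0 < T)
    {u : Trajectory G γ T} (hu : IsDissipativeSolution G a γ T u) :
    ∃ Λ, IsRelaxed a γ T (fluidEnergy G a γ (u.1.val 0) (u.2.val 0)).toReal u Λ := by
  obtain ⟨hρ, hce, Rv, Rp, hRv, hRp, hmom, hen⟩ := hu
  set E₀ := (fluidEnergy G a γ (u.1.val 0) (u.2.val 0)).toReal with hE₀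
  have hE₀0 : 0 ≤ E₀ := toReal_nonneg
  obtain ⟨S, hS, hSanti, hSle⟩ := ae_energy_le_of_energyInequality hen
  obtain ⟨-, hEfin, -⟩ := hen
  have hE : ∀ᵐ t ∂dt[T],
      fluidEnergy G a γ (u.1.val t) (u.2.val t) ≤ ofReal E₀ := by
    filter_upwards [hS, hEfin] with t ht htE
    calc fluidEnergy G a γ (u.1.val t) (u.2.val t)
        ≤ totalEnergy G a γ (u.1.val t) (u.2.val t) (Rv t) (Rp t) :=
          le_add_right (le_add_right le_rfl)
      _ = ofReal (totalEnergy G a γ (u.1.val t) (u.2.val t) (Rv t) (Rp t)).toReal :=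
          (ofReal_toReal htE.ne).symm
      _ ≤ ofReal E₀ := ofReal_le_ofReal (hSle t ht)
  have hfin := ae_isFiniteMeasure_of_isPressureDefect hRp
  obtain ⟨C, hC⟩ := exists_norm_defectStress_le hRv hRp
  -- the stress functional is the sum of the stress of the state and of the defects
  let Λ : ℝ → StressDual G := fun t =>
    stateStress a (u.1.val t) (u.2.val t) + defectStress (Rv t) (Rp t)
  have hΛm : ∀ F, AEMeasurable (fun t => Λ t F) dt[T] := fun F =>
    (aemeasurable_stateStress ha.le hρ hE F).add (aemeasurable_defectStress hRv hRp F)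
  have hΛb : ∀ᵐ t ∂dt[T], ‖Λ t‖
      ≤ (∑ _i : Fin d, ∑ _j : Fin d, 4 * E₀ + (γ - 1) * E₀) + C := by
    filter_upwards [hE, hC, ae_mem_Icc T] with t ht htC htT
    exact (norm_add_le (stateStress a (u.1.val t) (u.2.val t))
      (defectStress (Rv t) (Rp t))).trans (add_le_add
      (norm_stateStress_le ha.le (hρ t htT) hE₀0 ht) htC)
  refine ⟨Λ, ⟨hΛm, ⟨_, hΛb⟩, ?_, ?_⟩, hρ, fun φ hφ =>
    static_mass_of_continuityEquation hG hT hce hφ,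
    fun φ hφ => ?_⟩
  · filter_upwards [hE, hRv.symmetric, hRv.posSemidef, hfin, ae_mem_Icc T]
      with t ht hsymm hpos hf htT
    have hρt := hρ t htT
    have hk := lintegral_kin_lt_top (ht.trans_lt ofReal_lt_top)
    simp only [Λ]
    rw [stateStress_add_defectStress, signedDefect_eq]
    refine isStressBound_stressOf hG ha.le hρt (integrable_pressure hρt) (integrable_flux hρt hk)
      (ae_vacuum_of_kin hk) hsymm hpos fun B hB => ?_
    rw [Measure.toSignedMeasure_apply_measurable hB]
    exact measureReal_nonneg
  · have hgood : ∀ᵐ t ∂dt[T], Λ t (stressTest (energyStress d γ) 1)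
        = (totalEnergy G a γ (u.1.val t) (u.2.val t) (Rv t) (Rp t)).toReal := by
      filter_upwards [hE, hRv.supported, hRv.posSemidef, hfin, hRp.supported,
        ae_mem_Icc T] with t ht hs hpos hf hps htT
      have hk := lintegral_kin_lt_top (ht.trans_lt ofReal_lt_top)
      simp only [Λ]
      rw [stateStress_add_defectStress, signedDefect_eq]
      exact stressOf_energy_eq_totalEnergy hG ha.le (hρ t htT) hk
        hs hpos hps
    refine ⟨{t | t ∈ S ∧ Λ t (stressTest (energyStress d γ) 1)
        = (totalEnergy G a γ (u.1.val t) (u.2.val t) (Rv t) (Rp t)).toReal}, ?_, ?_, ?_⟩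
    · filter_upwards [hS, hgood] with t h1 h2 using ⟨h1, h2⟩
    · intro s hs t ht hst
      simp only
      rw [hs.2, ht.2]
      exact hSanti hs.1 ht.1 hst
    · intro t ht
      rw [ht.2]
      exact hSle t ht.1
  · have hi := integrableOn_apply_of_bounded hΛm hΛb
      (continuous_const (y := gradTest (G := G) hφ.contDiff))
    refine eqOn_Icc_of_Ioo hT ((continuousOn_integral_inner hG u hφ.contDiff.continuous).sub
      continuousOn_const) (continuousOn_primitive_of_integrableOn hT.le hi) fun τ hτ => ?_
    -- the test function is multiplied by a cutoff in time that is `1` on `[0,τ]`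
    obtain ⟨θ, hθ, -, ⟨τ', hτ', hθ1⟩, hθ0⟩ := exists_time_cutoff hτ.2
    have hv := isVectorTest_cutoff hθ hθ0 hφ
    have h := hmom _ hv τ hτ
    have hder : ∀ t < τ', ∀ x, deriv (fun s => θ s • φ x) t = 0 := fun t ht x =>
      deriv_eq_zero_of_eq_const (c := φ x) (fun s hs => by rw [hθ1 s hs, one_smul]) ht
    have hX : ∀ t ∈ uIcc 0 τ,
        ∫ x, inner ℝ (u.2.val t x) (deriv (fun s => θ s • φ x) t) ∂G.vol = 0 := by
      intro t ht
      rw [uIcc_of_le hτ.1.le] at ht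
      simp_rw [hder t (ht.2.trans_lt hτ'), inner_zero_right, integral_zero]
    have hdt : ∀ t, Continuous fun x => deriv (fun s => θ s • φ x) t := by
      intro t
      have h1 : ∀ x, deriv (fun s => θ s • φ x) t = deriv θ t • φ x := fun x =>
        deriv_smul_const (hθ.differentiable one_ne_zero t) _
      simp_rw [h1]
      exact hφ.contDiff.continuous.const_smul (deriv θ t)
    have hXi : IntervalIntegrable (fun t => ∫ x, inner ℝ (u.2.val t x)
        (deriv (fun s => θ s • φ x) t) ∂G.vol) volume 0 τ :=
      (intervalIntegrable_const (c := (0 : ℝ))).congr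
        fun t ht => (hX t (uIoc_subset_uIcc ht)).symm
    rw [momentum_rhs (φ := fun t x => θ t • φ x) hG ha.le hρ hE₀0 hE hRv hRp hv.contDiff
      (fun t => hφ.contDiff.const_smul (θ t)) hdt (Ioo_subset_Icc_self hτ) hXi] at h
    simp only [hθ1 τ hτ', hθ1 0 (hτ.1.trans hτ'), one_smul] at h
    change _ - _ = _
    rw [h]
    refine intervalIntegral.integral_congr fun t ht => ?_
    change (∫ x, inner ℝ (u.2.val t x) (deriv (fun s => θ s • φ x) t) ∂G.vol) + Λ t _ = Λ t _
    rw [hX t ht, zero_add]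
    rw [uIcc_of_le hτ.1.le] at ht
    have h1 : (fun x => θ t • φ x) = φ := by
      funext x; rw [hθ1 t (ht.2.trans_lt hτ'), one_smul]
    simp only [h1]

end ToRelaxed

/-! ### Measures representing positive functionals -/

section Riesz

variable {X : Type*} [PseudoEMetricSpace X] [T2Space X] [CompactSpace X] [MeasurableSpace X]
  [BorelSpace X]

lemma exists_measure_of_nonneg (ℓ : StrongDual ℝ C(X, ℝ)) (h : ∀ f : C(X, ℝ), 0 ≤ f → 0 ≤ ℓ f) :
    ∃ ν : Measure X, IsFiniteMeasure ν ∧ ∀ f : C(X, ℝ), ∫ x, f x ∂ν = ℓ f := by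
  let Λ : CompactlySupportedContinuousMap X ℝ →ₚ[ℝ] ℝ :=
    { toFun := fun f => ℓ f.toContinuousMap
      map_add' := fun f g => ℓ.map_add f.toContinuousMap g.toContinuousMap
      map_smul' := fun c f => ℓ.map_smul c f.toContinuousMap
      monotone' := fun f g hfg => by
        have h1 := h (g.toContinuousMap - f.toContinuousMap) fun x => sub_nonneg.2 (hfg x)
        rw [map_sub] at h1
        exact sub_nonneg.1 h1 }
  refine ⟨RealRMK.rieszMeasure Λ, inferInstance, fun f => ?_⟩
  exact RealRMK.integral_rieszMeasure Λ (CompactlySupportedContinuousMap.continuousMapEquiv f)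

open Classical in
/-- The measure representing a positive functional (and zero for other functionals). -/
def rieszMeas (ℓ : StrongDual ℝ C(X, ℝ)) : Measure X :=
  if h : ∀ f : C(X, ℝ), 0 ≤ f → 0 ≤ ℓ f then (exists_measure_of_nonneg ℓ h).choose else 0

instance isFiniteMeasure_rieszMeas (ℓ : StrongDual ℝ C(X, ℝ)) : IsFiniteMeasure (rieszMeas ℓ) := by
  unfold rieszMeas
  split_ifs with h
  · exact (exists_measure_of_nonneg ℓ h).choose_spec.1
  · infer_instance

lemma integral_rieszMeas {ℓ : StrongDual ℝ C(X, ℝ)} (h : ∀ f : C(X, ℝ), 0 ≤ f → 0 ≤ ℓ f)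
    (f : C(X, ℝ)) : ∫ x, f x ∂(rieszMeas ℓ) = ℓ f := by
  rw [rieszMeas, dif_pos h]
  exact (exists_measure_of_nonneg ℓ h).choose_spec.2 f

lemma aemeasurable_measure_of_integral {Ω : Type*} [MeasurableSpace Ω] {P : Measure Ω}
    {ν : Ω → Measure X} [∀ t, IsFiniteMeasure (ν t)]
    (hν : ∀ f : C(X, ℝ), AEMeasurable (fun t => ∫ x, f x ∂(ν t)) P) {B : Set X}
    (hB : MeasurableSet B) : AEMeasurable (fun t => ν t B) P := by
  have hclosed : ∀ F : Set X, IsClosed F → AEMeasurable (fun t => ν t F) P := by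
    intro F hF
    refine aemeasurable_of_tendsto_metrizable_ae atTop
      (f := fun (n : ℕ) t => ∫⁻ x, (thickenedIndicator
        (Nat.one_div_pos_of_nat : (0 : ℝ) < 1 / ((n : ℝ) + 1)) F x : ℝ≥0∞) ∂(ν t)) (fun n => ?_)
      (ae_of_all _ fun t => tendsto_lintegral_thickenedIndicator_of_isClosed (ν t) hF
        (δs := fun n : ℕ => 1 / ((n : ℝ) + 1)) (fun n => Nat.one_div_pos_of_nat)
        tendsto_one_div_add_atTop_nhds_zero_nat)
    let g := thickenedIndicator (Nat.one_div_pos_of_nat : (0 : ℝ) < 1 / ((n : ℝ) + 1)) F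
    refine (hν ⟨fun x => (g x : ℝ), NNReal.continuous_coe.comp g.continuous⟩).ennreal_ofReal.congr
      (ae_of_all _ fun t => ?_)
    have h1 := BoundedContinuousFunction.toReal_lintegral_coe_eq_integral g (ν t)
    change ofReal (∫ x, (g x : ℝ) ∂(ν t)) = _
    rw [← h1, ofReal_toReal]
    exact (BoundedContinuousFunction.lintegral_lt_top_of_nnreal (ν t) g).ne
  have hgen : ‹MeasurableSpace X› = MeasurableSpace.generateFrom {F | IsClosed F} := by
    rw [BorelSpace.measurable_eq (α := X), borel_eq_generateFrom_isClosed]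
  refine MeasurableSpace.induction_on_inter hgen isPiSystem_isClosed (C := fun B _ =>
    AEMeasurable (fun t => ν t B) P) (by simp) (fun F hF => hclosed F hF) (fun B hB ih => ?_)
    (fun f hd hm ih => ?_) B hB
  · simp_rw [measure_compl hB (measure_ne_top _ _)]
    exact (hclosed univ isClosed_univ).sub ih
  · simp_rw [measure_iUnion hd hm]
    exact AEMeasurable.tsum ih

lemma signedMeasure_eq_zero_of_sint {s : SignedMeasure X} (h : ∀ f : C(X, ℝ), sint s f = 0) :
    s = 0 := by
  set j := s.toJordanDecomposition with hj
  have hs : s = j.posPart.toSignedMeasure - j.negPart.toSignedMeasure := by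
    rw [← SignedMeasure.toSignedMeasure_toJordanDecomposition s]
    rfl
  have hpn : j.posPart = j.negPart := by
    refine ext_of_forall_integral_eq_of_IsFiniteMeasure fun f => ?_
    have h1 := h f.toContinuousMap
    have hb : ∃ c, ∀ x, |f x| ≤ c := ⟨‖f‖, f.norm_coe_le_norm⟩
    change sint s f = 0 at h1
    rw [hs, sint_sub_measure f.continuous.measurable hb, sint_toSignedMeasure,
      sint_toSignedMeasure] at h1
    exact sub_eq_zero.1 h1
  rw [hs, sub_eq_zero]
  exact Measure.toSignedMeasure_congr hpn

end Riesz

/-! ### The measures of a stress functional -/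

section StressMeasures

variable {d : ℕ} {G : FluidDomain d}

/-- The retraction of the closure of the domain onto the domain with its boundary: the identity
for a domain in `ℝ^d`, the identification of opposite faces for the torus. -/
def wrap : FluidDomain d → Space d → Space d
  | .bounded _, x => x
  | .torus, x => WithLp.toLp 2 fun i => if x i = 1 then -1 else x i

lemma measurable_wrap : Measurable (wrap G) := by
  cases G with
  | bounded Ω => exact measurable_id
  | torus =>
    refine (WithLp.measurable_toLp 2 _).comp (measurable_pi_lambda _ fun i => ?_)
    have hm : Measurable fun x : Space d => x i := by fun_prop
    exact Measurable.ite (hm (measurableSet_singleton 1)) measurable_const hm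

lemma wrap_of_mem_cell {x : Space d} (hx : x ∈ G.cell) : wrap G x = x := by
  cases G with
  | bounded Ω => rfl
  | torus =>
    ext i
    exact if_neg (hx i).2.ne

lemma mem_closed_cube_of_mem_hull {x : Space d}
    (hx : x ∈ closure (FluidDomain.torus : FluidDomain d).cell) (i : Fin d) :
    -1 ≤ x i ∧ x i ≤ 1 := by
  have hc : IsClosed {x : Space d | -1 ≤ x i ∧ x i ≤ 1} := by
    have hm : Continuous fun x : Space d => x i := by fun_prop
    exact (isClosed_le continuous_const hm).inter (isClosed_le hm continuous_const)
  have hs : (FluidDomain.torus : FluidDomain d).cell ⊆ {x : Space d | -1 ≤ x i ∧ x i ≤ 1} :=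
    fun y hy => ⟨(hy i).1, (hy i).2.le⟩
  exact closure_minimal hs hc hx

lemma wrap_mem_closedCell {x : Space d} (hx : x ∈ closure G.cell) : wrap G x ∈ G.closedCell := by
  cases G with
  | bounded Ω => exact hx
  | torus =>
    intro i
    have h := mem_closed_cube_of_mem_hull hx i
    change -1 ≤ (if x i = 1 then -1 else x i) ∧ (if x i = 1 then -1 else x i) < 1
    split_ifs with h1
    · norm_num
    · exact ⟨h.1, lt_of_le_of_ne h.2 h1⟩

lemma apply_wrap {Y : Type*} {f : Space d → Y} (hf : G.RespectsPeriods f) (x : Space d) :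
    f (wrap G x) = f x := by
  cases G with
  | bounded Ω => rfl
  | torus =>
    have key : ∀ s : Finset (Fin d),
        f (WithLp.toLp 2 fun i => if i ∈ s ∧ x i = 1 then -1 else x i) = f x := by
      intro s
      induction s using Finset.induction_on with
      | empty => simp
      | insert j s hj ih =>
        rw [← ih]
        by_cases hx : x j = 1
        · rw [← hf _ j]
          congr 1
          ext i
          by_cases hij : i = j
          · subst hij
            simp [hj, hx]
            norm_num
          · simp [hij]
        · congr 1
          ext i
          by_cases hij : i = j
          · subst hij; simp [hx]
          · simp [hij]
    simpa [wrap] using key Finset.univ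

variable [CompactSpace (Hull G)]

/-- The functional `f ↦ L (f S)` on scalar functions. -/
def stressPart (L : StressDual G) (S : Stress d) : StrongDual ℝ C(Hull G, ℝ) :=
  L.comp (stressTest S)

lemma stressPart_apply (L : StressDual G) (S : Stress d) (f : C(Hull G, ℝ)) :
    stressPart L S f = L (stressTest S f) := rfl

/-- The measure on the domain with its boundary that represents the functional `f ↦ L (f S)`. -/
def stressMeas (L : StressDual G) (S : Stress d) : Measure (Space d) :=
  (rieszMeas (stressPart L S)).map fun x : Hull G => wrap G x

lemma measurable_wrap_hull : Measurable fun x : Hull G => wrap G x :=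
  measurable_wrap.comp measurable_subtype_coe

instance isFiniteMeasure_stressMeas (L : StressDual G) (S : Stress d) :
    IsFiniteMeasure (stressMeas L S) := by
  unfold stressMeas
  infer_instance

lemma stressMeas_compl (L : StressDual G) (S : Stress d)
    (hm : MeasurableSet G.closedCell) : stressMeas L S G.closedCellᶜ = 0 := by
  rw [stressMeas, Measure.map_apply measurable_wrap_hull hm.compl]
  convert measure_empty (μ := rieszMeas (stressPart L S))
  ext x
  simpa using wrap_mem_closedCell x.2

lemma measurableSet_closedCell (hG : G.Admissible) : MeasurableSet G.closedCell := by
  cases G with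
  | bounded Ω => exact isClosed_closure.measurableSet
  | torus => exact measurableSet_cell hG

/-- The positivity of the functional `f ↦ L (f S)`. -/
def IsPositivePart (L : StressDual G) (S : Stress d) : Prop :=
  ∀ f : C(Hull G, ℝ), 0 ≤ f → 0 ≤ stressPart L S f

/-- The function on the closure of the domain extends to a function on `ℝ^d` that is periodic in the
case of the torus. -/
def IsPeriodicTest (f : C(Hull G, ℝ)) : Prop :=
  ∃ g : Space d → ℝ, G.RespectsPeriods g ∧ ∀ x (h : x ∈ closure G.cell), f ⟨x, h⟩ = g x

lemma integral_stressMeas {L : StressDual G} {S : Stress d}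
    (h : IsPositivePart L S) {f : C(Hull G, ℝ)} (hf : IsPeriodicTest f) :
    ∫ x, zeroExt f x ∂(stressMeas L S) = L (stressTest S f) := by
  obtain ⟨g, hg, hfg⟩ := hf
  rw [stressMeas, integral_map measurable_wrap_hull.aemeasurable
    (measurable_zeroExt f).aestronglyMeasurable, ← stressPart_apply, ← integral_rieszMeas h f]
  refine integral_congr_ae (ae_of_all _ fun x => ?_)
  have hx := closedCell_subset_hull (wrap_mem_closedCell x.2)
  change zeroExt f (wrap G x) = f x
  rw [zeroExt_of_mem f hx, hfg _ hx, apply_wrap hg, ← hfg _ x.2]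

lemma aemeasurable_stressMeas {Ω : Type*} [MeasurableSpace Ω] {P : Measure Ω}
    {Λ : Ω → StressDual G} (hΛ : ∀ F, AEMeasurable (fun t => Λ t F) P)
    {S : Stress d} (hpos : ∀ᵐ t ∂P, IsPositivePart (Λ t) S) {B : Set (Space d)}
    (hB : MeasurableSet B) : AEMeasurable (fun t => stressMeas (Λ t) S B) P := by
  have h1 : (fun t => stressMeas (Λ t) S B)
      = fun t => rieszMeas (stressPart (Λ t) S) ((fun x : Hull G => wrap G x) ⁻¹' B) := by
    funext t
    rw [stressMeas, Measure.map_apply measurable_wrap_hull hB]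
  rw [h1]
  refine aemeasurable_measure_of_integral (fun f => ?_) (measurable_wrap_hull hB)
  refine (hΛ (stressTest S f)).congr ?_
  filter_upwards [hpos] with t ht using (integral_rieszMeas ht f).symm

lemma stressMeas_univ {L : StressDual G} {S : Stress d}
    (h : IsPositivePart L S) : (stressMeas L S).real univ = L (stressTest S 1) := by
  have h1 := integral_rieszMeas h 1
  simp only [ContinuousMap.one_apply, integral_const, smul_eq_mul, mul_one] at h1
  rw [stressMeas, map_measureReal_apply measurable_wrap_hull MeasurableSet.univ, preimage_univ, h1,
    stressPart_apply]

lemma exists_nonneg_extension (f : C(Hull G, ℝ)) (hf : 0 ≤ f) :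
    ∃ g : C(Space d, ℝ), (∀ x, 0 ≤ g x) ∧ (∃ c, ∀ x, |g x| ≤ c) ∧
      g.restrict (closure G.cell) = f := by
  obtain ⟨g, hg⟩ := f.exists_restrict_eq isClosed_closure
  refine ⟨⟨fun x => max 0 (min (g x) ‖f‖), by fun_prop⟩, fun x => le_max_left _ _,
    ⟨‖f‖, fun x => ?_⟩,
    ?_⟩
  · change |max 0 (min (g x) ‖f‖)| ≤ ‖f‖
    rw [abs_of_nonneg (le_max_left _ _)]
    exact max_le (norm_nonneg _) (min_le_right _ _)
  · ext x
    have h1 : g x = f x := DFunLike.congr_fun hg x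
    change max 0 (min (g x) ‖f‖) = f x
    rw [h1, min_eq_left ((le_abs_self _).trans (f.norm_coe_le_norm x))]
    exact max_eq_right (hf x)

variable {a γ : ℝ} [hγ : Fact (1 < γ)] {ρ : DensSpace G γ} {m : MomSpace G γ}
  {L : StressDual G}

lemma IsStressBound.isPositivePart_squareStress (h : IsStressBound a γ ρ m L) (ξ : Fin d → ℝ) :
    IsPositivePart L (squareStress ξ) := by
  intro f hf
  obtain ⟨g, hg0, hgb, rfl⟩ := exists_nonneg_extension f hf
  have h1 := h.convective ξ g hg0 hgb (fun _ => 0) measurable_const ⟨0, by simp⟩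
  simpa [stressPart_apply] using h1

lemma IsStressBound.isPositivePart_scalarStress (h : IsStressBound a γ ρ m L) :
    IsPositivePart L (scalarStress d) := by
  intro f hf
  obtain ⟨g, hg0, hgb, rfl⟩ := exists_nonneg_extension f hf
  have h1 := h.pressure g hg0 hgb (fun _ => 0) measurable_const (fun _ => le_rfl) ⟨0, by simp⟩
  have hγ1 : γ - 1 ≠ 0 := by linarith [hγ.out]
  have hγ0 : γ ≠ 0 := by linarith [hγ.out]
  simpa [stressPart_apply, pressureTangent, EulerDissipative.pressure, zero_rpow, hγ1, hγ0] using h1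

lemma IsStressBound.lintegral_kin_le (h : IsStressBound a γ ρ m L) (hρ : 0 ≤ᵐ[G.vol] ρ)
    (ξ : Fin d → ℝ) {f : C(Space d, ℝ)} (hf0 : ∀ x, 0 ≤ f x) (hfb : ∃ c, ∀ x, |f x| ≤ c) :
    ∫⁻ x, ofReal (f x) * kin (ρ x) (∑ i, ξ i * m x i) ∂G.vol
      ≤ ofReal (L (stressTest (squareStress ξ) (f.restrict (closure G.cell)))) :=
  EulerDissipative.lintegral_kin_le f.continuous.measurable hfb (ae_of_all _ hf0)
    (Finset.measurable_fun_sum _ fun i _ => (measurable_mom m i).const_mul _) (measurable_dens ρ)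
    (integrable_finsetSum _ fun i _ => (integrable_mom m i).const_mul _) (integrable_dens ρ) hρ
    fun α hα hαb => ofReal_le_ofReal (h.convective ξ f hf0 hfb α hα hαb)

lemma IsStressBound.lintegral_pressure_le (ha : 0 ≤ a) (h : IsStressBound a γ ρ m L)
    (hρ : 0 ≤ᵐ[G.vol] ρ) {f : C(Space d, ℝ)} (hf0 : ∀ x, 0 ≤ f x) (hfb : ∃ c, ∀ x, |f x| ≤ c) :
    ∫⁻ x, ofReal (f x * EulerDissipative.pressure a γ (ρ x)) ∂G.vol
      ≤ ofReal (L (stressTest (scalarStress d) (f.restrict (closure G.cell)))) :=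
  EulerDissipative.lintegral_pressure_le ha hγ.out f.continuous.measurable hfb (ae_of_all _ hf0)
    (measurable_dens ρ) (integrable_dens ρ) hρ
    fun s hs hs0 hsb => ofReal_le_ofReal (h.pressure f hf0 hfb s hs hs0 hsb)

lemma IsStressBound.lintegral_kin_le_unit (h : IsStressBound a γ ρ m L) (hρ : 0 ≤ᵐ[G.vol] ρ)
    (i : Fin d) : ∫⁻ x, kin (ρ x) (m x i) ∂G.vol ≤ ofReal (L (stressTest (unitStress i i) 1)) := by
  have h1 := h.lintegral_kin_le hρ (Pi.single i 1) (f := 1) (fun _ => zero_le_one) ⟨1, by simp⟩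
  simp only [ContinuousMap.one_apply, ENNReal.ofReal_one, one_mul, sum_single_mul,
    squareStress_single] at h1
  exact h1

lemma IsStressBound.kin_lt_top (h : IsStressBound a γ ρ m L) (hρ : 0 ≤ᵐ[G.vol] ρ) (i : Fin d) :
    ∫⁻ x, kin (ρ x) (m x i) ∂G.vol < ∞ :=
  (h.lintegral_kin_le_unit hρ i).trans_lt ofReal_lt_top

lemma apply_energyStress (L : StressDual G) (f : C(Hull G, ℝ)) :
    L (stressTest (energyStress d γ) f) = 1 / 2 * ∑ i, L (stressTest (unitStress i i) f)
      + 1 / (γ - 1) * L (stressTest (scalarStress d) f) := by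
  rw [stressTest_eq_sum]
  simp [energyStress, mul_sum]

/-- The energy of the state is bounded by the total energy. -/
lemma IsStressBound.fluidEnergy_le (ha : 0 ≤ a) (h : IsStressBound a γ ρ m L)
    (hρ : 0 ≤ᵐ[G.vol] ρ) :
    fluidEnergy G a γ ρ m ≤ ofReal (L (stressTest (energyStress d γ) 1)) := by
  have hγ1 := sub_pos.2 hγ.out
  have h0 : ∀ i, 0 ≤ L (stressTest (unitStress i i) 1) := fun i => by
    have := h.isPositivePart_squareStress (Pi.single i 1) 1 zero_le_one
    rwa [squareStress_single] at this
  have h0' : 0 ≤ L (stressTest (scalarStress d) 1) := h.isPositivePart_scalarStress 1 zero_le_one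
  have h2 := h.lintegral_pressure_le ha hρ (f := 1) (fun _ => zero_le_one) ⟨1, by simp⟩
  simp only [ContinuousMap.one_apply, one_mul] at h2
  rw [fluidEnergy_eq, apply_energyStress, ofReal_add (mul_nonneg (by norm_num)
    (sum_nonneg fun i _ => h0 i)) (by positivity), ofReal_mul (by norm_num),
    ofReal_mul (by positivity), ofReal_sum_of_nonneg fun i _ => h0 i]
  refine add_le_add (mul_le_mul' ?_ (sum_le_sum fun i _ => h.lintegral_kin_le_unit hρ i))
    (mul_le_mul' le_rfl h2)
  rw [one_div, ENNReal.ofReal_inv_of_pos two_pos, ENNReal.ofReal_ofNat]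

end StressMeasures

/-! ### The defects of a stress functional -/

section Defects

variable {d : ℕ} {G : FluidDomain d} [CompactSpace (Hull G)]

/-- The matrix of measures representing the convective part of a stress functional, obtained from
the positive measures of the quadratic form by polarization. -/
def convMeas (L : StressDual G) (i j : Fin d) : SignedMeasure (Space d) :=
  (1 / 2 : ℝ) • ((stressMeas L (squareStress (Pi.single i 1 + Pi.single j 1))).toSignedMeasure
    - (stressMeas L (squareStress (Pi.single i 1))).toSignedMeasure
    - (stressMeas L (squareStress (Pi.single j 1))).toSignedMeasure)

lemma convMeas_symm (L : StressDual G) (i j : Fin d) :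
    convMeas L i j = convMeas L j i := by
  have h : (Pi.single i 1 + Pi.single j 1 : Fin d → ℝ) = Pi.single j 1 + Pi.single i 1 :=
    add_comm _ _
  rw [convMeas, convMeas, sub_right_comm]
  simp only [h]

lemma convMeas_apply (L : StressDual G) (i j : Fin d) {B : Set (Space d)}
    (hB : MeasurableSet B) : convMeas L i j B
      = 1 / 2 * ((stressMeas L (squareStress (Pi.single i 1 + Pi.single j 1))).real B
        - (stressMeas L (squareStress (Pi.single i 1))).real B
        - (stressMeas L (squareStress (Pi.single j 1))).real B) := by
  simp [convMeas, Measure.toSignedMeasure_apply_measurable hB]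

lemma stressTest_squareStress (ξ : Fin d → ℝ) (f : C(Hull G, ℝ)) :
    stressTest (squareStress ξ) f
      = ∑ i, ∑ j, (ξ i * ξ j) • stressTest (unitStress i j) f := by
  rw [stressTest_eq_sum]
  simp [squareStress]

variable {a γ : ℝ} [hγ : Fact (1 < γ)] {ρ : DensSpace G γ} {m : MomSpace G γ}
  {L : StressDual G}

lemma IsStressBound.polarization (h : IsStressBound a γ ρ m L) (i j : Fin d) (f : C(Hull G, ℝ)) :
    1 / 2 * (L (stressTest (squareStress (Pi.single i 1 + Pi.single j 1)) f)
      - L (stressTest (squareStress (Pi.single i 1)) f)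
      - L (stressTest (squareStress (Pi.single j 1)) f)) = L (stressTest (unitStress i j) f) := by
  have h1 : squareStress (Pi.single i 1 + Pi.single j 1 : Fin d → ℝ)
      = unitStress i i + unitStress j j + unitStress i j + unitStress j i := by
    ext k l
    · simp only [squareStress, unitStress, Pi.single_apply, Pi.add_apply, Prod.fst_add, ite_and]
      split_ifs <;> norm_num
    · simp [squareStress, unitStress]
  have h2 : ∀ S S' : Stress d, stressTest (S + S') f = stressTest S f + stressTest S' f := by
    intro S S'
    ext x <;> simp [stressTest_apply]
  rw [h1, squareStress_single, squareStress_single, h2, h2, h2, map_add, map_add, map_add,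
    h.symm j i f]
  ring

/-- The quadratic form of the matrix of measures is given by positive measures. -/
lemma IsStressBound.sum_convMeas (h : IsStressBound a γ ρ m L) (ξ : Fin d → ℝ)
    {B : Set (Space d)} (hB : MeasurableSet B) :
    ∑ i, ∑ j, ξ i * ξ j * convMeas L i j B = (stressMeas L (squareStress ξ)).real B := by
  let N : (Fin d → ℝ) → SignedMeasure (Hull G) := fun ζ =>
    (rieszMeas (stressPart L (squareStress ζ))).toSignedMeasure
  let A : Fin d → Fin d → SignedMeasure (Hull G) := fun i j =>
    (1 / 2 : ℝ) • (N (Pi.single i 1 + Pi.single j 1) - N (Pi.single i 1) - N (Pi.single j 1))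
  have hN : ∀ ζ (f : C(Hull G, ℝ)), sint (N ζ) f = L (stressTest (squareStress ζ) f) :=
      fun ζ f => by
    rw [sint_toSignedMeasure, integral_rieszMeas (h.isPositivePart_squareStress ζ),
      stressPart_apply]
  have key : ∑ i, ∑ j, (ξ i * ξ j) • A i j - N ξ = 0 := by
    refine signedMeasure_eq_zero_of_sint fun f => ?_
    have hm := f.continuous.measurable
    have hb : ∃ c, ∀ x, |f x| ≤ c := ⟨‖f‖, f.norm_coe_le_norm⟩
    simp only [sint_sub_measure hm hb, sint_sum_measure _ hm hb, sint_smul_measure, hN, A,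
      h.polarization]
    rw [stressTest_squareStress]
    simp [map_sum]
  have hB' := measurable_wrap_hull (G := G) hB
  have e1 : ∀ ζ, N ζ ((fun x : Hull G => wrap G x) ⁻¹' B)
      = (stressMeas L (squareStress ζ)).real B := fun ζ => by
    rw [Measure.toSignedMeasure_apply_measurable hB', stressMeas,
      map_measureReal_apply measurable_wrap_hull hB]
  have e2 := congrArg (fun s : SignedMeasure (Hull G) => s ((fun x : Hull G => wrap G x) ⁻¹' B)) key
  simp only [sub_apply, FunLike.coe_zero, Pi.zero_apply, e1] at e2
  rw [← sub_eq_zero, ← e2]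
  congr 1
  simp only [FunLike.coe_sum, Finset.sum_apply, FunLike.coe_smul, Pi.smul_apply, A,
    sub_apply, e1, smul_eq_mul, convMeas_apply L _ _ hB]

lemma setIntegral_le_stressMeas (hG : G.Admissible) {S : Stress d} (hS : IsPositivePart L S)
    {h : Space d → ℝ} (hh : Integrable h G.vol)
    (hle : ∀ f : C(Space d, ℝ), (∀ x, 0 ≤ f x) → (∃ c, ∀ x, |f x| ≤ c) →
      ∫ x, f x * h x ∂G.vol ≤ L (stressTest S (f.restrict (closure G.cell))))
    {B : Set (Space d)} (hB : MeasurableSet B) : ∫ x in B, h x ∂G.vol ≤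
      (stressMeas L S).real B := by
  have hval : Measurable (Subtype.val : Hull G → Space d) := measurable_subtype_coe
  have h1 := setIntegral_le_of_forall_integral_le (ν :=
    (rieszMeas (stressPart L S)).map Subtype.val)
    hh (fun f hf hfb => ?_) (measurable_wrap (G := G) hB)
  · rw [stressMeas, map_measureReal_apply measurable_wrap_hull hB]
    rw [map_measureReal_apply hval (measurable_wrap hB)] at h1
    refine le_trans (le_of_eq ?_) h1
    refine setIntegral_congr_set ?_
    filter_upwards [ae_mem_cell hG] with x hx
    change (x ∈ B) = (wrap G x ∈ B)
    rw [wrap_of_mem_cell hx]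
  · obtain ⟨c, hc⟩ := hfb
    refine (hle f hf ⟨c, fun x => by rw [abs_of_nonneg (hf x)]; exact hc x⟩).trans (le_of_eq ?_)
    rw [integral_map hval.aemeasurable f.continuous.measurable.aestronglyMeasurable]
    exact (integral_rieszMeas hS (f.restrict (closure G.cell))).symm

lemma IsStressBound.setIntegral_kin_le (hG : G.Admissible) (h : IsStressBound a γ ρ m L)
    (hρ : 0 ≤ᵐ[G.vol] ρ) (ξ : Fin d → ℝ) {B : Set (Space d)} (hB : MeasurableSet B) :
    ∑ i, ∑ j, ξ i * ξ j * flux ρ m i j B ≤ (stressMeas L (squareStress ξ)).real B := by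
  have hk := h.kin_lt_top hρ
  have hint := integrable_flux hρ hk
  obtain ⟨f, hf, hf0, hfb, hfB⟩ := exists_indicator_weight hB
  obtain ⟨hI, e⟩ := integral_mul_sq_sum_div hint hf hfb ξ
  have h1 := setIntegral_le_stressMeas hG (h.isPositivePart_squareStress ξ) hI
    (fun f hf hfb => ?_) hB
  · simpa only [hfB, e, flux, withDensityᵥ_apply (hint _ _) hB] using h1
  · rw [← toReal_lintegral_kin hρ hk f.continuous.measurable hf]
    refine toReal_le_of_le_ofReal ?_ (h.lintegral_kin_le hρ ξ hf hfb)
    exact h.isPositivePart_squareStress ξ _ fun x => hf x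

lemma IsStressBound.withDensity_pressure_le (hG : G.Admissible) (ha : 0 ≤ a)
    (h : IsStressBound a γ ρ m L) (hρ : 0 ≤ᵐ[G.vol] ρ) :
    G.vol.withDensity (fun x => ofReal (EulerDissipative.pressure a γ (ρ x)))
      ≤ stressMeas L (scalarStress d) := by
  refine Measure.le_iff.2 fun B hB => ?_
  have hI := integrable_pressure (a := a) hρ
  have h0 := ae_pressure_nonneg ha hρ
  have h1 := setIntegral_le_stressMeas hG h.isPositivePart_scalarStress hI (fun f hf hfb => ?_) hB
  · rw [withDensity_apply _ hB, ← ofReal_integral_eq_lintegral_ofReal hI.integrableOn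
      (ae_restrict_of_ae h0)]
    exact ENNReal.ofReal_le_of_le_toReal h1
  · rw [integral_eq_lintegral_of_nonneg_ae]
    · refine toReal_le_of_le_ofReal ?_ (h.lintegral_pressure_le ha hρ hf hfb)
      exact h.isPositivePart_scalarStress _ fun x => hf x
    · filter_upwards [h0] with x hx using mul_nonneg (hf x) hx
    · exact (f.continuous.measurable.mul
        (measurable_pressure (measurable_dens ρ))).aestronglyMeasurable

/-- The convective defect of a stress functional. -/
def convDefect (ρ : DensSpace G γ) (m : MomSpace G γ) (L : StressDual G)
    (i j : Fin d) : SignedMeasure (Space d) :=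
  convMeas L i j - flux ρ m i j

/-- The pressure defect of a stress functional. -/
def pressDefect (a : ℝ) (ρ : DensSpace G γ) (L : StressDual G) :
    Measure (Space d) :=
  stressMeas L (scalarStress d)
    - G.vol.withDensity fun x => ofReal (EulerDissipative.pressure a γ (ρ x))

instance isFiniteMeasure_pressDefect : IsFiniteMeasure (pressDefect a ρ L) :=
  isFiniteMeasure_of_le _ Measure.sub_le

lemma isFiniteMeasure_withDensity_pressure (hρ : 0 ≤ᵐ[G.vol] ρ) :
    IsFiniteMeasure (G.vol.withDensity fun x =>
      ofReal (EulerDissipative.pressure a γ (ρ x))) :=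
  isFiniteMeasure_withDensity_ofReal (integrable_pressure hρ).2

lemma ofReal_pressMeasure (ha : 0 ≤ a) (hρ : 0 ≤ᵐ[G.vol] ρ) {B : Set (Space d)}
    (hB : MeasurableSet B) : ofReal (pressMeasure a ρ B)
      = G.vol.withDensity (fun x => ofReal (EulerDissipative.pressure a γ (ρ x))) B := by
  rw [pressMeasure, withDensityᵥ_apply (integrable_pressure hρ) hB, withDensity_apply _ hB,
    ofReal_integral_eq_lintegral_ofReal (integrable_pressure hρ).integrableOn
      (ae_restrict_of_ae (ae_pressure_nonneg ha hρ))]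

lemma IsStressBound.pressDefect_apply (hG : G.Admissible) (ha : 0 ≤ a)
    (h : IsStressBound a γ ρ m L) (hρ : 0 ≤ᵐ[G.vol] ρ) {B : Set (Space d)} (hB : MeasurableSet B) :
    pressDefect a ρ L B
      = stressMeas L (scalarStress d) B - ofReal (pressMeasure a ρ B) := by
  have := isFiniteMeasure_withDensity_pressure (a := a) hρ
  rw [pressDefect, Measure.sub_apply hB (h.withDensity_pressure_le hG ha hρ),
    ofReal_pressMeasure ha hρ hB]

lemma pressMeasure_nonneg (ha : 0 ≤ a) (hρ : 0 ≤ᵐ[G.vol] ρ) {B : Set (Space d)}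
    (hB : MeasurableSet B) : 0 ≤ pressMeasure a ρ B := by
  rw [pressMeasure, withDensityᵥ_apply (integrable_pressure hρ) hB]
  exact integral_nonneg_of_ae (ae_restrict_of_ae (ae_pressure_nonneg ha hρ))

lemma IsStressBound.state_add_defect (hG : G.Admissible) (ha : 0 ≤ a)
    (h : IsStressBound a γ ρ m L) (hρ : 0 ≤ᵐ[G.vol] ρ) :
    stateStress a ρ m + defectStress (convDefect ρ m L) (pressDefect a ρ L)
      = stressOf (convMeas L) (stressMeas L (scalarStress d)).toSignedMeasure := by
  have h1 : ∀ i j, flux ρ m i j + convDefect ρ m L i j = convMeas L i j := fun i j => by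
    rw [convDefect]; abel
  have h2 : pressMeasure a ρ + signedDefect (pressDefect a ρ L)
      = (stressMeas L (scalarStress d)).toSignedMeasure := by
    ext B hB
    have h3 : ofReal (pressMeasure a ρ B) ≤ stressMeas L (scalarStress d) B :=
      (ofReal_pressMeasure ha hρ hB).trans_le (h.withDensity_pressure_le hG ha hρ B)
    rw [signedDefect_eq, add_apply, Measure.toSignedMeasure_apply_measurable hB,
      Measure.toSignedMeasure_apply_measurable hB, measureReal_def,
      h.pressDefect_apply hG ha hρ hB, ENNReal.toReal_sub_of_le h3 (measure_ne_top _ _),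
      toReal_ofReal (pressMeasure_nonneg ha hρ hB), measureReal_def]
    ring
  rw [stateStress_add_defectStress, h2]
  simp_rw [h1]

lemma IsStressBound.stressOf_convMeas (h : IsStressBound a γ ρ m L) {F : C(Hull G, Stress d)}
    (hF : ∀ i j, IsPeriodicTest (stressEntry i j F)) (hF' : IsPeriodicTest (stressScalar F)) :
    stressOf (convMeas L) (stressMeas L (scalarStress d)).toSignedMeasure F = L F := by
  rw [stressOf_apply, sint_toSignedMeasure, integral_stressMeas h.isPositivePart_scalarStress hF']
  conv_rhs => rw [stress_eq_sum F]
  rw [map_add, map_sum]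
  congr 1
  refine sum_congr rfl fun i _ => ?_
  rw [map_sum]
  refine sum_congr rfl fun j _ => ?_
  have hm := measurable_zeroExt (stressEntry i j F)
  have hb : ∃ c, ∀ x, |zeroExt (stressEntry i j F) x| ≤ c := ⟨_, abs_zeroExt_le _⟩
  simp only [convMeas, sint_smul_measure, sint_sub_measure hm hb, sint_toSignedMeasure,
    integral_stressMeas (h.isPositivePart_squareStress _) (hF i j), h.polarization]

end Defects

/-! ### The energy inequality of a non-increasing energy -/

section AntitoneEnergy

/-- If the increments of `D` over `[s,t]` are at most `K (t - s)` times the decrease of another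
function, then `D` does not increase; this follows from fine subdivisions. -/
lemma le_of_sub_le_mul_antitone {D g : ℝ → ℝ} {K α β : ℝ} (hαβ : α ≤ β)
    (h : ∀ s t, α ≤ s → s ≤ t → t ≤ β → D t - D s ≤ K * (t - s) * (g s - g t)) : D β ≤ D α := by
  have hn : ∀ n : ℕ, D β - D α ≤ K * (β - α) * (g α - g β) * (1 / ((n : ℝ) + 1)) := by
    intro n
    have hn0 : (0 : ℝ) < (n : ℝ) + 1 := by positivity
    let x : ℕ → ℝ := fun i => α + i * ((β - α) / (n + 1))
    have hx0 : x 0 = α := by simp [x]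
    have hxn : x (n + 1) = β := by
      simp only [x]; push_cast; field_simp; ring
    have hstep : ∀ i, x (i + 1) - x i = (β - α) / (n + 1) := fun i => by
      simp only [x]; push_cast; ring
    have hδ : 0 ≤ (β - α) / (n + 1) := div_nonneg (sub_nonneg.2 hαβ) hn0.le
    have hmono : Monotone x := monotone_nat_of_le_succ fun i => by linarith [hstep i]
    have h1 : ∀ i ∈ Finset.range (n + 1), D (x (i + 1)) - D (x i)
        ≤ K * ((β - α) / (n + 1)) * (g (x i) - g (x (i + 1))) := by
      intro i hi
      rw [← hstep i]
      refine h _ _ ?_ (hmono (Nat.le_succ i)) ?_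
      · rw [← hx0]; exact hmono (Nat.zero_le i)
      · rw [← hxn]; exact hmono (Finset.mem_range.1 hi)
    have h2 := sum_le_sum h1
    rw [Finset.sum_range_sub (fun i => D (x i)), ← mul_sum,
      Finset.sum_range_sub' (fun i => g (x i)), hx0, hxn] at h2
    refine h2.trans (le_of_eq ?_)
    field_simp
  have h3 := ge_of_tendsto' (tendsto_one_div_add_atTop_nhds_zero_nat.const_mul _) hn
  rw [mul_zero] at h3
  linarith

/-- Integration by parts for a non-increasing function and a non-negative weight. -/
lemma mul_sub_mul_le_integral_of_antitone {g ψ : ℝ → ℝ} (hg : Antitone g) (hψ : ContDiff ℝ 1 ψ)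
    {α β : ℝ} (hαβ : α ≤ β) (hψ0 : ∀ t ∈ Icc α β, 0 ≤ ψ t) :
    ψ β * g β - ψ α * g α ≤ ∫ t in α..β, deriv ψ t * g t := by
  have hdc : Continuous (deriv ψ) := hψ.continuous_deriv le_rfl
  obtain ⟨K, hK⟩ := (isCompact_Icc (a := α) (b := β)).exists_bound_of_continuousOn hdc.continuousOn
  have hgi : ∀ s t, IntervalIntegrable (fun r => deriv ψ r * g r) volume s t := fun s t =>
    hg.intervalIntegrable.continuousOn_mul hdc.continuousOn
  -- on short intervals the inequality holds up to `K (t - s) (g s - g t)`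
  have hmain := le_of_sub_le_mul_antitone (g := g) (K := K)
    (D := fun t => ψ t * g t - ∫ r in α..t, deriv ψ r * g r) hαβ (fun s t hs hst ht => ?_)
  · simp only [intervalIntegral.integral_same, sub_zero] at hmain
    linarith
  · have e1 := integral_interval_sub_left (hgi α t) (hgi α s)
    have e2 : ∫ r in s..t, deriv ψ r = ψ t - ψ s :=
      integral_deriv_eq_sub (fun x _ => hψ.differentiable one_ne_zero x)
        (hdc.intervalIntegrable _ _)
    have e3 : ∫ r in s..t, deriv ψ r * (g t - g r) = (ψ t - ψ s) * g t - ∫ r in s..t,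
      deriv ψ r * g r := by
      simp_rw [mul_sub]
      rw [intervalIntegral.integral_sub ((hdc.intervalIntegrable _ _).mul_const _) (hgi s t),
        intervalIntegral.integral_mul_const, e2]
    have e4 : |∫ r in s..t, deriv ψ r * (g t - g r)| ≤ K * (g s - g t) * |t - s| := by
      rw [← norm_eq_abs]
      refine norm_integral_le_of_norm_le_const fun r hr => ?_
      rw [uIoc_of_le hst] at hr
      have h1 := hg hr.1.le
      have h2 := hg hr.2
      rw [norm_mul, norm_eq_abs (g t - g r), abs_of_nonpos (by linarith)]
      have h3 := hK r ⟨by linarith [hr.1], by linarith [hr.2]⟩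
      exact mul_le_mul h3 (by linarith) (by linarith) ((norm_nonneg _).trans h3)
    rw [abs_of_nonneg (sub_nonneg.2 hst)] at e4
    have e5 := (abs_le.1 e4).2
    have e6 : ψ s * (g t - g s) ≤ 0 :=
      mul_nonpos_of_nonneg_of_nonpos (hψ0 s ⟨hs, hst.trans ht⟩) (by linarith [hg hst])
    nlinarith

/-- The energy inequality for the one-sided limits of a non-increasing function. -/
lemma energy_inequality_of_antitone {g ψ : ℝ → ℝ} (hg : Antitone g) (hψ : ContDiff ℝ 1 ψ) {T : ℝ}
    (hψ0 : ∀ t ∈ Ico 0 T, 0 ≤ ψ t) {τ₁ τ₂ : ℝ} (h0 : 0 ≤ τ₁) (h12 : τ₁ ≤ τ₂) (h2 : τ₂ < T) {y : ℝ}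
    (hy : 0 < τ₁ → Tendsto g (𝓝[<] τ₁) (𝓝 y)) (hy0 : τ₁ = 0 → g 0 ≤ y) {z : ℝ}
    (hz : Tendsto g (𝓝[>] τ₂) (𝓝 z)) :
    ψ τ₂ * z - ψ τ₁ * y ≤ ∫ t in τ₁..τ₂, deriv ψ t * g t := by
  have hdc : Continuous (deriv ψ) := hψ.continuous_deriv le_rfl
  have hgi : ∀ s t, IntervalIntegrable (fun r => deriv ψ r * g r) volume s t := fun s t =>
    hg.intervalIntegrable.continuousOn_mul hdc.continuousOn
  have hI : ∀ s, Continuous fun t => ∫ r in s..t, deriv ψ r * g r := fun s =>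
    intervalIntegral.continuous_primitive hgi s
  -- the limit at the upper end
  have hup : ∀ s ∈ Icc 0 τ₁, ψ τ₂ * z - ψ s * g s ≤ ∫ t in s..τ₂, deriv ψ t * g t := by
    intro s hs
    refine le_of_tendsto_of_tendsto (((hψ.continuous.tendsto τ₂).mono_left
      nhdsWithin_le_nhds).mul hz |>.sub_const (ψ s * g s))
      (((hI s).tendsto τ₂).mono_left nhdsWithin_le_nhds) ?_
    filter_upwards [Ioo_mem_nhdsGT h2] with t ht
    exact mul_sub_mul_le_integral_of_antitone hg hψ (by linarith [hs.2, ht.1])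
      fun r hr => hψ0 r ⟨hs.1.trans hr.1, hr.2.trans_lt ht.2⟩
  rcases h0.eq_or_lt with h | h
  · have h3 := hup 0 ⟨le_rfl, h0⟩
    rw [← h]
    have h4 := mul_le_mul_of_nonneg_left (hy0 h.symm)
      (hψ0 0 ⟨le_rfl, h0.trans_lt (h12.trans_lt h2)⟩)
    linarith
  · refine le_of_tendsto_of_tendsto ((((hψ.continuous.tendsto τ₁).mono_left
      nhdsWithin_le_nhds).mul (hy h)).const_sub (ψ τ₂ * z))
      (b := 𝓝[<] τ₁) (g := fun s => ∫ t in s..τ₂, deriv ψ t * g t) ?_ ?_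
    · have h5 : Continuous fun s => ∫ t in s..τ₂, deriv ψ t * g t := by
        simp_rw [intervalIntegral.integral_symm τ₂]
        exact (hI τ₂).neg
      exact (h5.tendsto τ₁).mono_left nhdsWithin_le_nhds
    · filter_upwards [Ioo_mem_nhdsLT h] with s hs using hup s ⟨hs.1.le, hs.2.le⟩

end AntitoneEnergy

/-! ### Curves of test functions -/

section Curves

variable {d : ℕ} {G : FluidDomain d} {E : Type*} [NormedAddCommGroup E] [NormedSpace ℝ E]

/-- The restriction of a continuous function to the closure of the domain. -/
def toHull {f : Space d → E} (hf : Continuous f) : C(Hull G, E) :=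
  (⟨f, hf⟩ : C(Space d, E)).restrict (closure G.cell)

variable [CompactSpace (Hull G)]

lemma continuous_toHull_curve {f : ℝ → Space d → E}
    (hf : Continuous fun z : ℝ × Space d => f z.1 z.2) (hft : ∀ t, Continuous (f t)) :
    Continuous fun t => toHull (G := G) (hft t) := by
  refine ContinuousMap.continuous_of_continuous_uncurry _ ?_
  exact hf.comp (continuous_fst.prodMk (continuous_subtype_val.comp continuous_snd))

lemma deriv_slice {φ : ℝ → Space d → E} (hφ : ContDiff ℝ 1 fun z : ℝ × Space d => φ z.1 z.2)
    (t : ℝ) (x : Space d) : HasDerivAt (fun s => φ s x)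
      (fderiv ℝ (fun z : ℝ × Space d => φ z.1 z.2) (t, x) (1, 0)) t := by
  have h1 : HasDerivAt (fun s : ℝ => ((s, x) : ℝ × Space d)) (1, 0) t :=
    (hasDerivAt_id t).prodMk (hasDerivAt_const t x)
  exact ((hφ.differentiable one_ne_zero (t, x)).hasFDerivAt).comp_hasDerivAt t h1

lemma continuous_deriv_slice {φ : ℝ → Space d → E}
    (hφ : ContDiff ℝ 1 fun z : ℝ × Space d => φ z.1 z.2) :
    Continuous fun z : ℝ × Space d => deriv (fun s => φ s z.2) z.1 := by
  simp_rw [fun z : ℝ × Space d => (deriv_slice hφ z.1 z.2).deriv]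
  exact (hφ.continuous_fderiv one_ne_zero).clm_apply continuous_const

lemma contDiff_slice {φ : ℝ → Space d → E}
    (hφ : ContDiff ℝ 1 fun z : ℝ × Space d => φ z.1 z.2) (t : ℝ) : ContDiff ℝ 1 (φ t) :=
  hφ.comp (contDiff_const.prodMk contDiff_id)

/-- The curve `t ↦ φ(t, ·)` in `C(closure Ω)` is differentiable. -/
lemma hasDerivAt_toHull [CompleteSpace E] {φ : ℝ → Space d → E}
    (hφ : ContDiff ℝ 1 fun z : ℝ × Space d => φ z.1 z.2) (hφt : ∀ t, Continuous (φ t))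
    (hdt : ∀ t, Continuous fun x => deriv (fun s => φ s x) t) (t : ℝ) :
    HasDerivAt (fun t => toHull (G := G) (hφt t)) (toHull (G := G) (hdt t)) t := by
  have hc : Continuous fun t => toHull (G := G) (hdt t) :=
    continuous_toHull_curve (continuous_deriv_slice hφ) hdt
  have h1 : ∀ t, toHull (G := G) (hφt t)
      = toHull (G := G) (hφt 0) + ∫ s in (0 : ℝ)..t, toHull (G := G) (hdt s) := by
    intro t
    ext x
    have h2 := (ContinuousMap.evalCLM ℝ x).intervalIntegral_comp_comm
      (hc.intervalIntegrable (μ := volume) 0 t)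
    have h3 : ∫ s in (0 : ℝ)..t, deriv (fun s => φ s x) s = φ t x - φ 0 x :=
      integral_deriv_eq_sub
        (fun s _ => (deriv_slice hφ s x).differentiableAt)
        (((continuous_deriv_slice hφ).comp (continuous_id.prodMk
          continuous_const)).intervalIntegrable
          _ _)
    change φ t x = φ 0 x + ContinuousMap.evalCLM ℝ x (∫ s in (0 : ℝ)..t, toHull (G := G) (hdt s))
    rw [← h2]
    change φ t x = φ 0 x + ∫ s in (0 : ℝ)..t, deriv (fun s => φ s x) s
    rw [h3]
    abel
  rw [funext h1]
  exact (intervalIntegral.integral_hasDerivAt_right (hc.intervalIntegrable _ _)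
    (hc.stronglyMeasurableAtFilter _ _) hc.continuousAt).const_add _

end Curves

section HullFunctional

variable {d : ℕ} {G : FluidDomain d} [CompactSpace (Hull G)] {E : Type*} [NormedAddCommGroup E]
  [InnerProductSpace ℝ E] [MeasurableSpace E] [BorelSpace E] [SecondCountableTopology E]
  {p : ℝ≥0∞} [hp : Fact (1 ≤ p)]

lemma norm_zeroExt_le (f : C(Hull G, E)) (x : Space d) : ‖zeroExt f x‖ ≤ ‖f‖ := by
  by_cases h : x ∈ closure G.cell
  · rw [zeroExt_of_mem _ h]; exact f.norm_coe_le_norm _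
  · rw [zeroExt_of_notMem _ h, norm_zero]; exact norm_nonneg _

lemma isWeight_zeroExt (f : C(Hull G, E)) : IsWeight G.vol (zeroExt f) :=
  isWeight_of_bounded (measurable_zeroExt f) ⟨_, norm_zeroExt_le f⟩

/-- A continuous function as a functional on states. -/
abbrev hullTest (f : C(Hull G, E)) : StrongDual ℝ (Lp E p G.vol) :=
  weightFunctional (isWeight_zeroExt f)

/-- A state as a functional on continuous functions. -/
def hullFunctional (v : Lp E p G.vol) : StrongDual ℝ C(Hull G, E) :=
  LinearMap.mkContinuous
    { toFun := fun f => ∫ x, inner ℝ (v x) (zeroExt f x) ∂G.vol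
      map_add' := fun f g => by
        have hv : Integrable v G.vol := (Lp.memLp v).integrable hp.out
        rw [← integral_add (integrable_inner_weight (isWeight_zeroExt f) hv)
          (integrable_inner_weight (isWeight_zeroExt g) hv)]
        refine integral_congr_ae (ae_of_all _ fun x => ?_)
        simp only
        rw [← inner_add_right]
        congr 1
        by_cases h : x ∈ closure G.cell
        · simp [zeroExt_of_mem _ h]
        · simp [zeroExt_of_notMem _ h]
      map_smul' := fun c f => by
        rw [RingHom.id_apply, smul_eq_mul, ← integral_const_mul]
        refine integral_congr_ae (ae_of_all _ fun x => ?_)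
        simp only
        rw [← real_inner_smul_right]
        congr 1
        by_cases h : x ∈ closure G.cell
        · simp [zeroExt_of_mem _ h]
        · simp [zeroExt_of_notMem _ h] }
    ((G.vol univ ^ (1 - 1 / p.toReal)).toReal * ‖v‖) fun f =>
      (abs_integral_inner_le (norm_nonneg f) (ae_of_all _ (norm_zeroExt_le f)) v).trans
        (le_of_eq (by ring))

lemma hullFunctional_apply (v : Lp E p G.vol) (f : C(Hull G, E)) :
    hullFunctional v f = hullTest f v := rfl

lemma norm_hullFunctional_le {v : Lp E p G.vol} {M : ℝ} (h : ‖v‖ ≤ M) :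
    ‖hullFunctional v‖ ≤ (G.vol univ ^ (1 - 1 / p.toReal)).toReal * M :=
  (LinearMap.mkContinuous_norm_le _ (by positivity) _).trans
    (mul_le_mul_of_nonneg_left h toReal_nonneg)

lemma hullFunctional_toHull (hG : G.Admissible) (v : Lp E p G.vol) {f : Space d → E}
    (hf : Continuous f) : hullFunctional v (toHull hf) = ∫ x, inner ℝ (v x) (f x) ∂G.vol := by
  rw [hullFunctional_apply, weightFunctional_apply]
  refine integral_congr_ae ?_
  filter_upwards [ae_mem_cell hG] with x hx
  rw [zeroExt_of_mem _ (subset_closure hx)]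
  rfl

/-- A bound almost everywhere along a weakly continuous trajectory holds everywhere. -/
lemma norm_val_le_of_ae {X : Type} [NormedAddCommGroup X] [NormedSpace ℝ X] {T M : ℝ} (hT : 0 < T)
    (u : CWeak T X) (h : ∀ᵐ t ∂dt[T], ‖u.val t‖ ≤ M) :
    ∀ t ∈ Icc 0 T, ‖u.val t‖ ≤ M := by
  rw [ae_restrict_iff' measurableSet_Ioo] at h
  have hden : Dense {t | t ∈ Ioo 0 T → ‖u.val t‖ ≤ M} := Measure.dense_of_ae h
  have hM : 0 ≤ M := by
    obtain ⟨s, hs, hs'⟩ := hden.exists_mem_open isOpen_Ioo (nonempty_Ioo.2 hT)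
    exact (norm_nonneg _).trans (hs hs')
  intro t ht
  refine NormedSpace.norm_le_dual_bound ℝ _ hM fun L => ?_
  have hc := (continuous_val u L).norm
  have hs : Ioo 0 T ∩ {t | t ∈ Ioo 0 T → ‖u.val t‖ ≤ M} ⊆ {t | ‖L (u.val t)‖ ≤ M * ‖L‖} := by
    intro s hs
    exact (L.le_opNorm _).trans ((mul_comm _ _).le.trans
      (mul_le_mul_of_nonneg_right (hs.2 hs.1) (norm_nonneg _)))
  have hcl : Icc 0 T ⊆ closure (Ioo 0 T ∩ {t | t ∈ Ioo 0 T → ‖u.val t‖ ≤ M}) := by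
    rw [← closure_Ioo hT.ne]
    exact closure_minimal (hden.open_subset_closure_inter isOpen_Ioo) isClosed_closure
  obtain ⟨w, hw, hwt⟩ := mem_closure_iff_seq_limit.1 (hcl ht)
  have hwI : Tendsto w atTop (𝓝[Icc 0 T] t) := tendsto_nhdsWithin_iff.2
    ⟨hwt, Eventually.of_forall fun n => Ioo_subset_Icc_self (hw n).1⟩
  exact le_of_tendsto' ((hc t ht).tendsto.comp hwI) fun n => hs (hw n)

end HullFunctional

/-! ### Relaxed solutions are dissipative solutions -/

section FromRelaxed

variable {d : ℕ} {G : FluidDomain d} [CompactSpace (Hull G)] {a γ T E₀ : ℝ} [hγ : Fact (1 < γ)]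
  {u : Trajectory G γ T} {Λ : ℝ → StressDual G}

lemma stressMeas_real_le (L : StressDual G) {S : Stress d}
    (h : IsPositivePart L S) {C : ℝ} (hC : ‖L‖ ≤ C) :
    (stressMeas L S).real univ ≤ C * ‖stressTest (G := G) S 1‖ := by
  rw [stressMeas_univ h]
  exact (le_abs_self _).trans ((L.le_opNorm _).trans
    (mul_le_mul_of_nonneg_right hC (norm_nonneg _)))

lemma variation_sub_real_le (s s' : SignedMeasure (Space d)) :
    (s - s').variation.real univ ≤ s.variation.real univ + s'.variation.real univ := by
  rw [← measureReal_add_apply]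
  exact toReal_mono (measure_ne_top _ _) (VectorMeasure.variation_sub_le univ)

lemma variation_smul_real (c : ℝ) (s : SignedMeasure (Space d)) :
    (c • s).variation.real univ = |c| * s.variation.real univ := by
  rw [VectorMeasure.variation_smul, measureReal_def, measureReal_def, Measure.smul_apply]
  simp [toReal_mul]

lemma IsRelaxed.ae_good (h : IsRelaxed a γ T E₀ u Λ) (ha : 0 ≤ a) :
    ∀ᵐ t ∂dt[T], 0 ≤ᵐ[G.vol] u.1.val t ∧
      IsStressBound a γ (u.1.val t) (u.2.val t) (Λ t) ∧
      fluidEnergy G a γ (u.1.val t) (u.2.val t) ≤ ofReal E₀ := by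
  obtain ⟨S, hS, -, hle⟩ := h.stress.energy
  filter_upwards [h.stress.bound, hS, ae_mem_Icc T] with t ht htS htT
  have hρ := h.nonneg t htT
  exact ⟨hρ, ht, (ht.fluidEnergy_le ha hρ).trans (ofReal_le_ofReal (hle t htS))⟩

/-- A bound for the states of a relaxed solution of total energy at most `E₀`. -/
def stateBound (a γ E₀ : ℝ) : ℝ :=
  max (((γ - 1) / a * E₀) ^ (1 / γ))
    ((2 * E₀ + (γ - 1) / a * E₀) ^ (1 / (2 * γ / (γ + 1))))

lemma IsRelaxed.norm_le (h : IsRelaxed a γ T E₀ u Λ) (ha : 0 < a) (hT : 0 < T) (hE₀ : 0 ≤ E₀) :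
    u ∈ boundedTrajectories G γ T (stateBound a γ E₀) := by
  have h1 : ∀ᵐ t ∂dt[T],
      ‖u.1.val t‖ ≤ stateBound a γ E₀ ∧ ‖u.2.val t‖ ≤ stateBound a γ E₀ := by
    filter_upwards [h.ae_good ha.le] with t ht
    have h2 := norm_rpow_le_of_energy ha ht.1 hE₀ ht.2.2
    exact ⟨h2.1.trans (le_max_left _ _), h2.2.trans (le_max_right _ _)⟩
  exact fun t ht => ⟨norm_val_le_of_ae hT u.1 (h1.mono fun t ht => ht.1) t ht,
    norm_val_le_of_ae hT u.2 (h1.mono fun t ht => ht.2) t ht⟩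

lemma ofReal_measureReal_univ (μ : Measure (Space d)) [IsFiniteMeasure μ] :
    ofReal (μ.real univ) = μ univ := ofReal_toReal (measure_ne_top _ _)

lemma IsRelaxed.isConvectiveDefect (hG : G.Admissible) (ha : 0 ≤ a) (hE₀ : 0 ≤ E₀)
    (h : IsRelaxed a γ T E₀ u Λ) :
    IsConvectiveDefect G T fun t => convDefect (u.1.val t) (u.2.val t) (Λ t) := by
  have hgood := h.ae_good ha
  have hk : ∀ᵐ t ∂dt[T], ∀ i,
      ∫⁻ x, kin (u.1.val t x) (u.2.val t x i) ∂G.vol < ∞ := by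
    filter_upwards [hgood] with t ht using lintegral_kin_lt_top (ht.2.2.trans_lt ofReal_lt_top)
  have hmeas : ∀ ξ : Fin d → ℝ, ∀ B, MeasurableSet B →
      AEMeasurable (fun t => (stressMeas (Λ t) (squareStress ξ)).real B) dt[T] :=
    fun ξ B hB => (aemeasurable_stressMeas h.stress.measurable (by
      filter_upwards [hgood] with t ht using ht.2.1.isPositivePart_squareStress ξ)
        hB).ennreal_toReal
  refine ⟨fun i j B hB => ?_, ?_, ?_, ?_, ?_⟩
  · have h1 : (fun t => convDefect (u.1.val t) (u.2.val t) (Λ t) i j B)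
        = fun t => 1 / 2 * ((stressMeas (Λ t) (squareStress (Pi.single i 1 + Pi.single j 1))).real B
          - (stressMeas (Λ t) (squareStress (Pi.single i 1))).real B
          - (stressMeas (Λ t) (squareStress (Pi.single j 1))).real B)
          - flux (u.1.val t) (u.2.val t) i j B := by
      funext t
      rw [convDefect, sub_apply, convMeas_apply _ _ _ hB]
    rw [h1]
    exact ((((hmeas _ B hB).sub (hmeas _ B hB)).sub (hmeas _ B hB)).const_mul _).sub
      (aemeasurable_flux u h.nonneg hk i j hB)
  · obtain ⟨C, hC⟩ := h.stress.bounded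
    let K : Fin d → Fin d → ℝ := fun i j =>
      1 / 2 * (C * ‖stressTest (G := G) (squareStress (Pi.single i 1 + Pi.single j 1)) 1‖
        + C * ‖stressTest (G := G) (squareStress (Pi.single i 1)) 1‖
        + C * ‖stressTest (G := G) (squareStress (Pi.single j 1)) 1‖) + 4 * E₀
    obtain ⟨M, hM⟩ : ∃ M, ∀ p : Fin d × Fin d, K p.1 p.2 ≤ M :=
      (Set.finite_range fun p : Fin d × Fin d => K p.1 p.2).bddAbove.imp
        fun M hM p => hM ⟨p, rfl⟩
    refine ⟨M.toNNReal, ?_⟩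
    filter_upwards [hgood, hC] with t ht htC i j
    rw [← ofReal_measureReal_univ]
    refine ofReal_le_ofReal (le_trans ?_ (hM (i, j)))
    have hr : ∀ ξ : Fin d → ℝ,
        (stressMeas (Λ t) (squareStress ξ)).toSignedMeasure.variation.real univ
        ≤ C * ‖stressTest (G := G) (squareStress ξ) 1‖ := fun ξ => by
      rw [Measure.variation_toSignedMeasure]
      exact stressMeas_real_le _ (ht.2.1.isPositivePart_squareStress ξ) htC
    refine (variation_sub_real_le _ _).trans (add_le_add ?_
      (variation_flux_le ha ht.1 hE₀ ht.2.2 i j))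
    rw [convMeas, variation_smul_real, abs_of_nonneg (by norm_num)]
    refine mul_le_mul_of_nonneg_left ?_ (by norm_num)
    refine (variation_sub_real_le _ _).trans (add_le_add ?_ (hr _))
    exact (variation_sub_real_le _ _).trans (add_le_add (hr _) (hr _))
  · filter_upwards [hgood] with t ht i j B hB hd
    have hm := measurableSet_closedCell hG
    have h0 : ∀ S : Stress d, (stressMeas (Λ t) S).real B = 0 := fun S => by
      rw [measureReal_def, measure_mono_null (fun x hx hc => disjoint_left.1 hd hx hc)
        (stressMeas_compl (Λ t) S hm), toReal_zero]
    have hv : G.vol B = 0 := by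
      refine measure_mono_null (t := G.cellᶜ) (fun x hx hc =>
        disjoint_left.1 hd hx (cell_subset_closedCell hc)) ?_
      exact ae_mem_cell hG
    rw [convDefect, sub_apply, convMeas_apply _ _ _ hB, h0, h0, h0, flux,
      withDensityᵥ_apply (integrable_flux ht.1 (ht.2.1.kin_lt_top ht.1) i j) hB,
      Measure.restrict_eq_zero.2 hv]
    simp
  · refine ae_of_all _ fun t i j => ?_
    rw [convDefect, convDefect, convMeas_symm, flux, flux]
    simp_rw [mul_comm]
  -- the quadratic form of the defect is the excess of the stress over the kinetic term
  · filter_upwards [hgood] with t ht ξ B hB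
    have h1 := ht.2.1.setIntegral_kin_le hG ht.1 ξ hB
    rw [← ht.2.1.sum_convMeas ξ hB, ← sub_nonneg, ← sum_sub_distrib] at h1
    simp_rw [← sum_sub_distrib, ← mul_sub] at h1
    exact h1

lemma IsRelaxed.isPressureDefect (hG : G.Admissible) (ha : 0 ≤ a)
    (h : IsRelaxed a γ T E₀ u Λ) :
    IsPressureDefect G T fun t => pressDefect a (u.1.val t) (Λ t) := by
  have hgood := h.ae_good ha
  have hpos : ∀ᵐ t ∂dt[T], IsPositivePart (Λ t) (scalarStress d) := by
    filter_upwards [hgood] with t ht using ht.2.1.isPositivePart_scalarStress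
  refine ⟨fun B hB => ?_, ?_, ?_⟩
  · refine ((aemeasurable_stressMeas h.stress.measurable hpos hB).sub
      (aemeasurable_pressMeasure ha u h.nonneg hB).ennreal_ofReal).congr ?_
    filter_upwards [hgood] with t ht using (ht.2.1.pressDefect_apply hG ha ht.1 hB).symm
  · obtain ⟨C, hC⟩ := h.stress.bounded
    refine ⟨(C * ‖stressTest (G := G) (scalarStress d) 1‖).toNNReal, ?_⟩
    filter_upwards [hC, hpos] with t htC ht
    refine (Measure.sub_le univ).trans ?_
    rw [← ofReal_measureReal_univ]
    exact ofReal_le_ofReal (stressMeas_real_le _ ht htC)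
  · exact ae_of_all _ fun t => le_antisymm ((Measure.sub_le _).trans_eq
      (stressMeas_compl (Λ t) (scalarStress d) (measurableSet_closedCell hG))) bot_le

lemma isPeriodicTest_gradTest {φ : Space d → Space d} (hφ : ContDiff ℝ 1 φ)
    (hp : G.RespectsPeriods φ) : (∀ i j, IsPeriodicTest (stressEntry i j (gradTest (G := G) hφ))) ∧
      IsPeriodicTest (stressScalar (gradTest (G := G) hφ)) := by
  have h1 : ∀ i j, G.RespectsPeriods fun x => grad φ x i j := by
    intro i j
    cases G with
    | bounded Ω => trivial
    | torus =>
      intro x k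
      have h2 : (fun y => φ (y + single k 2)) = φ := funext fun y => hp y k
      have h3 : fderiv ℝ φ (x + single k 2) = fderiv ℝ φ x := by
        rw [← fderiv_comp_add_right, h2]
      simp only [grad, h3]
  refine ⟨fun i j => ⟨fun x => grad φ x i j, h1 i j, fun x hx => rfl⟩, divg φ, ?_, fun x hx => rfl⟩
  cases G with
  | bounded Ω => trivial
  | torus => exact fun x k => sum_congr rfl fun i _ => h1 i i x k

lemma isPeriodicTest_stressTest_one (S : Stress d) :
    (∀ i j, IsPeriodicTest (stressEntry i j (stressTest (G := G) S 1))) ∧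
      IsPeriodicTest (stressScalar (stressTest (G := G) S 1)) := by
  have h1 : ∀ c : ℝ, G.RespectsPeriods fun _ : Space d => c := by
    intro c
    cases G with
    | bounded Ω => trivial
    | torus => exact fun _ _ => rfl
  exact ⟨fun i j => ⟨_, h1 (S.1 i j), fun x hx => by simp [stressEntry, stressTest_apply]⟩,
    _, h1 S.2, fun x hx => by simp [stressScalar, stressTest_apply]⟩

lemma IsRelaxed.continuityEquation (hG : G.Admissible) (ha : 0 < a) (hT : 0 < T) (hE₀ : 0 ≤ E₀)
    (h : IsRelaxed a γ T E₀ u Λ) : ContinuityEquation G γ T u := by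
  intro φ hφ τ hτ
  have hφt := contDiff_slice hφ.contDiff
  have hdt : ∀ t, Continuous fun x => deriv (fun s => φ s x) t := fun t =>
    (continuous_deriv_slice hφ.contDiff).comp (continuous_const.prodMk continuous_id)
  have hnorm := h.norm_le ha hT hE₀
  have hg : Continuous fun z : ℝ × Space d => gradient (φ z.1) z.2 := by
    have h1 : Continuous fun z : ℝ × Space d => fderiv ℝ (φ z.1) z.2 := by
      have h2 : ∀ z : ℝ × Space d, fderiv ℝ (φ z.1) z.2
          = (fderiv ℝ (fun z : ℝ × Space d => φ z.1 z.2) z).comp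
            (ContinuousLinearMap.inr ℝ ℝ (Space d)) := fun z => by
        have h3 : HasFDerivAt (fun x : Space d => ((z.1, x) : ℝ × Space d))
          (ContinuousLinearMap.inr ℝ ℝ (Space d)) z.2 := hasFDerivAt_prodMk_right z.1 z.2
        have h4 := ((hφ.contDiff.differentiable one_ne_zero z).hasFDerivAt).comp z.2 h3
        exact h4.fderiv
      simp_rw [h2]
      exact (hφ.contDiff.continuous_fderiv one_ne_zero).clm_comp continuous_const
    exact (InnerProductSpace.toDual ℝ (Space d)).symm.continuous.comp h1
  have hgt : ∀ t, Continuous (gradient (φ t)) := fun t => continuous_gradient (hφt t)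
  have hW : ∀ z : C(Hull G, ℝ), ContinuousOn (fun t => hullFunctional (u.1.val t) z) (Icc 0 T) :=
    fun z => continuous_val u.1 (hullTest z)
  have hΛ : ∀ z : C(Hull G, Space d),
      ContinuousOn (fun t => hullFunctional (u.2.val t) z) (Icc 0 T) :=
    fun z => continuous_val u.2 (hullTest z)
  obtain ⟨-, -, h1⟩ := eq_integral_of_static (T := T)
    (W := fun t => hullFunctional (u.1.val t)) hW
    (fun t ht => norm_hullFunctional_le (hnorm t ht).1)
    (Λ := fun t => hullFunctional (u.2.val t))
    (fun z => ((hΛ z).mono Ioo_subset_Icc_self).aemeasurable measurableSet_Ioo)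
    ((ae_mem_Icc T).mono fun t ht => norm_hullFunctional_le (hnorm t ht).2)
    (hasDerivAt_toHull (G := G) hφ.contDiff (fun t => (hφt t).continuous) hdt)
    (continuous_toHull_curve (continuous_deriv_slice hφ.contDiff) hdt)
    (F := fun t => toHull (G := G) (hgt t)) (continuous_toHull_curve hg hgt)
    (fun s _ τ hτ => by
      have h2 := h.mass (φ s) ⟨hφt s, hφ.periodic s⟩ τ hτ
      simp only [hullFunctional_toHull hG, ← fderiv_eq_inner_gradient]
      simpa [mul_comm] using h2) (Ioo_subset_Icc_self hτ)
  simp only [hullFunctional_toHull hG, ← fderiv_eq_inner_gradient] at h1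
  have h3 : ∀ x y : ℝ, inner ℝ x y = x * y := fun x y => by simp [mul_comm]
  simp only [h3] at h1
  rw [h1]
  refine intervalIntegral.integral_congr fun t _ => ?_
  have i1 := integrable_inner_weight (isWeight_of_continuous hG (hdt t))
    ((Lp.memLp (u.1.val t)).integrable Fact.out)
  have i2 := integrable_inner_weight (isWeight_of_continuous hG (hgt t))
    ((Lp.memLp (u.2.val t)).integrable Fact.out)
  simp only [h3] at i1
  simp only [← fderiv_eq_inner_gradient] at i2
  exact (integral_add i1 i2).symm

lemma IsRelaxed.momentumEquation (hG : G.Admissible) (ha : 0 < a) (hT : 0 < T) (hE₀ : 0 ≤ E₀)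
    (h : IsRelaxed a γ T E₀ u Λ) :
    MomentumEquation G a γ T u (fun t => convDefect (u.1.val t) (u.2.val t) (Λ t))
      (fun t => pressDefect a (u.1.val t) (Λ t)) := by
  intro φ hφ τ hτ
  have hφt := contDiff_slice hφ.contDiff
  have hdt : ∀ t, Continuous fun x => deriv (fun s => φ s x) t := fun t =>
    (continuous_deriv_slice hφ.contDiff).comp (continuous_const.prodMk continuous_id)
  have hnorm := h.norm_le ha hT hE₀
  have hgood := h.ae_good ha.le
  have hτ' := Ioo_subset_Icc_self hτ
  have hF := continuous_gradTest_curve (G := G) hφ.contDiff hφt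
  have hW : ∀ z : C(Hull G, Space d),
      ContinuousOn (fun t => hullFunctional (u.2.val t) z) (Icc 0 T) :=
    fun z => continuous_val u.2 (hullTest z)
  obtain ⟨C, hC⟩ := h.stress.bounded
  obtain ⟨hX, -, h1⟩ := eq_integral_of_static (T := T)
    (W := fun t => hullFunctional (u.2.val t)) hW
    (fun t ht => norm_hullFunctional_le (hnorm t ht).2)
    (Λ := Λ) h.stress.measurable hC
    (hasDerivAt_toHull (G := G) hφ.contDiff (fun t => (hφt t).continuous) hdt)
    (continuous_toHull_curve (continuous_deriv_slice hφ.contDiff) hdt)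
    (F := fun t => gradTest (G := G) (hφt t)) hF
    (fun s hs τ hτ => by
      have h2 := h.momentum (φ s) ⟨hφt s, hφ.periodic s, hφ.impermeable s hs⟩ τ hτ
      simp only [hullFunctional_toHull hG]
      exact h2) hτ'
  simp only [hullFunctional_toHull hG] at h1 hX
  rw [h1, momentum_rhs (G := G) (φ := φ) hG ha.le h.nonneg hE₀ (hgood.mono fun t ht => ht.2.2)
    (h.isConvectiveDefect hG ha.le hE₀) (h.isPressureDefect hG ha.le) hφ.contDiff hφt hdt hτ' hX]
  refine intervalIntegral.integral_congr_ae ?_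
  filter_upwards [ae_mem_uIoc hgood ⟨le_rfl, hT.le⟩ hτ'] with t hg htI
  replace hg := hg htI
  have hp := isPeriodicTest_gradTest (G := G) (hφt t) (hφ.periodic t)
  rw [hg.2.1.state_add_defect hG ha.le hg.1, hg.2.1.stressOf_convMeas hp.1 hp.2]

lemma IsRelaxed.energyInequality (hG : G.Admissible) (ha : 0 < a)
    (h : IsRelaxed a γ T E₀ u Λ) (hfin : fluidEnergy G a γ (u.1.val 0) (u.2.val 0) < ∞)
    (hE : (fluidEnergy G a γ (u.1.val 0) (u.2.val 0)).toReal = E₀) :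
    EnergyInequality G a γ T u (fun t => convDefect (u.1.val t) (u.2.val t) (Λ t))
      (fun t => pressDefect a (u.1.val t) (Λ t)) := by
  have hE₀ : 0 ≤ E₀ := hE ▸ toReal_nonneg
  have hgood := h.ae_good ha.le
  have hRv := h.isConvectiveDefect hG ha.le hE₀
  have hRp := h.isPressureDefect hG ha.le
  set Rv : MatrixMeasures d := fun t => convDefect (u.1.val t) (u.2.val t) (Λ t) with hRvdef
  set Rp : ℝ → Measure (Space d) := fun t => pressDefect a (u.1.val t) (Λ t) with hRpdef
  have htot : ∀ᵐ t ∂dt[T],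
      (totalEnergy G a γ (u.1.val t) (u.2.val t) (Rv t) (Rp t)).toReal
        = Λ t (stressTest (energyStress d γ) 1) := by
    filter_upwards [hgood, hRv.supported, hRv.posSemidef, hRp.supported] with t ht hs hpos hps
    have hk := ht.2.1.kin_lt_top ht.1
    rw [← ht.2.1.stressOf_convMeas (isPeriodicTest_stressTest_one _).1
      (isPeriodicTest_stressTest_one _).2, ← ht.2.1.state_add_defect hG ha.le ht.1,
      stateStress_add_defectStress, signedDefect_eq]
    exact (stressOf_energy_eq_totalEnergy hG ha.le ht.1 hk
      hs hpos hps).symm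
  obtain ⟨S, hS, hanti, hle⟩ := h.stress.energy
  -- a non-increasing representative of the energy on the whole line
  obtain ⟨g, hg, hgS⟩ : ∃ g : ℝ → ℝ, Antitone g ∧ (∀ t, g t ≤ E₀) ∧
      ∀ᵐ t ∂dt[T], g t = Λ t (stressTest (energyStress d γ) 1) := by
    let S' : Set ℝ := {t | t ∈ S ∧ 0 ≤ Λ t (stressTest (energyStress d γ) 1)}
    have hsub : S' ⊆ S := fun t ht => ht.1
    obtain ⟨g, hg, hgS⟩ := (hanti.mono hsub).exists_antitone_extension
      ⟨0, by rintro _ ⟨t, ht, rfl⟩; exact ht.2⟩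
      ⟨E₀, by rintro _ ⟨t, ht, rfl⟩; exact hle t ht.1⟩
    refine ⟨fun t => min (g t) E₀, fun s t hst => min_le_min_right _ (hg hst),
      fun t => min_le_right _ _, ?_⟩
    filter_upwards [hS, htot] with t ht htt
    have h0 : t ∈ S' := ⟨ht, htt ▸ toReal_nonneg⟩
    have h1 := hgS h0
    simp only at h1
    rw [← h1, min_eq_left (hle t ht)]
  have hgE : ∀ᵐ t ∂dt[T],
      (totalEnergy G a γ (u.1.val t) (u.2.val t) (Rv t) (Rp t)).toReal = g t := by
    filter_upwards [htot, hgS.2] with t h1 h2 using h1.trans h2.symm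
  have hgE' := (ae_restrict_iff' measurableSet_Ioo).1 hgE
  refine ⟨hfin, ?_, fun τ => if τ = 0 then E₀ else Function.leftLim g τ, Function.rightLim g,
    ?_, ?_,
    ?_, ?_⟩
  · filter_upwards [hgood] with t ht
    refine ENNReal.add_lt_top.2 ⟨ENNReal.add_lt_top.2 ⟨ht.2.2.trans_lt ofReal_lt_top,
      ofReal_lt_top⟩, ENNReal.mul_lt_top ofReal_lt_top (measure_lt_top _ _)⟩
  · simp [hE]
  · intro τ hτ
    simp only [hτ.1.ne', if_false]
    refine ((hg.tendsto_leftLim τ).mono_left inf_le_left).congr' ?_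
    filter_upwards [mem_inf_of_left (Ioo_mem_nhdsLT hτ.1), mem_inf_of_right hgE'] with t ht ht'
    exact (ht' ⟨ht.1, ht.2.trans hτ.2⟩).symm
  · intro τ hτ
    refine ((hg.tendsto_rightLim τ).mono_left inf_le_left).congr' ?_
    filter_upwards [mem_inf_of_left (Ioo_mem_nhdsGT hτ.2), mem_inf_of_right hgE'] with t ht ht'
    exact (ht' ⟨hτ.1.trans_lt ht.1, ht.2⟩).symm
  · intro ψ hψ τ₁ τ₂ h0 h12 h2
    have h3 := energy_inequality_of_antitone hg hψ.contDiff hψ.nonneg h0 h12 h2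
      (y := if τ₁ = 0 then E₀ else Function.leftLim g τ₁)
      (fun hpos => by simpa only [hpos.ne', if_false] using hg.tendsto_leftLim τ₁)
      (fun hz => by simpa only [hz, if_true] using hgS.1 0) (hg.tendsto_rightLim τ₂)
    refine h3.trans (le_of_eq (intervalIntegral.integral_congr_ae ?_))
    filter_upwards [hgE'] with t ht htI
    rw [uIoc_of_le h12] at htI
    rw [ht ⟨h0.trans_lt htI.1, htI.2.trans_lt h2⟩]

/-- The excess of the stress functional over the stress of the state provides the defects. -/
lemma IsRelaxed.isDissipativeSolution (hG : G.Admissible) (ha : 0 < a) (hT : 0 < T)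
    (h : IsRelaxed a γ T E₀ u Λ) (hfin : fluidEnergy G a γ (u.1.val 0) (u.2.val 0) < ∞)
    (hE : (fluidEnergy G a γ (u.1.val 0) (u.2.val 0)).toReal = E₀) :
    IsDissipativeSolution G a γ T u := by
  have hE₀ : 0 ≤ E₀ := hE ▸ toReal_nonneg
  exact ⟨h.nonneg, h.continuityEquation hG ha hT hE₀, _, _, h.isConvectiveDefect hG ha.le hE₀,
    h.isPressureDefect hG ha.le, h.momentumEquation hG ha hT hE₀, h.energyInequality hG ha hfin hE⟩

end FromRelaxed

/-! ### Stability of relaxed solutions -/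

section Stability

variable {d : ℕ} {G : FluidDomain d} [CompactSpace (Hull G)] {a γ T E₀ : ℝ} [hγ : Fact (1 < γ)]
  {W : ℕ → ℕ →₀ ℝ}

lemma IsStressBound.of_tendsto_combo {ρ : ℕ → DensSpace G γ} {m : ℕ → MomSpace G γ}
    {L : ℕ → StressDual G} (h : ∀ n, IsStressBound a γ (ρ n) (m n) (L n))
    (hW : ∀ n, IsTailConvex n (W n)) {ρ' : DensSpace G γ} {m' : MomSpace G γ}
    {L' : StressDual G}
    (hρ : ∀ ℓ : StrongDual ℝ (DensSpace G γ), Tendsto (fun n => ℓ (ρ n)) atTop (𝓝 (ℓ ρ')))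
    (hm : ∀ ℓ : StrongDual ℝ (MomSpace G γ), Tendsto (fun n => ℓ (m n)) atTop (𝓝 (ℓ m')))
    (hL : ∀ F, Tendsto (fun n => combo (W n) fun j => L j F) atTop (𝓝 (L' F))) :
    IsStressBound a γ ρ' m' L' := by
  refine ⟨fun i j f => ?_, fun ξ f hf0 hfb α hα hαb => ?_, fun f hf0 hfb s hs hs0 hsb => ?_⟩
  · refine tendsto_nhds_unique (hL _) ((hL _).congr fun n => ?_)
    simp_rw [(h _).symm i j]
  · obtain ⟨ℓ, ℓ', hℓ⟩ := exists_convective_functional (G := G) (γ := γ) f.continuous.measurable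
      hfb ξ hα hαb
    refine le_of_tendsto_of_tendsto' (tendsto_combo hW ((hm ℓ).sub (hρ ℓ'))) (hL _)
      (fun n => (hW n).combo_mono fun j _ => ?_) |> fun h => (hℓ ρ' m').trans_le h
    exact (hℓ (ρ j) (m j)).symm.trans_le ((h j).convective ξ f hf0 hfb α hα hαb)
  · obtain ⟨c, ℓ, hℓ⟩ := exists_pressure_functional (G := G) (γ := γ) a f.continuous.measurable
      hfb hs hs0 hsb
    refine le_of_tendsto_of_tendsto' (tendsto_combo hW ((hρ ℓ).const_add c)) (hL _)
      (fun n => (hW n).combo_mono fun j _ => ?_) |> fun h => (hℓ ρ').trans_le h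
    exact (hℓ (ρ j)).symm.trans_le ((h j).pressure f hf0 hfb s hs hs0 hsb)

lemma IsPositivePart.abs_le {L : StressDual G} {S : Stress d}
    (h : IsPositivePart L S) (f : C(Hull G, ℝ)) :
    |L (stressTest S f)| ≤ L (stressTest S 1) * ‖f‖ := by
  have h1 : 0 ≤ ‖f‖ • (1 : C(Hull G, ℝ)) - f := fun x => by
    simpa using (le_abs_self _).trans (f.norm_coe_le_norm x)
  have h2 : 0 ≤ ‖f‖ • (1 : C(Hull G, ℝ)) + f := fun x => by
    have := (neg_le_abs _).trans (f.norm_coe_le_norm x)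
    change (0 : ℝ) ≤ ‖f‖ * 1 + f x
    linarith
  have h3 := h _ h1
  have h4 := h _ h2
  simp only [stressPart_apply, map_sub, map_add, map_smul, smul_eq_mul] at h3 h4
  rw [_root_.abs_le]
  constructor <;> linarith

/-- The stress functionals are controlled by the total energy, by positivity. -/
lemma exists_norm_le_energy (G : FluidDomain d) [CompactSpace (Hull G)] (a γ : ℝ)
    [hγ : Fact (1 < γ)] : ∃ K : ℝ, 0 ≤ K ∧ ∀ (ρ : DensSpace G γ) (m : MomSpace G γ)
      (L : StressDual G), IsStressBound a γ ρ m L →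
      ‖L‖ ≤ K * L (stressTest (energyStress d γ) 1) := by
  have hγ1 := sub_pos.2 hγ.out
  refine ⟨∑ i : Fin d, ∑ j : Fin d, 6 * ‖stressEntry (G := G) i j‖
    + (γ - 1) * ‖stressScalar (G := G)‖, by positivity, fun ρ m L h => ?_⟩
  set e := L (stressTest (energyStress d γ) 1) with he
  have hp := fun ξ => h.isPositivePart_squareStress ξ
  have hs := h.isPositivePart_scalarStress
  have hp1 : ∀ ξ, 0 ≤ L (stressTest (squareStress ξ) 1) := fun ξ => hp ξ 1 fun _ => zero_le_one
  have hs1 : 0 ≤ L (stressTest (scalarStress d) 1) := hs 1 fun _ => zero_le_one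
  have he' := apply_energyStress (γ := γ) L 1
  -- the energy is half the trace plus `1/(γ-1)` times the scalar part, all terms being positive
  have hu : ∀ i, L (stressTest (squareStress (Pi.single i 1)) 1) ≤ 2 * e := by
    intro i
    have h1 : L (stressTest (squareStress (Pi.single i 1)) 1)
        ≤ ∑ i, L (stressTest (unitStress i i) 1) := by
      rw [squareStress_single]
      refine single_le_sum (f := fun i => L (stressTest (unitStress i i) 1))
        (fun j _ => ?_) (Finset.mem_univ i)
      rw [← squareStress_single]; exact hp1 _
    have h2 : 0 ≤ 1 / (γ - 1) * L (stressTest (scalarStress d) 1) := by positivity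
    linarith
  have hsc : L (stressTest (scalarStress d) 1) ≤ (γ - 1) * e := by
    have h1 : 0 ≤ ∑ i, L (stressTest (unitStress i i) 1) := sum_nonneg fun j _ => by
      rw [← squareStress_single]; exact hp1 _
    have h2 : (γ - 1) * (1 / (γ - 1) * L (stressTest (scalarStress d) 1))
      = L (stressTest (scalarStress d) 1) := by field_simp
    rw [← h2]
    exact mul_le_mul_of_nonneg_left (by linarith) hγ1.le
  have he0 : 0 ≤ e := by nlinarith
  -- the parallelogram identity bounds the off-diagonal parts
  have hpar : ∀ i j, L (stressTest (squareStress (Pi.single i 1 + Pi.single j 1)) 1) ≤ 8 * e := by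
    intro i j
    have h1 : ∀ ξ η : Fin d → ℝ, stressTest (G := G) (squareStress (ξ + η)) 1
        + stressTest (squareStress (ξ - η)) 1
        = (2 : ℝ) • stressTest (squareStress ξ) 1 + (2 : ℝ) • stressTest (squareStress η) 1 := by
      intro ξ η
      ext x
      · simp [stressTest_apply, squareStress]; ring
      · simp [stressTest_apply, squareStress]
    have h2 := congrArg L (h1 (Pi.single i 1) (Pi.single j 1))
    simp only [map_add, map_smul, smul_eq_mul] at h2
    have h3 := hp1 (Pi.single i 1 - Pi.single j 1)
    have h4 := hu i
    have h5 := hu j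
    linarith
  have hij : ∀ i j f, |L (stressTest (unitStress i j) f)| ≤ 6 * e * ‖f‖ := by
    intro i j f
    rw [← h.polarization, abs_mul, abs_of_nonneg (by norm_num : (0 : ℝ) ≤ 1 / 2)]
    have h1 := ((hp (Pi.single i 1 + Pi.single j 1)).abs_le f).trans
      (mul_le_mul_of_nonneg_right (hpar i j) (norm_nonneg f))
    have h2 := ((hp (Pi.single i 1)).abs_le f).trans
      (mul_le_mul_of_nonneg_right (hu i) (norm_nonneg f))
    have h3 := ((hp (Pi.single j 1)).abs_le f).trans
      (mul_le_mul_of_nonneg_right (hu j) (norm_nonneg f))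
    have h4 := abs_sub (L (stressTest (squareStress (Pi.single i 1 + Pi.single j 1)) f)
      - L (stressTest (squareStress (Pi.single i 1)) f))
      (L (stressTest (squareStress (Pi.single j 1)) f))
    have h5 := abs_sub (L (stressTest (squareStress (Pi.single i 1 + Pi.single j 1)) f))
      (L (stressTest (squareStress (Pi.single i 1)) f))
    linarith
  refine L.opNorm_le_bound (by positivity) fun F => ?_
  conv_lhs => rw [stress_eq_sum F]
  rw [map_add, map_sum, norm_eq_abs]
  calc _ ≤ ∑ i, ∑ j, 6 * e * (‖stressEntry (G := G) i j‖ * ‖F‖)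
        + (γ - 1) * e * (‖stressScalar (G := G)‖ * ‖F‖) := by
        refine (abs_add_le _ _).trans (add_le_add ?_ ?_)
        · refine (Finset.abs_sum_le_sum_abs _ _).trans (sum_le_sum fun i _ => ?_)
          rw [map_sum]
          refine (Finset.abs_sum_le_sum_abs _ _).trans (sum_le_sum fun j _ => ?_)
          exact (hij i j _).trans (mul_le_mul_of_nonneg_left
            (ContinuousLinearMap.le_opNorm _ _) (by positivity))
        · exact (hs.abs_le _).trans (mul_le_mul hsc (ContinuousLinearMap.le_opNorm _ _)
            (norm_nonneg _) (by positivity))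
    _ = _ := by
        simp only [add_mul, sum_mul]
        congr 1
        · exact sum_congr rfl fun i _ => sum_congr rfl fun j _ => by ring
        · ring

lemma tendsto_intervalIntegral_of_bounded {f : ℕ → ℝ → ℝ} {g : ℝ → ℝ} {C : ℝ}
    (hm : ∀ n, AEMeasurable (f n) dt[T])
    (hb : ∀ᵐ t ∂dt[T], ∀ n, |f n t| ≤ C)
    (hlim : ∀ᵐ t ∂dt[T], Tendsto (fun n => f n t) atTop (𝓝 (g t)))
    {τ : ℝ} (hτ : τ ∈ Icc 0 T) :
    Tendsto (fun n => ∫ t in (0 : ℝ)..τ, f n t) atTop (𝓝 (∫ t in (0 : ℝ)..τ, g t)) := by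
  have hle : (volume : Measure ℝ).restrict (uIoc 0 τ) ≤ dt[T] := by
    rw [uIoc_of_le hτ.1, Measure.restrict_congr_set Ioo_ae_eq_Ioc]
    exact Measure.restrict_mono (Ioc_subset_Ioc_right hτ.2) le_rfl
  refine intervalIntegral.tendsto_integral_filter_of_dominated_convergence (fun _ => C)
    (Eventually.of_forall fun n => ((hm n).mono_measure hle).aestronglyMeasurable)
    (Eventually.of_forall fun n => ?_) intervalIntegrable_const ?_
  · have h1 := hb.filter_mono (ae_mono hle)
    rw [ae_restrict_iff' measurableSet_uIoc] at h1
    filter_upwards [h1] with t ht htI using ht htI n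
  · have h1 := hlim.filter_mono (ae_mono hle)
    rwa [ae_restrict_iff' measurableSet_uIoc] at h1

lemma combo_apply {Y : Type*} [NormedAddCommGroup Y] [NormedSpace ℝ Y] (w : ℕ →₀ ℝ)
    (L : ℕ → StrongDual ℝ Y) (y : Y) : combo w L y = combo w fun j => L j y := by
  simp [combo_eq_sum]

/-- Convex combinations of tails of bounded stress families have a limit, which is a stress family
along the limit of the states. -/
lemma exists_limit_stressFamily {E : ℕ → ℝ} (hE : Tendsto E atTop (𝓝 E₀))
    {v : ℕ → ℝ → DensSpace G γ} {w : ℕ → ℝ → MomSpace G γ}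
    {Λ : ℕ → ℝ → StressDual G}
    (h : ∀ n, IsStressFamily a γ T (E n) (v n) (w n) (Λ n)) {u : Trajectory G γ T}
    (hv : ∀ t ∈ Icc 0 T, ∀ ℓ : StrongDual ℝ (DensSpace G γ),
      Tendsto (fun n => ℓ (v n t)) atTop (𝓝 (ℓ (u.1.val t))))
    (hw : ∀ t ∈ Icc 0 T, ∀ ℓ : StrongDual ℝ (MomSpace G γ),
      Tendsto (fun n => ℓ (w n t)) atTop (𝓝 (ℓ (u.2.val t)))) :
    ∃ (C : ℝ) (W : ℕ → ℕ →₀ ℝ) (Λ' : ℝ → StressDual G),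
      (∀ n, IsTailConvex n (W n)) ∧ IsStressFamily a γ T E₀ u.1.val u.2.val Λ' ∧
      (∀ᵐ t ∂dt[T], ∀ n, ‖Λ n t‖ ≤ C) ∧
      ∀ᵐ t ∂dt[T], ∀ F,
        Tendsto (fun n => combo (W n) fun j => Λ j t F) atTop (𝓝 (Λ' t F)) := by
  obtain ⟨K, hK0, hK⟩ := exists_norm_le_energy G a γ
  obtain ⟨B, hB⟩ := hE.bddAbove_range
  have hB' : ∀ n, E n ≤ B := fun n => hB (mem_range_self n)
  choose S hS hanti hle using fun n => (h n).energy
  have hC : ∀ᵐ t ∂dt[T], ∀ n, ‖Λ n t‖ ≤ K * B := by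
    refine ae_all_iff.2 fun n => ?_
    filter_upwards [(h n).bound, hS n] with t ht htS
    exact (hK _ _ _ ht).trans (mul_le_mul_of_nonneg_left ((hle n t htS).trans (hB' n)) hK0)
  let F : ℕ → C(Hull G, Stress d) := TopologicalSpace.denseSeq _
  obtain ⟨W, hW, hlim⟩ := exists_tailConvex_ae_tendsto (g := fun n k t => Λ n t (F k))
    (C := fun k => K * B * ‖F k‖) (fun n k => (h n).measurable (F k)) (fun n k => by
      filter_upwards [hC] with t ht
      exact (Λ n t).le_of_opNorm_le (ht n) _)
  have hpt : ∀ᵐ t ∂dt[T], ∃ L' : StressDual G,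
      ‖L'‖ ≤ K * B ∧ ∀ F, Tendsto (fun n => combo (W n) fun j => Λ j t F) atTop (𝓝 (L' F)) := by
    filter_upwards [hC, ae_all_iff.2 hlim] with t ht hl
    have h1 := exists_tendsto_of_tendsto_dense (L := fun n => combo (W n) fun j => Λ j t)
      (C := K * B) (fun n => (hW n).norm_combo_le fun j _ => ht j)
      (TopologicalSpace.denseRange_denseSeq _) (fun k => by simpa only [combo_apply] using hl k)
    simpa only [combo_apply] using h1
  classical
  -- the limit where it exists, and zero at the exceptional times
  let Λ' : ℝ → StressDual G := fun t =>
    if h : ∃ L' : StressDual G, ‖L'‖ ≤ K * B ∧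
      ∀ F, Tendsto (fun n => combo (W n) fun j => Λ j t F) atTop (𝓝 (L' F)) then h.choose else 0
  have hΛ' : ∀ᵐ t ∂dt[T], ‖Λ' t‖ ≤ K * B ∧
      ∀ F, Tendsto (fun n => combo (W n) fun j => Λ j t F) atTop (𝓝 (Λ' t F)) := by
    filter_upwards [hpt] with t ht
    simp only [Λ', dif_pos ht]
    exact ht.choose_spec
  refine ⟨K * B, W, Λ', hW, ⟨fun F => ?_, ⟨K * B, hΛ'.mono fun t ht => ht.1⟩, ?_, ?_⟩, hC,
    hΛ'.mono fun t ht => ht.2⟩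
  · refine aemeasurable_of_tendsto_metrizable_ae atTop
      (f := fun n t => combo (W n) fun j => Λ j t F) (fun n => ?_) (hΛ'.mono fun t ht => ht.2 F)
    simp only [combo_eq_sum]
    exact aemeasurable_fun_sum _ fun j _ => ((h j).measurable F).const_mul _
  · filter_upwards [hΛ', ae_all_iff.2 fun n => (h n).bound, ae_mem_Icc T]
      with t ht hb htT
    exact IsStressBound.of_tendsto_combo hb hW (hv t htT) (hw t htT) ht.2
  · refine ⟨{t | (∀ n, t ∈ S n) ∧ ∀ F, Tendsto (fun n => combo (W n) fun j => Λ j t F) atTop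
      (𝓝 (Λ' t F))}, ?_, ?_, ?_⟩
    · filter_upwards [hΛ', ae_all_iff.2 hS] with t ht hs using ⟨hs, ht.2⟩
    · intro s hs t ht hst
      exact le_of_tendsto_of_tendsto' (ht.2 _) (hs.2 _) fun n =>
        (hW n).combo_mono fun j _ => hanti j (hs.1 j) (ht.1 j) hst
    · intro t ht
      exact le_of_tendsto_of_tendsto' (ht.2 _) (tendsto_combo hW hE) fun n =>
        (hW n).combo_mono fun j _ => hle j t (ht.1 j)

lemma ae_nonneg_of_tendsto {ρ : ℕ → DensSpace G γ} {ρ' : DensSpace G γ}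
    (h : ∀ n, 0 ≤ᵐ[G.vol] ρ n) (hρ : ∀ ℓ : StrongDual ℝ (DensSpace G γ),
      Tendsto (fun n => ℓ (ρ n)) atTop (𝓝 (ℓ ρ'))) : 0 ≤ᵐ[G.vol] ρ' := by
  refine ae_nonneg_of_forall_setIntegral_nonneg (integrable_dens ρ') fun s hs _ => ?_
  have hw : IsWeight G.vol (s.indicator fun _ => (1 : ℝ)) :=
    isWeight_of_bounded (measurable_const.indicator hs) ⟨1, fun x => by
      by_cases hx : x ∈ s <;> simp [hx]⟩
  have h1 : ∀ r : DensSpace G γ, weightFunctional hw r = ∫ x in s, r x ∂G.vol := fun r => by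
    rw [weightFunctional_apply, ← integral_indicator hs]
    refine integral_congr_ae (ae_of_all _ fun x => ?_)
    by_cases hx : x ∈ s <;> simp [hx]
  rw [← h1]
  refine ge_of_tendsto' (hρ (weightFunctional hw)) fun n => ?_
  rw [h1]
  exact integral_nonneg_of_ae (ae_restrict_of_ae (h n))

end Stability

/-! ### Countable families of test functions -/

section DenseFamilies

variable {d : ℕ} {G : FluidDomain d} [CompactSpace (Hull G)] {a γ T E₀ : ℝ} [hγ : Fact (1 < γ)]

/-- A countable family of scalar test functions, dense with respect to the `C¹` norm on the closure
of the domain. -/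
structure IsDenseScalarFamily (G : FluidDomain d) [CompactSpace (Hull G)]
    (χ : ℕ → Space d → ℝ) : Prop where
  static : ∀ k, IsStaticScalar G (χ k)
  dense : ∀ φ (hφ : IsStaticScalar G φ), ∃ s : ℕ → ℕ,
    Tendsto (fun j => toHull (G := G) (static (s j)).contDiff.continuous) atTop
      (𝓝 (toHull hφ.contDiff.continuous)) ∧
    Tendsto (fun j => toHull (G := G) (continuous_gradient (static (s j)).contDiff)) atTop
      (𝓝 (toHull (continuous_gradient hφ.contDiff)))

/-- A countable family of vector-valued test functions, dense with respect to the `C¹` norm on the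
closure of the domain. -/
structure IsDenseVectorFamily (G : FluidDomain d) [CompactSpace (Hull G)]
    (φ : ℕ → Space d → Space d) : Prop where
  static : ∀ k, IsStaticVector G (φ k)
  dense : ∀ ψ (hψ : IsStaticVector G ψ), ∃ s : ℕ → ℕ,
    Tendsto (fun j => toHull (G := G) (static (s j)).contDiff.continuous) atTop
      (𝓝 (toHull hψ.contDiff.continuous)) ∧
    Tendsto (fun j => gradTest (G := G) (static (s j)).contDiff) atTop
      (𝓝 (gradTest hψ.contDiff))

/-- Every family in a second countable metrizable space has a countable dense subfamily. -/
lemma exists_dense_subfamily {ι X : Type*} [Nonempty ι] [TopologicalSpace X]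
    [SecondCountableTopology X] [TopologicalSpace.PseudoMetrizableSpace X] (f : ι → X) :
    ∃ q : ℕ → ι, ∀ i, ∃ s : ℕ → ℕ, Tendsto (fun j => f (q (s j))) atTop (𝓝 (f i)) := by
  let b : ℕ → range f := TopologicalSpace.denseSeq (range f)
  choose q hq using fun k => (b k).2
  refine ⟨q, fun i => ?_⟩
  obtain ⟨x, hx, hlim⟩ := mem_closure_iff_seq_limit.1
    (TopologicalSpace.denseRange_denseSeq (range f) ⟨f i, mem_range_self i⟩)
  choose s hs using hx
  refine ⟨s, ?_⟩
  refine ((continuous_subtype_val.tendsto _).comp hlim).congr fun j => ?_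
  rw [hq, Function.comp_apply, ← hs]

lemma isStaticScalar_zero : IsStaticScalar G fun _ => 0 := by
  refine ⟨contDiff_const, ?_⟩
  cases G with
  | bounded Ω => trivial
  | torus => exact fun _ _ => rfl

lemma isStaticVector_zero : IsStaticVector G fun _ => 0 := by
  refine ⟨contDiff_const, ?_, ?_⟩ <;> cases G with
  | bounded Ω => first | trivial | exact fun _ _ _ _ => inner_zero_left _
  | torus => first | trivial | exact fun _ _ => rfl

lemma exists_denseScalarFamily (G : FluidDomain d) [CompactSpace (Hull G)] :
    ∃ χ, IsDenseScalarFamily G χ := by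
  have : Nonempty {φ // IsStaticScalar G φ} := ⟨⟨_, isStaticScalar_zero⟩⟩
  obtain ⟨q, hq⟩ := exists_dense_subfamily (fun φ : {φ // IsStaticScalar G φ} =>
    (toHull (G := G) φ.2.contDiff.continuous, toHull (G := G) (continuous_gradient φ.2.contDiff)))
  refine ⟨fun k => q k, fun k => (q k).2, fun φ hφ => ?_⟩
  obtain ⟨s, hs⟩ := hq ⟨φ, hφ⟩
  exact ⟨s, (continuous_fst.tendsto _).comp hs, (continuous_snd.tendsto _).comp hs⟩

lemma exists_denseVectorFamily (G : FluidDomain d) [CompactSpace (Hull G)] :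
    ∃ φ, IsDenseVectorFamily G φ := by
  have : Nonempty {φ // IsStaticVector G φ} := ⟨⟨_, isStaticVector_zero⟩⟩
  obtain ⟨q, hq⟩ := exists_dense_subfamily (fun φ : {φ // IsStaticVector G φ} =>
    (toHull (G := G) φ.2.contDiff.continuous, gradTest (G := G) φ.2.contDiff))
  refine ⟨fun k => q k, fun k => (q k).2, fun φ hφ => ?_⟩
  obtain ⟨s, hs⟩ := hq ⟨φ, hφ⟩
  exact ⟨s, (continuous_fst.tendsto _).comp hs, (continuous_snd.tendsto _).comp hs⟩

/-- If the states converge weakly, the equations hold in the limit for a dense family of test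
functions, and the energy is bounded, then the limit is a relaxed solution. -/
lemma exists_isRelaxed_of_tendsto (hG : G.Admissible) {χ : ℕ → Space d → ℝ}
    (hχ : IsDenseScalarFamily G χ)
    {φ : ℕ → Space d → Space d} (hφ : IsDenseVectorFamily G φ) {E : ℕ → ℝ}
    (hE : Tendsto E atTop (𝓝 E₀)) {v : ℕ → ℝ → DensSpace G γ} {w : ℕ → ℝ → MomSpace G γ}
    {Λ : ℕ → ℝ → StressDual G}
    (h : ∀ n, IsStressFamily a γ T (E n) (v n) (w n) (Λ n)) {u : Trajectory G γ T}
    (hv : ∀ t ∈ Icc 0 T, ∀ ℓ : StrongDual ℝ (DensSpace G γ),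
      Tendsto (fun n => ℓ (v n t)) atTop (𝓝 (ℓ (u.1.val t))))
    (hw : ∀ t ∈ Icc 0 T, ∀ ℓ : StrongDual ℝ (MomSpace G γ),
      Tendsto (fun n => ℓ (w n t)) atTop (𝓝 (ℓ (u.2.val t))))
    (hv0 : ∀ n, ∀ t ∈ Icc 0 T, 0 ≤ᵐ[G.vol] v n t)
    (hwm : ∀ n (ℓ : StrongDual ℝ (MomSpace G γ)),
      AEMeasurable (fun t => ℓ (w n t)) dt[T])
    {M : ℝ} (hM : ∀ n, ∀ t ∈ Icc 0 T, ‖w n t‖ ≤ M) (huM : ∀ t ∈ Icc 0 T, ‖u.2.val t‖ ≤ M)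
    (hmass : ∀ k, ∀ τ ∈ Icc 0 T, Tendsto (fun n => ∫ x, v n τ x * χ k x ∂G.vol
      - ∫ x, v n 0 x * χ k x ∂G.vol - ∫ t in (0 : ℝ)..τ, ∫ x, fderiv ℝ (χ k) x (w n t x) ∂G.vol)
      atTop (𝓝 0))
    (hmom : ∀ k, ∀ τ ∈ Icc 0 T, Tendsto (fun n => ∫ x, inner ℝ (w n τ x) (φ k x) ∂G.vol
      - ∫ x, inner ℝ (w n 0 x) (φ k x) ∂G.vol
      - ∫ t in (0 : ℝ)..τ, Λ n t (gradTest (hφ.static k).contDiff)) atTop (𝓝 0)) :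
    ∃ Λ', IsRelaxed a γ T E₀ u Λ' := by
  obtain ⟨C, W, Λ', hW, hΛ', hC, hlim⟩ := exists_limit_stressFamily hE h hv hw
  obtain ⟨C', hC'⟩ := hΛ'.bounded
  have hcap : ∀ {τ : ℝ}, τ ∈ Icc 0 T → (0 : ℝ) ∈ Icc 0 T := fun hτ => ⟨le_rfl, hτ.1.trans hτ.2⟩
  refine ⟨Λ', hΛ', fun t ht => ae_nonneg_of_tendsto (fun n => hv0 n t ht) (hv t ht), ?_, ?_⟩
  -- the equation of continuity: for the family, then for all test functions by density
  · have hF : ∀ (r : MomSpace G γ) {ψ : Space d → ℝ} (hψ : IsStaticScalar G ψ),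
        ∫ x, fderiv ℝ ψ x (r x) ∂G.vol
          = hullFunctional r (toHull (G := G) (continuous_gradient hψ.contDiff)) := fun r ψ hψ => by
      simp only [hullFunctional_toHull hG, ← fderiv_eq_inner_gradient]
    have hV : ∀ (r : DensSpace G γ) {ψ : Space d → ℝ} (hψ : IsStaticScalar G ψ),
        ∫ x, r x * ψ x ∂G.vol = hullFunctional r (toHull (G := G) hψ.contDiff.continuous) :=
      fun r ψ hψ => by
        rw [hullFunctional_toHull hG]
        exact integral_congr_ae (ae_of_all _ fun x => mul_comm _ _)
    have hk : ∀ k, ∀ τ ∈ Icc 0 T, ∫ x, u.1.val τ x * χ k x ∂G.vol - ∫ x, u.1.val 0 x * χ k x ∂G.vol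
        = ∫ t in (0 : ℝ)..τ, ∫ x, fderiv ℝ (χ k) x (u.2.val t x) ∂G.vol := by
      intro k τ hτ
      have h1 := hmass k τ hτ
      simp only [hF _ (hχ.static k), hV _ (hχ.static k)] at h1 ⊢
      have h2 := tendsto_intervalIntegral_of_bounded (T := T)
        (f := fun n t => hullFunctional (w n t)
          (toHull (G := G) (continuous_gradient (hχ.static k).contDiff)))
        (fun n => hwm n (hullTest _))
        (C := (G.vol univ ^ (1 - 1 / (momExp γ).toReal)).toReal * M
          * ‖toHull (G := G) (continuous_gradient (hχ.static k).contDiff)‖)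
        (by
          filter_upwards [ae_mem_Icc T] with t ht n
          exact (hullFunctional (w n t)).le_of_opNorm_le (norm_hullFunctional_le (hM n t ht)) _)
        ((ae_mem_Icc T).mono fun t ht => hw t ht (hullTest _)) hτ
      have h4 := ((hv τ hτ (hullTest (toHull (hχ.static k).contDiff.continuous))).sub
        (hv 0 (hcap hτ) (hullTest (toHull (hχ.static k).contDiff.continuous)))).sub h2
      exact sub_eq_zero.1 (tendsto_nhds_unique h4 h1)
    intro ψ hψ τ hτ
    obtain ⟨s, hs1, hs2⟩ := hχ.dense ψ hψ
    obtain ⟨B, hB⟩ := (hs2.norm).bddAbove_range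
    have h2 := tendsto_intervalIntegral_of_bounded (T := T)
      (f := fun n t => hullFunctional (u.2.val t)
        (toHull (G := G) (continuous_gradient (hχ.static (s n)).contDiff)))
      (fun n => ((continuous_val u.2 (hullTest _)).mono
        Ioo_subset_Icc_self).aemeasurable measurableSet_Ioo)
      (C := (G.vol univ ^ (1 - 1 / (momExp γ).toReal)).toReal * M * B)
      (by
        filter_upwards [ae_mem_Icc T] with t ht n
        have hM0 : 0 ≤ M := (norm_nonneg _).trans (huM t ht)
        refine ((hullFunctional (u.2.val t)).le_of_opNorm_le (norm_hullFunctional_le (huM t ht)) _).trans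
          (mul_le_mul_of_nonneg_left (hB (mem_range_self n))
            (mul_nonneg toReal_nonneg hM0)))
      (ae_of_all _ fun t => ((hullFunctional (u.2.val t)).continuous.tendsto _).comp hs2) hτ
    have h4 := (((hullFunctional (u.1.val τ)).continuous.tendsto _).comp hs1).sub
      (((hullFunctional (u.1.val 0)).continuous.tendsto _).comp hs1)
    simp only [hF _ hψ, hV _ hψ]
    refine tendsto_nhds_unique h4 (h2.congr fun n => ?_)
    have h5 := hk (s n) τ hτ
    simp only [hF _ (hχ.static _), hV _ (hχ.static _)] at h5
    exact h5.symm
  -- the momentum equation: the convex combinations of the stress functionals pass to the limit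
  · have hV : ∀ (r : MomSpace G γ) {ψ : Space d → Space d} (hψ : IsStaticVector G ψ),
        ∫ x, inner ℝ (r x) (ψ x) ∂G.vol
          = hullFunctional r (toHull (G := G) hψ.contDiff.continuous) :=
      fun r ψ hψ => (hullFunctional_toHull hG _ _).symm
    have hk : ∀ k, ∀ τ ∈ Icc 0 T, ∫ x, inner ℝ (u.2.val τ x) (φ k x) ∂G.vol
        - ∫ x, inner ℝ (u.2.val 0 x) (φ k x) ∂G.vol
        = ∫ t in (0 : ℝ)..τ, Λ' t (gradTest (hφ.static k).contDiff) := by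
      intro k τ hτ
      have h1 := hmom k τ hτ
      simp only [hV _ (hφ.static k)] at h1 ⊢
      set F := gradTest (G := G) (hφ.static k).contDiff with hFdef
      have hI : ∀ j, IntervalIntegrable (fun t => Λ j t F) volume 0 τ := fun j =>
        intervalIntegrable_of_integrableOn_Ioo (integrableOn_apply_of_bounded (h j).measurable
          (hC.mono fun t ht => ht j) (F := fun _ => F) continuous_const) hτ
      have h2 := tendsto_intervalIntegral_of_bounded (T := T)
        (f := fun n t => combo (W n) fun j => Λ j t F) (fun n => by
          simp only [combo_eq_sum]
          exact aemeasurable_fun_sum _ fun j _ => ((h j).measurable F).const_mul _)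
        (C := C * ‖F‖) (by
          filter_upwards [hC] with t ht n
          exact (hW n).norm_combo_le fun j _ => (Λ j t).le_of_opNorm_le (ht j) _)
        (hlim.mono fun t ht => ht F) hτ
      have h5 := tendsto_combo hW (((hw τ hτ (hullTest (toHull
        (hφ.static k).contDiff.continuous))).sub (hw 0 (hcap hτ) (hullTest (toHull
          (hφ.static k).contDiff.continuous)))).sub h1)
      rw [sub_zero] at h5
      refine tendsto_nhds_unique h5 (h2.congr fun n => ?_)
      simp only [combo_eq_sum, smul_eq_mul]
      rw [intervalIntegral.integral_finsetSum fun j _ => (hI j).const_mul _]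
      refine sum_congr rfl fun j _ => ?_
      rw [intervalIntegral.integral_const_mul]
      congr 1
      simp only [hullFunctional_apply]
      ring
    intro ψ hψ τ hτ
    obtain ⟨s, hs1, hs2⟩ := hφ.dense ψ hψ
    obtain ⟨B, hB⟩ := (hs2.norm).bddAbove_range
    have h2 := tendsto_intervalIntegral_of_bounded (T := T)
      (f := fun n t => Λ' t (gradTest (G := G) (hφ.static (s n)).contDiff))
      (fun n => hΛ'.measurable _) (C := C' * B)
      (by
        filter_upwards [hC'] with t ht n
        exact ((Λ' t).le_of_opNorm_le ht _).trans
          (mul_le_mul_of_nonneg_left (hB (mem_range_self n)) ((norm_nonneg (Λ' t)).trans ht)))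
      (ae_of_all _ fun t => ((Λ' t).continuous.tendsto _).comp hs2) hτ
    have h4 := (((hullFunctional (u.2.val τ)).continuous.tendsto _).comp hs1).sub
      (((hullFunctional (u.2.val 0)).continuous.tendsto _).comp hs1)
    simp only [hV _ hψ]
    refine tendsto_nhds_unique h4 (h2.congr fun n => ?_)
    have h5 := hk (s n) τ hτ
    simp only [hV _ (hφ.static _)] at h5
    exact h5.symm

end DenseFamilies

/-! ### Compactness of sequences of approximate solutions -/

section Compactness

variable {d : ℕ} {G : FluidDomain d} [CompactSpace (Hull G)] {a γ T E₀ : ℝ} [hγ : Fact (1 < γ)]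

/-- The test functions separate the integrable functions. On the torus, the problem is
transported by `x ↦ (exp (-i π x_j))_j`, which is injective on the fundamental cell. -/
lemma ae_eq_zero_of_forall_static (hG : G.Admissible) {v : Space d → ℝ} (hvm : Measurable v)
    (hv : Integrable v G.vol) (h : ∀ χ, IsStaticScalar G χ →
      (∀ e : Space d, IsStaticVector G fun x => χ x • e) → ∫ x, v x * χ x ∂G.vol = 0) :
    ∀ᵐ x ∂G.vol, v x = 0 := by
  cases G with
  | bounded Ω =>
    have hΩ : IsOpen Ω := hG.1
    refine (ae_restrict_iff' hΩ.measurableSet).2 (hΩ.ae_eq_zero_of_integral_contDiff_smul_eq_zero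
      (IntegrableOn.locallyIntegrableOn hv) fun g hg _ hgs => ?_)
    have h0 : ∀ x ∉ Ω, g x = 0 := fun x hx => image_eq_zero_of_notMem_tsupport fun h => hx (hgs h)
    have h1 := h g ⟨hg.of_le (by exact_mod_cast le_top), trivial⟩ fun e =>
      ⟨(hg.of_le (by exact_mod_cast le_top)).smul contDiff_const, trivial, fun x hx n _ => by
        rw [h0 x fun h => hx.2 (hΩ.interior_eq.symm ▸ h), zero_smul, inner_zero_left]⟩
    rw [← setIntegral_eq_integral_of_forall_compl_eq_zero (s := Ω) fun x hx => by
      rw [h0 x hx, zero_smul], ← h1]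
    exact integral_congr_ae (ae_of_all _ fun x => mul_comm _ _)
  | torus =>
    let J : Space d → (Fin d → ℂ) := fun x i => Complex.exp ((-(Real.pi * x i) : ℝ) * Complex.I)
    let I : (Fin d → ℂ) → Space d := fun z => WithLp.toLp 2 fun i => -(z i).arg / Real.pi
    have hJ : ContDiff ℝ 1 J := by
      refine contDiff_pi.2 fun i => ?_
      refine ContDiff.cexp (ContDiff.mul ?_ contDiff_const)
      have hx : ContDiff ℝ 1 fun x : Space d => Real.pi * x i := by fun_prop
      exact Complex.ofRealCLM.contDiff.comp hx.neg
    have hIm : Measurable I := by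
      refine (PiLp.continuous_toLp 2 _).measurable.comp (measurable_pi_lambda _ fun i => ?_)
      exact ((Complex.measurable_arg.comp (measurable_pi_apply i)).neg).div_const _
    have hIJ : ∀ x ∈ (FluidDomain.torus : FluidDomain d).cell, I (J x) = x := by
      intro x hx
      ext i
      change -(Complex.exp ((-(Real.pi * x i) : ℝ) * Complex.I)).arg / Real.pi = x i
      have hpi := Real.pi_pos
      rw [Complex.arg_exp_mul_I, (toIocMod_eq_self _).2 ⟨by nlinarith [(hx i).2], by
        nlinarith [(hx i).1]⟩]
      field_simp
    -- `I` inverts `J` on the cell, where the arguments lie in `(-π, π]`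
    have hmap : ∀ᵐ x ∂(FluidDomain.torus : FluidDomain d).vol, v (I (J x)) = v x := by
      filter_upwards [ae_mem_cell hG] with x hx using by rw [hIJ x hx]
    have hm := hJ.continuous.measurable
    have hfi : Integrable (v ∘ I) ((FluidDomain.torus : FluidDomain d).vol.map J) :=
      (integrable_map_measure (hvm.comp hIm).aestronglyMeasurable hm.aemeasurable).2
        (hv.congr (hmap.mono fun x hx => hx.symm))
    have h1 := ae_eq_zero_of_integral_contDiff_smul_eq_zero hfi.locallyIntegrable fun g hg _ => by
      have hper : ∀ (x : Space d) (i : Fin d), J (x + single i 2) = J x := by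
        intro x i
        funext j
        by_cases hj : j = i
        · subst hj
          have e1 : ((-(Real.pi * (x + single j (2 : ℝ)) j) : ℝ) : ℂ) * Complex.I
            = ((-(Real.pi * x j) : ℝ) : ℂ) * Complex.I - 2 * Real.pi * Complex.I := by
              simp; ring
          simp only [J]
          rw [e1, Complex.exp_periodic.sub_eq]
        · simp [J, hj]
      have hc : ContDiff ℝ 1 (g ∘ J) := (hg.of_le (by exact_mod_cast le_top)).comp hJ
      have h2 := h (g ∘ J) ⟨hc, fun x i => by simp only [Function.comp_apply, hper]⟩ fun e =>
        ⟨hc.smul contDiff_const, fun x i => by simp only [Function.comp_apply, hper], trivial⟩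
      have h3 : AEStronglyMeasurable (fun z => g z • (v ∘ I) z)
          ((FluidDomain.torus : FluidDomain d).vol.map J) :=
        hg.continuous.aestronglyMeasurable.smul hfi.aestronglyMeasurable
      rw [integral_map hm.aemeasurable h3, ← h2]
      refine integral_congr_ae ?_
      filter_upwards [hmap] with x hx
      simp only [Function.comp_apply, hx, smul_eq_mul, mul_comm]
    filter_upwards [ae_of_ae_map hm.aemeasurable h1, hmap] with x hx hx'
    rw [← hx']; exact hx

lemma isSeparatingFamily_dens (hG : G.Admissible) {χ : ℕ → Space d → ℝ}
    (hχ : IsDenseScalarFamily G χ) : IsSeparatingFamily (DensSpace G γ) fun k =>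
      hullTest (toHull (G := G) (hχ.static k).contDiff.continuous) := by
  have hpq := (Real.HolderConjugate.conjExponent hγ.out).ennrealOfReal
  have hq : Fact (1 ≤ ofReal γ.conjExponent) := ⟨hpq.symm.one_le⟩
  refine ⟨fun M => isCompact_weak_closedBall_Lp (hpq := hpq) ofReal_ne_top
    ofReal_ne_top M, fun r hr => ?_⟩
  refine (Lp.eq_zero_iff_ae_eq_zero).2 ?_
  refine ae_eq_zero_of_forall_static hG (measurable_dens r) (integrable_dens r) fun ψ hψ _ => ?_
  obtain ⟨s, hs, -⟩ := hχ.dense ψ hψ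
  have h1 := ((hullFunctional r).continuous.tendsto _).comp hs
  have h2 : hullFunctional r (toHull (G := G) hψ.contDiff.continuous) = 0 :=
    tendsto_nhds_unique h1 (tendsto_const_nhds.congr fun j => (hr (s j)).symm)
  rw [hullFunctional_toHull hG] at h2
  rw [← h2]
  exact integral_congr_ae (ae_of_all _ fun x => mul_comm _ _)

lemma isSeparatingFamily_mom (hG : G.Admissible) {φ : ℕ → Space d → Space d}
    (hφ : IsDenseVectorFamily G φ) : IsSeparatingFamily (MomSpace G γ) fun k =>
      hullTest (toHull (G := G) (hφ.static k).contDiff.continuous) := by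
  have h1 : 1 < 2 * γ / (γ + 1) := by
    have := hγ.out
    rw [lt_div_iff₀ (by linarith)]; linarith
  have hpq := (Real.HolderConjugate.conjExponent h1).ennrealOfReal
  have hq : Fact (1 ≤ ofReal (2 * γ / (γ + 1)).conjExponent) := ⟨hpq.symm.one_le⟩
  refine ⟨fun M => isCompact_weak_closedBall_Lp (hpq := hpq) ofReal_ne_top
    ofReal_ne_top M, fun r hr => ?_⟩
  refine (Lp.eq_zero_iff_ae_eq_zero).2 ?_
  have h2 : ∀ᵐ x ∂G.vol, ∀ i, r x i = 0 := ae_all_iff.2 fun i => by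
    refine ae_eq_zero_of_forall_static hG (measurable_mom r i) (integrable_mom r i)
      fun ψ hψ hψ' => ?_
    obtain ⟨s, hs, -⟩ := hφ.dense _ (hψ' (single i 1))
    have h1 := ((hullFunctional r).continuous.tendsto _).comp hs
    have h2 : hullFunctional r (toHull (G := G) (hψ' (single i 1)).contDiff.continuous)
        = 0 := tendsto_nhds_unique h1 (tendsto_const_nhds.congr fun j => (hr (s j)).symm)
    rw [hullFunctional_toHull hG] at h2
    rw [← h2]
    refine integral_congr_ae (ae_of_all _ fun x => ?_)
    simp only [inner_smul_right, EuclideanSpace.inner_single_right]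
    simp [mul_comm]
  filter_upwards [h2] with x hx
  ext i
  exact hx i

/-- A function with a bounded derivative up to an error is Lipschitz up to an error. -/
lemma abs_sub_le_of_integral_error {T : ℝ} {A f : ℝ → ℝ} {C ε : ℝ}
    (hm : AEMeasurable f dt[T])
    (hC : ∀ᵐ t ∂dt[T], |f t| ≤ C)
    (h : ∀ τ ∈ Icc 0 T, |A τ - A 0 - ∫ t in (0 : ℝ)..τ, f t| ≤ ε) :
    ∀ s ∈ Icc 0 T, ∀ t ∈ Icc 0 T, |A t - A s| ≤ C * |t - s| + 2 * ε := by
  intro s hs t ht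
  have hi : IntegrableOn f (Ioo 0 T) := Integrable.of_bound hm.aestronglyMeasurable C hC
  have e1 := integral_interval_sub_left
    (intervalIntegrable_of_integrableOn_Ioo hi ht) (intervalIntegrable_of_integrableOn_Ioo hi hs)
  have e2 : |∫ r in s..t, f r| ≤ C * |t - s| := by
    rw [← norm_eq_abs]
    refine norm_integral_le_of_norm_le_const_ae ?_
    exact ae_mem_uIoc (p := fun t => |f t| ≤ C) hC hs ht
  have h1 := h t ht
  have h2 := h s hs
  rw [abs_le] at h1 h2 e2 ⊢
  constructor <;> linarith

/-- Approximate solutions with bounded energy have a subsequence converging to a relaxed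
solution. The equations need only hold, up to vanishing errors, for a dense family of test
functions, each of them being admitted from some index on. -/
lemma exists_subseq_isRelaxed (hG : G.Admissible) (hT : 0 < T) {χ : ℕ → Space d → ℝ}
    (hχ : IsDenseScalarFamily G χ)
    {φ : ℕ → Space d → Space d} (hφ : IsDenseVectorFamily G φ) {E : ℕ → ℝ}
    (hE : Tendsto E atTop (𝓝 E₀)) {v : ℕ → ℝ → DensSpace G γ} {w : ℕ → ℝ → MomSpace G γ}
    {Λ : ℕ → ℝ → StressDual G}
    (h : ∀ n, IsStressFamily a γ T (E n) (v n) (w n) (Λ n))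
    (hv0 : ∀ n, ∀ t ∈ Icc 0 T, 0 ≤ᵐ[G.vol] v n t)
    (hwm : ∀ n (ℓ : StrongDual ℝ (MomSpace G γ)),
      AEMeasurable (fun t => ℓ (w n t)) dt[T])
    {M : ℝ} (hvM : ∀ n, ∀ t ∈ Icc 0 T, ‖v n t‖ ≤ M) (hwM : ∀ n, ∀ t ∈ Icc 0 T, ‖w n t‖ ≤ M)
    {ε : ℕ → ℝ} (hε : Tendsto ε atTop (𝓝 0))
    (hmass : ∀ k, ∀ n ≥ k, ∀ τ ∈ Icc 0 T, |∫ x, v n τ x * χ k x ∂G.vol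
      - ∫ x, v n 0 x * χ k x ∂G.vol - ∫ t in (0 : ℝ)..τ, ∫ x, fderiv ℝ (χ k) x (w n t x) ∂G.vol|
      ≤ ε n)
    (hmom : ∀ k, ∀ n ≥ k, ∀ τ ∈ Icc 0 T, |∫ x, inner ℝ (w n τ x) (φ k x) ∂G.vol
      - ∫ x, inner ℝ (w n 0 x) (φ k x) ∂G.vol
      - ∫ t in (0 : ℝ)..τ, Λ n t (gradTest (hφ.static k).contDiff)| ≤ ε n) :
    ∃ s : ℕ → ℕ, StrictMono s ∧ ∃ (u : Trajectory G γ T) (Λ' : _), IsRelaxed a γ T E₀ u Λ' ∧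
      u ∈ boundedTrajectories G γ T M ∧
      (∀ t ∈ Icc 0 T, ∀ ℓ : StrongDual ℝ (DensSpace G γ),
        Tendsto (fun n => ℓ (v (s n) t)) atTop (𝓝 (ℓ (u.1.val t)))) ∧
      (∀ t ∈ Icc 0 T, ∀ ℓ : StrongDual ℝ (MomSpace G γ),
        Tendsto (fun n => ℓ (w (s n) t)) atTop (𝓝 (ℓ (u.2.val t)))) ∧
      (∀ k, TendstoUniformlyOn (fun n t => ∫ x, inner ℝ (v (s n) t x) (χ k x) ∂G.vol)
        (fun t => ∫ x, inner ℝ (u.1.val t x) (χ k x) ∂G.vol) atTop (Icc 0 T)) ∧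
      ∀ k, TendstoUniformlyOn (fun n t => ∫ x, inner ℝ (w (s n) t x) (φ k x) ∂G.vol)
        (fun t => ∫ x, inner ℝ (u.2.val t x) (φ k x) ∂G.vol) atTop (Icc 0 T) := by
  have hcapT : (0 : ℝ) ∈ Icc 0 T := ⟨le_rfl, hT.le⟩
  obtain ⟨K, hK0, hK⟩ := exists_norm_le_energy G a γ
  obtain ⟨B, hB⟩ := hE.bddAbove_range
  have hΛ : ∀ n, ∀ᵐ t ∂dt[T], ‖Λ n t‖ ≤ K * B := by
    intro n
    obtain ⟨S, hS, -, hle⟩ := (h n).energy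
    filter_upwards [(h n).bound, hS] with t ht htS
    exact (hK _ _ _ ht).trans
      (mul_le_mul_of_nonneg_left ((hle t htS).trans (hB (mem_range_self n))) hK0)
  -- equicontinuity of the moments; the finitely many unsuitable indices get a trivial bound
  have hlip : ∀ {X : Type} [NormedAddCommGroup X] [NormedSpace ℝ X] (r : ℕ → ℝ → X)
      (_ : ∀ n, ∀ t ∈ Icc 0 T, ‖r n t‖ ≤ M) (ℓ : ℕ → StrongDual ℝ X) (f : ℕ → ℕ → ℝ → ℝ) (C : ℕ → ℝ)
      (_ : ∀ n k, AEMeasurable (f n k) dt[T])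
      (_ : ∀ n k, ∀ᵐ t ∂dt[T], |f n k t| ≤ C k)
      (_ : ∀ k, ∀ n ≥ k, ∀ τ ∈ Icc 0 T,
        |ℓ k (r n τ) - ℓ k (r n 0) - ∫ t in (0 : ℝ)..τ, f n k t| ≤ ε n),
      ∀ n k, ∀ s ∈ Icc 0 T, ∀ t ∈ Icc 0 T, |ℓ k (r n t) - ℓ k (r n s)|
        ≤ |C k| * |t - s| + if k ≤ n then 2 * ε n else 2 * (‖ℓ k‖ * M) := by
    intro X _ _ r hr ℓ f C hm hC hf n k s hs t ht
    split_ifs with hkn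
    · refine (abs_sub_le_of_integral_error (hm n k) (hC n k) (hf k n hkn) s hs t ht).trans ?_
      gcongr
      exact le_abs_self _
    · have h1 : ∀ t ∈ Icc 0 T, |ℓ k (r n t)| ≤ ‖ℓ k‖ * M := fun t ht =>
        (ℓ k).le_opNorm_of_le (hr n t ht)
      have h2 := (abs_sub (ℓ k (r n t)) (ℓ k (r n s))).trans (add_le_add (h1 t ht) (h1 s hs))
      have : 0 ≤ |C k| * |t - s| := by positivity
      linarith
  have herr : ∀ (B : ℕ → ℝ) k,
      Tendsto (fun n => if k ≤ n then 2 * ε n else B k) atTop (𝓝 0) := fun B k => by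
    have h1 : Tendsto (fun n => 2 * ε n) atTop (𝓝 0) := by simpa using hε.const_mul 2
    refine h1.congr' ?_
    filter_upwards [eventually_ge_atTop k] with n hn
    rw [if_pos hn]
  have hsd := isSeparatingFamily_dens (γ := γ) hG hχ
  have hsm := isSeparatingFamily_mom (γ := γ) hG hφ
  have hV : ∀ (r : DensSpace G γ) k, ∫ x, r x * χ k x ∂G.vol
      = hullTest (toHull (G := G) (hχ.static k).contDiff.continuous) r := fun r k => by
    rw [← hullFunctional_apply, hullFunctional_toHull hG]
    exact integral_congr_ae (ae_of_all _ fun x => mul_comm _ _)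
  have hW : ∀ (r : MomSpace G γ) k, ∫ x, inner ℝ (r x) (φ k x) ∂G.vol
      = hullTest (toHull (G := G) (hφ.static k).contDiff.continuous) r := fun r k => by
    rw [← hullFunctional_apply, hullFunctional_toHull hG]
  have hF : ∀ (r : MomSpace G γ) k, ∫ x, fderiv ℝ (χ k) x (r x) ∂G.vol
      = hullTest (toHull (G := G)
        (continuous_gradient (hχ.static k).contDiff)) r := fun r k => by
    rw [← hullFunctional_apply]
    simp only [hullFunctional_toHull hG, ← fderiv_eq_inner_gradient]
  -- subsequences first for the densities, then for the momenta
  obtain ⟨s₁, hs₁, u₁, hu₁M, hu₁, hu₁'⟩ := hsd.exists_subseq_tendsto hT hvM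
    (herr fun k => 2 * (_ * M)) (hlip v hvM _
      (fun n k t => ∫ x, fderiv ℝ (χ k) x (w n t x) ∂G.vol)
      (fun k => ‖hullTest (p := momExp γ) (toHull (G := G)
        (continuous_gradient (hχ.static k).contDiff))‖ * M)
      (fun n k => by simp only [hF]; exact hwm n _)
      (fun n k => by
        filter_upwards [ae_mem_Icc T] with t ht
        rw [hF, ← norm_eq_abs]
        exact (hullTest _).le_opNorm_of_le (hwM n t ht))
      (fun k n hn τ hτ => by simpa only [hV] using hmass k n hn τ hτ))
  obtain ⟨s₂, hs₂, u₂, hu₂M, hu₂, hu₂'⟩ := hsm.exists_subseq_tendsto (v := fun n => w (s₁ n)) hT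
    (fun n => hwM (s₁ n)) (fun k => (herr (fun k => 2 * (_ * M)) k).comp hs₁.tendsto_atTop)
    (fun n => hlip w hwM _ (fun n k t => Λ n t (gradTest (G := G) (hφ.static k).contDiff))
      (fun k => K * B * ‖gradTest (G := G) (hφ.static k).contDiff‖)
      (fun n k => (h n).measurable _)
      (fun n k => (hΛ n).mono fun t ht => (Λ n t).le_of_opNorm_le ht _)
      (fun k n hn τ hτ => by simpa only [hW] using hmom k n hn τ hτ) (s₁ n))
  have hs : StrictMono (s₁ ∘ s₂) := hs₁.comp hs₂
  have hv : ∀ t ∈ Icc 0 T, ∀ ℓ : StrongDual ℝ (DensSpace G γ),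
      Tendsto (fun n => ℓ (v ((s₁ ∘ s₂) n) t)) atTop (𝓝 (ℓ (u₁.val t))) := fun t ht ℓ =>
    (hu₁' ℓ t ht).comp hs₂.tendsto_atTop
  have hzero : ∀ k (F : ℕ → ℝ), (∀ n ≥ k, |F n| ≤ ε n) →
      Tendsto (fun n => F ((s₁ ∘ s₂) n)) atTop (𝓝 0) := fun k F hF => by
    refine (squeeze_zero_norm' ?_ hε).comp hs.tendsto_atTop
    filter_upwards [eventually_ge_atTop k] with n hn using hF n hn
  obtain ⟨Λ', hΛ'⟩ := exists_isRelaxed_of_tendsto (u := (u₁, u₂)) hG hχ hφ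
    (hE.comp hs.tendsto_atTop) (fun n => h ((s₁ ∘ s₂) n)) hv (fun t ht ℓ => hu₂' ℓ t ht)
    (fun n => hv0 _) (fun n => hwm _) (fun n => hwM _) hu₂M
    (fun k τ hτ => hzero k _ fun n hn => hmass k n hn τ hτ)
    (fun k τ hτ => hzero k _ fun n hn => hmom k n hn τ hτ)
  have hV' : ∀ (r : DensSpace G γ) k, ∫ x, inner ℝ (r x) (χ k x) ∂G.vol
      = hullTest (toHull (G := G) (hχ.static k).contDiff.continuous) r := fun r k => by
    rw [← hullFunctional_apply, hullFunctional_toHull hG]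
  refine ⟨s₁ ∘ s₂, hs, (u₁, u₂), Λ', hΛ', fun t ht => ⟨hu₁M t ht, hu₂M t ht⟩, hv,
    fun t ht ℓ => hu₂' ℓ t ht, ?_, ?_⟩
  · intro k
    simp only [hV']
    exact fun U hU => hs₂.tendsto_atTop.eventually (hu₁ k U hU)
  · intro k
    simp only [hW]
    exact hu₂ k

end Compactness

/-! ### Convexity and compactness of the set of relaxed solutions -/

section RelaxedSet

variable {d : ℕ} {G : FluidDomain d} [CompactSpace (Hull G)] {a γ T E₀ : ℝ} [hγ : Fact (1 < γ)]

lemma val_combination {X : Type} [NormedAddCommGroup X] [NormedSpace ℝ X] (α β : ℝ)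
    (u u' : CWeak T X) (t : ℝ) : (α • u + β • u').val t = α • u.val t + β • u'.val t := by
  unfold CWeak.val
  split_ifs
  · simp
  · simp

lemma IsStressBound.combination {ρ ρ' : DensSpace G γ} {m m' : MomSpace G γ}
    {L L' : StressDual G} (h : IsStressBound a γ ρ m L)
    (h' : IsStressBound a γ ρ' m' L') {α β : ℝ} (hα : 0 ≤ α) (hβ : 0 ≤ β) (hαβ : α + β = 1) :
    IsStressBound a γ (α • ρ + β • ρ') (α • m + β • m') (α • L + β • L') := by
  refine ⟨fun i j f => ?_, fun ξ f hf0 hfb s hs hsb => ?_, fun f hf0 hfb s hs hs0 hsb => ?_⟩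
  · change α * L _ + β * L' _ = α * L _ + β * L' _
    rw [h.symm i j, h'.symm i j]
  · obtain ⟨ℓ, ℓ', hℓ⟩ := exists_convective_functional (G := G) (γ := γ) f.continuous.measurable
      hfb ξ hs hsb
    have h1 := h.convective ξ f hf0 hfb s hs hsb
    have h2 := h'.convective ξ f hf0 hfb s hs hsb
    rw [hℓ] at h1 h2 ⊢
    simp only [map_add, map_smul, smul_eq_mul]
    change _ ≤ α * L _ + β * L' _
    have := mul_le_mul_of_nonneg_left h1 hα
    have := mul_le_mul_of_nonneg_left h2 hβ
    linarith
  · obtain ⟨c, ℓ, hℓ⟩ := exists_pressure_functional (G := G) (γ := γ) a f.continuous.measurable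
      hfb hs hs0 hsb
    have h1 := h.pressure f hf0 hfb s hs hs0 hsb
    have h2 := h'.pressure f hf0 hfb s hs hs0 hsb
    rw [hℓ] at h1 h2 ⊢
    simp only [map_add, map_smul, smul_eq_mul]
    change _ ≤ α * L _ + β * L' _
    have h3 := mul_le_mul_of_nonneg_left h1 hα
    have h4 := mul_le_mul_of_nonneg_left h2 hβ
    have h5 : c = α * c + β * c := by rw [← add_mul, hαβ, one_mul]
    linarith

/-- A convex combination of solutions is a solution with the combined stress functional, as all
conditions are linear or jointly convex. -/
lemma IsRelaxed.combination (hG : G.Admissible) {u u' : Trajectory G γ T}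
    {Λ Λ' : ℝ → StressDual G} (h : IsRelaxed a γ T E₀ u Λ)
    (h' : IsRelaxed a γ T E₀ u' Λ') {α β : ℝ} (hα : 0 ≤ α) (hβ : 0 ≤ β) (hαβ : α + β = 1) :
    IsRelaxed a γ T E₀ (α • u + β • u') (fun t => α • Λ t + β • Λ' t) := by
  have hv1 : (α • u + β • u').1.val = fun t => α • u.1.val t + β • u'.1.val t :=
    funext fun t => val_combination α β u.1 u'.1 t
  have hv2 : (α • u + β • u').2.val = fun t => α • u.2.val t + β • u'.2.val t :=
    funext fun t => val_combination α β u.2 u'.2 t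
  refine ⟨⟨fun F => ?_, ?_, ?_, ?_⟩, fun t ht => ?_, fun φ hφ τ hτ => ?_, fun φ hφ τ hτ => ?_⟩
  · exact ((h.stress.measurable F).const_mul α).add ((h'.stress.measurable F).const_mul β)
  · obtain ⟨C, hC⟩ := h.stress.bounded
    obtain ⟨C', hC'⟩ := h'.stress.bounded
    refine ⟨α * C + β * C', ?_⟩
    filter_upwards [hC, hC'] with t h1 h2
    have h3 := (norm_nonneg (Λ t)).trans h1
    have h4 := (norm_nonneg (Λ' t)).trans h2
    refine ContinuousLinearMap.opNorm_le_bound _ (by positivity) fun F => ?_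
    change |α * Λ t F + β * Λ' t F| ≤ _
    refine (abs_add_le _ _).trans ?_
    rw [abs_mul, abs_mul, abs_of_nonneg hα, abs_of_nonneg hβ, add_mul, mul_assoc, mul_assoc]
    exact add_le_add (mul_le_mul_of_nonneg_left ((Λ t).le_of_opNorm_le h1 F) hα)
      (mul_le_mul_of_nonneg_left ((Λ' t).le_of_opNorm_le h2 F) hβ)
  · filter_upwards [h.stress.bound, h'.stress.bound] with t h1 h2
    rw [hv1, hv2]
    exact h1.combination h2 hα hβ hαβ
  · obtain ⟨S, hS, hanti, hle⟩ := h.stress.energy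
    obtain ⟨S', hS', hanti', hle'⟩ := h'.stress.energy
    refine ⟨S ∩ S', hS.and hS', fun s hs t ht hst => ?_, fun t ht => ?_⟩
    · exact add_le_add (mul_le_mul_of_nonneg_left (hanti hs.1 ht.1 hst) hα)
        (mul_le_mul_of_nonneg_left (hanti' hs.2 ht.2 hst) hβ)
    · have h1 := add_le_add (mul_le_mul_of_nonneg_left (hle t ht.1) hα)
        (mul_le_mul_of_nonneg_left (hle' t ht.2) hβ)
      rwa [← add_mul, hαβ, one_mul] at h1
  · rw [hv1]
    filter_upwards [h.nonneg t ht, h'.nonneg t ht, Lp.coeFn_add (α • u.1.val t) (β • u'.1.val t),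
      Lp.coeFn_smul α (u.1.val t), Lp.coeFn_smul β (u'.1.val t)] with x h1 h2 h3 h4 h5
    rw [h3, Pi.add_apply, h4, h5]
    exact add_nonneg (mul_nonneg hα h1) (mul_nonneg hβ h2)
  · have hF : ∀ r : MomSpace G γ, ∫ x, fderiv ℝ φ x (r x) ∂G.vol
        = hullFunctional r (toHull (G := G) (continuous_gradient hφ.contDiff)) := fun r => by
      simp only [hullFunctional_toHull hG, ← fderiv_eq_inner_gradient]
    have hV : ∀ r : DensSpace G γ, ∫ x, r x * φ x ∂G.vol
        = hullFunctional r (toHull (G := G) hφ.contDiff.continuous) := fun r => by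
      rw [hullFunctional_toHull hG]
      exact integral_congr_ae (ae_of_all _ fun x => mul_comm _ _)
    have h1 := h.mass φ hφ τ hτ
    have h2 := h'.mass φ hφ τ hτ
    have hi : ∀ w : CWeak T (MomSpace G γ), IntervalIntegrable (fun t => hullFunctional (w.val t)
        (toHull (G := G) (continuous_gradient hφ.contDiff))) volume 0 τ := fun w =>
      ((continuous_val w (hullTest _)).mono (by
        rw [uIcc_of_le hτ.1]; exact Icc_subset_Icc_right hτ.2)).intervalIntegrable
    simp only [hF, hV, hv1, hv2] at h1 h2 ⊢
    simp only [hullFunctional_apply, map_add, map_smul, smul_eq_mul] at h1 h2 hi ⊢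
    rw [intervalIntegral.integral_add ((hi u.2).const_mul α) ((hi u'.2).const_mul β),
      intervalIntegral.integral_const_mul, intervalIntegral.integral_const_mul, ← h1, ← h2]
    ring
  · have hV : ∀ r : MomSpace G γ, ∫ x, inner ℝ (r x) (φ x) ∂G.vol
        = hullTest (toHull (G := G) hφ.contDiff.continuous) r := fun r =>
      (hullFunctional_toHull hG _ _).symm
    have h1 := h.momentum φ hφ τ hτ
    have h2 := h'.momentum φ hφ τ hτ
    obtain ⟨C, hC⟩ := h.stress.bounded
    obtain ⟨C', hC'⟩ := h'.stress.bounded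
    have i1 := intervalIntegrable_of_integrableOn_Ioo (integrableOn_apply_of_bounded
      h.stress.measurable hC (F := fun _ => gradTest (G := G) hφ.contDiff) continuous_const) hτ
    have i2 := intervalIntegrable_of_integrableOn_Ioo (integrableOn_apply_of_bounded
      h'.stress.measurable hC' (F := fun _ => gradTest (G := G) hφ.contDiff) continuous_const) hτ
    simp only [hV, hv2] at h1 h2 ⊢
    change _ = ∫ t in (0 : ℝ)..τ, (α * Λ t _ + β * Λ' t _)
    simp only [map_add, map_smul, smul_eq_mul]
    rw [intervalIntegral.integral_add (i1.const_mul α) (i2.const_mul β),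
      intervalIntegral.integral_const_mul, intervalIntegral.integral_const_mul, ← h1, ← h2]
    ring

lemma metrizable_boundedTrajectories (hG : G.Admissible) (M : ℝ) :
    TopologicalSpace.MetrizableSpace (boundedTrajectories G γ T M) := by
  obtain ⟨χ, hχ⟩ := exists_denseScalarFamily G
  obtain ⟨φ, hφ⟩ := exists_denseVectorFamily G
  have h1 := (isSeparatingFamily_dens (γ := γ) hG hχ).metrizable_bounded T M
  have h2 := (isSeparatingFamily_mom (γ := γ) hG hφ).metrizable_bounded T M
  let i : boundedTrajectories G γ T M → {u : CWeak T (DensSpace G γ) | ∀ t ∈ Icc 0 T, ‖u.val t‖ ≤ M}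
      × {u : CWeak T (MomSpace G γ) | ∀ t ∈ Icc 0 T, ‖u.val t‖ ≤ M} :=
    fun u => (⟨u.1.1, fun t ht => (u.2 t ht).1⟩, ⟨u.1.2, fun t ht => (u.2 t ht).2⟩)
  have hi : IsEmbedding i := by
    refine .of_comp (g := Prod.map Subtype.val Subtype.val) (by fun_prop) (by fun_prop) ?_
    exact IsEmbedding.subtypeVal
  exact hi.metrizableSpace

/-- The relaxed solutions with given initial values form a compact set. -/
lemma isCompact_setOf_isRelaxed (hG : G.Admissible) (ha : 0 < a) (hT : 0 < T) (hE₀ : 0 ≤ E₀)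
    (ρ₀ : DensSpace G γ) (m₀ : MomSpace G γ) :
    IsCompact {u : Trajectory G γ T |
      (∃ Λ, IsRelaxed a γ T E₀ u Λ) ∧ u.1.val 0 = ρ₀ ∧ u.2.val 0 = m₀} := by
  obtain ⟨χ, hχ⟩ := exists_denseScalarFamily G
  obtain ⟨φ, hφ⟩ := exists_denseVectorFamily G
  set M := stateBound a γ E₀ with hMdef
  have hmetr := metrizable_boundedTrajectories (G := G) (γ := γ) (T := T) hG M
  let S : Set (boundedTrajectories G γ T M) :=
    {u | (∃ Λ, IsRelaxed a γ T E₀ (u : Trajectory G γ T) Λ) ∧ u.1.1.val 0 = ρ₀ ∧ u.1.2.val 0 = m₀}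
  have hS : {u : Trajectory G γ T | (∃ Λ, IsRelaxed a γ T E₀ u Λ) ∧ u.1.val 0 = ρ₀ ∧ u.2.val 0 = m₀}
      = Subtype.val '' S := by
    ext u
    constructor
    · rintro ⟨⟨Λ, hΛ⟩, h⟩
      exact ⟨⟨u, hΛ.norm_le ha hT hE₀⟩, ⟨⟨Λ, hΛ⟩, h⟩, rfl⟩
    · rintro ⟨v, hv, rfl⟩; exact hv
  rw [hS]
  refine IsCompact.image ?_ continuous_subtype_val
  -- by metrizability sequential compactness suffices
  let _ := TopologicalSpace.metrizableSpaceMetric (boundedTrajectories G γ T M)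
  refine IsSeqCompact.isCompact fun u hu => ?_
  choose hu1 hu0 using hu
  choose Λ hΛ using hu1
  have hz : (0 : ℝ) ∈ Icc 0 T := ⟨le_rfl, hT.le⟩
  obtain ⟨s, hs, v, Λ', hv, hvM, hlim1, hlim2, hun1, hun2⟩ := exists_subseq_isRelaxed hG hT hχ hφ
    (E := fun _ => E₀) tendsto_const_nhds (v := fun n => (u n).1.1.val)
      (w := fun n => (u n).1.2.val)
    (fun n => (hΛ n).stress) (fun n => (hΛ n).nonneg) (fun n ℓ => ((continuous_val (u n).1.2 ℓ).mono
      Ioo_subset_Icc_self).aemeasurable measurableSet_Ioo) (fun n t ht => ((u n).2 t ht).1)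
    (fun n t ht => ((u n).2 t ht).2) (ε := fun _ => 0) tendsto_const_nhds
    (fun k n _ τ hτ => by rw [(hΛ n).mass _ (hχ.static k) τ hτ, sub_self, abs_zero])
    (fun k n _ τ hτ => by rw [(hΛ n).momentum _ (hφ.static k) τ hτ, sub_self, abs_zero])
  refine ⟨⟨v, hvM⟩, ⟨⟨Λ', hv⟩, ?_, ?_⟩, s, hs, ?_⟩
  · refine (SeparatingDual.eq_iff_forall_dual_eq (R := ℝ)).2 fun ℓ => ?_
    refine tendsto_nhds_unique (hlim1 0 hz ℓ) (tendsto_const_nhds.congr fun n => ?_)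
    rw [(hu0 (s n)).1]
  · refine (SeparatingDual.eq_iff_forall_dual_eq (R := ℝ)).2 fun ℓ => ?_
    refine tendsto_nhds_unique (hlim2 0 hz ℓ) (tendsto_const_nhds.congr fun n => ?_)
    rw [(hu0 (s n)).2]
  · rw [tendsto_subtype_rng]
    refine Tendsto.prodMk_nhds (mx := fun n => (u (s n)).1.1) (my := fun n => (u (s n)).1.2) ?_ ?_
    · refine (isSeparatingFamily_dens (γ := γ) hG hχ).tendsto_of_moments
        (fun n t ht => ((u (s n)).2 t ht).1) (fun t ht => (hvM t ht).1) fun k => ?_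
      simp only [← hullFunctional_apply, hullFunctional_toHull hG]
      exact hun1 k
    · refine (isSeparatingFamily_mom (γ := γ) hG hφ).tendsto_of_moments
        (fun n t ht => ((u (s n)).2 t ht).2) (fun t ht => (hvM t ht).2) fun k => ?_
      simp only [← hullFunctional_apply, hullFunctional_toHull hG]
      exact hun2 k

end RelaxedSet

/-! ### A conservative explicit scheme in entropy variables -/

section Scheme

lemma integral_comp_floor {τ : ℝ} (hτ : 0 < τ) (g : ℕ → ℝ) (k : ℕ) :
    ∀ t ∈ Icc (k * τ) ((k + 1) * τ), IntervalIntegrable (fun s => g ⌊s / τ⌋₊) volume 0 t ∧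
      ∫ s in (0 : ℝ)..t, g ⌊s / τ⌋₊ = ∑ j ∈ Finset.range k, τ * g j + (t - k * τ) * g k := by
  -- on each interval of the subdivision the integrand is constant
  have hpiece : ∀ k : ℕ, ∀ t ∈ Icc (k * τ) ((k + 1) * τ),
      IntervalIntegrable (fun s => g ⌊s / τ⌋₊) volume (k * τ) t ∧
      ∫ s in (k * τ)..t, g ⌊s / τ⌋₊ = (t - k * τ) * g k := by
    intro k t ht
    have hne : ∀ᵐ s : ℝ, s ≠ t := by simp [ae_iff, measure_singleton]
    have hae : ∀ᵐ s : ℝ, s ∈ uIoc (k * τ) t → g k = g ⌊s / τ⌋₊ := by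
      filter_upwards [hne] with s hs hsI
      rw [uIoc_of_le ht.1] at hsI
      congr 1
      refine (Nat.floor_eq_iff (div_nonneg ((mul_nonneg k.cast_nonneg hτ.le).trans hsI.1.le)
        hτ.le)).2 ⟨(le_div_iff₀ hτ).2 hsI.1.le, (div_lt_iff₀ hτ).2 ?_⟩ |>.symm
      exact lt_of_lt_of_le (lt_of_le_of_ne hsI.2 hs) ht.2
    constructor
    · refine IntervalIntegrable.congr_ae intervalIntegrable_const
        ((ae_restrict_iff' measurableSet_uIoc).2 hae)
    · rw [← intervalIntegral.integral_congr_ae hae, intervalIntegral.integral_const, smul_eq_mul]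
  induction k with
  | zero =>
    intro t ht
    simpa using hpiece 0 t ht
  | succ k ih =>
    intro t ht
    have h1 := ih ((k + 1) * τ) ⟨by nlinarith, le_rfl⟩
    have h2 := hpiece (k + 1) t ht
    push_cast at h2 ⊢
    refine ⟨h1.1.trans h2.1, ?_⟩
    rw [← intervalIntegral.integral_add_adjacent_intervals h1.1 h2.1, h1.2, h2.2,
      Finset.sum_range_succ]
    ring

variable {V : Type*} [NormedAddCommGroup V] [InnerProductSpace ℝ V] [FiniteDimensional ℝ V]
  {F G : V → V} {Φ : V → ℝ}

/-- A perturbation of the gradient `F` of a convex function is onto: the preimage of `y` minimizes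
`Φ(c) + ε/2 |c|² - ⟨y, c⟩`. -/
lemma exists_add_smul_eq (hF : Continuous F) (hΦc : Continuous Φ) (hΦ0 : ∀ c, 0 ≤ Φ c)
    (hΦ : ∀ c c', Φ c + inner ℝ (F c) (c' - c) ≤ Φ c') {ε : ℝ} (hε : 0 < ε) (y : V) :
    ∃ c, F c + ε • c = y := by
  let J : V → ℝ := fun c => Φ c + ε / 2 * ‖c‖ ^ 2 - inner ℝ y c
  have hJc : Continuous J := by fun_prop
  have hJ : Tendsto J (cocompact V) atTop := by
    have h1 : Tendsto (fun r : ℝ => r * (ε / 2 * r - ‖y‖)) atTop atTop := by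
      refine tendsto_id.atTop_mul_atTop₀ (tendsto_atTop_add_const_right _ _ ?_)
      exact tendsto_id.const_mul_atTop (half_pos hε)
    refine tendsto_atTop_mono (fun c => ?_) (h1.comp (tendsto_norm_cocompact_atTop (E := V)))
    have h2 := real_inner_le_norm y c
    have h3 := hΦ0 c
    simp only [J, Function.comp_apply]
    nlinarith
  obtain ⟨c, hc⟩ := hJc.exists_forall_le hJ
  -- the first variation, obtained from the convexity inequality instead of a derivative of `Φ`
  have h0 : ∀ v, 0 ≤ inner ℝ (F c + ε • c - y) v := by
    intro v
    have hlim : Tendsto (fun t : ℝ => inner ℝ (F (c + t • v)) v + ε * inner ℝ c v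
        + ε / 2 * t * ‖v‖ ^ 2 - inner ℝ y v) (𝓝[>] 0) (𝓝 (inner ℝ (F c + ε • c - y) v)) := by
      have h1 : Continuous fun t : ℝ => inner ℝ (F (c + t • v)) v + ε * inner ℝ c v
        + ε / 2 * t * ‖v‖ ^ 2 - inner ℝ y v := by fun_prop
      have h2 := (h1.tendsto 0).mono_left (nhdsWithin_le_nhds (s := Ioi 0))
      convert h2 using 2
      simp [inner_sub_left, inner_add_left, real_inner_smul_left]
    refine ge_of_tendsto hlim ?_
    filter_upwards [self_mem_nhdsWithin] with t ht
    have ht0 : 0 < t := ht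
    have h1 := hc (c + t • v)
    have h2 := hΦ (c + t • v) c
    have h3 : ‖c + t • v‖ ^ 2 = ‖c‖ ^ 2 + 2 * (t * inner ℝ c v) + t ^ 2 * ‖v‖ ^ 2 := by
      rw [norm_add_sq_real, real_inner_smul_right, norm_smul, mul_pow, norm_eq_abs, sq_abs]
    simp only [J] at h1
    rw [h3, inner_add_right, real_inner_smul_right] at h1
    rw [show c - (c + t • v) = -(t • v) by abel, inner_neg_right, real_inner_smul_right] at h2
    have h4 : 0 ≤ t * (inner ℝ (F (c + t • v)) v + ε * inner ℝ c v
        + ε / 2 * t * ‖v‖ ^ 2 - inner ℝ y v) := by nlinarith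
    exact nonneg_of_mul_nonneg_right h4 ht0
  have h1 := h0 (-(F c + ε • c - y))
  rw [inner_neg_right, real_inner_self_eq_norm_sq] at h1
  refine ⟨c, sub_eq_zero.1 (norm_eq_zero.1 ?_)⟩
  nlinarith [norm_nonneg (F c + ε • c - y)]

/-- An approximate solution of `d/dt F(c) = G(c)`, `F(c(0)) = y₀`, where `F` is the gradient of the
convex function `Φ`, by a step function. The energy is the Legendre transform `⟨F(c), c⟩ - Φ(c)`,
conserved by the equation as `⟨G(c), c⟩ = 0`. The explicit Euler scheme is applied to
`y = F(c) + ε c`, whose energy has the additional term `ε/2 |c|²`. -/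
lemma exists_approximate_solution (hF : Continuous F) (hG : Continuous G) (hΦc : Continuous Φ)
    (hΦ0 : ∀ c, 0 ≤ Φ c) (hΦz : Φ 0 = 0) (hΦ : ∀ c c', Φ c + inner ℝ (F c) (c' - c) ≤ Φ c')
    (hGc : ∀ c, inner ℝ (G c) c = 0) {y₀ : V} {E₀ : ℝ} (hy : ∀ c, inner ℝ y₀ c - Φ c ≤ E₀)
    {T δ : ℝ} (hT : 0 < T) (hδ : 0 < δ) :
    ∃ (b : ℕ → V) (τ : ℝ), 0 < τ ∧ ∀ t ∈ Icc 0 T,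
      inner ℝ (F (b ⌊t / τ⌋₊)) (b ⌊t / τ⌋₊) - Φ (b ⌊t / τ⌋₊) ≤ E₀ + δ ∧
      ∀ v, ‖v‖ ≤ 1 → |inner ℝ (F (b ⌊t / τ⌋₊)) v - inner ℝ (F (b 0)) v
          - ∫ s in (0 : ℝ)..t, inner ℝ (G (b ⌊s / τ⌋₊)) v| ≤ δ ∧
        |inner ℝ (F (b 0)) v - inner ℝ y₀ v| ≤ δ := by
  have hE₀ : 0 ≤ E₀ := by simpa [hΦz] using hy 0
  set B := E₀ + δ with hBdef
  have hB : 0 < B := by positivity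
  -- then `ε |c| ≤ δ/4` whenever `ε/2 |c|² ≤ B`
  obtain ⟨ε, hε, hεB⟩ : ∃ ε > 0, 2 * ε * B ≤ (δ / 4) ^ 2 :=
    ⟨(δ / 4) ^ 2 / (2 * B), by positivity, by field_simp; exact le_rfl⟩
  choose c hc using exists_add_smul_eq hF hΦc hΦ0 hΦ hε
  -- a bound for the coefficients of states of energy at most `B`
  set R := √(2 * B / ε) with hR
  obtain ⟨K₀, hK₀⟩ := (isCompact_closedBall (0 : V) R).exists_bound_of_continuousOn hG.continuousOn
  set K := |K₀| + 1 with hKdef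
  have hK : 0 < K := by positivity
  have hGK : ∀ c, ‖c‖ ≤ R → ‖G c‖ ≤ K := fun c hc =>
    (hK₀ c (mem_closedBall_zero_iff.2 hc)).trans (by linarith [le_abs_self K₀])
  obtain ⟨τ, hτ, hτ1, hτ2⟩ : ∃ τ > 0, τ * K ≤ δ / 2 ∧ T * τ * K ^ 2 / (2 * ε) ≤ δ := by
    refine ⟨min (δ / 2 / K) (2 * ε * δ / (T * K ^ 2)), by positivity, ?_, ?_⟩
    · exact (mul_le_mul_of_nonneg_right (min_le_left _ _) hK.le).trans_eq (by field_simp)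
    · rw [div_le_iff₀ (by positivity)]
      calc T * min (δ / 2 / K) (2 * ε * δ / (T * K ^ 2)) * K ^ 2
          ≤ T * (2 * ε * δ / (T * K ^ 2)) * K ^ 2 := by gcongr; exact min_le_right _ _
        _ = δ * (2 * ε) := by field_simp
  let y : ℕ → V := fun k => Nat.rec y₀ (fun _ z => z + τ • G (c z)) k
  have hys : ∀ k, y (k + 1) = y k + τ • G (c (y k)) := fun k => rfl
  let b : ℕ → V := fun k => c (y k)
  have hb : ∀ k, F (b k) + ε • b k = y k := fun k => hc (y k)
  let Ψ : ℕ → ℝ := fun k => inner ℝ (y k) (b k) - Φ (b k) - ε / 2 * ‖b k‖ ^ 2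
  have hΨ : ∀ k, Ψ k = inner ℝ (F (b k)) (b k) - Φ (b k) + ε / 2 * ‖b k‖ ^ 2 := fun k => by
    simp only [Ψ]
    rw [← hb k, inner_add_left, real_inner_smul_left, real_inner_self_eq_norm_sq]
    ring
  have hpos : ∀ c, 0 ≤ inner ℝ (F c) c - Φ c := fun c => by
    have := hΦ c 0
    rw [zero_sub, inner_neg_right, hΦz] at this
    linarith
  have hbR : ∀ k, Ψ k ≤ B → ‖b k‖ ≤ R := fun k hk => by
    refine Real.le_sqrt_of_sq_le ?_
    rw [le_div_iff₀ hε]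
    have := hΨ k
    have := hpos (b k)
    nlinarith
  -- the strong convexity of the regularization absorbs the error of the explicit step
  have hstep : ∀ k, ‖G (b k)‖ ≤ K → Ψ (k + 1) ≤ Ψ k + τ * (τ * K ^ 2 / (2 * ε)) := by
    intro k hk
    have h1 := hΦ (b k) (b (k + 1))
    have h2 : F (b k) = y k - ε • b k := by rw [← hb k]; abel
    have h3 : inner ℝ (G (b k)) (b (k + 1)) ≤ K * ‖b (k + 1) - b k‖ := by
      have h4 : inner ℝ (G (b k)) (b (k + 1)) = inner ℝ (G (b k)) (b (k + 1) - b k) := by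
        rw [inner_sub_right, hGc, sub_zero]
      rw [h4]
      exact (real_inner_le_norm _ _).trans (mul_le_mul_of_nonneg_right hk (norm_nonneg _))
    have h5 := norm_sub_sq_real (b (k + 1)) (b k)
    rw [real_inner_comm] at h5
    have h6 : inner ℝ (y (k + 1)) (b (k + 1))
        = inner ℝ (y k) (b (k + 1)) + τ * inner ℝ (G (b k)) (b (k + 1)) := by
      rw [hys, inner_add_left, real_inner_smul_left]
    rw [h2, inner_sub_left, inner_sub_right, inner_sub_right, real_inner_smul_left,
      real_inner_smul_left, real_inner_self_eq_norm_sq] at h1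
    simp only [Ψ]
    rw [h6]
    have h7 : τ * inner ℝ (G (b k)) (b (k + 1)) ≤ τ * (K * ‖b (k + 1) - b k‖) :=
      mul_le_mul_of_nonneg_left h3 hτ.le
    have h8 : τ * (K * ‖b (k + 1) - b k‖)
        ≤ τ * (τ * K ^ 2 / (2 * ε)) + ε / 2 * ‖b (k + 1) - b k‖ ^ 2 := by
      have h9 : 0 ≤ (τ * K - ε * ‖b (k + 1) - b k‖) ^ 2 / (2 * ε) := by positivity
      have h10 : (τ * K - ε * ‖b (k + 1) - b k‖) ^ 2 / (2 * ε) = τ * (τ * K ^ 2 / (2 * ε))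
          + ε / 2 * ‖b (k + 1) - b k‖ ^ 2 - τ * (K * ‖b (k + 1) - b k‖) := by
        field_simp; ring
      linarith
    nlinarith
  have herr : ∀ r ≤ T, r * (τ * K ^ 2 / (2 * ε)) ≤ δ := fun r hr =>
    (mul_le_mul_of_nonneg_right hr (by positivity)).trans (le_of_eq_of_le (by ring) hτ2)
  -- the energy grows by at most `δ`, so that the coefficients stay in the ball of radius `R`
  have hΨk : ∀ k : ℕ, k * τ ≤ T → Ψ k ≤ E₀ + k * τ * (τ * K ^ 2 / (2 * ε)) := by
    intro k
    induction k with
    | zero =>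
      intro _
      have h1 := hy (b 0)
      have h2 : 0 ≤ ε / 2 * ‖b 0‖ ^ 2 := by positivity
      simp only [Ψ, Nat.cast_zero, zero_mul, add_zero]
      exact (sub_le_self _ h2).trans h1
    | succ k ih =>
      intro hk
      push_cast at hk ⊢
      have hk' : k * τ ≤ T := by nlinarith
      have h1 := ih hk'
      have h2 : Ψ k ≤ B := by
        exact h1.trans (add_le_add le_rfl (herr _ hk'))
      have h3 := hstep k (hGK _ (hbR k h2))
      linarith
  have hΨB : ∀ k : ℕ, k * τ ≤ T → Ψ k ≤ B := fun k hk => by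
    exact (hΨk k hk).trans (add_le_add le_rfl (herr _ hk))
  have hεb : ∀ k : ℕ, k * τ ≤ T → ∀ v : V, ‖v‖ ≤ 1 → |ε * inner ℝ (b k) v| ≤ δ / 4 := by
    intro k hk v hv
    have h1 : (ε * ‖b k‖) ^ 2 ≤ (δ / 4) ^ 2 := by
      have := hΨ k
      have := hpos (b k)
      have := hΨB k hk
      have h2 : ε / 2 * ‖b k‖ ^ 2 ≤ B := by linarith
      calc (ε * ‖b k‖) ^ 2 = 2 * ε * (ε / 2 * ‖b k‖ ^ 2) := by ring
        _ ≤ 2 * ε * B := by gcongr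
        _ ≤ _ := hεB
    rw [abs_mul, abs_of_pos hε]
    calc ε * |inner ℝ (b k) v| ≤ ε * (‖b k‖ * 1) := by
          gcongr
          exact (abs_real_inner_le_norm _ _).trans (by gcongr)
      _ ≤ δ / 4 := by rw [mul_one]; exact le_of_sq_le_sq h1 (by positivity)
  have hFy : ∀ k v, inner ℝ (F (b k)) v = inner ℝ (y k) v - ε * inner ℝ (b k) v := fun k v => by
    rw [← hb k, inner_add_left, real_inner_smul_left]; ring
  have hsum : ∀ k v, inner ℝ (y k) v - inner ℝ y₀ v
      = ∑ j ∈ Finset.range k, τ * inner ℝ (G (b j)) v := by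
    intro k v
    induction k with
    | zero => simp [y]
    | succ k ih =>
      rw [Finset.sum_range_succ, ← ih, hys, inner_add_left, real_inner_smul_left]
      ring
  have h0T : ((0 : ℕ) : ℝ) * τ ≤ T := by simpa using hT.le
  refine ⟨b, τ, hτ, fun t ht => ?_⟩
  set k := ⌊t / τ⌋₊ with hkdef
  have hk1 : k * τ ≤ t := (le_div_iff₀ hτ).1 (Nat.floor_le (div_nonneg ht.1 hτ.le))
  have hk2 : t ≤ (k + 1) * τ := ((div_lt_iff₀ hτ).1 (Nat.lt_floor_add_one _)).le
  have hkT : k * τ ≤ T := hk1.trans ht.2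
  refine ⟨?_, fun v hv => ⟨?_, ?_⟩⟩
  · have h1 := hΨB k hkT
    rw [hΨ] at h1
    have : 0 ≤ ε / 2 * ‖b k‖ ^ 2 := by positivity
    linarith
  · rw [(integral_comp_floor hτ (fun j => inner ℝ (G (b j)) v) k t ⟨hk1, hk2⟩).2, ← hsum, hFy, hFy]
    have h1 := hεb k hkT v hv
    have h2 := hεb 0 h0T v hv
    have h3 : |(t - k * τ) * inner ℝ (G (b k)) v| ≤ δ / 2 := by
      rw [abs_mul, abs_of_nonneg (by linarith)]
      refine le_trans ?_ hτ1
      refine mul_le_mul (by linarith) ?_ (abs_nonneg _) hτ.le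
      calc |inner ℝ (G (b k)) v| ≤ ‖G (b k)‖ * ‖v‖ := abs_real_inner_le_norm _ _
        _ ≤ K * 1 := mul_le_mul (hGK _ (hbR k (hΨB k hkT))) hv (norm_nonneg _) hK.le
        _ = K := mul_one K
    have h4 : y 0 = y₀ := rfl
    rw [h4]
    rw [abs_le] at h1 h2 h3 ⊢
    constructor <;> linarith
  · have h2 := hεb 0 h0T v hv
    rw [hFy]
    change |inner ℝ y₀ v - _ - _| ≤ δ
    rw [abs_le] at h2 ⊢
    constructor <;> linarith

end Scheme

/-! ### The Legendre transform of the pressure potential -/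

section Dual

variable {a γ : ℝ}

/-- The maximizer `r ≥ 0` of `h r - P(r)`. -/
def dualDensity (a γ h : ℝ) : ℝ := ((γ - 1) / (a * γ) * max h 0) ^ (1 / (γ - 1))

/-- The Legendre transform of the potential `P`. It is the pressure of the maximizer. -/
def dualPressure (a γ h : ℝ) : ℝ := pressure a γ (dualDensity a γ h)

lemma dualDensity_nonneg (ha : 0 < a) (hγ : 1 < γ) (h : ℝ) : 0 ≤ dualDensity a γ h :=
  rpow_nonneg (mul_nonneg (div_nonneg (by linarith) (by positivity)) (le_max_right _ _)) _

lemma continuous_dualDensity (hγ : 1 < γ) : Continuous (dualDensity a γ) := by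
  unfold dualDensity
  exact Continuous.rpow_const (by fun_prop) fun _ => Or.inr (by
    have := sub_pos.2 hγ; positivity)

lemma dualPressure_zero (hγ : 1 < γ) : dualPressure a γ 0 = 0 := by
  have := sub_pos.2 hγ
  rw [dualPressure, dualDensity, max_self, mul_zero, zero_rpow (by positivity), pressure,
    zero_rpow (by linarith), mul_zero]

lemma dualDensity_mul (ha : 0 < a) (hγ : 1 < γ) (h : ℝ) :
    dualDensity a γ h * h = potential a γ (dualDensity a γ h) + dualPressure a γ h ∧
    ∀ s, 0 ≤ s → s * h ≤ potential a γ s + dualPressure a γ h := by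
  have hγ1 := sub_pos.2 hγ
  set r := dualDensity a γ h with hr
  have hr0 : 0 ≤ r := dualDensity_nonneg ha hγ h
  have h0 : 0 ≤ (γ - 1) / (a * γ) * max h 0 :=
    mul_nonneg (div_nonneg hγ1.le (by positivity)) (le_max_right _ _)
  have h1 : r ^ (γ - 1) = (γ - 1) / (a * γ) * max h 0 := by
    rw [hr, dualDensity, ← rpow_mul h0, one_div_mul_cancel hγ1.ne', Real.rpow_one]
  have h2 : r ^ γ = (γ - 1) / (a * γ) * max h 0 * r := by
    rw [← h1, ← Real.rpow_add_one' hr0 (by linarith), sub_add_cancel]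
  have h3 : r * h = r * max h 0 := by
    rcases le_total h 0 with hh | hh
    · rw [hr, dualDensity, max_eq_right hh, mul_zero, zero_rpow (by positivity)]
      simp
    · rw [max_eq_left hh]
  have h4 : r * max h 0 = potential a γ r + dualPressure a γ h := by
    rw [dualPressure, ← hr, potential, pressure, h2]
    field_simp
    ring
  refine ⟨h3.trans h4, fun s hs => ?_⟩
  have h5 := pressureTangent_le (A := a / (γ - 1)) (by positivity) hγ hr0 hs
  simp only [pressureTangent, h1] at h5
  have h6 : a / (γ - 1) * γ * ((γ - 1) / (a * γ) * max h 0) * (s - r) = max h 0 * (s - r) := by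
    field_simp
  rw [h6] at h5
  have h7 := mul_le_mul_of_nonneg_left (le_max_left h 0) hs
  simp only [potential, pressure] at h4 h5 ⊢
  linarith

lemma dualPressure_add_le (ha : 0 < a) (hγ : 1 < γ) (h h' : ℝ) :
    dualPressure a γ h + dualDensity a γ h * (h' - h) ≤ dualPressure a γ h' := by
  have h1 := (dualDensity_mul ha hγ h).1
  have h2 := (dualDensity_mul ha hγ h').2 _ (dualDensity_nonneg ha hγ h)
  linarith

lemma hasDerivAt_dualPressure (ha : 0 < a) (hγ : 1 < γ) (h : ℝ) :
    HasDerivAt (dualPressure a γ) (dualDensity a γ h) h := by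
  rw [hasDerivAt_iff_isLittleO, Asymptotics.isLittleO_iff]
  intro c hc
  have h1 : Tendsto (fun y => |dualDensity a γ y - dualDensity a γ h|) (𝓝 h) (𝓝 0) := by
    have := ((continuous_dualDensity (a := a) hγ).tendsto h).sub_const (dualDensity a γ h)
    simpa using this.abs
  filter_upwards [h1.eventually_le_const hc] with y hy
  have h2 := dualPressure_add_le ha hγ h y
  have h3 := dualPressure_add_le ha hγ y h
  rw [smul_eq_mul, norm_of_nonneg (by linarith)]
  calc _ ≤ (dualDensity a γ y - dualDensity a γ h) * (y - h) := by linarith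
    _ ≤ |dualDensity a γ y - dualDensity a γ h| * ‖y - h‖ := by
        rw [norm_eq_abs, ← abs_mul]; exact le_abs_self _
    _ ≤ _ := by gcongr

lemma contDiff_dualPressure (ha : 0 < a) (hγ : 1 < γ) : ContDiff ℝ 1 (dualPressure a γ) :=
  contDiff_one_iff_deriv.2 ⟨fun h => (hasDerivAt_dualPressure ha hγ h).differentiableAt, by
    rw [funext fun h => (hasDerivAt_dualPressure ha hγ h).deriv]
    exact continuous_dualDensity hγ⟩

/-- Young's inequality for the energy density of the state `[s, w]` and its dual variables: the
velocity `u` and `θ = h - ½ |u|²`. -/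
lemma pairing_le_energy {E : Type*} [NormedAddCommGroup E] [InnerProductSpace ℝ E]
    (ha : 0 < a) (hγ : 1 < γ) {s θ : ℝ} {w u : E} (hs : 0 ≤ s) (hw : s = 0 → w = 0) :
    s * θ + inner ℝ w u ≤ 1 / 2 * (‖w‖ ^ 2 / s) + potential a γ s
      + dualPressure a γ (θ + ‖u‖ ^ 2 / 2) := by
  have h1 := (dualDensity_mul ha hγ (θ + ‖u‖ ^ 2 / 2)).2 s hs
  have h2 : inner ℝ w u ≤ 1 / 2 * (‖w‖ ^ 2 / s) + s * (‖u‖ ^ 2 / 2) := by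
    rcases hs.eq_or_lt with rfl | hs
    · simp [hw rfl]
    · have h3 := sq_nonneg ‖w - s • u‖
      rw [← sq_abs, abs_of_nonneg (norm_nonneg _), norm_sub_sq_real, norm_smul, mul_pow,
        norm_eq_abs, sq_abs, real_inner_smul_right] at h3
      have h4 : 1 / 2 * (‖w‖ ^ 2 / s) + s * (‖u‖ ^ 2 / 2) - inner ℝ w u
          = (‖w‖ ^ 2 - 2 * (s * inner ℝ w u) + s ^ 2 * ‖u‖ ^ 2) / (2 * s) := by
        field_simp
        ring
      have h5 := div_nonneg h3 (by positivity : 0 ≤ 2 * s)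
      linarith
  linarith

end Dual

/-! ### The Galerkin system in dual variables -/

section Galerkin

variable {d : ℕ} {G : FluidDomain d} [CompactSpace (Hull G)] {a γ : ℝ}

lemma continuous_integral_vol {V : Type*} [TopologicalSpace V] [FirstCountableTopology V]
    [LocallyCompactSpace V] (hG : G.Admissible) {f : V → Space d → ℝ}
    (hf : Continuous f.uncurry) : Continuous fun c => ∫ x, f c x ∂G.vol := by
  have h := continuous_parametric_integral_of_continuous (μ := G.vol) hf
    (isCompact_iff_compactSpace.2 (inferInstance : CompactSpace (Hull G)))
  rwa [Measure.restrict_eq_self_of_ae_mem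
    ((ae_mem_cell hG).mono fun x hx => subset_closure hx)] at h

lemma integrable_vol_of_continuous (hG : G.Admissible) {f : Space d → ℝ} (hf : Continuous f) :
    Integrable f G.vol := by
  obtain ⟨h1, c, hc⟩ := isWeight_of_continuous hG hf
  exact Integrable.of_bound h1 c hc

variable {ι : Type*} [Fintype ι] {χ : ι → Space d → ℝ} {φ : ι → Space d → Space d}

/-- The velocity field with the coefficients `c` in the basis `φ`. -/
def velocity (φ : ι → Space d → Space d) (c : EuclideanSpace ℝ ι) (x : Space d) : Space d :=
  ∑ i, c i • φ i x

/-- The dual variable `h = θ + ½ |u|²` of the density, with `θ` and `u` combinations of the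
functions `χ` and `φ` with the coefficients `c`. -/
def enthalpy (χ : ι → Space d → ℝ) (φ : ι → Space d → Space d) (c : EuclideanSpace ℝ ι)
    (x : Space d) : ℝ := ∑ i, c i * χ i x + ‖velocity φ c x‖ ^ 2 / 2

/-- The moments of the state `[r, r u]` with respect to the functions `(χ i, φ i)`. -/
def stateMoments (G : FluidDomain d) (χ : ι → Space d → ℝ) (φ : ι → Space d → Space d)
    (r : Space d → ℝ) (u : Space d → Space d) : EuclideanSpace ℝ ι :=
  WithLp.toLp 2 fun i => ∫ x, (r x * χ i x + r x * inner ℝ (u x) (φ i x)) ∂G.vol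

/-- The rate of change of the moments of a state `[r, r u]` of pressure `p`. -/
def fluxMoments (G : FluidDomain d) (χ : ι → Space d → ℝ) (φ : ι → Space d → Space d)
    (r p : Space d → ℝ) (u : Space d → Space d) : EuclideanSpace ℝ ι :=
  WithLp.toLp 2 fun i => ∫ x, (r x * fderiv ℝ (χ i) x (u x)
    + r x * inner ℝ (u x) (fderiv ℝ (φ i) x (u x)) + p x * divg (φ i) x) ∂G.vol

lemma inner_toLp_integral {f : ι → Space d → ℝ} (hf : ∀ i, Integrable (f i) G.vol)
    (v : EuclideanSpace ℝ ι) :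
    inner ℝ (WithLp.toLp 2 fun i => ∫ x, f i x ∂G.vol : EuclideanSpace ℝ ι) v
      = ∫ x, ∑ i, v i * f i x ∂G.vol := by
  rw [integral_finsetSum _ fun i _ => (hf i).const_mul _]
  simp [PiLp.inner_apply, integral_const_mul]

lemma continuous_velocity (hφ : ∀ i, IsStaticVector G (φ i)) :
    Continuous (velocity φ).uncurry := by
  have h1 := fun i => (hφ i).contDiff.continuous
  unfold velocity
  simp only [Function.uncurry_def]
  fun_prop

lemma continuous_enthalpy (hχ : ∀ i, IsStaticScalar G (χ i)) (hφ : ∀ i, IsStaticVector G (φ i)) :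
    Continuous (enthalpy χ φ).uncurry := by
  have h1 := fun i => (hχ i).contDiff.continuous
  have h2 := continuous_velocity hφ
  unfold enthalpy
  simp only [Function.uncurry_def] at h2 ⊢
  fun_prop

lemma fderiv_velocity (hφ : ∀ i, IsStaticVector G (φ i)) (c : EuclideanSpace ℝ ι) (x : Space d) :
    HasFDerivAt (velocity φ c) (∑ i, c i • fderiv ℝ (φ i) x) x :=
  HasFDerivAt.fun_sum fun i _ =>
    (((hφ i).contDiff.differentiable one_ne_zero x).hasFDerivAt.const_smul (c i))

lemma fderiv_enthalpy (hχ : ∀ i, IsStaticScalar G (χ i)) (hφ : ∀ i, IsStaticVector G (φ i))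
    (c : EuclideanSpace ℝ ι) (x w : Space d) :
    DifferentiableAt ℝ (enthalpy χ φ c) x ∧ fderiv ℝ (enthalpy χ φ c) x w
      = ∑ i, c i * (fderiv ℝ (χ i) x w + inner ℝ (velocity φ c x) (fderiv ℝ (φ i) x w)) := by
  have h1 : HasFDerivAt (fun x => ∑ i, c i * χ i x) (∑ i, c i • fderiv ℝ (χ i) x) x :=
    HasFDerivAt.fun_sum fun i _ =>
      (((hχ i).contDiff.differentiable one_ne_zero x).hasFDerivAt.const_mul (c i))
  have h2 := h1.add ((fderiv_velocity hφ c x).norm_sq.mul_const (1 / 2))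
  have h3 : HasFDerivAt (enthalpy χ φ c) _ x :=
    h2.congr_of_eventuallyEq (Eventually.of_forall fun y => by
      simp only [enthalpy, Pi.add_apply]; ring)
  refine ⟨h3.differentiableAt, ?_⟩
  rw [h3.fderiv]
  simp [mul_sum, ← sum_add_distrib, mul_add]

/-- The convective and pressure terms do no work: `⟨G(c), c⟩` is the integral of
`div (p(r) u)`. -/
lemma inner_fluxMoments_self (hd : d ≠ 0) (hG : G.Admissible) (ha : 0 < a) (hγ : 1 < γ)
    (hχ : ∀ i, IsStaticScalar G (χ i)) (hφ : ∀ i, IsStaticVector G (φ i))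
    (hi : ∀ c : EuclideanSpace ℝ ι, ∀ i, Integrable (fun x =>
      dualDensity a γ (enthalpy χ φ c x) * fderiv ℝ (χ i) x (velocity φ c x)
      + dualDensity a γ (enthalpy χ φ c x)
        * inner ℝ (velocity φ c x) (fderiv ℝ (φ i) x (velocity φ c x))
      + dualPressure a γ (enthalpy χ φ c x) * divg (φ i) x) G.vol) (c : EuclideanSpace ℝ ι) :
    inner ℝ (fluxMoments G χ φ (fun x => dualDensity a γ (enthalpy χ φ c x))
      (fun x => dualPressure a γ (enthalpy χ φ c x)) (velocity φ c)) c = 0 := by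
  rw [fluxMoments, inner_toLp_integral (hi c)]
  have hu : ContDiff ℝ 1 (velocity φ c) := by
    unfold velocity
    exact ContDiff.sum fun i _ => (hφ i).contDiff.const_smul (c i)
  have hh : ContDiff ℝ 1 (enthalpy χ φ c) := by
    unfold enthalpy
    exact (ContDiff.sum fun i _ => contDiff_const.mul (hχ i).contDiff).add
      ((hu.norm_sq ℝ).div_const 2)
  have hv : ContDiff ℝ 1 fun x => dualPressure a γ (enthalpy χ φ c x) • velocity φ c x :=
    ((contDiff_dualPressure ha hγ).comp hh).smul hu
  rw [← integral_divg_eq_zero hd hG hv]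
  · refine integral_congr_ae (ae_of_all _ fun x => ?_)
    have hP := (hasDerivAt_dualPressure ha hγ (enthalpy χ φ c x)).comp_hasFDerivAt x
      (fderiv_enthalpy hχ hφ c x 0).1.hasFDerivAt
    have hdiv : divg (velocity φ c) x = ∑ i, c i * divg (φ i) x := by
      simp only [divg, grad, (fderiv_velocity hφ c x).fderiv, sum_apply,
        mul_sum]
      rw [sum_comm]
      simp
    change _ = divg (fun y => (dualPressure a γ ∘ enthalpy χ φ c) y • velocity φ c y) x
    rw [divg_smul hP.differentiableAt (hu.differentiable one_ne_zero x), hP.fderiv, hdiv,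
      smul_apply, (fderiv_enthalpy hχ hφ c x _).2, smul_eq_mul,
      mul_sum, mul_sum, ← sum_add_distrib]
    refine sum_congr rfl fun i _ => ?_
    simp only [Function.comp_apply]
    ring
  · cases G with
    | bounded Ω => trivial
    | torus =>
      intro x j
      have h1 : velocity φ c (x + single j 2) = velocity φ c x :=
        sum_congr rfl fun i _ => by rw [(hφ i).periodic x j]
      have h2 : enthalpy χ φ c (x + single j 2) = enthalpy χ φ c x := by
        unfold enthalpy
        rw [h1, sum_congr rfl fun i _ => by rw [(hχ i).periodic x j]]
      simp only [h1, h2]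
  · cases G with
    | bounded Ω =>
      intro x hx n hn
      rw [real_inner_smul_left, velocity, sum_inner, sum_eq_zero, mul_zero]
      intro i _
      rw [real_inner_smul_left, (hφ i).impermeable x hx n hn, mul_zero]
    | torus => trivial

set_option maxHeartbeats 1000000 in
/-- Approximate solutions, given by step functions with values in the states `[r, r u]` that are
dual to the span of the functions `(χ i, φ i)`. -/
lemma exists_galerkin_solution [DecidableEq ι] (hd : d ≠ 0) (hG : G.Admissible) (ha : 0 < a)
    [hγ : Fact (1 < γ)] (hχ : ∀ i, IsStaticScalar G (χ i)) (hφ : ∀ i, IsStaticVector G (φ i))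
    {ρ₀ : DensSpace G γ} {m₀ : MomSpace G γ} (hρ₀ : 0 ≤ᵐ[G.vol] ρ₀)
    (hE₀ : fluidEnergy G a γ ρ₀ m₀ < ∞) {T δ : ℝ} (hT : 0 < T) (hδ : 0 < δ) :
    ∃ (r : ℕ → Space d → ℝ) (u : ℕ → Space d → Space d) (τ : ℝ), 0 < τ ∧
      (∀ k, Continuous (r k) ∧ (∀ x, 0 ≤ r k x) ∧ Continuous (u k)) ∧ ∀ t ∈ Icc 0 T,
      ∫ x, (r ⌊t / τ⌋₊ x * ‖u ⌊t / τ⌋₊ x‖ ^ 2 / 2 + potential a γ (r ⌊t / τ⌋₊ x)) ∂G.vol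
        ≤ (fluidEnergy G a γ ρ₀ m₀).toReal + δ ∧
      ∀ i, |stateMoments G χ φ (r ⌊t / τ⌋₊) (u ⌊t / τ⌋₊) i - stateMoments G χ φ (r 0) (u 0) i
          - ∫ s in (0 : ℝ)..t, fluxMoments G χ φ (r ⌊s / τ⌋₊)
              (fun x => pressure a γ (r ⌊s / τ⌋₊ x)) (u ⌊s / τ⌋₊) i| ≤ δ ∧
        |stateMoments G χ φ (r 0) (u 0) i
          - (∫ x, ρ₀ x * χ i x ∂G.vol + ∫ x, inner ℝ (m₀ x) (φ i x) ∂G.vol)| ≤ δ := by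
  have hγ' := hγ.out
  have hγ1 := sub_pos.2 hγ'
  let R : EuclideanSpace ℝ ι → Space d → ℝ := fun c x => dualDensity a γ (enthalpy χ φ c x)
  let Q : EuclideanSpace ℝ ι → Space d → ℝ := fun c x => dualPressure a γ (enthalpy χ φ c x)
  have hh := continuous_enthalpy hχ hφ
  have hu := continuous_velocity hφ
  have hR : Continuous R.uncurry := (continuous_dualDensity hγ').comp hh
  have hQ : Continuous Q.uncurry := (contDiff_dualPressure ha hγ').continuous.comp hh
  have hR0 : ∀ c x, 0 ≤ R c x := fun c x => dualDensity_nonneg ha hγ' _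
  have c1 := fun i => (hχ i).contDiff.continuous
  have c2 := fun i => (hφ i).contDiff.continuous
  have c3 := fun i => (hχ i).contDiff.continuous_fderiv one_ne_zero
  have c4 := fun i => (hφ i).contDiff.continuous_fderiv one_ne_zero
  have c5 := fun i => continuous_divg (hφ i).contDiff
  have hFc : ∀ i, Continuous (fun c x => R c x * χ i x
      + R c x * inner ℝ (velocity φ c x) (φ i x)).uncurry := fun i => by
    simp only [Function.uncurry_def] at hR hu ⊢
    fun_prop
  have hGc : ∀ i, Continuous (fun c x => R c x * fderiv ℝ (χ i) x (velocity φ c x)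
      + R c x * inner ℝ (velocity φ c x) (fderiv ℝ (φ i) x (velocity φ c x))
      + Q c x * divg (φ i) x).uncurry := fun i => by
    simp only [Function.uncurry_def] at hR hQ hu ⊢
    fun_prop
  have sl : ∀ {f : EuclideanSpace ℝ ι → Space d → ℝ}, Continuous f.uncurry → ∀ c,
      Integrable (f c) G.vol := fun hf c =>
    integrable_vol_of_continuous hG (hf.comp (continuous_const.prodMk continuous_id))
  let F : EuclideanSpace ℝ ι → EuclideanSpace ℝ ι := fun c =>
    stateMoments G χ φ (R c) (velocity φ c)
  let K : EuclideanSpace ℝ ι → EuclideanSpace ℝ ι := fun c =>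
    fluxMoments G χ φ (R c) (Q c) (velocity φ c)
  have hFv : ∀ c v, inner ℝ (F c) v = ∫ x, R c x * (∑ i, v i * χ i x
      + inner ℝ (velocity φ c x) (velocity φ v x)) ∂G.vol := fun c v => by
    refine (inner_toLp_integral (fun i => sl (hFc i) c) v).trans
      (integral_congr_ae (ae_of_all _ fun x => ?_))
    simp only [velocity, inner_sum, real_inner_smul_right, mul_add, mul_sum,
      sum_add_distrib]
    congr 1 <;> exact sum_congr rfl fun i _ => by ring
  have iF : ∀ c v, Integrable (fun x => R c x * (∑ i, v i * χ i x
      + inner ℝ (velocity φ c x) (velocity φ v x))) G.vol := fun c v => by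
    have h1 : Continuous (R c) := hR.comp (continuous_const.prodMk continuous_id)
    have h2 : ∀ c, Continuous (velocity φ c) := fun c =>
      hu.comp (continuous_const.prodMk continuous_id)
    refine integrable_vol_of_continuous hG ?_
    have := h2 c
    have := h2 v
    fun_prop
  -- the Legendre transform of the integrated dual pressure is the energy
  have hen : ∀ c, inner ℝ (F c) c - ∫ x, Q c x ∂G.vol
      = ∫ x, (R c x * ‖velocity φ c x‖ ^ 2 / 2 + potential a γ (R c x)) ∂G.vol := fun c => by
    rw [hFv, ← integral_sub (iF c c) (sl hQ c)]
    refine integral_congr_ae (ae_of_all _ fun x => ?_)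
    have h1 := (dualDensity_mul ha hγ' (enthalpy χ φ c x)).1
    simp only [R, Q, real_inner_self_eq_norm_sq]
    rw [enthalpy] at h1 ⊢
    linarith
  have hk := lintegral_kin_lt_top hE₀
  have hvac := ae_vacuum_of_kin hk
  have i0 : Integrable (fun x => 1 / 2 * ∑ i, m₀ x i * m₀ x i / ρ₀ x
      + 1 / (γ - 1) * pressure a γ (ρ₀ x)) G.vol :=
    ((integrable_finsetSum _ fun i _ => integrable_flux hρ₀ hk i i).const_mul _).add
      ((integrable_pressure hρ₀).const_mul _)
  have hE : (fluidEnergy G a γ ρ₀ m₀).toReal = ∫ x, (1 / 2 * ∑ i, m₀ x i * m₀ x i / ρ₀ x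
      + 1 / (γ - 1) * pressure a γ (ρ₀ x)) ∂G.vol := by
    rw [(fluidEnergy_toReal ha.le hρ₀ hk).1, integral_add
      ((integrable_finsetSum _ fun i _ => integrable_flux hρ₀ hk i i).const_mul _)
      ((integrable_pressure hρ₀).const_mul _), integral_const_mul, integral_const_mul,
      integral_finsetSum _ fun i _ => integrable_flux hρ₀ hk i i]
  have i1 : ∀ i, Integrable (fun x => ρ₀ x * χ i x) G.vol := fun i => by
    obtain ⟨h1, c, hc⟩ := isWeight_of_continuous hG (c1 i)
    exact (integrable_dens ρ₀).mul_bdd h1 (c := c) hc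
  have i2 : ∀ i, Integrable (fun x => inner ℝ (m₀ x) (φ i x)) G.vol := fun i =>
    integrable_inner_weight (isWeight_of_continuous hG (c2 i)) ((Lp.memLp m₀).integrable Fact.out)
  have i3 : ∀ i, Integrable (fun x => ρ₀ x * χ i x + inner ℝ (m₀ x) (φ i x)) G.vol := fun i =>
    (i1 i).add (i2 i)
  let y₀ : EuclideanSpace ℝ ι :=
    WithLp.toLp 2 fun i => ∫ x, (ρ₀ x * χ i x + inner ℝ (m₀ x) (φ i x)) ∂G.vol
  -- convexity of the dual pressure
  have hconv : ∀ c c', ∫ x, Q c x ∂G.vol + inner ℝ (F c) (c' - c) ≤ ∫ x, Q c' x ∂G.vol := by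
    intro c c'
    rw [inner_sub_right, hFv, hFv, ← integral_sub (iF c c') (iF c c)]
    refine (integral_add (sl hQ c) ((iF c c').sub (iF c c))).symm.trans_le ?_
    refine integral_mono ((sl hQ c).add ((iF c c').sub (iF c c))) (sl hQ c') fun x => ?_
    have h1 := dualPressure_add_le ha hγ' (enthalpy χ φ c x) (enthalpy χ φ c' x)
    have h2 := mul_nonneg (hR0 c x) (sq_nonneg ‖velocity φ c' x - velocity φ c x‖)
    rw [norm_sub_sq_real, real_inner_comm] at h2
    simp only [Q, R, Pi.sub_apply, real_inner_self_eq_norm_sq] at h1 h2 ⊢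
    refine le_trans ?_ h1
    simp only [enthalpy] at h2 ⊢
    linarith
  -- Young's inequality for the initial data
  have hy : ∀ c, inner ℝ y₀ c - ∫ x, Q c x ∂G.vol ≤ (fluidEnergy G a γ ρ₀ m₀).toReal := by
    intro c
    have hy₀ : inner ℝ y₀ c = _ := inner_toLp_integral i3 c
    rw [hy₀, hE, ← integral_sub
      (integrable_finsetSum _ fun i _ => (i3 i).const_mul _) (sl hQ c)]
    refine integral_mono_ae ((integrable_finsetSum _ fun i _ =>
      (i3 i).const_mul _).sub (sl hQ c)) i0 ?_
    filter_upwards [hρ₀, hvac] with x hx hv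
    have h1 := pairing_le_energy (θ := ∑ i, c i * χ i x) (u := velocity φ c x) ha hγ' hx hv
    have h2 : ∑ i, c i * (ρ₀ x * χ i x + inner ℝ (m₀ x) (φ i x))
        = ρ₀ x * ∑ i, c i * χ i x + inner ℝ (m₀ x) (velocity φ c x) := by
      simp only [velocity, inner_sum, real_inner_smul_right, mul_add, mul_sum,
        sum_add_distrib]
      congr 1
      exact sum_congr rfl fun i _ => by ring
    have h3 : ∑ i, m₀ x i * m₀ x i / ρ₀ x = ‖m₀ x‖ ^ 2 / ρ₀ x := by
      rw [← sum_div, EuclideanSpace.real_norm_sq_eq]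
      simp only [sq]
    have h4 : potential a γ (ρ₀ x) = 1 / (γ - 1) * pressure a γ (ρ₀ x) := by
      rw [potential, pressure]; ring
    simp only [Q, enthalpy]
    rw [h2, h3]
    linarith
  obtain ⟨b, τ, hτ, h⟩ := exists_approximate_solution (F := F) (G := K)
    (Φ := fun c => ∫ x, Q c x ∂G.vol) (y₀ := y₀) (E₀ := (fluidEnergy G a γ ρ₀ m₀).toReal)
    ((PiLp.continuous_toLp 2 _).comp (continuous_pi fun i => continuous_integral_vol hG (hFc i)))
    ((PiLp.continuous_toLp 2 _).comp (continuous_pi fun i => continuous_integral_vol hG (hGc i)))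
    (continuous_integral_vol hG hQ)
    (fun c => integral_nonneg fun x => pressure_nonneg ha.le (hR0 c x))
    (by simp [Q, enthalpy, velocity, dualPressure_zero hγ'])
    hconv (inner_fluxMoments_self hd hG ha hγ' hχ hφ fun c i => sl (hGc i) c)
    hy hT hδ
  refine ⟨fun k => R (b k), fun k => velocity φ (b k), τ, hτ, fun k =>
    ⟨hR.comp (continuous_const.prodMk continuous_id), hR0 _,
      hu.comp (continuous_const.prodMk continuous_id)⟩, fun t ht => ?_⟩
  obtain ⟨h1, h2⟩ := h t ht
  refine ⟨(hen _).symm.trans_le h1, fun i => ?_⟩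
  have h3 := h2 (single i 1) (by simp)
  simp only [EuclideanSpace.inner_single_right, RCLike.conj_to_real, one_mul] at h3
  refine ⟨h3.1, ?_⟩
  rw [← integral_add (i1 i) (i2 i)]
  exact h3.2

end Galerkin

/-! ### Existence of relaxed solutions -/

section Existence

variable {d : ℕ} {G : FluidDomain d} [CompactSpace (Hull G)] {a γ T : ℝ} [hγ : Fact (1 < γ)]

lemma vol_univ_pos (hG : G.Admissible) : 0 < G.vol.real univ := by
  refine ENNReal.toReal_pos ?_ (measure_ne_top _ _)
  rw [FluidDomain.vol, Measure.restrict_apply_univ]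
  cases G with
  | bounded Ω => exact (hG.1.measure_pos volume hG.2.1.nonempty).ne'
  | torus =>
    have ho : IsOpen {x : Space d | ∀ i, -1 < x i ∧ x i < 1} := by
      simp only [Set.ofPred_forall]
      exact isOpen_iInter_of_finite fun i => (isOpen_lt (by fun_prop) (by fun_prop)).and
        (isOpen_lt (by fun_prop) (by fun_prop))
    refine (lt_of_lt_of_le (ho.measure_pos volume ⟨0, fun i => by simp⟩)
      (measure_mono (t := FluidDomain.torus.cell) fun x hx i => ⟨(hx i).1.le, (hx i).2⟩)).ne'

/-- A stress functional for the smooth state `[r, r u]` with prescribed total energy `E`. The excess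
energy is attributed to a pressure defect that is constant in space; it does not contribute to the
momentum equation, as test functions have mean divergence zero. -/
lemma exists_isStressBound (hd : d ≠ 0) (hG : G.Admissible) (ha : 0 < a) {r : Space d → ℝ}
    {u : Space d → Space d} (hr : Continuous r) (hr0 : ∀ x, 0 ≤ r x) (hu : Continuous u)
    {ρ : DensSpace G γ} {m : MomSpace G γ} (hρ : ρ =ᵐ[G.vol] r)
    (hm : m =ᵐ[G.vol] fun x => r x • u x) {E : ℝ}
    (hE : ∫ x, (r x * ‖u x‖ ^ 2 / 2 + potential a γ (r x)) ∂G.vol ≤ E) :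
    ∃ L : StressDual G, IsStressBound a γ ρ m L ∧
      L (stressTest (energyStress d γ) 1) = E ∧
      ∀ φ (hφ : IsStaticVector G φ), L (gradTest hφ.contDiff)
        = ∫ x, (r x * inner ℝ (u x) (fderiv ℝ φ x (u x))
          + pressure a γ (r x) * divg φ x) ∂G.vol := by
  have hγ1 := sub_pos.2 hγ.out
  have hV := vol_univ_pos hG
  set e := ∫ x, (r x * ‖u x‖ ^ 2 / 2 + potential a γ (r x)) ∂G.vol with he
  have hρ0 : 0 ≤ᵐ[G.vol] ρ := by filter_upwards [hρ] with x hx; rw [hx]; exact hr0 x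
  have hfl : ∀ x i j, (r x • u x) i * (r x • u x) j / r x = r x * (u x i * u x j) := fun x i j => by
    rcases eq_or_ne (r x) 0 with h | h
    · simp [h]
    · simp only [PiLp.smul_apply, smul_eq_mul]; field_simp
  have hk : ∀ i, ∫⁻ x, kin (ρ x) (m x i) ∂G.vol < ∞ := fun i => by
    refine lt_of_eq_of_lt (lintegral_congr_ae ?_) (integrable_vol_of_continuous hG
      (f := fun x => r x * (u x i * u x i)) (by fun_prop)).lintegral_lt_top
    filter_upwards [hρ, hm] with x h1 h2
    rw [h1, h2, kin_eq_ofReal (hr0 x) fun h => by simp [h], sq, hfl]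
  have hflux : ∀ i j, ∀ᵐ x ∂G.vol, m x i * m x j / ρ x = r x * (u x i * u x j) := fun i j => by
    filter_upwards [hρ, hm] with x h1 h2
    rw [h1, h2, hfl]
  have hpr : ∀ᵐ x ∂G.vol, pressure a γ (ρ x) = pressure a γ (r x) := by
    filter_upwards [hρ] with x h1
    rw [h1]
  have cp : Continuous fun x => pressure a γ (r x) :=
    continuous_const.mul (hr.rpow_const fun _ => Or.inr (by linarith))
  have he' : (fluidEnergy G a γ ρ m).toReal = e ∧ fluidEnergy G a γ ρ m < ∞ := by
    obtain ⟨h1, h2⟩ := fluidEnergy_toReal ha.le hρ0 hk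
    refine ⟨?_, h2⟩
    rw [h1, ← integral_finsetSum _ fun i _ => integrable_flux hρ0 hk i i, ← integral_const_mul,
      ← integral_const_mul, ← integral_add
        ((integrable_finsetSum _ fun i _ => integrable_flux hρ0 hk i i).const_mul _)
        ((integrable_pressure hρ0).const_mul _)]
    refine integral_congr_ae ?_
    filter_upwards [ae_all_iff.2 fun i => hflux i i, hpr] with x h3 h4
    rw [sum_congr rfl fun i _ => h3 i, h4, ← mul_sum, EuclideanSpace.real_norm_sq_eq,
      potential, pressure]
    simp only [sq]
    ring
  -- a constant pressure defect whose energy is `E - e`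
  set s := (γ - 1) * (E - e) / G.vol.real univ with hs
  have hs0 : 0 ≤ s := div_nonneg (mul_nonneg hγ1.le (by linarith)) hV.le
  let μ : Measure (Space d) := s.toNNReal • G.vol
  have hμ : μ G.closedCellᶜ = 0 := by
    have h1 : G.vol G.closedCellᶜ = 0 :=
      ae_iff.1 ((ae_mem_cell hG).mono fun x hx => cell_subset_closedCell hx)
    simp [μ, h1]
  have hsup : ∀ i j : Fin d, SupportedInCell G
      ((0 : Fin d → Fin d → SignedMeasure (Space d)) i j) :=
    fun i j B _ _ => rfl
  refine ⟨stressOf (fun i j => flux ρ m i j + 0) (pressMeasure a ρ + μ.toSignedMeasure),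
    isStressBound_stressOf hG ha.le hρ0 (integrable_pressure hρ0) (integrable_flux hρ0 hk)
      (ae_vacuum_of_kin hk) (R := 0) (fun _ _ => rfl) (fun ξ B _ => by simp) fun B hB => ?_, ?_,
    fun φ hφ => ?_⟩
  · rw [Measure.toSignedMeasure_apply_measurable hB]
    exact measureReal_nonneg
  · have h1 := stressOf_energy_eq_totalEnergy hG ha.le hρ0 hk hsup (fun ξ B _ => by simp) hμ
    refine h1.trans ?_
    rw [totalEnergy, toReal_add (ENNReal.add_ne_top.2 ⟨he'.2.ne, ofReal_ne_top⟩)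
      (ENNReal.mul_ne_top ofReal_ne_top (measure_ne_top _ _)),
      toReal_add he'.2.ne ofReal_ne_top, he'.1, toReal_mul,
      toReal_ofReal (by positivity : 0 ≤ 1 / (γ - 1)), ← measureReal_def]
    simp only [μ, measureReal_nnreal_smul_apply, Real.coe_toNNReal s hs0]
    simp only [Pi.zero_apply, FunLike.coe_zero, sum_const_zero, mul_zero,
      ofReal_zero, toReal_zero]
    rw [hs]
    field_simp
    ring
  · have h1 := stressOf_add (G := G) (flux ρ m) 0 (pressMeasure a ρ) μ.toSignedMeasure
      (gradTest hφ.contDiff)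
    refine h1.trans ?_
    rw [(stressOf_gradTest_state hG hρ0 hk hφ.contDiff).2,
      stressOf_gradTest_defect hsup hμ hφ.contDiff, defectAction]
    -- a constant pressure does not act on impermeable fields
    have h2 : ∫ x, divg φ x ∂μ = 0 := by
      simp only [μ]
      rw [integral_smul_nnreal_measure,
        integral_divg_eq_zero hd hG hφ.contDiff hφ.periodic hφ.impermeable, smul_zero]
    rw [h2, add_zero]
    simp only [Pi.zero_apply, VectorMeasure.integral_zero_vectorMeasure, sum_const_zero,
      add_zero]
    refine integral_congr_ae ?_
    filter_upwards [ae_all_iff.2 fun i => ae_all_iff.2 fun j => hflux i j, hpr] with x h3 h4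
    rw [h4, PiLp.inner_apply, mul_sum]
    congr 1
    refine sum_congr rfl fun i _ => ?_
    rw [show (fderiv ℝ φ x (u x)) i = ((EuclideanSpace.proj (𝕜 := ℝ) i).comp (fderiv ℝ φ x)) (u x)
      from rfl, ← sum_fderiv_single_mul (u x)]
    simp only [RCLike.inner_apply, RCLike.conj_to_real, mul_sum, sum_mul]
    refine sum_congr rfl fun j _ => ?_
    rw [h3]
    simp only [grad, ContinuousLinearMap.comp_apply, PiLp.proj_apply]
    ring

lemma exists_lp_ae_eq (hG : G.Admissible) {E : Type*} [NormedAddCommGroup E]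
    [SecondCountableTopology E] [MeasurableSpace E] [BorelSpace E] [InnerProductSpace ℝ E]
    {f : Space d → E} (hf : Continuous f) (p : ℝ≥0∞) : ∃ v : Lp E p G.vol, v =ᵐ[G.vol] f := by
  obtain ⟨h1, c, hc⟩ := isWeight_of_continuous hG hf
  exact ⟨(MemLp.of_bound h1 c hc).toLp f, MemLp.coeFn_toLp _⟩

/-- For all finite energy initial data there is a relaxed solution, the limit of the Galerkin
approximations with all tests up to index `n` and time discretization error `1/(n+1)`. -/
lemma exists_isRelaxed (hd : d ≠ 0) (hG : G.Admissible) (ha : 0 < a) (hT : 0 < T)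
    {ρ₀ : DensSpace G γ} {m₀ : MomSpace G γ} (hρ₀ : 0 ≤ᵐ[G.vol] ρ₀)
    (hE₀ : fluidEnergy G a γ ρ₀ m₀ < ∞) :
    ∃ (u : Trajectory G γ T) (Λ : _), IsRelaxed a γ T (fluidEnergy G a γ ρ₀ m₀).toReal u Λ ∧
      u.1.val 0 = ρ₀ ∧ u.2.val 0 = m₀ := by
  obtain ⟨χ, hχ⟩ := exists_denseScalarFamily G
  obtain ⟨φ, hφ⟩ := exists_denseVectorFamily G
  set E₀ := (fluidEnergy G a γ ρ₀ m₀).toReal with hE₀def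
  let ε : ℕ → ℝ := fun n => 1 / ((n : ℝ) + 1)
  have hε : Tendsto ε atTop (𝓝 0) := tendsto_one_div_add_atTop_nhds_zero_nat
  have hε0 : ∀ n, 0 < ε n := fun n => by positivity
  have hε1 : ∀ n, ε n ≤ 1 := fun n => by
    simp only [ε]
    rw [div_le_one (by positivity)]
    linarith [n.cast_nonneg (α := ℝ)]
  -- the first summand tests the density, the second one the momentum
  let χ' : ∀ n, Fin (n + 1) ⊕ Fin (n + 1) → Space d → ℝ := fun n =>
    Sum.elim (fun i => χ i) fun _ _ => 0
  let φ' : ∀ n, Fin (n + 1) ⊕ Fin (n + 1) → Space d → Space d := fun n =>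
    Sum.elim (fun _ _ => 0) fun i => φ i
  have hχ' : ∀ n i, IsStaticScalar G (χ' n i) := fun n i => by
    rcases i with i | i
    · exact hχ.static i
    · exact isStaticScalar_zero
  have hφ' : ∀ n i, IsStaticVector G (φ' n i) := fun n i => by
    rcases i with i | i
    · exact isStaticVector_zero
    · exact hφ.static i
  choose r u τ hτ hru hsol using fun n =>
    exists_galerkin_solution hd hG ha (hχ' n) (hφ' n) hρ₀ hE₀ hT (hε0 n)
  have hstate : ∀ n k, ∃ (ρ : DensSpace G γ) (m : MomSpace G γ)
      (L : StressDual G), ρ =ᵐ[G.vol] r n k ∧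
      m =ᵐ[G.vol] (fun x => r n k x • u n k x) ∧
      (∫ x, (r n k x * ‖u n k x‖ ^ 2 / 2 + potential a γ (r n k x)) ∂G.vol ≤ E₀ + ε n →
        IsStressBound a γ ρ m L ∧ L (stressTest (energyStress d γ) 1) = E₀ + ε n ∧
        ∀ φ (hφ : IsStaticVector G φ), L (gradTest hφ.contDiff)
          = ∫ x, (r n k x * inner ℝ (u n k x) (fderiv ℝ φ x (u n k x))
            + pressure a γ (r n k x) * divg φ x) ∂G.vol) := fun n k => by
    obtain ⟨h1, h2, h3⟩ := hru n k
    obtain ⟨ρ, hρ⟩ := exists_lp_ae_eq hG h1 (densExp γ)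
    obtain ⟨m, hm⟩ := exists_lp_ae_eq hG (h1.smul h3) (momExp γ)
    -- only the steps up to the time `T` satisfy the energy bound; `0` is never used
    by_cases hE : ∫ x, (r n k x * ‖u n k x‖ ^ 2 / 2 + potential a γ (r n k x)) ∂G.vol ≤ E₀ + ε n
    · obtain ⟨L, hL⟩ := exists_isStressBound hd hG ha h1 h2 h3 hρ hm hE
      exact ⟨ρ, m, L, hρ, hm, fun _ => hL⟩
    · exact ⟨ρ, m, 0, hρ, hm, fun h => absurd h hE⟩
  choose ρ m L hρ hm hL using hstate
  have hL' : ∀ n, ∀ t ∈ Icc 0 T, _ := fun n t ht => hL n ⌊t / τ n⌋₊ (hsol n t ht).1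
  have hρ0 : ∀ n k, 0 ≤ᵐ[G.vol] ρ n k := fun n k => by
    filter_upwards [hρ n k] with x hx
    rw [hx]
    exact (hru n k).2.1 x
  have hM : ∀ n, ∀ t ∈ Icc 0 T, ‖ρ n ⌊t / τ n⌋₊‖ ≤ stateBound a γ (E₀ + 1) ∧
      ‖m n ⌊t / τ n⌋₊‖ ≤ stateBound a γ (E₀ + 1) := fun n t ht => by
    obtain ⟨h1, h2, -⟩ := hL' n t ht
    have h3 := h1.fluidEnergy_le ha.le (hρ0 _ _)
    rw [h2] at h3
    have h4 := norm_rpow_le_of_energy ha (hρ0 n ⌊t / τ n⌋₊)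
      (add_nonneg toReal_nonneg zero_le_one)
      (h3.trans (ofReal_le_ofReal (add_le_add_right (hε1 n) E₀)))
    exact ⟨h4.1.trans (le_max_left _ _), h4.2.trans (le_max_right _ _)⟩
  have hmeas : ∀ n (g : ℕ → ℝ), AEMeasurable (fun t => g ⌊t / τ n⌋₊) dt[T] :=
    fun n g => (measurable_from_nat.comp
      (Nat.measurable_floor.comp (measurable_id.div_const (τ n)))).aemeasurable
  -- the moments of the approximations
  have e1 : ∀ n j k (hk : k ≤ n), ∫ x, ρ n j x * χ k x ∂G.vol
      = stateMoments G (χ' n) (φ' n) (r n j) (u n j) (Sum.inl ⟨k, Nat.lt_succ_of_le hk⟩) :=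
    fun n j k hk => by
      refine integral_congr_ae ?_
      filter_upwards [hρ n j] with x hx
      simp [χ', φ', hx]
  have e2 : ∀ n j k (hk : k ≤ n), ∫ x, inner ℝ (m n j x) (φ k x) ∂G.vol
      = stateMoments G (χ' n) (φ' n) (r n j) (u n j) (Sum.inr ⟨k, Nat.lt_succ_of_le hk⟩) :=
    fun n j k hk => by
      refine integral_congr_ae ?_
      filter_upwards [hm n j] with x hx
      simp [χ', φ', hx, real_inner_smul_left]
  have e3 : ∀ n j k (hk : k ≤ n), ∫ x, fderiv ℝ (χ k) x (m n j x) ∂G.vol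
      = fluxMoments G (χ' n) (φ' n) (r n j) (fun x => pressure a γ (r n j x)) (u n j)
        (Sum.inl ⟨k, Nat.lt_succ_of_le hk⟩) := fun n j k hk => by
    refine integral_congr_ae ?_
    filter_upwards [hm n j] with x hx
    simp [χ', φ', hx, divg, grad]
  have e4 : ∀ n, ∀ t ∈ Icc 0 T, ∀ k (hk : k ≤ n),
      L n ⌊t / τ n⌋₊ (gradTest (hφ.static k).contDiff)
      = fluxMoments G (χ' n) (φ' n) (r n ⌊t / τ n⌋₊) (fun x => pressure a γ (r n ⌊t / τ n⌋₊ x))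
        (u n ⌊t / τ n⌋₊) (Sum.inr ⟨k, Nat.lt_succ_of_le hk⟩) := fun n t ht k hk => by
    rw [(hL' n t ht).2.2 _ (hφ.static k)]
    simp [fluxMoments, χ', φ']
  have h0T : (0 : ℝ) ∈ Icc 0 T := ⟨le_rfl, hT.le⟩
  obtain ⟨K, hK0, hK⟩ := exists_norm_le_energy G a γ
  obtain ⟨s, hs, w, Λ, hw, -, -, -, hc1, hc2⟩ := exists_subseq_isRelaxed (a := a) hG hT hχ hφ
    (E := fun n => E₀ + ε n) (E₀ := E₀) (by simpa using hε.const_add E₀)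
    (v := fun n t => ρ n ⌊t / τ n⌋₊) (w := fun n t => m n ⌊t / τ n⌋₊)
    (Λ := fun n t => L n ⌊t / τ n⌋₊)
    (fun n => ⟨fun F => hmeas n fun j => L n j F, ⟨K * (E₀ + ε n),
      (ae_mem_Icc T).mono fun t ht => by
        obtain ⟨h1, h2, -⟩ := hL' n t ht
        rw [← h2]
        exact hK _ _ _ h1⟩, (ae_mem_Icc T).mono fun t ht => (hL' n t ht).1, Icc 0 T, ae_mem_Icc T,
        fun t ht t' ht' _ => ((hL' n t' ht').2.1.trans (hL' n t ht).2.1.symm).le,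
        fun t ht => (hL' n t ht).2.1.le⟩)
    (fun n t _ => hρ0 n _) (fun n ℓ => hmeas n fun j => ℓ (m n j))
    (fun n t ht => (hM n t ht).1) (fun n t ht => (hM n t ht).2) hε
    (fun k n hk t ht => by
      have h1 := ((hsol n t ht).2 (Sum.inl ⟨k, Nat.lt_succ_of_le hk⟩)).1
      simpa only [e1 n _ k hk, e3 n _ k hk, zero_div, Nat.floor_zero] using h1)
    (fun k n hk t ht => by
      have h1 := ((hsol n t ht).2 (Sum.inr ⟨k, Nat.lt_succ_of_le hk⟩)).1
      have h2 : ∫ t in (0 : ℝ)..t, L n ⌊t / τ n⌋₊ (gradTest (hφ.static k).contDiff) = _ :=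
        intervalIntegral.integral_congr fun s hs => e4 n s (by
          rw [uIcc_of_le ht.1] at hs
          exact ⟨hs.1, hs.2.trans ht.2⟩) k hk
      rw [h2]
      simpa only [e2 n _ k hk, zero_div, Nat.floor_zero] using h1)
  have hlim : ∀ {f : ℕ → ℝ} {c : ℝ} (k : ℕ), (∀ n ≥ k, |f n - c| ≤ ε n) →
      Tendsto (fun n => f (s n)) atTop (𝓝 c) := fun {f c} k h => by
    have h1 : Tendsto f atTop (𝓝 c) := by
      rw [tendsto_iff_dist_tendsto_zero]
      refine squeeze_zero' (Eventually.of_forall fun n => dist_nonneg) ?_ hε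
      filter_upwards [eventually_ge_atTop k] with n hn using h n hn
    exact h1.comp hs.tendsto_atTop
  refine ⟨w, Λ, hw, sub_eq_zero.1 ((isSeparatingFamily_dens hG hχ).separates _ fun k => ?_),
    sub_eq_zero.1 ((isSeparatingFamily_mom hG hφ).separates _ fun k => ?_)⟩
  · rw [map_sub, sub_eq_zero]
    refine (hullFunctional_toHull hG _ _).trans (Eq.trans ?_ (hullFunctional_toHull hG _ _).symm)
    refine tendsto_nhds_unique ((hc1 k).tendsto_at h0T) (hlim (f := fun n =>
      ∫ x, inner ℝ (ρ n ⌊0 / τ n⌋₊ x) (χ k x) ∂G.vol) k fun n hn => ?_)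
    have h1 := ((hsol n 0 h0T).2 (Sum.inl ⟨k, Nat.lt_succ_of_le hn⟩)).2
    rw [← e1 n 0 k hn] at h1
    simpa [χ', φ', mul_comm] using h1
  · rw [map_sub, sub_eq_zero]
    refine (hullFunctional_toHull hG _ _).trans (Eq.trans ?_ (hullFunctional_toHull hG _ _).symm)
    refine tendsto_nhds_unique ((hc2 k).tendsto_at h0T) (hlim (f := fun n =>
      ∫ x, inner ℝ (m n ⌊0 / τ n⌋₊ x) (φ k x) ∂G.vol) k fun n hn => ?_)
    have h1 := ((hsol n 0 h0T).2 (Sum.inr ⟨k, Nat.lt_succ_of_le hn⟩)).2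
    rw [← e2 n 0 k hn] at h1
    simpa [χ', φ'] using h1

end Existence

end EulerDissipative

end

open EulerDissipative

theorem mainTheorem5 (d : ℕ) (hd : d = 2 ∨ d = 3)
    (G : EulerDissipative.FluidDomain d) (hG : G.Admissible)
    (a γ T : ℝ) (ha : 0 < a) [hγ : Fact (1 < γ)] (hT : 0 < T)
    (ρ₀ : EulerDissipative.DensSpace G γ) (m₀ : EulerDissipative.MomSpace G γ)
    (hρ₀ : 0 ≤ᵐ[G.vol] ρ₀)
    (hE₀ : EulerDissipative.fluidEnergy G a γ ρ₀ m₀ < ∞) :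
    (EulerDissipative.solutionSet G a γ T ρ₀ m₀).Nonempty ∧
    Convex ℝ (EulerDissipative.solutionSet G a γ T ρ₀ m₀) ∧
    ∃ M : ℝ,
      EulerDissipative.solutionSet G a γ T ρ₀ m₀
        ⊆ EulerDissipative.boundedTrajectories G γ T M ∧
      TopologicalSpace.MetrizableSpace (EulerDissipative.boundedTrajectories G γ T M) ∧
      IsCompact (EulerDissipative.solutionSet G a γ T ρ₀ m₀) := by
  have := compactSpace_hull hG
  have hd0 : d ≠ 0 := by omega
  set E₀ := (fluidEnergy G a γ ρ₀ m₀).toReal with hE₀def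
  have hE0 : 0 ≤ E₀ := ENNReal.toReal_nonneg
  have hset : solutionSet G a γ T ρ₀ m₀ = {u | (∃ Λ, IsRelaxed a γ T E₀ u Λ) ∧
      u.1.val 0 = ρ₀ ∧ u.2.val 0 = m₀} := by
    ext u
    constructor
    · rintro ⟨hu, h1, h2⟩
      obtain ⟨Λ, hΛ⟩ := isRelaxed_of_isDissipativeSolution hG ha hT hu
      rw [h1, h2] at hΛ
      exact ⟨⟨Λ, hΛ⟩, h1, h2⟩
    · rintro ⟨⟨Λ, hΛ⟩, h1, h2⟩
      exact ⟨hΛ.isDissipativeSolution hG ha hT (by rwa [h1, h2]) (by rw [h1, h2]), h1, h2⟩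
  rw [hset]
  refine ⟨?_, ?_, stateBound a γ E₀, ?_, metrizable_boundedTrajectories hG _,
    isCompact_setOf_isRelaxed hG ha hT hE0 ρ₀ m₀⟩
  · obtain ⟨u, Λ, h⟩ := exists_isRelaxed hd0 hG ha hT hρ₀ hE₀
    exact ⟨u, ⟨Λ, h.1⟩, h.2⟩
  · rintro u ⟨⟨Λ, hu⟩, h1, h2⟩ u' ⟨⟨Λ', hu'⟩, h1', h2'⟩ α β hα hβ hαβ
    refine ⟨⟨_, hu.combination hG hu' hα hβ hαβ⟩, ?_, ?_⟩
    · simp only [Prod.fst_add, Prod.smul_fst, val_combination]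
      rw [h1, h1', ← add_smul, hαβ, one_smul]
    · simp only [Prod.snd_add, Prod.smul_snd, val_combination]
      rw [h2, h2', ← add_smul, hαβ, one_smul]
  · rintro u ⟨⟨Λ, hu⟩, -, -⟩
    exact hu.norm_le ha hT hE0
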